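/- Let $k,\sigma,\eta\ge 0$ and let $\Lambda:(0,\infty)^2\to[0,\infty)$ be measurable and symmetric, with $\Lambda(\mu,\nu)\le k(\mu\nu)^{-\sigma}$ on $(0,1)^2$, $\Lambda(\mu,\nu)\le k\mu\nu^{-\sigma}$ on $[1,\infty)\times(0,1)$, $\Lambda(\mu,\nu)\le k(\mu+\nu)$ on $[1,\infty)^2$, and such that $\Lambda\in W^{1,\infty}_{\mathrm{loc}}((0,\infty)^2)$ with $\partial_\mu\Lambda(\mu,\nu)\ge-\eta\mu^{-\sigma-1}\nu^{-\sigma}$ almost everywhere. Let $0\le\zeta^{in}\in L^1((0,\infty);(\mu+\mu^{-2\sigma})\,d\mu)$. For $T\in(0,\infty]$, a weak solution on $[0,T)$ of the Oort--Hulst--Safronov (OHS) equation $$\partial_t\zeta(\mu,t)=-\partial_\mu\Big(\zeta(\mu,t)\int_0^\mu\nu\Lambda(\mu,\nu)\zeta(\nu,t)\,d\nu\Big)-\int_\mu^\infty\Lambda(\mu,\nu)\zeta(\mu,t)\zeta(\nu,t)\,d\nu$$ with initial datum $\zeta^{in}$ is a nonnegative $\zeta\in\mathcal C_w([0,T);L^1(0,\infty))\cap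 L^\infty(0,T;L^1((0,\infty);(\mu^{-\sigma}+\mu)\,d\mu))$ such that for all $t\in[0,T)$ and all $\omega\in W^{1,\infty}(0,\infty)$ whose derivative $\omega'$ has bounded support $$\int_0^\infty\omega(\mu)\{\zeta(\mu,t)-\zeta^{in}(\mu)\}\,d\mu=\int_0^t\int_0^\infty\int_0^\nu\big(\tau\omega'(\nu)-\omega(\tau)\big)\Lambda(\nu,\tau)\zeta(\nu,s)\zeta(\tau,s)\,d\tau\,d\nu\,ds.$$ For $\varepsilon\in(0,1]$, a weak solution $\zeta_\varepsilon$ of the $\varepsilon$-generalized coagulation equation with initial datum $\zeta^{in}$ is defined in the same way, with $\tau\omega'(\nu)-\omega(\tau)$ replaced by $\frac{\omega(\nu+\varepsilon\tau)-\omega(\nu)}{\varepsilon}-\omega(\tau)$ ($\varepsilon=1$ is the Smoluchowski equation, and the OHS equation is the formal limit $\varepsilon\to0$). Here $\mathcal C_w([0,T);X)$ is the space of weakly continuous functions from $[0,T)$ to $X$; convergence in it means weak convergence in $X$, uniformly on compact subsets of $[0,T)$ for each functional. Then: (i) for every $\varepsilon\in(0,1]$ the $\varepsilon$-generalized equation has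 a weak solution $\zeta_\varepsilon$ on $[0,\infty)$ with initial datum $\zeta^{in}$; (ii) for every family $(\zeta_\varepsilon)_{\varepsilon\in(0,1]}$ of such weak solutions, every sequence in $(0,1]$ tending to $0$ has a subsequence $(\varepsilon_k)$ for which there is a weak solution $\zeta$ of the OHS equation on $[0,\infty)$ with initial datum $\zeta^{in}$ such that, for each $T\in(0,\infty]$, $$\zeta_{\varepsilon_k}\to\zeta\quad\text{in }\mathcal C_w([0,T);L^1((0,\infty);(\mu^{-\sigma}+\mu)\,d\mu)),$$ and $\int_0^\infty\mu\,\zeta(\mu,t)\,d\mu=\int_0^\infty\mu\,\zeta^{in}(\mu)\,d\mu$ for all $t\ge0$; (iii) for every $T\in(0,\infty]$, every weak solution $\zeta$ of the OHS equation on $[0,T)$ with initial datum $\zeta^{in}$ satisfies $\int_0^\infty\mu\,\zeta(\mu,t)\,d\mu=\int_0^\infty\mu\,\zeta^{in}(\mu)\,d\mu$ for all $t\in[0,T)$. -/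

import Mathlib

open MeasureTheory Set Filter Topology


namespace OHS

/-! ## Weak derivatives and Sobolev classes -/

/-- `g` is the weak derivative of `f` in the direction `v` on the open set `U`:
`∫_U f ∂_v φ = - ∫_U g φ` for all `φ ∈ C_c^∞(U)`. -/
def HasWeakDirDeriv {E : Type*} [NormedAddCommGroup E] [NormedSpace ℝ E] [MeasureSpace E]
    (U : Set E) (v : E) (f g : E → ℝ) : Prop :=
  ∀ φ : E → ℝ, ContDiff ℝ ((⊤ : ℕ∞) : WithTop ℕ∞) φ → HasCompactSupport φ → tsupport φ ⊆ U →
    ∫ x in U, f x * fderiv ℝ φ x v = - ∫ x in U, g x * φ x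

/-- `f ∈ L^∞_loc(U)`: `f` is essentially bounded on every compact subset of `U`. -/
def MemLinftyLoc {E : Type*} [TopologicalSpace E] [MeasureSpace E]
    (U : Set E) (f : E → ℝ) : Prop :=
  ∀ K : Set E, IsCompact K → K ⊆ U → MemLp f ⊤ (volume.restrict K)

/-- The open quadrant `(0,∞)²`. -/
def quadrant : Set (ℝ × ℝ) := Ioi (0 : ℝ) ×ˢ Ioi (0 : ℝ)

/-- `f ∈ W^{1,∞}_loc((0,∞)²)` with weak partial derivatives `g₁` (first variable) and
`g₂` (second variable). -/
structure IsW1InftyLoc (f g₁ g₂ : ℝ × ℝ → ℝ) : Prop where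
  mem : MemLinftyLoc quadrant f
  mem_fst : MemLinftyLoc quadrant g₁
  mem_snd : MemLinftyLoc quadrant g₂
  weak_fst : HasWeakDirDeriv quadrant ((1 : ℝ), (0 : ℝ)) f g₁
  weak_snd : HasWeakDirDeriv quadrant ((0 : ℝ), (1 : ℝ)) f g₂

/-- A test function: `g ∈ W^{1,∞}(0,∞)` with weak derivative `g'`, where `g'` vanishes (almost
everywhere) outside a bounded set. -/
structure IsTestFunction (g g' : ℝ → ℝ) : Prop where
  mem : MemLp g ⊤ (volume.restrict (Ioi (0 : ℝ)))
  mem_deriv : MemLp g' ⊤ (volume.restrict (Ioi (0 : ℝ)))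
  weak_deriv : HasWeakDirDeriv (Ioi (0 : ℝ)) (1 : ℝ) g g'
  support : ∃ R : ℝ, ∀ᵐ x ∂(volume.restrict (Ioi (0 : ℝ))), R < x → g' x = 0

/-! ## Assumptions on the kernel and the initial datum -/

/-- Assumptions on the coagulation kernel, which is only evaluated on `(0,∞)²`. -/
structure IsAdmissibleKernel (k σ η : ℝ) (Λ : ℝ → ℝ → ℝ) : Prop where
  k_nonneg : 0 ≤ k
  σ_nonneg : 0 ≤ σ
  η_nonneg : 0 ≤ η
  measurable : AEMeasurable (Function.uncurry Λ) (volume.restrict quadrant)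
  nonneg : ∀ x y, 0 < x → 0 < y → 0 ≤ Λ x y
  symm : ∀ x y, 0 < x → 0 < y → Λ x y = Λ y x
  bound_small : ∀ x y, 0 < x → x < 1 → 0 < y → y < 1 → Λ x y ≤ k * (x * y) ^ (-σ)
  bound_mixed : ∀ x y, 1 ≤ x → 0 < y → y < 1 → Λ x y ≤ k * x * y ^ (-σ)
  bound_large : ∀ x y, 1 ≤ x → 1 ≤ y → Λ x y ≤ k * (x + y)
  regular : ∃ Λ₁ Λ₂ : ℝ × ℝ → ℝ, IsW1InftyLoc (Function.uncurry Λ) Λ₁ Λ₂ ∧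
    ∀ᵐ p ∂(volume.restrict quadrant), -η * p.1 ^ (-σ - 1) * p.2 ^ (-σ) ≤ Λ₁ p

/-- The positive cone of `L¹((0,∞); (x + x^{-2σ}) dx)`. -/
def IsAdmissibleDatum (σ : ℝ) (f : ℝ → ℝ) : Prop :=
  (∀ᵐ x ∂(volume.restrict (Ioi (0 : ℝ))), 0 ≤ f x) ∧
    IntegrableOn (fun x => (x + x ^ (-2 * σ)) * f x) (Ioi 0)

/-! ## Function spaces in time. A time-dependent density is written `u t x`. -/

/-- The time interval `[0, T)`, where `T` may be `⊤`. -/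
def timeInterval (T : EReal) : Set ℝ := {t : ℝ | 0 ≤ t ∧ (t : EReal) < T}

/-- `u ∈ C_w([0,T); L¹((0,∞); w dx))` for a positive weight `w`: every `u t` lies in the weighted
space, and `u` is continuous in its weak topology, the dual being `L^∞(0,∞)`. -/
structure MemCw (w : ℝ → ℝ) (T : EReal) (u : ℝ → ℝ → ℝ) : Prop where
  integrable : ∀ t ∈ timeInterval T, IntegrableOn (fun x => w x * u t x) (Ioi 0)
  weak_continuous : ∀ ψ : ℝ → ℝ, MemLp ψ ⊤ (volume.restrict (Ioi (0 : ℝ))) →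
    ContinuousOn (fun t => ∫ x in Ioi (0 : ℝ), ψ x * (w x * u t x)) (timeInterval T)

/-- Convergence `u n → v` in `C_w([0,T); L¹((0,∞); w dx))`: the functions belong to the space, and
the convergence holds in the weak topology, uniformly on compact subsets of `[0,T)`. -/
structure TendstoCw (w : ℝ → ℝ) (T : EReal) (u : ℕ → ℝ → ℝ → ℝ) (v : ℝ → ℝ → ℝ) : Prop where
  mem : ∀ n, MemCw w T (u n)
  mem_lim : MemCw w T v
  tendsto : ∀ ψ : ℝ → ℝ, MemLp ψ ⊤ (volume.restrict (Ioi (0 : ℝ))) →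
    ∀ b ∈ timeInterval T,
      TendstoUniformlyOn (fun n t => ∫ x in Ioi (0 : ℝ), ψ x * (w x * u n t x))
        (fun t => ∫ x in Ioi (0 : ℝ), ψ x * (w x * v t x)) atTop (Icc 0 b)

/-- The weight `x^{-σ} + x`. -/
noncomputable def weight (σ : ℝ) (x : ℝ) : ℝ := x ^ (-σ) + x

/-- Nonnegative elements of `C_w([0,T); L¹(dx)) ∩ L^∞(0,T; L¹((x^{-σ} + x) dx))`.
(Measurability in time follows from weak continuity.) -/
structure IsSolutionClass (σ : ℝ) (T : EReal) (u : ℝ → ℝ → ℝ) : Prop where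
  nonneg : ∀ t ∈ timeInterval T, ∀ᵐ x ∂(volume.restrict (Ioi (0 : ℝ))), 0 ≤ u t x
  mem_Cw : MemCw (fun _ => 1) T u
  bounded : ∃ C : ℝ, ∀ᵐ t ∂(volume.restrict (timeInterval T)),
    IntegrableOn (fun x => weight σ x * u t x) (Ioi 0) ∧
      ∫ x in Ioi (0 : ℝ), weight σ x * u t x ≤ C

/-! ## Weak solutions -/

/-- Weak solutions on `[0,T)` to the Oort–Hulst–Safronov equation with initial datum `f`. For an
admissible kernel, the membership in the solution class makes all integrals absolutely
convergent (the inner ones for almost every time `s`). -/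
structure IsWeakSolutionOHS (σ : ℝ) (Λ : ℝ → ℝ → ℝ) (f : ℝ → ℝ) (T : EReal)
    (u : ℝ → ℝ → ℝ) : Prop where
  mem : IsSolutionClass σ T u
  eqn : ∀ g g' : ℝ → ℝ, IsTestFunction g g' → ∀ t ∈ timeInterval T,
    ∫ x in Ioi (0 : ℝ), g x * (u t x - f x) =
      ∫ s in (0 : ℝ)..t, ∫ y in Ioi (0 : ℝ), ∫ z in Ioo (0 : ℝ) y,
        (z * g' y - g z) * Λ y z * u s y * u s z

/-- Weak solutions on `[0,T)` to the `ε`-generalized coagulation equation with initial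
datum `f`. -/
structure IsWeakSolutionGen (σ : ℝ) (Λ : ℝ → ℝ → ℝ) (f : ℝ → ℝ) (ε : ℝ) (T : EReal)
    (u : ℝ → ℝ → ℝ) : Prop where
  mem : IsSolutionClass σ T u
  eqn : ∀ g g' : ℝ → ℝ, IsTestFunction g g' → ∀ t ∈ timeInterval T,
    ∫ x in Ioi (0 : ℝ), g x * (u t x - f x) =
      ∫ s in (0 : ℝ)..t, ∫ y in Ioi (0 : ℝ), ∫ z in Ioo (0 : ℝ) y,
        ((g (y + ε * z) - g y) / ε - g z) * Λ y z * u s y * u s z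

/-- The first moment of `g` on `(0,∞)` is finite and equals that of `f`. -/
def SameMass (g f : ℝ → ℝ) : Prop :=
  IntegrableOn (fun x => x * g x) (Ioi 0) ∧
    ∫ x in Ioi (0 : ℝ), x * g x = ∫ x in Ioi (0 : ℝ), x * f x

end OHS

/-!
# From the Smoluchowski equation to the Oort-Hulst-Safronov equation

The argument is a compactness argument in `L¹((0,∞); (x^{-σ} + x) dx)` that is uniform in `ε`.

*Flows.* Because of the symmetry of the kernel only its values on `0 < z < y` matter. There the
kernel agrees almost everywhere with a nonnegative function `L`, for which the one-sided bound on
the derivative is an inequality `L (y - ε z, z) - L (y, z) ≤ ε η z^{-2σ}` between values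
(`IsReducedKernel`, `IsAdmissibleKernel.exists_isReducedKernel`). For fixed `ε` every function
`(g (y + ε z) - g y) / ε - g z` with bounded `g` is bounded, so by a monotone class argument a weak
solution may be tested with all bounded measurable functions (`IsFlow`,
`IsWeakSolutionGen.exists_isFlow`).

*Uniform estimates.* Nonincreasing functions of the size, and the size itself, have nonincreasing
moments (`IsFlow.integral_antitone_le`, `IsFlow.first_moment_le`). The first moment beyond a level
`R` grows at a rate controlled by the first moment beyond `R / 4`, since a collision involves a
particle of size at least `R / 2` if it produces one of size `R`; iterating down from a high level
gives uniformly small tails (`exists_tail_le`). The decisive estimate is equi-integrability: for the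
indicator `θ` of the superlevel set `{u(t) > ℓ}`, one may replace `(θ (y + ε z) - θ y) u(y)` by
`ℓ (θ (y + ε z) - θ y)`, and a shear moves the difference quotient onto `L`, where its upper bound is
uniform in `ε` (`coagRate_superlevel_le`). Hence the excess of `u` above `ℓ` grows at a rate
controlled by its excess above `ℓ / 2`, and the same iteration applies (`exists_excess_le`,
`exists_equiIntegrable`).

*Limits.* Equi-integrability, equicontinuity in time and a diagonal argument give a subsequence that
converges weakly in the weighted space, locally uniformly in time; tensor squares converge as well,
and the collision integrals pass to the limit even if the kernel or `ε` varies
(`IsFlowSeq.exists_limit`). The case `ε → 0` gives solutions of the Oort-Hulst-Safronov equation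
(`exists_tendsto_isWeakSolutionOHS`). For fixed `ε` and the kernels `min L n` it gives existence
for the generalized equation (`exists_isWeakSolutionGen`), once bounded kernels are treated: there
the collision operator is locally Lipschitz on `L¹`, and the equation is an ordinary differential
equation whose solutions stay nonnegative and do not gain particles (`exists_isFlow_of_bounded`).

*Conservation of mass.* For the test function `g = min x n` the expression `z g'(y) - g z` vanishes
for `y < n`, so the collision integral tends to zero by dominated convergence
(`IsWeakSolutionOHS.sameMass`).
-/

namespace OHS

/-! ### Weights, densities and the coagulation operator -/

theorem one_le_weight {σ x : ℝ} (hσ : 0 ≤ σ) (hx : 0 < x) : 1 ≤ weight σ x := by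
  unfold weight
  rcases le_total x 1 with h | h
  · have := Real.one_le_rpow_of_pos_of_le_one_of_nonpos hx h (neg_nonpos.2 hσ)
    linarith
  · have := Real.rpow_nonneg hx.le (-σ)
    linarith

theorem weight_pos {σ x : ℝ} (hx : 0 < x) : 0 < weight σ x :=
  add_pos (Real.rpow_pos_of_pos hx _) hx

theorem le_weight {σ x : ℝ} (hx : 0 < x) : x ≤ weight σ x := by
  unfold weight
  have := Real.rpow_nonneg hx.le (-σ)
  linarith

theorem rpow_le_weight {σ x : ℝ} (hx : 0 < x) : x ^ (-σ) ≤ weight σ x := by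
  unfold weight; linarith

theorem max_rpow_le_weight {σ x : ℝ} (hx : 0 < x) : max x (x ^ (-σ)) ≤ weight σ x :=
  max_le (le_weight hx) (rpow_le_weight hx)

theorem max_one_rpow_le_weight {σ x : ℝ} (hσ : 0 ≤ σ) (hx : 0 < x) :
    max 1 (x ^ (-σ)) ≤ weight σ x :=
  max_le (one_le_weight hσ hx) (rpow_le_weight hx)

theorem mul_max_one_rpow_le_weight {σ x : ℝ} (hσ : 0 ≤ σ) (hx : 0 < x) :
    x * max 1 (x ^ (-σ)) ≤ weight σ x := by
  rcases le_total x 1 with h | h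
  · have h1 := Real.one_le_rpow_of_pos_of_le_one_of_nonpos hx h (neg_nonpos.2 hσ)
    rw [max_eq_right h1]
    calc x * x ^ (-σ) ≤ 1 * x ^ (-σ) := by gcongr
      _ ≤ weight σ x := by rw [one_mul]; exact rpow_le_weight hx
  · have h1 := Real.rpow_le_one_of_one_le_of_nonpos h (neg_nonpos.2 hσ)
    rw [max_eq_left h1, mul_one]
    exact le_weight hx

theorem weight_le_two_mul {σ x : ℝ} (hσ : 0 ≤ σ) (hx : 1 ≤ x) : weight σ x ≤ 2 * x := by
  have := Real.rpow_le_one_of_one_le_of_nonpos hx (neg_nonpos.2 hσ)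
  unfold weight; linarith

theorem measurable_weight (σ : ℝ) : Measurable (weight σ) := by
  unfold weight
  fun_prop

/-- Measurable nonnegative functions on the line that vanish on `(-∞, 0]`: these represent the
densities on `(0,∞)`, so that all integrals may be taken over the whole line. -/
structure IsDensity (u : ℝ → ℝ) : Prop where
  measurable : Measurable u
  nonneg : ∀ x, 0 ≤ u x
  eq_zero : ∀ x, x ≤ 0 → u x = 0

/-- The operator `(y, z) ↦ (g (y + ε z) - g y) / ε - g z` of the weak formulation. -/
noncomputable def coagOp (ε : ℝ) (g : ℝ → ℝ) (p : ℝ × ℝ) : ℝ :=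
  (g (p.1 + ε * p.2) - g p.1) / ε - g p.2

theorem measurable_coagOp (ε : ℝ) {g : ℝ → ℝ} (hg : Measurable g) : Measurable (coagOp ε g) := by
  unfold coagOp
  fun_prop

theorem abs_coagOp_le {ε M : ℝ} (hε : 0 < ε) {g : ℝ → ℝ} (hg : ∀ x, |g x| ≤ M) (p : ℝ × ℝ) :
    |coagOp ε g p| ≤ (2 / ε + 1) * M := by
  unfold coagOp
  have h1 : |(g (p.1 + ε * p.2) - g p.1) / ε| ≤ (M + M) / ε := by
    rw [abs_div, abs_of_pos hε]
    gcongr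
    exact (abs_sub _ _).trans (add_le_add (hg _) (hg _))
  calc _ ≤ (M + M) / ε + M := (abs_sub _ _).trans (add_le_add h1 (hg _))
    _ = _ := by ring

theorem abs_coagOp_le_of_lipschitz {ε M ℓ : ℝ} (hε : 0 < ε) {g : ℝ → ℝ} (hg : ∀ x, |g x| ≤ M)
    (hl : ∀ x y, |g x - g y| ≤ ℓ * |x - y|) {p : ℝ × ℝ} (hp : 0 < p.2) :
    |coagOp ε g p| ≤ ℓ * p.2 + M := by
  unfold coagOp
  have h1 : |(g (p.1 + ε * p.2) - g p.1) / ε| ≤ ℓ * p.2 := by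
    rw [abs_div, abs_of_pos hε, div_le_iff₀ hε]
    refine (hl _ _).trans (le_of_eq ?_)
    rw [add_sub_cancel_left, abs_of_pos (mul_pos hε hp)]; ring
  exact (abs_sub _ _).trans (add_le_add h1 (hg _))

/-- The kernel seen by the weak formulation: the coagulation kernel multiplied by the indicator of
`0 < z < y`. The last field is the integrated form, along the segment from `(y - ε z, z)` to
`(y, z)`, of the one-sided bound on the derivative in the first variable. -/
structure IsReducedKernel (k σ η : ℝ) (L : ℝ × ℝ → ℝ) : Prop where
  k_nonneg : 0 ≤ k
  σ_nonneg : 0 ≤ σ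
  η_nonneg : 0 ≤ η
  measurable : Measurable L
  nonneg : ∀ p, 0 ≤ L p
  eq_zero : ∀ p : ℝ × ℝ, ¬ (0 < p.2 ∧ p.2 < p.1) → L p = 0
  le : ∀ p : ℝ × ℝ, 0 < p.2 → p.2 < p.1 →
    L p ≤ 2 * k * (max p.1 (p.1 ^ (-σ)) * max 1 (p.2 ^ (-σ)))
  incr : ∀ ε ∈ Ioc (0 : ℝ) 1, ∀ᵐ p : ℝ × ℝ, 0 < p.2 → (1 + ε) * p.2 < p.1 →
    L (p.1 - ε * p.2, p.2) - L p ≤ ε * η * p.2 ^ (-2 * σ)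

namespace IsReducedKernel

variable {k σ η : ℝ} {L : ℝ × ℝ → ℝ}

theorem le_weight_mul (hL : IsReducedKernel k σ η L) {p : ℝ × ℝ} (h1 : 0 < p.1) (h2 : 0 < p.2) :
    L p ≤ 2 * k * (weight σ p.1 * weight σ p.2) := by
  have hk := hL.k_nonneg
  by_cases h : p.2 < p.1
  · refine (hL.le p h2 h).trans ?_
    gcongr
    · exact (weight_pos h1).le
    · exact max_rpow_le_weight h1
    · exact max_one_rpow_le_weight hL.σ_nonneg h2
  · rw [hL.eq_zero p (by tauto)]
    have := weight_pos (σ := σ) h1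
    have := weight_pos (σ := σ) h2
    positivity

theorem mul_le_weight_mul (hL : IsReducedKernel k σ η L) {p : ℝ × ℝ} (h1 : 0 < p.1)
    (h2 : 0 < p.2) : p.2 * L p ≤ 2 * k * (weight σ p.1 * weight σ p.2) := by
  have hk := hL.k_nonneg
  by_cases h : p.2 < p.1
  · calc p.2 * L p ≤ p.2 * (2 * k * (max p.1 (p.1 ^ (-σ)) * max 1 (p.2 ^ (-σ)))) := by
          gcongr; exact hL.le p h2 h
      _ = 2 * k * (max p.1 (p.1 ^ (-σ)) * (p.2 * max 1 (p.2 ^ (-σ)))) := by ring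
      _ ≤ _ := by
        gcongr
        · exact (weight_pos h1).le
        · exact max_rpow_le_weight h1
        · exact mul_max_one_rpow_le_weight hL.σ_nonneg h2
  · rw [hL.eq_zero p (by tauto)]
    have := weight_pos (σ := σ) h1
    have := weight_pos (σ := σ) h2
    simp only [mul_zero]
    positivity

/-- Large first arguments enter only through the factor `y` (and not `y ^ (-σ) + y`). -/
theorem mul_le_mul_weight (hL : IsReducedKernel k σ η L) {p : ℝ × ℝ} (h1 : 1 ≤ p.1)
    (h2 : 0 < p.2) : p.2 * L p ≤ 2 * k * (p.1 * weight σ p.2) := by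
  have hk := hL.k_nonneg
  by_cases h : p.2 < p.1
  · have h3 : max p.1 (p.1 ^ (-σ)) = p.1 :=
      max_eq_left ((Real.rpow_le_one_of_one_le_of_nonpos h1
        (neg_nonpos.2 hL.σ_nonneg)).trans h1)
    calc p.2 * L p ≤ p.2 * (2 * k * (max p.1 (p.1 ^ (-σ)) * max 1 (p.2 ^ (-σ)))) := by
          gcongr; exact hL.le p h2 h
      _ = 2 * k * (p.1 * (p.2 * max 1 (p.2 ^ (-σ)))) := by rw [h3]; ring
      _ ≤ _ := by
        gcongr
        exact mul_max_one_rpow_le_weight hL.σ_nonneg h2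
  · rw [hL.eq_zero p (by tauto)]
    have := weight_pos (σ := σ) h2
    simp only [mul_zero]
    positivity

/-- Truncating the kernel from above preserves the assumptions; a smooth cut-off in the first
variable would destroy the one-sided bound on the increments. -/
theorem truncate (hL : IsReducedKernel k σ η L) {B : ℝ} (hB : 0 ≤ B) :
    IsReducedKernel k σ η (fun p => min (L p) B) where
  k_nonneg := hL.k_nonneg
  σ_nonneg := hL.σ_nonneg
  η_nonneg := hL.η_nonneg
  measurable := hL.measurable.min measurable_const
  nonneg p := le_min (hL.nonneg p) hB
  eq_zero p hp := by rw [hL.eq_zero p hp]; exact min_eq_left hB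
  le p h1 h2 := (min_le_left _ _).trans (hL.le p h1 h2)
  incr ε hε := by
    filter_upwards [hL.incr ε hε] with p hp h1 h2
    have h3 := hp h1 h2
    have h4 : 0 ≤ ε * η * p.2 ^ (-2 * σ) :=
      mul_nonneg (mul_nonneg hε.1.le hL.η_nonneg) (Real.rpow_nonneg h1.le _)
    rcases le_total (L p) B with h | h
    · have := min_le_left (L (p.1 - ε * p.2, p.2)) B
      rw [min_eq_left h]; linarith
    · have := min_le_right (L (p.1 - ε * p.2, p.2)) B
      rw [min_eq_right h]; linarith

end IsReducedKernel

/-! ### Integrals against the tensor square of a density -/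

theorem integrable_of_weight_mul {σ : ℝ} (hσ : 0 ≤ σ) {u : ℝ → ℝ} (hu : IsDensity u)
    (hw : Integrable fun x => weight σ x * u x) : Integrable u := by
  refine hw.mono' hu.measurable.aestronglyMeasurable (ae_of_all _ fun x => ?_)
  rw [Real.norm_of_nonneg (hu.nonneg x)]
  rcases le_or_gt x 0 with hx | hx
  · simp [hu.eq_zero x hx]
  · exact le_mul_of_one_le_left (hu.nonneg x) (one_le_weight hσ hx)

theorem IsDensity.weight_mul {u : ℝ → ℝ} (hu : IsDensity u) (σ : ℝ) :
    IsDensity fun x => weight σ x * u x where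
  measurable := (measurable_weight σ).mul hu.measurable
  nonneg x := by
    rcases le_or_gt x 0 with hx | hx
    · simp [hu.eq_zero x hx]
    · exact mul_nonneg (weight_pos hx).le (hu.nonneg x)
  eq_zero x hx := by simp [hu.eq_zero x hx]

theorem IsDensity.le_weight_mul {u : ℝ → ℝ} (hu : IsDensity u) {σ : ℝ} (hσ : 0 ≤ σ) (x : ℝ) :
    u x ≤ weight σ x * u x := by
  rcases le_or_gt x 0 with hx | hx
  · simp [hu.eq_zero x hx]
  · exact le_mul_of_one_le_left (hu.nonneg x) (one_le_weight hσ hx)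

/-- Pointwise domination behind every estimate of the collision integrals. -/
theorem abs_mul_tensor_le {σ C : ℝ} {u v : ℝ → ℝ} {K : ℝ × ℝ → ℝ} (hu : IsDensity u) (hv : IsDensity v)
    {p : ℝ × ℝ} (hK : 0 < p.1 → 0 < p.2 → |K p| ≤ C * (weight σ p.1 * weight σ p.2)) :
    |K p * (u p.1 * v p.2)| ≤ C * ((weight σ p.1 * u p.1) * (weight σ p.2 * v p.2)) := by
  rcases le_or_gt p.1 0 with h1 | h1
  · simp [hu.eq_zero _ h1]
  rcases le_or_gt p.2 0 with h2 | h2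
  · simp [hv.eq_zero _ h2]
  rw [abs_mul, abs_of_nonneg (mul_nonneg (hu.nonneg _) (hv.nonneg _))]
  calc _ ≤ C * (weight σ p.1 * weight σ p.2) * (u p.1 * v p.2) :=
        mul_le_mul_of_nonneg_right (hK h1 h2) (mul_nonneg (hu.nonneg _) (hv.nonneg _))
    _ = _ := by ring

theorem integrable_mul_tensor {σ C : ℝ} {u v : ℝ → ℝ} {K : ℝ × ℝ → ℝ}
    (hu : IsDensity u) (hv : IsDensity v)
    (hwu : Integrable fun x => weight σ x * u x) (hwv : Integrable fun x => weight σ x * v x)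
    (hKm : Measurable K)
    (hK : ∀ p : ℝ × ℝ, 0 < p.1 → 0 < p.2 → |K p| ≤ C * (weight σ p.1 * weight σ p.2)) :
    Integrable fun p : ℝ × ℝ => K p * (u p.1 * v p.2) := by
  refine Integrable.mono' ((hwu.mul_prod hwv).const_mul C) ?_ (ae_of_all _ fun p => ?_)
  · exact (hKm.mul ((hu.measurable.comp measurable_fst).mul
      (hv.measurable.comp measurable_snd))).aestronglyMeasurable
  · exact abs_mul_tensor_le hu hv (hK p)

theorem abs_integral_mul_tensor_le {σ C : ℝ} {u v : ℝ → ℝ} {K : ℝ × ℝ → ℝ}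
    (hu : IsDensity u) (hv : IsDensity v)
    (hwu : Integrable fun x => weight σ x * u x) (hwv : Integrable fun x => weight σ x * v x)
    (hK : ∀ p : ℝ × ℝ, 0 < p.1 → 0 < p.2 → |K p| ≤ C * (weight σ p.1 * weight σ p.2)) :
    |∫ p : ℝ × ℝ, K p * (u p.1 * v p.2)| ≤
      C * ((∫ x, weight σ x * u x) * ∫ x, weight σ x * v x) := by
  rw [← integral_prod_mul, ← integral_const_mul, ← Real.norm_eq_abs]
  refine norm_integral_le_of_norm_le ((hwu.mul_prod hwv).const_mul C) (ae_of_all _ fun p => ?_)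
  exact abs_mul_tensor_le hu hv (hK p)

/-! ### Measurability in time -/

theorem measurable_withDensity_of_setIntegral {u : ℝ → ℝ → ℝ} (hu : ∀ t, IsDensity (u t))
    (hi : ∀ t, Integrable (u t))
    (hm : ∀ A, MeasurableSet A → Measurable fun t => ∫ x in A, u t x) :
    Measurable fun t => (volume : Measure ℝ).withDensity fun x => ENNReal.ofReal (u t x) := by
  refine Measure.measurable_of_measurable_coe _ fun A hA => ?_
  have : (fun t => ((volume : Measure ℝ).withDensity fun x => ENNReal.ofReal (u t x)) A) =
      fun t => ENNReal.ofReal (∫ x in A, u t x) := by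
    ext t
    rw [withDensity_apply _ hA, ofReal_integral_eq_lintegral_ofReal (hi t).integrableOn
      (ae_of_all _ (hu t).nonneg)]
  rw [this]
  exact (hm A hA).ennreal_ofReal

theorem integral_withDensity_ofReal {α : Type*} [MeasurableSpace α] {μ : Measure α} {v : α → ℝ}
    (hv : Measurable v) (h0 : ∀ x, 0 ≤ v x) (φ : α → ℝ) :
    ∫ x, φ x ∂(μ.withDensity fun x => ENNReal.ofReal (v x)) = ∫ x, φ x * v x ∂μ := by
  rw [integral_withDensity_eq_integral_toReal_smul hv.ennreal_ofReal (by simp)]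
  refine integral_congr_ae (ae_of_all _ fun x => ?_)
  simp only [smul_eq_mul, ENNReal.toReal_ofReal (h0 x)]
  ring

theorem prod_withDensity_ofReal {u v : ℝ → ℝ} (hu : IsDensity u) (hv : IsDensity v) :
    ((volume : Measure ℝ).withDensity fun x => ENNReal.ofReal (u x)).prod
      ((volume : Measure ℝ).withDensity fun x => ENNReal.ofReal (v x)) =
    (volume : Measure (ℝ × ℝ)).withDensity fun p => ENNReal.ofReal (u p.1 * v p.2) := by
  have : SFinite ((volume : Measure ℝ).withDensity fun x => ENNReal.ofReal (v x)) := inferInstance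
  rw [prod_withDensity hu.measurable.ennreal_ofReal hv.measurable.ennreal_ofReal]
  simp_rw [ENNReal.ofReal_mul (hu.nonneg _)]
  rfl

theorem measurable_integral_mul_tensor {u : ℝ → ℝ → ℝ} (hu : ∀ t, IsDensity (u t))
    (hi : ∀ t, Integrable (u t)) {C : ℝ} (hC : ∀ t, ∫ x, u t x ≤ C)
    (hm : ∀ A, MeasurableSet A → Measurable fun t => ∫ x in A, u t x)
    {K : ℝ × ℝ → ℝ} (hK : Measurable K) :
    Measurable fun t => ∫ p : ℝ × ℝ, K p * (u t p.1 * u t p.2) := by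
  let κ : ProbabilityTheory.Kernel ℝ ℝ :=
    ⟨_, measurable_withDensity_of_setIntegral hu hi hm⟩
  have hκ : ∀ t, κ t = (volume : Measure ℝ).withDensity fun x => ENNReal.ofReal (u t x) :=
    fun t => rfl
  have : ProbabilityTheory.IsFiniteKernel κ := by
    refine ⟨ENNReal.ofReal C, ENNReal.ofReal_lt_top, fun t => ?_⟩
    rw [hκ, withDensity_apply _ MeasurableSet.univ, setLIntegral_univ,
      ← ofReal_integral_eq_lintegral_ofReal (hi t) (ae_of_all _ (hu t).nonneg)]
    exact ENNReal.ofReal_le_ofReal (hC t)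
  have h := (hK.stronglyMeasurable.integral_kernel (κ := κ.prod κ)).measurable
  convert h using 2 with t
  rw [ProbabilityTheory.Kernel.prod_apply, hκ, prod_withDensity_ofReal (hu t) (hu t),
    integral_withDensity_ofReal _ (fun p => mul_nonneg ((hu t).nonneg _) ((hu t).nonneg _))]
  exact ((hu t).measurable.comp measurable_fst).mul ((hu t).measurable.comp measurable_snd)

theorem measurable_integral_mul {u : ℝ → ℝ → ℝ} (hu : ∀ t, IsDensity (u t))
    (hi : ∀ t, Integrable (u t))
    (hm : ∀ A, MeasurableSet A → Measurable fun t => ∫ x in A, u t x)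
    {φ : ℝ → ℝ} (hφ : Measurable φ) : Measurable fun t => ∫ x, φ x * u t x := by
  let κ : ProbabilityTheory.Kernel ℝ ℝ :=
    ⟨_, measurable_withDensity_of_setIntegral hu hi hm⟩
  have hκ : ∀ t, κ t = (volume : Measure ℝ).withDensity fun x => ENNReal.ofReal (u t x) :=
    fun t => rfl
  have h := (hφ.stronglyMeasurable.integral_kernel (κ := κ)).measurable
  convert h using 2 with t
  rw [hκ, integral_withDensity_ofReal (hu t).measurable (hu t).nonneg]

/-! ### Flows -/

/-- The collision integral `∫∫ ((g (y + ε z) - g y) / ε - g z) L(y, z) u(y) u(z) dz dy`. -/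
noncomputable def coagRate (ε : ℝ) (L : ℝ × ℝ → ℝ) (g u : ℝ → ℝ) : ℝ :=
  ∫ p : ℝ × ℝ, coagOp ε g p * L p * (u p.1 * u p.2)

/-- Global solutions of the weak `ε`-generalized equation with every bounded measurable function
as a test function. For convenience they are defined at all real times and everywhere in space. -/
structure IsFlow (σ ε : ℝ) (L : ℝ × ℝ → ℝ) (f : ℝ → ℝ) (u : ℝ → ℝ → ℝ) : Prop where
  dens : ∀ t, IsDensity (u t)
  meas : ∀ A, MeasurableSet A → Measurable fun t => ∫ x in A, u t x
  integrable : ∀ t, Integrable fun x => weight σ x * u t x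
  bound : ∃ C, ∀ t, ∫ x, weight σ x * u t x ≤ C
  eqn : ∀ g : ℝ → ℝ, Measurable g → (∃ M, ∀ x, |g x| ≤ M) → ∀ t, 0 ≤ t →
    (∫ x, g x * u t x) - ∫ x, g x * f x = ∫ s in (0 : ℝ)..t, coagRate ε L g (u s)

/-! ### Moment estimates -/

/-- A form of Fatou's lemma. -/
theorem integrable_of_tendsto_of_integral_le {α : Type*} [MeasurableSpace α] {μ : Measure α}
    {F : ℕ → α → ℝ} {G : α → ℝ} {C : ℝ} (hF : ∀ n, Integrable (F n) μ) (h0 : ∀ n x, 0 ≤ F n x)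
    (hG : AEStronglyMeasurable G μ) (hlim : ∀ x, Tendsto (fun n => F n x) atTop (𝓝 (G x)))
    (hC : ∀ n, ∫ x, F n x ∂μ ≤ C) : Integrable G μ ∧ ∫ x, G x ∂μ ≤ C := by
  have hG0 : ∀ x, 0 ≤ G x := fun x => ge_of_tendsto' (hlim x) fun n => h0 n x
  have hC0 : 0 ≤ C := (integral_nonneg (h0 0)).trans (hC 0)
  have key : ∫⁻ x, ENNReal.ofReal (G x) ∂μ ≤ ENNReal.ofReal C := by
    have h1 : ∀ x, ENNReal.ofReal (G x) = liminf (fun n => ENNReal.ofReal (F n x)) atTop :=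
      fun x => (((ENNReal.continuous_ofReal.tendsto _).comp (hlim x)).liminf_eq).symm
    simp_rw [h1]
    refine (lintegral_liminf_le' fun n => (hF n).aemeasurable.ennreal_ofReal).trans ?_
    refine liminf_le_of_frequently_le' (Eventually.frequently (Eventually.of_forall fun n => ?_))
    rw [← ofReal_integral_eq_lintegral_ofReal (hF n) (ae_of_all _ (h0 n))]
    exact ENNReal.ofReal_le_ofReal (hC n)
  have hi : Integrable G μ :=
    ⟨hG, by
      rw [hasFiniteIntegral_iff_ofReal (ae_of_all _ hG0)]
      exact key.trans_lt ENNReal.ofReal_lt_top⟩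
  refine ⟨hi, ?_⟩
  rw [← ofReal_integral_eq_lintegral_ofReal hi (ae_of_all _ hG0)] at key
  exact (ENNReal.ofReal_le_ofReal_iff hC0).1 key

theorem IsDensity.integrable_mul_of_le_weight {u : ℝ → ℝ} (hu : IsDensity u) {σ : ℝ}
    (hw : Integrable fun x => weight σ x * u x) {φ : ℝ → ℝ} (hφ : Measurable φ) {M : ℝ}
    (h : ∀ x, 0 < x → |φ x| ≤ M * weight σ x) : Integrable fun x => φ x * u x := by
  refine (hw.const_mul M).mono' (hφ.mul hu.measurable).aestronglyMeasurable
    (ae_of_all _ fun x => ?_)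
  rcases le_or_gt x 0 with hx | hx
  · simp [hu.eq_zero x hx]
  · rw [Real.norm_eq_abs, abs_mul, abs_of_nonneg (hu.nonneg x), ← mul_assoc]
    exact mul_le_mul_of_nonneg_right (h x hx) (hu.nonneg x)

theorem IsDensity.integrable_mul_of_bounded {u : ℝ → ℝ} (hu : IsDensity u) (hi : Integrable u)
    {φ : ℝ → ℝ} (hφ : Measurable φ) {M : ℝ}
    (h : ∀ x, |φ x| ≤ M) : Integrable fun x => φ x * u x := by
  refine (hi.norm.const_mul M).mono' (hφ.mul hu.measurable).aestronglyMeasurable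
    (ae_of_all _ fun x => ?_)
  rw [Real.norm_eq_abs, abs_mul]
  exact mul_le_mul_of_nonneg_right (h x) (abs_nonneg _)

theorem abs_coagOp_mul_le {k σ η ε M : ℝ} {L : ℝ × ℝ → ℝ} (hL : IsReducedKernel k σ η L)
    (hε : 0 < ε) {g : ℝ → ℝ} (hg : ∀ x, |g x| ≤ M) (p : ℝ × ℝ) (h1 : 0 < p.1) (h2 : 0 < p.2) :
    |coagOp ε g p * L p| ≤ (2 / ε + 1) * M * (2 * k) * (weight σ p.1 * weight σ p.2) := by
  rw [abs_mul, abs_of_nonneg (hL.nonneg p), mul_assoc _ (2 * k)]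
  have hM : 0 ≤ M := (abs_nonneg _).trans (hg 0)
  exact mul_le_mul (abs_coagOp_le hε hg p) (hL.le_weight_mul h1 h2) (hL.nonneg p) (by positivity)

theorem abs_coagOp_mul_le_of_lipschitz {k σ η ε M ℓ : ℝ} {L : ℝ × ℝ → ℝ}
    (hL : IsReducedKernel k σ η L) (hε : 0 < ε) {g : ℝ → ℝ} (hg : ∀ x, |g x| ≤ M) (hℓ : 0 ≤ ℓ)
    (hl : ∀ x y, |g x - g y| ≤ ℓ * |x - y|) (p : ℝ × ℝ) (h1 : 0 < p.1) (h2 : 0 < p.2) :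
    |coagOp ε g p * L p| ≤ (ℓ + M) * (2 * k) * (weight σ p.1 * weight σ p.2) := by
  rw [abs_mul, abs_of_nonneg (hL.nonneg p)]
  have hM : 0 ≤ M := (abs_nonneg _).trans (hg 0)
  calc |coagOp ε g p| * L p ≤ (ℓ * p.2 + M) * L p :=
        mul_le_mul_of_nonneg_right (abs_coagOp_le_of_lipschitz hε hg hl h2) (hL.nonneg p)
    _ = ℓ * (p.2 * L p) + M * L p := by ring
    _ ≤ ℓ * (2 * k * (weight σ p.1 * weight σ p.2)) +
        M * (2 * k * (weight σ p.1 * weight σ p.2)) := by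
      exact add_le_add (mul_le_mul_of_nonneg_left (hL.mul_le_weight_mul h1 h2) hℓ)
        (mul_le_mul_of_nonneg_left (hL.le_weight_mul h1 h2) hM)
    _ = _ := by ring

namespace IsFlow

variable {k σ η ε : ℝ} {L : ℝ × ℝ → ℝ} {f : ℝ → ℝ} {u : ℝ → ℝ → ℝ}

theorem integrable_density (hu : IsFlow σ ε L f u) (hσ : 0 ≤ σ) (t : ℝ) : Integrable (u t) :=
  integrable_of_weight_mul hσ (hu.dens t) (hu.integrable t)

theorem bound_density (hu : IsFlow σ ε L f u) (hσ : 0 ≤ σ) : ∃ C, ∀ t, ∫ x, u t x ≤ C := by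
  obtain ⟨C, hC⟩ := hu.bound
  exact ⟨C, fun t => (integral_mono (hu.integrable_density hσ t) (hu.integrable t)
    ((hu.dens t).le_weight_mul hσ)).trans (hC t)⟩

theorem measurable_integral_tensor (hu : IsFlow σ ε L f u) (hσ : 0 ≤ σ) {K : ℝ × ℝ → ℝ}
    (hK : Measurable K) : Measurable fun t => ∫ p : ℝ × ℝ, K p * (u t p.1 * u t p.2) := by
  obtain ⟨C, hC⟩ := hu.bound_density hσ
  exact measurable_integral_mul_tensor hu.dens (hu.integrable_density hσ) hC hu.meas hK

theorem intervalIntegrable_coagRate (hu : IsFlow σ ε L f u) (hL : IsReducedKernel k σ η L)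
    (hε : 0 < ε) {g : ℝ → ℝ} (hg : Measurable g) {M : ℝ} (hM : ∀ x, |g x| ≤ M) (a b : ℝ) :
    IntervalIntegrable (fun s => coagRate ε L g (u s)) volume a b := by
  obtain ⟨C, hC⟩ := hu.bound
  have h0 : 0 ≤ M := (abs_nonneg _).trans (hM 0)
  have hk := hL.k_nonneg
  refine (intervalIntegrable_const (c := (2 / ε + 1) * M * (2 * k) * (C * C))).mono_fun' ?_
    (ae_of_all _ fun s => ?_)
  · exact (hu.measurable_integral_tensor hL.σ_nonneg
      ((measurable_coagOp ε hg).mul hL.measurable)).aestronglyMeasurable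
  · have hi0 : 0 ≤ ∫ x, weight σ x * u s x := integral_nonneg ((hu.dens s).weight_mul σ).nonneg
    refine (abs_integral_mul_tensor_le (hu.dens s) (hu.dens s) (hu.integrable s)
      (hu.integrable s) (abs_coagOp_mul_le hL hε hM)).trans ?_
    exact mul_le_mul_of_nonneg_left (mul_le_mul (hC s) (hC s) hi0 (hi0.trans (hC s)))
      (by positivity)

theorem integral_le_of_coagOp_nonpos (hu : IsFlow σ ε L f u) (hL : IsReducedKernel k σ η L)
    {g : ℝ → ℝ} (hg : Measurable g) {M : ℝ} (hM : ∀ x, |g x| ≤ M)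
    (h : ∀ p : ℝ × ℝ, 0 < p.2 → p.2 < p.1 → coagOp ε g p ≤ 0) {t : ℝ} (ht : 0 ≤ t) :
    ∫ x, g x * u t x ≤ ∫ x, g x * f x := by
  have h1 := hu.eqn g hg ⟨M, hM⟩ t ht
  have h2 : ∫ s in (0 : ℝ)..t, coagRate ε L g (u s) ≤ 0 := by
    rw [intervalIntegral.integral_of_le ht]
    refine integral_nonpos fun s => integral_nonpos fun p => ?_
    refine mul_nonpos_of_nonpos_of_nonneg ?_ (mul_nonneg ((hu.dens s).nonneg _)
      ((hu.dens s).nonneg _))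
    by_cases hp : 0 < p.2 ∧ p.2 < p.1
    · exact mul_nonpos_of_nonpos_of_nonneg (h p hp.1 hp.2) (hL.nonneg p)
    · simp [hL.eq_zero p hp]
  linarith

/-- Every nonincreasing moment decreases in time. -/
theorem integral_antitone_le (hu : IsFlow σ ε L f u) (hL : IsReducedKernel k σ η L)
    (hf : IsDensity f) (hε : 0 < ε) {g : ℝ → ℝ} (hg : Measurable g) (h0 : ∀ x, 0 < x → 0 ≤ g x)
    (hanti : AntitoneOn g (Ioi 0)) (hi : Integrable fun x => g x * f x) {t : ℝ} (ht : 0 ≤ t) :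
    Integrable (fun x => g x * u t x) ∧ ∫ x, g x * u t x ≤ ∫ x, g x * f x := by
  -- only bounded test functions are allowed: truncate at height `n` and use Fatou's lemma
  let G : ℕ → ℝ → ℝ := fun n => (Ioi (0 : ℝ)).indicator fun x => min (g x) n
  have hGm : ∀ n, Measurable (G n) := fun n =>
    (hg.min measurable_const).indicator measurableSet_Ioi
  have hG0 : ∀ n x, 0 ≤ G n x := fun n x =>
    indicator_nonneg (fun x hx => le_min (h0 x hx) (Nat.cast_nonneg n)) x
  have hGn : ∀ n x, |G n x| ≤ n := fun n x => by
    rw [abs_of_nonneg (hG0 n x)]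
    exact indicator_le' (fun x _ => min_le_right _ _) (fun _ _ => Nat.cast_nonneg n) x
  have hGp : ∀ n x, 0 < x → G n x = min (g x) n := fun n x hx => indicator_of_mem hx _
  have hop : ∀ n, ∀ p : ℝ × ℝ, 0 < p.2 → p.2 < p.1 → coagOp ε (G n) p ≤ 0 := by
    intro n p h1 h2
    have h3 : p.1 ≤ p.1 + ε * p.2 := le_add_of_nonneg_right (mul_pos hε h1).le
    have h4 : G n (p.1 + ε * p.2) ≤ G n p.1 := by
      rw [hGp _ _ (h1.trans h2), hGp _ _ ((h1.trans h2).trans_le h3)]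
      exact min_le_min_right _ (hanti (h1.trans h2) ((h1.trans h2).trans_le h3) h3)
    unfold coagOp
    have h5 : (G n (p.1 + ε * p.2) - G n p.1) / ε ≤ 0 :=
      div_nonpos_of_nonpos_of_nonneg (sub_nonpos.2 h4) hε.le
    linarith [hG0 n p.2]
  refine integrable_of_tendsto_of_integral_le (F := fun n x => G n x * u t x)
    (fun n => (hu.dens t).integrable_mul_of_bounded (hu.integrable_density hL.σ_nonneg t)
      (hGm n) (hGn n))
    (fun n x => mul_nonneg (hG0 n x) ((hu.dens t).nonneg x))
    (hg.mul (hu.dens t).measurable).aestronglyMeasurable (fun x => ?_) (fun n => ?_)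
  · rcases le_or_gt x 0 with hx | hx
    · simp [(hu.dens t).eq_zero x hx]
    · refine Tendsto.mul_const _ (tendsto_const_nhds.congr' ?_)
      filter_upwards [eventually_ge_atTop ⌈g x⌉₊] with n hn
      rw [hGp n x hx, min_eq_left (Nat.ceil_le.1 hn)]
  · refine (hu.integral_le_of_coagOp_nonpos hL (hGm n) (hGn n) (hop n) ht).trans ?_
    refine integral_mono_of_nonneg (ae_of_all _ fun x => mul_nonneg (hG0 n x) (hf.nonneg x)) hi
      (ae_of_all _ fun x => ?_)
    rcases le_or_gt x 0 with hx | hx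
    · simp [hf.eq_zero x hx]
    · dsimp only
      rw [hGp n x hx]
      exact mul_le_mul_of_nonneg_right (min_le_left _ _) (hf.nonneg x)

/-- The truncations `min x n` satisfy `coagOp ε (min · n) ≤ 0` on `0 < z < y`, so the first moment
does not increase. -/
theorem first_moment_le (hu : IsFlow σ ε L f u) (hL : IsReducedKernel k σ η L)
    (hf : IsDensity f) (hε : 0 < ε) (hi : Integrable fun x => x * f x) {t : ℝ} (ht : 0 ≤ t) :
    Integrable (fun x => x * u t x) ∧ ∫ x, x * u t x ≤ ∫ x, x * f x := by
  let G : ℕ → ℝ → ℝ := fun n x => min (max x 0) n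
  have hGm : ∀ n, Measurable (G n) := fun n => by fun_prop
  have hG0 : ∀ n x, 0 ≤ G n x := fun n x => le_min (le_max_right _ _) (Nat.cast_nonneg n)
  have hGn : ∀ n x, |G n x| ≤ n := fun n x => by
    rw [abs_of_nonneg (hG0 n x)]; exact min_le_right _ _
  have hGp : ∀ n x, 0 < x → G n x = min x n := fun n x hx => by
    simp only [G, max_eq_left hx.le]
  have hop : ∀ n, ∀ p : ℝ × ℝ, 0 < p.2 → p.2 < p.1 → coagOp ε (G n) p ≤ 0 := by
    intro n p h1 h2
    have h3 : 0 < ε * p.2 := mul_pos hε h1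
    unfold coagOp
    rw [hGp _ _ (h1.trans h2), hGp _ _ h1, hGp _ _ (by linarith), sub_nonpos, div_le_iff₀ hε]
    rcases le_total p.2 (n : ℝ) with h | h
    · rw [min_eq_left h]
      rcases le_total p.1 (n : ℝ) with h' | h'
      · rw [min_eq_left h']
        linarith [min_le_left (p.1 + ε * p.2) (n : ℝ)]
      · rw [min_eq_right h']
        linarith [min_le_right (p.1 + ε * p.2) (n : ℝ)]
    · rw [min_eq_right h, min_eq_right (h.trans h2.le), min_eq_right (by linarith), sub_self]
      positivity
  refine integrable_of_tendsto_of_integral_le (F := fun n x => G n x * u t x)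
    (fun n => (hu.dens t).integrable_mul_of_bounded (hu.integrable_density hL.σ_nonneg t)
      (hGm n) (hGn n))
    (fun n x => mul_nonneg (hG0 n x) ((hu.dens t).nonneg x))
    (measurable_id.mul (hu.dens t).measurable).aestronglyMeasurable (fun x => ?_) (fun n => ?_)
  · rcases le_or_gt x 0 with hx | hx
    · simp [(hu.dens t).eq_zero x hx]
    · refine Tendsto.mul_const _ (tendsto_const_nhds.congr' ?_)
      filter_upwards [eventually_ge_atTop ⌈x⌉₊] with n hn
      rw [hGp n x hx, min_eq_left (Nat.ceil_le.1 hn)]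
  · refine (hu.integral_le_of_coagOp_nonpos hL (hGm n) (hGn n) (hop n) ht).trans ?_
    refine integral_mono_of_nonneg (ae_of_all _ fun x => mul_nonneg (hG0 n x) (hf.nonneg x)) hi
      (ae_of_all _ fun x => ?_)
    rcases le_or_gt x 0 with hx | hx
    · simp [hf.eq_zero x hx]
    · dsimp only
      rw [hGp n x hx]
      exact mul_le_mul_of_nonneg_right (min_le_left _ _) (hf.nonneg x)

end IsFlow

theorem antitoneOn_rpow_neg {s : ℝ} (hs : 0 ≤ s) : AntitoneOn (fun x : ℝ => x ^ (-s)) (Ioi 0) :=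
  fun _ hx _ _ hxy => Real.rpow_le_rpow_of_nonpos hx hxy (neg_nonpos.2 hs)

theorem IsDensity.integrable_rpow_mul {f : ℝ → ℝ} (hf : IsDensity f) {σ : ℝ}
    (hw : Integrable fun x => weight σ x * f x) : Integrable fun x => x ^ (-σ) * f x :=
  hf.integrable_mul_of_le_weight hw (M := 1) (by fun_prop) fun x hx => by
    rw [one_mul, abs_of_nonneg (Real.rpow_nonneg hx.le _)]
    exact rpow_le_weight hx

theorem IsDensity.integrable_id_mul {f : ℝ → ℝ} (hf : IsDensity f) {σ : ℝ}
    (hw : Integrable fun x => weight σ x * f x) : Integrable fun x => x * f x :=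
  hf.integrable_mul_of_le_weight hw (M := 1) (by fun_prop) fun x hx => by
    rw [one_mul, abs_of_nonneg hx.le]
    exact le_weight hx

namespace IsFlow

variable {k σ η ε : ℝ} {L : ℝ × ℝ → ℝ} {f : ℝ → ℝ} {u : ℝ → ℝ → ℝ}

theorem integral_weight_le (hu : IsFlow σ ε L f u) (hL : IsReducedKernel k σ η L)
    (hf : IsDensity f) (hε : 0 < ε) (hw : Integrable fun x => weight σ x * f x) {t : ℝ}
    (ht : 0 ≤ t) : ∫ x, weight σ x * u t x ≤ ∫ x, weight σ x * f x := by
  obtain ⟨h1, h2⟩ := hu.integral_antitone_le hL hf hε (g := fun x => x ^ (-σ)) (by fun_prop)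
    (fun x hx => Real.rpow_nonneg hx.le _) (antitoneOn_rpow_neg hL.σ_nonneg)
    (hf.integrable_rpow_mul hw) ht
  obtain ⟨h3, h4⟩ := hu.first_moment_le hL hf hε (hf.integrable_id_mul hw) ht
  have h5 := integral_add h1 h3
  have h6 := integral_add (hf.integrable_rpow_mul hw) (hf.integrable_id_mul hw)
  simp only [weight, add_mul]
  linarith

/-- No `x ^ (-σ)`-moment concentrates at the origin. -/
theorem integral_small_le (hu : IsFlow σ ε L f u) (hL : IsReducedKernel k σ η L)
    (hf : IsDensity f) (hε : 0 < ε) (hw : Integrable fun x => weight σ x * f x) {t : ℝ}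
    (ht : 0 ≤ t) (δ : ℝ) :
    ∫ x in Iio δ, x ^ (-σ) * u t x ≤ ∫ x in Iio δ, x ^ (-σ) * f x := by
  have hg : Measurable ((Iio δ).indicator fun x : ℝ => x ^ (-σ)) :=
    Measurable.indicator (by fun_prop) measurableSet_Iio
  have heq : ∀ v : ℝ → ℝ, (fun x => (Iio δ).indicator (fun x : ℝ => x ^ (-σ)) x * v x) =
      (Iio δ).indicator fun x => x ^ (-σ) * v x := fun v => by
    ext x; by_cases hx : x ∈ Iio δ <;> simp [hx]
  have h := (hu.integral_antitone_le hL hf hε hg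
    (fun x hx => indicator_apply_nonneg fun _ => (Real.rpow_nonneg hx.le _)) ?_ ?_ ht).2
  · rwa [heq, heq, integral_indicator measurableSet_Iio, integral_indicator measurableSet_Iio] at h
  · intro x hx y hy hxy
    by_cases hyd : y < δ
    · rw [indicator_of_mem (show y ∈ Iio δ from hyd), indicator_of_mem (show x ∈ Iio δ from
        hxy.trans_lt hyd)]
      exact antitoneOn_rpow_neg hL.σ_nonneg hx hy hxy
    · rw [indicator_of_notMem (show y ∉ Iio δ from hyd)]
      exact indicator_apply_nonneg fun _ => (Real.rpow_nonneg (le_of_lt hx) _)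
  · rw [heq]
    exact (hf.integrable_rpow_mul hw).indicator measurableSet_Iio

end IsFlow

/-! ### Tails at infinity -/

/-- Iterating a delayed Grönwall inequality, in which each member of a hierarchy is controlled by
the previous one. -/
theorem le_exp_add_pow_div_factorial {h : ℕ → ℝ → ℝ} {a c M b : ℝ} (hc : 0 ≤ c)
    (hM : ∀ n, ∀ t ∈ Icc 0 b, h n t ≤ M) (ha : 0 ≤ a)
    (hi : ∀ n, ∀ t ∈ Icc 0 b, IntervalIntegrable (h n) volume 0 t)
    (hstep : ∀ n, ∀ t ∈ Icc 0 b, h (n + 1) t ≤ a + c * ∫ s in (0 : ℝ)..t, h n s) (n : ℕ) :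
    ∀ t ∈ Icc 0 b, h n t ≤ a * Real.exp (c * t) + M * ((c * t) ^ n / n.factorial) := by
  induction n with
  | zero =>
    intro t ht
    have := Real.exp_pos (c * t)
    simpa using (hM 0 t ht).trans (le_add_of_nonneg_left (by positivity))
  | succ n ih =>
    intro t ht
    have hderiv : ∀ s ∈ uIcc 0 t, HasDerivAt
        (fun s => a * Real.exp (c * s) + M * ((c * s) ^ (n + 1) / (n + 1).factorial))
        (c * (a * Real.exp (c * s) + M * ((c * s) ^ n / n.factorial))) s := by
      intro s _
      have h1 : HasDerivAt (fun s => c * s) c s := by simpa using (hasDerivAt_id s).const_mul c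
      have h2 := (h1.exp.const_mul a).add
        (((h1.pow (n + 1)).div_const ((n + 1).factorial : ℝ)).const_mul M)
      refine h2.congr_deriv ?_
      rw [Nat.factorial_succ]
      have : (n.factorial : ℝ) ≠ 0 := by positivity
      push_cast
      field_simp
    have hint : IntervalIntegrable
        (fun s => c * (a * Real.exp (c * s) + M * ((c * s) ^ n / n.factorial))) volume 0 t :=
      Continuous.intervalIntegrable (by fun_prop) _ _
    have hint' : IntervalIntegrable
        (fun s => a * Real.exp (c * s) + M * ((c * s) ^ n / n.factorial)) volume 0 t :=
      Continuous.intervalIntegrable (by fun_prop) _ _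
    have h3 := intervalIntegral.integral_eq_sub_of_hasDerivAt hderiv hint
    rw [intervalIntegral.integral_const_mul] at h3
    have h4 : ∫ s in (0 : ℝ)..t, h n s ≤
        ∫ s in (0 : ℝ)..t, (a * Real.exp (c * s) + M * ((c * s) ^ n / n.factorial)) :=
      intervalIntegral.integral_mono_on ht.1 (hi n t ht) hint' fun s hs =>
        ih s ⟨hs.1, hs.2.trans ht.2⟩
    have h5 := mul_le_mul_of_nonneg_left h4 hc
    have h6 := hstep n t ht
    simp only [mul_zero, Real.exp_zero, mul_one, ne_eq, Nat.succ_ne_zero, not_false_eq_true,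
      zero_pow, zero_div, add_zero] at h3
    linarith

/-- The excess `∫ (x - R)₊ u(x) dx` of the first moment above the level `R`. -/
noncomputable def tail (R : ℝ) (u : ℝ → ℝ) : ℝ := ∫ x, max (x - R) 0 * u x

theorem IsDensity.integrable_tail {u : ℝ → ℝ} (hu : IsDensity u) {σ : ℝ}
    (hw : Integrable fun x => weight σ x * u x) {R : ℝ} (hR : 0 ≤ R) :
    Integrable fun x => max (x - R) 0 * u x :=
  hu.integrable_mul_of_le_weight hw (M := 1) (by fun_prop) fun x hx => by
    rw [one_mul, abs_of_nonneg (le_max_right _ _)]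
    exact max_le ((sub_le_self _ hR).trans (le_weight hx)) (weight_pos hx).le

theorem tail_le_of_weight {σ C R : ℝ} {u : ℝ → ℝ} (hu : IsDensity u)
    (hw : Integrable fun x => weight σ x * u x) (hR : 0 ≤ R)
    (hC : ∫ x, weight σ x * u x ≤ C) : tail R u ≤ C := by
  refine (integral_mono (hu.integrable_tail hw hR) hw fun x => ?_).trans hC
  rcases le_or_gt x 0 with hx | hx
  · simp [hu.eq_zero x hx]
  · exact mul_le_mul_of_nonneg_right
      (max_le ((sub_le_self _ hR).trans (le_weight hx)) (weight_pos hx).le) (hu.nonneg x)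

theorem tail_anti {σ R R' : ℝ} {u : ℝ → ℝ} (hu : IsDensity u)
    (hw : Integrable fun x => weight σ x * u x) (hR : 0 ≤ R) (hRR : R ≤ R') :
    tail R' u ≤ tail R u :=
  integral_mono (hu.integrable_tail hw (hR.trans hRR)) (hu.integrable_tail hw hR) fun x =>
    mul_le_mul_of_nonneg_right (max_le_max_right _ (by linarith)) (hu.nonneg x)

theorem tail_nonneg {u : ℝ → ℝ} (hu : IsDensity u) (R : ℝ) : 0 ≤ tail R u :=
  integral_nonneg fun x => mul_nonneg (le_max_right _ _) (hu.nonneg x)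

theorem tendsto_tail {σ : ℝ} {u : ℝ → ℝ} (hu : IsDensity u)
    (hw : Integrable fun x => weight σ x * u x) :
    Tendsto (fun n : ℕ => tail n u) atTop (𝓝 0) := by
  have h0 : (0 : ℝ) = ∫ x : ℝ, (0 : ℝ) := by simp
  rw [h0]
  refine tendsto_integral_of_dominated_convergence _
    (fun n => (hu.integrable_tail hw (Nat.cast_nonneg n)).aestronglyMeasurable) hw
    (fun n => ae_of_all _ fun x => ?_) (ae_of_all _ fun x => ?_)
  · have hn : (0 : ℝ) ≤ n := Nat.cast_nonneg n
    rcases le_or_gt x 0 with hx | hx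
    · simp [hu.eq_zero x hx]
    · rw [Real.norm_of_nonneg (mul_nonneg (le_max_right _ _) (hu.nonneg x))]
      exact mul_le_mul_of_nonneg_right
        (max_le ((sub_le_self _ hn).trans (le_weight hx)) (weight_pos hx).le) (hu.nonneg x)
  · refine tendsto_const_nhds.congr' ?_
    filter_upwards [eventually_ge_atTop ⌈x⌉₊] with n hn
    have := Nat.ceil_le.1 hn
    rw [max_eq_right (by linarith), zero_mul]

namespace IsFlow

variable {k σ η ε : ℝ} {L : ℝ × ℝ → ℝ} {f : ℝ → ℝ} {u : ℝ → ℝ → ℝ}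

theorem intervalIntegrable_tail (hu : IsFlow σ ε L f u) (hσ : 0 ≤ σ) {R : ℝ} (hR : 0 ≤ R)
    (a b : ℝ) : IntervalIntegrable (fun s => tail R (u s)) volume a b := by
  obtain ⟨C, hC⟩ := hu.bound
  refine (intervalIntegrable_const (c := C)).mono_fun' ?_ (ae_of_all _ fun s => ?_)
  · exact (measurable_integral_mul hu.dens (hu.integrable_density hσ) hu.meas
      (by fun_prop)).aestronglyMeasurable
  · dsimp only
    rw [Real.norm_of_nonneg (tail_nonneg (hu.dens s) R)]
    exact tail_le_of_weight (hu.dens s) (hu.integrable s) hR (hC s)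

/-- A collision can raise the excess above `R` only if the larger particle exceeds `R / 2`, which
gives a closed hierarchy of inequalities for the excesses above the levels `R / 4 ^ n`. -/
theorem tail_le (hu : IsFlow σ ε L f u) (hL : IsReducedKernel k σ η L)
    (hf : IsDensity f) (hε : ε ∈ Ioc (0 : ℝ) 1) (hw : Integrable fun x => weight σ x * f x)
    {R : ℝ} (hR : 2 ≤ R) {t : ℝ} (ht : 0 ≤ t) :
    tail R (u t) ≤ tail R f +
      4 * k * (∫ x, weight σ x * f x) * ∫ s in (0 : ℝ)..t, tail (R / 4) (u s) := by
  set W := ∫ x, weight σ x * f x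
  have hk := hL.k_nonneg
  have hR0 : 0 ≤ R := by linarith
  let G : ℕ → ℝ → ℝ := fun n x => min (max (x - R) 0) n
  have hGm : ∀ n, Measurable (G n) := fun n => by fun_prop
  have hG0 : ∀ n x, 0 ≤ G n x := fun n x => le_min (le_max_right _ _) (Nat.cast_nonneg n)
  have hGn : ∀ n x, |G n x| ≤ n := fun n x => by
    rw [abs_of_nonneg (hG0 n x)]; exact min_le_right _ _
  have hop : ∀ n, ∀ p : ℝ × ℝ, 0 < p.1 → 0 < p.2 →
      coagOp ε (G n) p * L p ≤ 4 * k * (max (p.1 - R / 4) 0 * weight σ p.2) := by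
    intro n p h1 h2
    have h3 : 0 < ε * p.2 := mul_pos hε.1 h2
    have hw2 := weight_pos (σ := σ) h2
    have hr : 0 ≤ 4 * k * (max (p.1 - R / 4) 0 * weight σ p.2) :=
      mul_nonneg (by positivity) (mul_nonneg (le_max_right _ _) hw2.le)
    by_cases h : p.2 < p.1
    swap
    · rw [hL.eq_zero p (by tauto), mul_zero]; exact hr
    have h4 : ε * p.2 ≤ p.2 := mul_le_of_le_one_left h2.le hε.2
    -- if `y ≤ R / 2`, then `y + ε z ≤ 2 y ≤ R` and the excess does not change
    rcases le_or_gt p.1 (R / 2) with h5 | h5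
    · have h6 : coagOp ε (G n) p ≤ 0 := by
        unfold coagOp
        have h7 : G n (p.1 + ε * p.2) = 0 := by
          simp only [G]
          rw [max_eq_right (by linarith), min_eq_left (Nat.cast_nonneg n)]
        have h8 : G n p.1 = 0 := by
          simp only [G]
          rw [max_eq_right (by linarith), min_eq_left (Nat.cast_nonneg n)]
        rw [h7, h8]
        simpa using hG0 n p.2
      exact (mul_nonpos_of_nonpos_of_nonneg h6 (hL.nonneg p)).trans hr
    · have h6 : coagOp ε (G n) p ≤ p.2 := by
        unfold coagOp
        have h7 : G n (p.1 + ε * p.2) - G n p.1 ≤ ε * p.2 := by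
          simp only [G]
          rcases le_total (max (p.1 - R) 0) (n : ℝ) with h8 | h8
          · rw [min_eq_left h8]
            have h9 : max (p.1 + ε * p.2 - R) 0 ≤ max (p.1 - R) 0 + ε * p.2 :=
              max_le (by linarith [le_max_left (p.1 - R) 0]) (by linarith [le_max_right (p.1 - R) 0])
            linarith [min_le_left (max (p.1 + ε * p.2 - R) 0) (n : ℝ)]
          · rw [min_eq_right h8]
            linarith [min_le_right (max (p.1 + ε * p.2 - R) 0) (n : ℝ)]
        have h8 : (G n (p.1 + ε * p.2) - G n p.1) / ε ≤ p.2 := by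
          rw [div_le_iff₀ hε.1]; linarith
        linarith [hG0 n p.2]
      -- `y > R / 2` gives `y ≤ 2 (y - R / 4)`
      calc coagOp ε (G n) p * L p ≤ p.2 * L p := mul_le_mul_of_nonneg_right h6 (hL.nonneg p)
        _ ≤ 2 * k * (p.1 * weight σ p.2) := hL.mul_le_mul_weight (by linarith) h2
        _ ≤ 2 * k * ((2 * max (p.1 - R / 4) 0) * weight σ p.2) := by
          gcongr
          linarith [le_max_left (p.1 - R / 4) 0]
        _ = _ := by ring
  have hrate : ∀ n s, 0 ≤ s → coagRate ε L (G n) (u s) ≤ 4 * k * W * tail (R / 4) (u s) := by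
    intro n s hs
    have h1 := hu.dens s
    have h2 : coagRate ε L (G n) (u s) ≤
        ∫ p : ℝ × ℝ, 4 * k * ((max (p.1 - R / 4) 0 * u s p.1) * (weight σ p.2 * u s p.2)) := by
      refine integral_mono (integrable_mul_tensor h1 h1 (hu.integrable s) (hu.integrable s)
        ((measurable_coagOp ε (hGm n)).mul hL.measurable) (abs_coagOp_mul_le hL hε.1 (hGn n)))
        (((h1.integrable_tail (hu.integrable s) (by linarith)).mul_prod
          (hu.integrable s)).const_mul _) fun p => ?_
      dsimp only
      rcases le_or_gt p.1 0 with h3 | h3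
      · simp [h1.eq_zero _ h3]
      rcases le_or_gt p.2 0 with h4 | h4
      · simp [h1.eq_zero _ h4]
      calc _ ≤ 4 * k * (max (p.1 - R / 4) 0 * weight σ p.2) * (u s p.1 * u s p.2) :=
            mul_le_mul_of_nonneg_right (hop n p h3 h4) (mul_nonneg (h1.nonneg _) (h1.nonneg _))
        _ = _ := by ring
    refine h2.trans ?_
    rw [integral_const_mul, Measure.volume_eq_prod,
      integral_prod_mul (fun x => max (x - R / 4) 0 * u s x) (fun x => weight σ x * u s x)]
    have h3 := hu.integral_weight_le hL hf hε.1 hw hs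
    have h4 := tail_nonneg h1 (R / 4)
    calc 4 * k * (tail (R / 4) (u s) * ∫ x, weight σ x * u s x)
        ≤ 4 * k * (tail (R / 4) (u s) * W) := by gcongr
      _ = _ := by ring
  refine (integrable_of_tendsto_of_integral_le (F := fun n x => G n x * u t x)
    (fun n => (hu.dens t).integrable_mul_of_bounded (hu.integrable_density hL.σ_nonneg t)
      (hGm n) (hGn n))
    (fun n x => mul_nonneg (hG0 n x) ((hu.dens t).nonneg x))
    ((hu.dens t).integrable_tail (hu.integrable t) hR0).aestronglyMeasurable
    (fun x => ?_) (fun n => ?_)).2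
  · refine Tendsto.mul_const _ (tendsto_const_nhds.congr' ?_)
    filter_upwards [eventually_ge_atTop ⌈max (x - R) 0⌉₊] with n hn
    exact (min_eq_left (Nat.ceil_le.1 hn)).symm
  · have h1 := hu.eqn (G n) (hGm n) ⟨n, hGn n⟩ t ht
    have h2 : ∫ x, G n x * f x ≤ tail R f := by
      refine integral_mono_of_nonneg (ae_of_all _ fun x => mul_nonneg (hG0 n x) (hf.nonneg x))
        (hf.integrable_tail hw hR0) (ae_of_all _ fun x => ?_)
      exact mul_le_mul_of_nonneg_right (min_le_left _ _) (hf.nonneg x)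
    have h3 : ∫ s in (0 : ℝ)..t, coagRate ε L (G n) (u s) ≤
        ∫ s in (0 : ℝ)..t, 4 * k * W * tail (R / 4) (u s) :=
      intervalIntegral.integral_mono_on ht (hu.intervalIntegrable_coagRate hL hε.1 (hGm n)
        (hGn n) _ _) ((hu.intervalIntegrable_tail hL.σ_nonneg (by linarith) _ _).const_mul _)
        fun s hs => hrate n s hs.1
    rw [intervalIntegral.integral_const_mul] at h3
    linarith

end IsFlow

/-- The first moments of all flows with a given initial datum have uniformly small tails, locally
uniformly in time. -/
theorem exists_tail_le {σ : ℝ} {f : ℝ → ℝ} (hf : IsDensity f)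
    (hw : Integrable fun x => weight σ x * f x) (k η b : ℝ) {δ : ℝ} (hδ : 0 < δ) :
    ∃ R, 1 ≤ R ∧ ∀ ε ∈ Ioc (0 : ℝ) 1, ∀ L u, IsReducedKernel k σ η L → IsFlow σ ε L f u →
      ∀ t ∈ Icc 0 b, tail R (u t) ≤ δ := by
  rcases lt_or_ge k 0 with hk | hk
  · exact ⟨1, le_rfl, fun ε _ L u hL => absurd hL.k_nonneg (not_le.2 hk)⟩
  set W := ∫ x, weight σ x * f x
  have hW : 0 ≤ W := integral_nonneg (hf.weight_mul σ).nonneg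
  set c := 4 * k * W
  have hc : 0 ≤ c := by positivity
  have hE := Real.exp_pos (c * b)
  -- start the hierarchy at a level `m` with small initial excess, and iterate it `n` times
  obtain ⟨m, hm2, hm⟩ : ∃ m : ℕ, 2 ≤ m ∧ tail m f < δ / 2 / Real.exp (c * b) := by
    have h1 : ∀ᶠ n : ℕ in atTop, tail n f < δ / 2 / Real.exp (c * b) :=
      (tendsto_tail hf hw).eventually_lt_const (by positivity)
    obtain ⟨m, h2, h3⟩ := (h1.and (eventually_ge_atTop 2)).exists
    exact ⟨m, h3, h2⟩
  obtain ⟨n, hn⟩ : ∃ n : ℕ, W * ((c * b) ^ n / n.factorial) < δ / 2 := by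
    have h1 : Tendsto (fun n : ℕ => W * ((c * b) ^ n / n.factorial)) atTop (𝓝 (W * 0)) :=
      (FloorSemiring.tendsto_pow_div_factorial_atTop (c * b)).const_mul W
    rw [mul_zero] at h1
    exact (h1.eventually_lt_const (by positivity)).exists
  have hm2' : (2 : ℝ) ≤ m := by exact_mod_cast hm2
  have hlev : ∀ i : ℕ, (2 : ℝ) ≤ m * 4 ^ i := fun i =>
    hm2'.trans (le_mul_of_one_le_right (by linarith) (one_le_pow₀ (by norm_num)))
  refine ⟨m * 4 ^ n, by linarith [hlev n], fun ε hε L u hL hu t ht => ?_⟩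
  have key := le_exp_add_pow_div_factorial (h := fun i t => tail (m * 4 ^ i) (u t)) (b := b)
    (M := W) hc
    (fun i t ht => tail_le_of_weight (hu.dens t) (hu.integrable t) (by linarith [hlev i])
      (hu.integral_weight_le hL hf hε.1 hw ht.1))
    (tail_nonneg hf m)
    (fun i t ht => hu.intervalIntegrable_tail hL.σ_nonneg (by linarith [hlev i]) _ _)
    (fun i t ht => by
      have h1 := hu.tail_le hL hf hε hw (hlev (i + 1)) ht.1
      have h2 : (m * 4 ^ (i + 1) : ℝ) / 4 = m * 4 ^ i := by rw [pow_succ]; ring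
      rw [h2] at h1
      have h3 : tail (m * 4 ^ (i + 1)) f ≤ tail m f := tail_anti hf hw (by linarith)
        (le_mul_of_one_le_right (by linarith) (one_le_pow₀ (by norm_num)))
      linarith) n t ht
  have h1 : tail m f * Real.exp (c * t) ≤ δ / 2 := by
    calc _ ≤ δ / 2 / Real.exp (c * b) * Real.exp (c * b) := by
          gcongr
          exact ht.2
      _ = _ := div_mul_cancel₀ _ hE.ne'
  have h2 : W * ((c * t) ^ n / n.factorial) ≤ W * ((c * b) ^ n / n.factorial) := by
    have := ht.1
    gcongr
    exact ht.2
  linarith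

/-! ### Uniformly countably additive families of densities -/

section Families

variable {α ι : Type*} [mα : MeasurableSpace α] {μ : Measure α}

/-- The signed measures with densities `d i` are uniformly countably additive, and uniformly
absolutely continuous with respect to `μ`. This is the form in which equi-integrability is used:
no finite reference measure is needed. -/
def UnifCountablyAdditive (μ : Measure α) (d : ι → α → ℝ) : Prop :=
  ∀ B : ℕ → Set α, (∀ n, MeasurableSet (B n)) → Antitone B → μ (⋂ n, B n) = 0 →
    ∀ η : ℝ, 0 < η → ∃ N, ∀ i, ∫ x in B N, |d i x| ∂μ ≤ η

theorem UnifCountablyAdditive.comp {κ : Type*} {d : ι → α → ℝ} (hd : UnifCountablyAdditive μ d)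
    (j : κ → ι) : UnifCountablyAdditive μ fun i => d (j i) := fun B hB hB' h0 η hη => by
  obtain ⟨N, hN⟩ := hd B hB hB' h0 η hη
  exact ⟨N, fun i => hN (j i)⟩

theorem UnifCountablyAdditive.exists_forall_ge {d : ι → α → ℝ}
    (hd : UnifCountablyAdditive μ d) (hi : ∀ i, Integrable (d i) μ) {B : ℕ → Set α}
    (hB : ∀ n, MeasurableSet (B n)) (hB' : Antitone B) (h0 : μ (⋂ n, B n) = 0) {η : ℝ}
    (hη : 0 < η) : ∃ N, ∀ n, N ≤ n → ∀ i, ∫ x in B n, |d i x| ∂μ ≤ η := by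
  obtain ⟨N, hN⟩ := hd B hB hB' h0 η hη
  exact ⟨N, fun n hn i => (setIntegral_mono_set (hi i).abs.integrableOn
    (ae_of_all _ fun x => abs_nonneg _) (hB' hn).eventuallyLE).trans (hN i)⟩

theorem UnifCountablyAdditive.sub {d d' : ι → α → ℝ} (hd : UnifCountablyAdditive μ d)
    (hd' : UnifCountablyAdditive μ d') (hi : ∀ i, Integrable (d i) μ)
    (hi' : ∀ i, Integrable (d' i) μ) : UnifCountablyAdditive μ fun i x => d i x - d' i x := by
  intro B hB hB' h0 η hη
  obtain ⟨N, hN⟩ := hd.exists_forall_ge hi hB hB' h0 (half_pos hη)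
  obtain ⟨N', hN'⟩ := hd'.exists_forall_ge hi' hB hB' h0 (half_pos hη)
  refine ⟨max N N', fun i => ?_⟩
  have h1 : ∫ x in B (max N N'), |d i x - d' i x| ∂μ ≤
      ∫ x in B (max N N'), (|d i x| + |d' i x|) ∂μ :=
    integral_mono ((hi i).sub (hi' i)).abs.integrableOn
      ((hi i).abs.add (hi' i).abs).integrableOn fun x => abs_sub _ _
  rw [integral_add (hi i).abs.integrableOn (hi' i).abs.integrableOn] at h1
  linarith [hN _ (le_max_left N N') i, hN' _ (le_max_right N N') i]

theorem unifCountablyAdditive_const {v : α → ℝ} (hv : Integrable v μ) :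
    UnifCountablyAdditive μ fun _ : ι => v := by
  intro B hB hB' h0 η hη
  have h := tendsto_setIntegral_of_antitone hB hB' ⟨0, hv.abs.integrableOn⟩
  rw [setIntegral_measure_zero _ h0] at h
  obtain ⟨N, hN⟩ := (h.eventually_lt_const hη).exists
  exact ⟨N, fun _ => hN.le⟩

/-- Convergence of the measures of all sets follows from convergence on a generating `π`-system:
uniform countable additivity makes the class of good sets stable under disjoint unions. -/
theorem tendsto_setIntegral_zero {d : ι → α → ℝ}
    {l : Filter ι} {C : Set (Set α)}
    (hgen : mα = MeasurableSpace.generateFrom C) (hpi : IsPiSystem C)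
    (hi : ∀ i, Integrable (d i) μ) (hd : UnifCountablyAdditive μ d)
    (huniv : Tendsto (fun i => ∫ x, d i x ∂μ) l (𝓝 0))
    (hC : ∀ A ∈ C, Tendsto (fun i => ∫ x in A, d i x ∂μ) l (𝓝 0)) (A : Set α)
    (hA : MeasurableSet A) : Tendsto (fun i => ∫ x in A, d i x ∂μ) l (𝓝 0) := by
  induction A, hA using MeasurableSpace.induction_on_inter hgen hpi with
  | empty => simp [tendsto_const_nhds]
  | basic A hA => exact hC A hA
  | compl A hA ih =>
    have : (fun i => ∫ x in Aᶜ, d i x ∂μ) = fun i => ∫ x, d i x ∂μ - ∫ x in A, d i x ∂μ := by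
      ext i
      rw [setIntegral_compl hA (hi i)]
    rw [this]
    simpa using huniv.sub ih
  | iUnion A hdisj hA ih =>
    rw [Metric.tendsto_nhds]
    intro η hη
    let B : ℕ → Set α := fun N => ⋃ i, ⋃ (_ : N ≤ i), A i
    have hBm : ∀ N, MeasurableSet (B N) := fun N =>
      MeasurableSet.iUnion fun i => MeasurableSet.iUnion fun _ => hA i
    have hB0 : ⋂ N, B N = ∅ := by
      ext x
      simp only [B, mem_iInter, mem_iUnion, mem_empty_iff_false, iff_false, not_forall]
      by_contra! h
      obtain ⟨i, _, hxi⟩ := h 0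
      obtain ⟨j, hj, hxj⟩ := h (i + 1)
      exact (hdisj (show i ≠ j by omega)).le_bot ⟨hxi, hxj⟩
    obtain ⟨N, hN⟩ := hd B hBm (fun N N' h x hx => by
      simp only [B, mem_iUnion] at hx ⊢
      obtain ⟨i, hi, hx⟩ := hx
      exact ⟨i, h.trans hi, hx⟩) (by rw [hB0, measure_empty]) (η / 2) (half_pos hη)
    have hfin : Tendsto (fun i => ∑ j ∈ Finset.range N, ∫ x in A j, d i x ∂μ) l (𝓝 0) := by
      have := tendsto_finsetSum (Finset.range N) fun j _ => ih j
      simpa using this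
    rw [Metric.tendsto_nhds] at hfin
    filter_upwards [hfin (η / 2) (half_pos hη)] with i h1
    rw [dist_zero_right] at h1 ⊢
    have hsplit : (⋃ j, A j) = (⋃ j ∈ Finset.range N, A j) ∪ B N := by
      ext x
      simp only [B, mem_iUnion, mem_union, Finset.mem_range]
      constructor
      · rintro ⟨j, hj⟩
        rcases lt_or_ge j N with h | h
        · exact Or.inl ⟨j, h, hj⟩
        · exact Or.inr ⟨j, h, hj⟩
      · rintro (⟨j, _, hj⟩ | ⟨j, _, hj⟩) <;> exact ⟨j, hj⟩
    have hdis : Disjoint (⋃ j ∈ Finset.range N, A j) (B N) := by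
      rw [Set.disjoint_left]
      intro x hx hx'
      simp only [B, mem_iUnion, Finset.mem_range] at hx hx'
      obtain ⟨j, hj, hxj⟩ := hx
      obtain ⟨j', hj', hxj'⟩ := hx'
      exact (hdisj (show j ≠ j' by omega)).le_bot ⟨hxj, hxj'⟩
    rw [hsplit, setIntegral_union hdis (hBm N) (hi i).integrableOn (hi i).integrableOn,
      integral_biUnion_finset _ (fun j _ => hA j) (fun j _ j' _ h => hdisj h)
        fun j _ => (hi i).integrableOn]
    have h2 : ‖∫ x in B N, d i x ∂μ‖ ≤ η / 2 :=
      (norm_integral_le_integral_norm _).trans (hN i)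
    calc _ ≤ _ := norm_add_le _ _
      _ < η := by linarith

/-- A uniform Egorov argument: bounded almost everywhere convergence is convergence in mean,
uniformly over a uniformly countably additive family. -/
theorem UnifCountablyAdditive.exists_integral_abs_sub_le {d : ι → α → ℝ}
    (hd : UnifCountablyAdditive μ d) (hi : ∀ i, Integrable (d i) μ) {W : ℝ}
    (hW : ∀ i, ∫ x, |d i x| ∂μ ≤ W) {ψ : ℕ → α → ℝ} {φ : α → ℝ} {M : ℝ}
    (hψ : ∀ n, Measurable (ψ n)) (hφ : Measurable φ) (hψM : ∀ n x, |ψ n x| ≤ M)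
    (hφM : ∀ x, |φ x| ≤ M) (hlim : ∀ᵐ x ∂μ, Tendsto (fun n => ψ n x) atTop (𝓝 (φ x)))
    {η : ℝ} (hη : 0 < η) :
    ∃ N, ∀ n, N ≤ n → ∀ i, ∫ x, |ψ n x - φ x| * |d i x| ∂μ ≤ η := by
  rcases isEmpty_or_nonempty ι with hι | ⟨⟨i₀⟩⟩
  · exact ⟨0, fun n _ i => (hι.false i).elim⟩
  rcases isEmpty_or_nonempty α with hα | ⟨⟨x₀⟩⟩
  · exact ⟨0, fun n _ i => by simp [Measure.eq_zero_of_isEmpty μ, hη.le]⟩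
  have hW0 : 0 ≤ W := (integral_nonneg fun x => abs_nonneg _).trans (hW i₀)
  have hM0 : 0 ≤ M := (abs_nonneg _).trans (hφM x₀)
  -- `B N` is the set where the convergence is worse than `δ` at some index beyond `N`
  set δ := η / 2 / (W + 1)
  have hδ : 0 < δ := by positivity
  let B : ℕ → Set α := fun N => ⋃ n, ⋃ (_ : N ≤ n), {x | δ < |ψ n x - φ x|}
  have hBm : ∀ N, MeasurableSet (B N) := fun N => MeasurableSet.iUnion fun n =>
    MeasurableSet.iUnion fun _ => measurableSet_lt measurable_const ((hψ n).sub hφ).abs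
  have hBa : Antitone B := fun N N' h x hx => by
    simp only [B, mem_iUnion] at hx ⊢
    obtain ⟨i, hi, hx⟩ := hx
    exact ⟨i, h.trans hi, hx⟩
  have hB0 : μ (⋂ N, B N) = 0 := by
    refine measure_mono_null (fun x hx => ?_) (ae_iff.1 hlim)
    simp only [mem_ofPred_eq]
    intro h
    obtain ⟨N, hN⟩ := Metric.tendsto_atTop.1 h δ hδ
    simp only [B, mem_iInter, mem_iUnion] at hx
    obtain ⟨n, hn, hx⟩ := hx N
    exact absurd (hN n hn) (not_lt.2 (le_of_lt hx))
  obtain ⟨N, hN⟩ := hd B hBm hBa hB0 (η / 2 / (2 * M + 1)) (by positivity)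
  refine ⟨N, fun n hn i => ?_⟩
  have h1 : ∀ x, |ψ n x - φ x| * |d i x| ≤
      δ * |d i x| + (B N).indicator (fun x => 2 * M * |d i x|) x := by
    intro x
    by_cases hx : x ∈ B N
    · rw [indicator_of_mem hx]
      have h2 : |ψ n x - φ x| ≤ 2 * M := (abs_sub _ _).trans (by linarith [hψM n x, hφM x])
      have h3 := mul_le_mul_of_nonneg_right h2 (abs_nonneg (d i x))
      have h4 : 0 ≤ δ * |d i x| := by positivity
      linarith
    · rw [indicator_of_notMem hx, add_zero]
      simp only [B, mem_iUnion, not_exists, mem_ofPred_eq, not_lt] at hx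
      exact mul_le_mul_of_nonneg_right (hx n hn) (abs_nonneg _)
  have h2 : Integrable (fun x => δ * |d i x| + (B N).indicator (fun x => 2 * M * |d i x|) x) μ :=
    ((hi i).abs.const_mul _).add (((hi i).abs.const_mul _).indicator (hBm N))
  have h3 := integral_mono_of_nonneg (ae_of_all _ fun x => by positivity) h2 (ae_of_all _ h1)
  rw [integral_add ((hi i).abs.const_mul _) (((hi i).abs.const_mul _).indicator (hBm N)),
    integral_const_mul, integral_indicator (hBm N), integral_const_mul] at h3
  have h4 : δ * ∫ x, |d i x| ∂μ ≤ η / 2 := by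
    calc _ ≤ δ * (W + 1) := by gcongr; linarith [hW i]
      _ = _ := div_mul_cancel₀ _ (by positivity)
  have h5 : 2 * M * ∫ x in B N, |d i x| ∂μ ≤ η / 2 := by
    have h6 : 0 ≤ ∫ x in B N, |d i x| ∂μ := integral_nonneg fun x => abs_nonneg _
    calc _ ≤ (2 * M + 1) * (η / 2 / (2 * M + 1)) := by
          apply mul_le_mul (by linarith) (hN i) h6 (by linarith)
      _ = _ := mul_div_cancel₀ _ (by positivity)
  linarith

theorem integrable_bdd_mul' {d ψ : α → ℝ} (hd : Integrable d μ) (hψ : Measurable ψ) {M : ℝ}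
    (hM : ∀ x, |ψ x| ≤ M) : Integrable (fun x => ψ x * d x) μ :=
  hd.bdd_mul hψ.aestronglyMeasurable (ae_of_all _ hM)

/-- From sets to bounded measurable functions: simple functions approximate in mean, uniformly over
the family. -/
theorem tendsto_integral_mul_zero {d : ι → α → ℝ} {l : Filter ι}
    (hi : ∀ i, Integrable (d i) μ) (hd : UnifCountablyAdditive μ d) {W : ℝ}
    (hW : ∀ i, ∫ x, |d i x| ∂μ ≤ W)
    (h : ∀ A, MeasurableSet A → Tendsto (fun i => ∫ x in A, d i x ∂μ) l (𝓝 0))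
    {ψ : α → ℝ} (hψ : Measurable ψ) {M : ℝ} (hM : ∀ x, |ψ x| ≤ M) :
    Tendsto (fun i => ∫ x, ψ x * d i x ∂μ) l (𝓝 0) := by
  have hsimple : ∀ s : SimpleFunc α ℝ, Tendsto (fun i => ∫ x, s x * d i x ∂μ) l (𝓝 0) := by
    intro s
    induction s using SimpleFunc.induction with
    | const c hs =>
      rename_i s
      have : (fun i => ∫ x, (SimpleFunc.piecewise s hs (SimpleFunc.const α c)
          (SimpleFunc.const α 0)) x * d i x ∂μ) = fun i => c * ∫ x in s, d i x ∂μ := by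
        ext i
        rw [← integral_const_mul, ← integral_indicator hs]
        congr 1 with x
        by_cases hx : x ∈ s <;> simp [hx]
      rw [this]
      simpa using (h s hs).const_mul c
    | add _ hf hg =>
      rename_i f g _
      have : (fun i => ∫ x, (f + g) x * d i x ∂μ) =
          fun i => ∫ x, f x * d i x ∂μ + ∫ x, g x * d i x ∂μ := by
        ext i
        obtain ⟨Cf, hCf⟩ := f.exists_forall_norm_le
        obtain ⟨Cg, hCg⟩ := g.exists_forall_norm_le
        rw [← integral_add (integrable_bdd_mul' (hi i) f.measurable hCf)
          (integrable_bdd_mul' (hi i) g.measurable hCg)]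
        congr 1 with x
        simp [add_mul]
      rw [this]
      simpa using hf.add hg
  have hsm := hψ.stronglyMeasurable
  rw [Metric.tendsto_nhds]
  intro η hη
  rcases isEmpty_or_nonempty α with hα | ⟨⟨x₀⟩⟩
  · exact Eventually.of_forall fun i => by simp [Measure.eq_zero_of_isEmpty μ, hη]
  have hM0 : 0 ≤ M := (abs_nonneg _).trans (hM x₀)
  obtain ⟨N, hN⟩ := hd.exists_integral_abs_sub_le hi hW (ψ := fun n => hsm.approxBounded M n)
    (φ := ψ) (M := M) (fun n => (hsm.approxBounded M n).measurable) hψ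
    (fun n x => hsm.norm_approxBounded_le hM0 n x) hM
    (ae_of_all _ fun x => hsm.tendsto_approxBounded_of_norm_le (hM x)) (half_pos hη)
  filter_upwards [(Metric.tendsto_nhds.1 (hsimple (hsm.approxBounded M N))) _ (half_pos hη)]
    with i h1
  rw [dist_zero_right] at h1 ⊢
  have hs1 : Integrable (fun x => hsm.approxBounded M N x * d i x) μ :=
    integrable_bdd_mul' (hi i) (hsm.approxBounded M N).measurable
      fun x => hsm.norm_approxBounded_le hM0 N x
  have hs2 := integrable_bdd_mul' (hi i) hψ hM
  have h2 : ‖∫ x, hsm.approxBounded M N x * d i x ∂μ - ∫ x, ψ x * d i x ∂μ‖ ≤ η / 2 := by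
    rw [← integral_sub hs1 hs2]
    refine (norm_integral_le_integral_norm _).trans (le_trans (le_of_eq ?_) (hN N le_rfl i))
    congr 1 with x
    rw [← sub_mul, norm_mul, Real.norm_eq_abs, Real.norm_eq_abs]
  have h3 := norm_le_norm_add_norm_sub (∫ x, hsm.approxBounded M N x * d i x ∂μ)
    (∫ x, ψ x * d i x ∂μ)
  linarith

/-- The setwise limit of a uniformly countably additive sequence of nonnegative densities is
again given by a density. -/
theorem exists_density_tendsto_setIntegral [SigmaFinite μ] {v : ℕ → α → ℝ}
    (hi : ∀ n, Integrable (v n) μ) (h0 : ∀ n x, 0 ≤ v n x) (hv : UnifCountablyAdditive μ v)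
    (hc : ∀ A, MeasurableSet A → CauchySeq fun n => ∫ x in A, v n x ∂μ) :
    ∃ u : α → ℝ, Measurable u ∧ (∀ x, 0 ≤ u x) ∧ Integrable u μ ∧
      ∀ A, MeasurableSet A → Tendsto (fun n => ∫ x in A, v n x ∂μ) atTop
        (𝓝 (∫ x in A, u x ∂μ)) := by
  have hlim : ∀ A : Set α, ∃ ℓ : ℝ, MeasurableSet A →
      Tendsto (fun n => ∫ x in A, v n x ∂μ) atTop (𝓝 ℓ) := fun A => by
    by_cases hA : MeasurableSet A
    · obtain ⟨ℓ, hℓ⟩ := cauchySeq_tendsto_of_complete (hc A hA)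
      exact ⟨ℓ, fun _ => hℓ⟩
    · exact ⟨0, fun h => absurd h hA⟩
  choose ℓ hℓ using hlim
  have hℓ0 : ∀ A, MeasurableSet A → 0 ≤ ℓ A := fun A hA =>
    ge_of_tendsto' (hℓ A hA) fun n => integral_nonneg (h0 n)
  have hadd : ∀ A B, MeasurableSet A → MeasurableSet B → Disjoint A B →
      ℓ (A ∪ B) = ℓ A + ℓ B := fun A B hA hB hAB =>
    tendsto_nhds_unique (hℓ _ (hA.union hB)) (((hℓ A hA).add (hℓ B hB)).congr fun n =>
      (setIntegral_union hAB hB (hi n).integrableOn (hi n).integrableOn).symm)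
  have hempty : ℓ ∅ = 0 := tendsto_nhds_unique (hℓ ∅ MeasurableSet.empty) (by simp)
  have hsum : ∀ A : ℕ → Set α, (∀ n, MeasurableSet (A n)) → Pairwise (Function.onFun Disjoint A) →
      HasSum (fun n => ℓ (A n)) (ℓ (⋃ n, A n)) := by
    intro A hA hdisj
    rw [hasSum_iff_tendsto_nat_of_nonneg fun n => hℓ0 _ (hA n)]
    have hU : MeasurableSet (⋃ n, A n) := MeasurableSet.iUnion hA
    have hpm : ∀ N, MeasurableSet (⋃ j ∈ Finset.range N, A j) := fun N =>
      Finset.measurableSet_biUnion _ fun j _ => hA j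
    have hpart : ∀ N, ∑ n ∈ Finset.range N, ℓ (A n) = ℓ (⋃ j ∈ Finset.range N, A j) := by
      intro N
      refine tendsto_nhds_unique (tendsto_finsetSum _ fun n _ => hℓ _ (hA n))
        ((hℓ _ (hpm N)).congr fun n => ?_)
      exact integral_biUnion_finset _ (fun j _ => hA j) (fun j _ j' _ h => hdisj h)
        fun j _ => (hi n).integrableOn
    let B : ℕ → Set α := fun N => (⋃ n, A n) \ ⋃ j ∈ Finset.range N, A j
    have hBm : ∀ N, MeasurableSet (B N) := fun N => hU.diff (hpm N)
    have hBa : Antitone B := fun N N' h => by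
      refine sdiff_subset_sdiff_right (biUnion_subset_biUnion_left ?_)
      intro j hj
      simp only [Finset.coe_range, mem_Iio] at hj ⊢
      omega
    have hB0 : ⋂ N, B N = ∅ := by
      ext x
      simp only [B, mem_iInter, Set.mem_sdiff, mem_iUnion, Finset.mem_range, mem_empty_iff_false,
        iff_false, not_forall]
      by_contra! h
      obtain ⟨i, hxi⟩ := (h 0).1
      exact (h (i + 1)).2 i (by omega) hxi
    have hdiff : ∀ N, ℓ (⋃ n, A n) = ℓ (⋃ j ∈ Finset.range N, A j) + ℓ (B N) := fun N => by
      rw [← hadd _ _ (hpm N) (hBm N) disjoint_sdiff_right, union_sdiff_cancel]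
      exact iUnion₂_subset fun j _ => subset_iUnion A j
    rw [Metric.tendsto_atTop]
    intro η hη
    obtain ⟨N, hN⟩ := hv.exists_forall_ge hi hBm hBa (by rw [hB0, measure_empty]) (half_pos hη)
    refine ⟨N, fun n hn => ?_⟩
    have h1 : ℓ (B n) ≤ η / 2 := le_of_tendsto' (hℓ _ (hBm n)) fun m => by
      refine le_trans (le_of_eq ?_) (hN n hn m)
      exact integral_congr_ae (ae_of_all _ fun x => (abs_of_nonneg (h0 m x)).symm)
    have h2 := hℓ0 _ (hBm n)
    rw [hpart, Real.dist_eq, hdiff n, sub_add_cancel_left, abs_neg, abs_of_nonneg h2]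
    linarith
  let m : Measure α := Measure.ofMeasurable (fun A _ => ENNReal.ofReal (ℓ A)) (by simp [hempty])
    (fun A hA hdisj => by
      rw [← (hsum A hA hdisj).tsum_eq,
        ENNReal.ofReal_tsum_of_nonneg (fun n => hℓ0 _ (hA n)) (hsum A hA hdisj).summable])
  have hm : ∀ A, MeasurableSet A → m A = ENNReal.ofReal (ℓ A) := fun A hA =>
    Measure.ofMeasurable_apply A hA
  have : IsFiniteMeasure m := ⟨by rw [hm _ MeasurableSet.univ]; exact ENNReal.ofReal_lt_top⟩
  have hac : m ≪ μ := Measure.AbsolutelyContinuous.mk fun A hA hA0 => by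
    rw [hm A hA]
    have : ℓ A = 0 := tendsto_nhds_unique (hℓ A hA)
      (by simp_rw [setIntegral_measure_zero _ hA0]; exact tendsto_const_nhds)
    simp [this]
  refine ⟨fun x => (m.rnDeriv μ x).toReal, (Measure.measurable_rnDeriv _ _).ennreal_toReal,
    fun x => ENNReal.toReal_nonneg, Measure.integrable_toReal_rnDeriv, fun A hA => ?_⟩
  rw [Measure.setIntegral_toReal_rnDeriv hac, measureReal_def, hm A hA,
    ENNReal.toReal_ofReal (hℓ0 A hA)]
  exact hℓ A hA

end Families

/-! ### Equi-integrable families on the half-line and their tensor squares -/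

/-- A family of densities on `(0,∞)` is equi-integrable: the masses are small, uniformly over the
family, on every set whose part in some fixed bounded interval has small Lebesgue measure. -/
def EquiIntegrable {ι : Type*} (v : ι → ℝ → ℝ) : Prop :=
  ∀ η : ℝ, 0 < η → ∃ R δ : ℝ, 0 < δ ∧ ∀ i A, MeasurableSet A →
    volume (A ∩ Ioo 0 R) ≤ ENNReal.ofReal δ → ∫ x in A, v i x ≤ η

theorem EquiIntegrable.unifCountablyAdditive {ι : Type*} {v : ι → ℝ → ℝ} (hv : EquiIntegrable v)
    (hd : ∀ i, IsDensity (v i)) : UnifCountablyAdditive volume v := by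
  intro B hB hB' h0 η hη
  obtain ⟨R, δ, hδ, h⟩ := hv η hη
  have h1 : Tendsto (fun n => volume (B n ∩ Ioo 0 R)) atTop (𝓝 0) := by
    have h2 := tendsto_measure_iInter_atTop (μ := volume) (s := fun n => B n ∩ Ioo 0 R)
      (fun n => ((hB n).inter measurableSet_Ioo).nullMeasurableSet)
      (fun n m hnm => inter_subset_inter_left _ (hB' hnm))
      ⟨0, ((measure_mono inter_subset_right).trans_lt measure_Ioo_lt_top).ne⟩
    rwa [measure_mono_null (iInter_mono fun n => inter_subset_left) h0] at h2
  obtain ⟨N, hN⟩ := (h1.eventually_le_const (ENNReal.ofReal_pos.2 hδ)).exists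
  refine ⟨N, fun i => ?_⟩
  simp_rw [abs_of_nonneg ((hd i).nonneg _)]
  exact h i _ (hB N) hN

theorem EquiIntegrable.tensor {ι : Type*} {v : ι → ℝ → ℝ} (hv : EquiIntegrable v)
    (hd : ∀ i, IsDensity (v i)) (hi : ∀ i, Integrable (v i)) {W : ℝ} (hW : ∀ i, ∫ x, v i x ≤ W) :
    UnifCountablyAdditive volume fun i (p : ℝ × ℝ) => v i p.1 * v i p.2 := by
  intro B hB hB' h0 η hη
  rcases isEmpty_or_nonempty ι with hι | ⟨⟨i₀⟩⟩
  · exact ⟨0, fun i => (hι.false i).elim⟩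
  have hW0 : 0 ≤ W := (integral_nonneg (hd i₀).nonneg).trans (hW i₀)
  set η' := η / (2 * W + 1)
  have hη' : 0 < η' := by positivity
  obtain ⟨R, δ, hδ, h⟩ := hv η' hη'
  set Q : Set (ℝ × ℝ) := Ioo 0 R ×ˢ Ioo 0 R
  have hQ : MeasurableSet Q := measurableSet_Ioo.prod measurableSet_Ioo
  have hQv : volume Q < ⊤ := by
    rw [Measure.volume_eq_prod, Measure.prod_prod]
    exact ENNReal.mul_lt_top measure_Ioo_lt_top measure_Ioo_lt_top
  have h1 : Tendsto (fun n => volume (B n ∩ Q)) atTop (𝓝 0) := by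
    have h2 := tendsto_measure_iInter_atTop (μ := volume) (s := fun n => B n ∩ Q)
      (fun n => ((hB n).inter hQ).nullMeasurableSet)
      (fun n m hnm => inter_subset_inter_left _ (hB' hnm))
      ⟨0, ((measure_mono inter_subset_right).trans_lt hQv).ne⟩
    rwa [measure_mono_null (iInter_mono fun n => inter_subset_left) h0] at h2
  obtain ⟨N, hN⟩ := (h1.eventually_le_const (ENNReal.ofReal_pos.2 (mul_pos hδ hδ))).exists
  -- the first coordinates with a large section form a set of small measure
  let s : ℝ → ENNReal := fun y => volume (Prod.mk y ⁻¹' (B N ∩ Q))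
  have hs : Measurable s := measurable_measure_prodMk_left ((hB N).inter hQ)
  let E : Set ℝ := {y | ENNReal.ofReal δ ≤ s y}
  have hE : MeasurableSet E := measurableSet_le measurable_const hs
  have hEv : volume (E ∩ Ioo 0 R) ≤ ENNReal.ofReal δ := by
    have h2 := mul_meas_ge_le_lintegral (μ := volume) hs (ENNReal.ofReal δ)
    rw [← Measure.prod_apply ((hB N).inter hQ), ← Measure.volume_eq_prod] at h2
    have h3 := h2.trans hN
    rw [ENNReal.ofReal_mul hδ.le] at h3
    exact (measure_mono inter_subset_left).trans
      ((ENNReal.mul_le_mul_iff_right (ENNReal.ofReal_pos.2 hδ).ne' ENNReal.ofReal_ne_top).1 h3)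
  refine ⟨N, fun i => ?_⟩
  have hbound : ∀ y, v i y * ∫ z in Prod.mk y ⁻¹' B N, v i z ≤
      (E ∪ Ici R).indicator (v i) y * W + v i y * η' := by
    intro y
    have h0 := (hd i).nonneg y
    by_cases hy : y ∈ E ∪ Ici R
    · rw [indicator_of_mem hy]
      have h2 : ∫ z in Prod.mk y ⁻¹' B N, v i z ≤ W :=
        (setIntegral_le_integral (hi i) (ae_of_all _ (hd i).nonneg)).trans (hW i)
      have h3 := mul_le_mul_of_nonneg_left h2 h0
      have h4 : 0 ≤ v i y * η' := by positivity
      linarith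
    · rw [indicator_of_notMem hy, zero_mul, zero_add]
      rcases le_or_gt y 0 with hy0 | hy0
      · simp [(hd i).eq_zero y hy0]
      refine mul_le_mul_of_nonneg_left (h i _ (measurable_prodMk_left (hB N)) ?_) h0
      simp only [mem_union, mem_Ici, not_or, not_le] at hy
      have h2 : Prod.mk y ⁻¹' (B N ∩ Q) = Prod.mk y ⁻¹' B N ∩ Ioo 0 R := by
        ext z
        simp only [Q, mem_preimage, mem_inter_iff, mem_prod, mem_Ioo]
        have := hy.2
        tauto
      have h3 : ¬ ENNReal.ofReal δ ≤ s y := hy.1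
      simp only [s, h2, not_le] at h3
      exact h3.le
  have hcong : ∫ p in B N, |v i p.1 * v i p.2| = ∫ y, v i y * ∫ z in Prod.mk y ⁻¹' B N, v i z := by
    rw [← integral_indicator (hB N), Measure.volume_eq_prod, integral_prod]
    · congr 1 with y
      rw [← integral_const_mul, ← integral_indicator (measurable_prodMk_left (hB N))]
      congr 1 with z
      have h3 : |v i y * v i z| = v i y * v i z :=
        abs_of_nonneg (mul_nonneg ((hd i).nonneg _) ((hd i).nonneg _))
      by_cases hz : (y, z) ∈ B N <;> simp [indicator, hz, h3]
    · exact ((hi i).mul_prod (hi i)).abs.indicator (hB N)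
  have hEm : MeasurableSet (E ∪ Ici R) := hE.union measurableSet_Ici
  have hint : Integrable fun y => (E ∪ Ici R).indicator (v i) y * W + v i y * η' :=
    (((hi i).indicator hEm).mul_const _).add ((hi i).mul_const _)
  have h2 : ∫ y, v i y * ∫ z in Prod.mk y ⁻¹' B N, v i z ≤
      ∫ y, ((E ∪ Ici R).indicator (v i) y * W + v i y * η') :=
    integral_mono_of_nonneg (ae_of_all _ fun y => mul_nonneg ((hd i).nonneg y)
      (integral_nonneg (hd i).nonneg)) hint (ae_of_all _ hbound)
  rw [integral_add (((hi i).indicator hEm).mul_const _) ((hi i).mul_const _),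
    integral_mul_const, integral_mul_const, integral_indicator hEm] at h2
  have h3 : ∫ y in E ∪ Ici R, v i y ≤ η' := by
    refine h i _ hEm (le_trans (measure_mono ?_) hEv)
    rintro y ⟨hy | hy, hy'⟩
    · exact ⟨hy, hy'⟩
    · exact absurd hy'.2 (not_lt.2 hy)
  rw [hcong]
  calc _ ≤ _ := h2
    _ ≤ η' * W + W * η' := add_le_add (mul_le_mul_of_nonneg_right h3 hW0)
        (mul_le_mul_of_nonneg_right (hW i) hη'.le)
    _ ≤ (2 * W + 1) * η' := by linarith
    _ = η := mul_div_cancel₀ _ (by positivity)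

/-! ### Splitting the weight -/

theorem IsDensity.tendsto_integral_small {f : ℝ → ℝ} (hf : IsDensity f) {φ : ℝ → ℝ}
    (hi : Integrable fun x => φ x * f x) :
    Tendsto (fun n : ℕ => ∫ x in Iio (1 / (n + 1 : ℝ)), φ x * f x) atTop (𝓝 0) := by
  have h := tendsto_setIntegral_of_antitone (μ := volume) (s := fun n : ℕ => Iio (1 / (n + 1 : ℝ)))
    (f := fun x => φ x * f x) (fun n => measurableSet_Iio) (fun n m h => Iio_subset_Iio
      (by gcongr)) ⟨0, hi.integrableOn⟩
  have h0 : ∫ x in ⋂ n : ℕ, Iio (1 / (n + 1 : ℝ)), φ x * f x = 0 := by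
    refine setIntegral_eq_zero_of_forall_eq_zero fun x hx => ?_
    rw [mem_iInter] at hx
    have : x ≤ 0 := ge_of_tendsto' tendsto_one_div_add_atTop_nhds_zero_nat fun n => (hx n).le
    simp [hf.eq_zero x this]
  rwa [h0] at h

/-- Up to a part `r` that carries little mass of any flow, the weight is bounded and supported in
a bounded interval. -/
theorem exists_weight_split {σ : ℝ} (hσ : 0 ≤ σ) {f : ℝ → ℝ} (hf : IsDensity f)
    (hw : Integrable fun x => weight σ x * f x) (k η b : ℝ) {δ : ℝ} (hδ : 0 < δ) :
    ∃ (M R : ℝ) (r : ℝ → ℝ), 0 ≤ M ∧ 1 ≤ R ∧ Measurable r ∧ (∀ x, 0 < x → 0 ≤ r x) ∧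
      (∀ x, 0 < x → x < R → weight σ x ≤ r x + M) ∧ (∀ x, R ≤ x → weight σ x ≤ r x) ∧
      ∀ ε ∈ Ioc (0 : ℝ) 1, ∀ L u, IsReducedKernel k σ η L → IsFlow σ ε L f u →
      ∀ t ∈ Icc 0 b, Integrable (fun x => r x * u t x) ∧ ∫ x, r x * u t x ≤ δ := by
  obtain ⟨R, hR1, hR⟩ := exists_tail_le hf hw k η b (δ := δ / 8) (by positivity)
  obtain ⟨n, hn⟩ := ((hf.tendsto_integral_small (hf.integrable_rpow_mul hw)).eventually_lt_const
    (show 0 < δ / 4 by positivity)).exists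
  set d : ℝ := 1 / (n + 1)
  have hd0 : 0 < d := by positivity
  have hd1 : d ≤ 1 := by
    rw [div_le_one (by positivity)]; linarith [(Nat.cast_nonneg n : (0 : ℝ) ≤ n)]
  have hdσ : 0 ≤ d ^ (-σ) := Real.rpow_nonneg hd0.le _
  have hind : ∀ x, 0 < x → 0 ≤ (Iio d).indicator (fun x : ℝ => 2 * x ^ (-σ)) x := fun x hx =>
    indicator_apply_nonneg fun _ => mul_nonneg zero_le_two (Real.rpow_nonneg hx.le _)
  -- `2 x ^ (-σ)` dominates the weight for `x < d ≤ 1`, and `4 (x - R)₊ ≥ 2 x` does so for `x ≥ 2 R`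
  refine ⟨d ^ (-σ) + 2 * R, 2 * R,
    fun x => (Iio d).indicator (fun x => 2 * x ^ (-σ)) x + 4 * max (x - R) 0, by linarith,
    by linarith, ?_, fun x hx => ?_, fun x hx hxR => ?_, fun x hxR => ?_, ?_⟩
  · exact (Measurable.indicator (by fun_prop) measurableSet_Iio).add (by fun_prop)
  · exact add_nonneg (hind x hx) (mul_nonneg (by norm_num) (le_max_right _ _))
  · have h4 : 0 ≤ max (x - R) 0 := le_max_right _ _
    beta_reduce
    rcases lt_or_ge x d with h | h
    · rw [indicator_of_mem (show x ∈ Iio d from h)]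
      have h1 := Real.one_le_rpow_of_pos_of_le_one_of_nonpos hx (h.le.trans hd1) (neg_nonpos.2 hσ)
      unfold weight
      linarith
    · have h1 := antitoneOn_rpow_neg hσ (show d ∈ Ioi 0 from hd0) (show x ∈ Ioi 0 from hx) h
      have h2 := hind x hx
      simp only at h1
      unfold weight
      linarith
  · have hx : 0 < x := by linarith
    have h1 := weight_le_two_mul hσ (show 1 ≤ x by linarith)
    have h2 := hind x hx
    linarith [le_max_left (x - R) 0]
  · intro ε hε L u hL hu t ht
    have hut := hu.dens t
    have h1 := hut.integrable_rpow_mul (hu.integrable t)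
    have h2 := hut.integrable_tail (hu.integrable t) (show 0 ≤ R by linarith)
    have h3 : (fun x => ((Iio d).indicator (fun x => 2 * x ^ (-σ)) x + 4 * max (x - R) 0) * u t x) =
        fun x => 2 * (Iio d).indicator (fun x => x ^ (-σ) * u t x) x +
          4 * (max (x - R) 0 * u t x) := by
      ext x
      by_cases hx : x ∈ Iio d <;> simp [hx] <;> ring
    rw [h3]
    have h4 : Integrable fun x => 2 * (Iio d).indicator (fun x => x ^ (-σ) * u t x) x :=
      (h1.indicator measurableSet_Iio).const_mul 2
    refine ⟨h4.add (h2.const_mul 4), ?_⟩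
    rw [integral_add h4 (h2.const_mul 4), integral_const_mul, integral_const_mul,
      integral_indicator measurableSet_Iio]
    have h5 := hu.integral_small_le hL hf hε.1 hw ht.1 d
    have h6 : tail R (u t) ≤ δ / 8 := hR ε hε L u hL hu t ht
    unfold tail at h6
    linarith

/-! ### Strong continuity in time -/

namespace IsFlow

variable {k σ η ε : ℝ} {L : ℝ × ℝ → ℝ} {f : ℝ → ℝ} {u : ℝ → ℝ → ℝ}

theorem eqn_sub (hu : IsFlow σ ε L f u) (hL : IsReducedKernel k σ η L)
    (hε : 0 < ε) {g : ℝ → ℝ} (hg : Measurable g) {M : ℝ} (hM : ∀ x, |g x| ≤ M)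
    {s t : ℝ} (hs : 0 ≤ s) (ht : 0 ≤ t) :
    (∫ x, g x * u t x) - ∫ x, g x * u s x = ∫ q in s..t, coagRate ε L g (u q) := by
  have hi := hu.intervalIntegrable_coagRate hL hε hg hM
  rw [← intervalIntegral.integral_interval_sub_left (hi 0 t) (hi 0 s),
    ← hu.eqn g hg ⟨M, hM⟩ t ht, ← hu.eqn g hg ⟨M, hM⟩ s hs]
  ring

theorem abs_coagRate_le (hu : IsFlow σ ε L f u) (hL : IsReducedKernel k σ η L)
    (hf : IsDensity f) (hw : Integrable fun x => weight σ x * f x)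
    (hε : 0 < ε) {g : ℝ → ℝ} {C : ℝ} (hC0 : 0 ≤ C)
    (hC : ∀ p : ℝ × ℝ, 0 < p.1 → 0 < p.2 →
      |coagOp ε g p * L p| ≤ C * (weight σ p.1 * weight σ p.2)) {s : ℝ} (hs : 0 ≤ s) :
    |coagRate ε L g (u s)| ≤ C * (∫ x, weight σ x * f x) ^ 2 := by
  have hi0 : 0 ≤ ∫ x, weight σ x * u s x := integral_nonneg ((hu.dens s).weight_mul σ).nonneg
  have hle := hu.integral_weight_le hL hf hε hw hs
  refine (abs_integral_mul_tensor_le (hu.dens s) (hu.dens s) (hu.integrable s)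
      (hu.integrable s) hC).trans ?_
  rw [sq]
  have h0 := hi0.trans hle
  gcongr

theorem abs_integral_sub_le (hu : IsFlow σ ε L f u) (hL : IsReducedKernel k σ η L)
    (hf : IsDensity f) (hw : Integrable fun x => weight σ x * f x)
    (hε : 0 < ε) {g : ℝ → ℝ} (hg : Measurable g) {M : ℝ} (hM : ∀ x, |g x| ≤ M) {C : ℝ}
    (hC0 : 0 ≤ C) (hC : ∀ p : ℝ × ℝ, 0 < p.1 → 0 < p.2 →
      |coagOp ε g p * L p| ≤ C * (weight σ p.1 * weight σ p.2))
    {s t : ℝ} (hs : 0 ≤ s) (ht : 0 ≤ t) :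
    |(∫ x, g x * u t x) - ∫ x, g x * u s x| ≤
      C * (∫ x, weight σ x * f x) ^ 2 * |t - s| := by
  rw [hu.eqn_sub hL hε hg hM hs ht, ← Real.norm_eq_abs]
  refine intervalIntegral.norm_integral_le_of_norm_le_const fun q hq => ?_
  refine hu.abs_coagRate_le hL hf hw hε hC0 hC ?_
  rcases le_total s t with h | h
  · rw [uIoc_of_le h] at hq; exact hs.trans hq.1.le
  · rw [uIoc_of_ge h] at hq; exact ht.trans hq.1.le

/-- Lipschitz continuity in time with values in `L¹`. The constant depends on `ε`. -/
theorem integral_abs_sub_le (hu : IsFlow σ ε L f u) (hL : IsReducedKernel k σ η L)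
    (hf : IsDensity f) (hw : Integrable fun x => weight σ x * f x)
    (hε : 0 < ε) {s t : ℝ} (hs : 0 ≤ s) (ht : 0 ≤ t) :
    ∫ x, |u t x - u s x| ≤
      (2 / ε + 1) * 1 * (2 * k) * (∫ x, weight σ x * f x) ^ 2 * |t - s| := by
  have hk := hL.k_nonneg
  have hut := hu.integrable_density hL.σ_nonneg t
  have hus := hu.integrable_density hL.σ_nonneg s
  -- the test function is the sign of the difference
  let g : ℝ → ℝ := fun x => if u s x ≤ u t x then 1 else -1
  have hg : Measurable g := Measurable.ite
    (measurableSet_le (hu.dens s).measurable (hu.dens t).measurable)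
    measurable_const measurable_const
  have hg1 : ∀ x, |g x| ≤ 1 := fun x => by
    simp only [g]; split_ifs <;> simp
  have h1 := hu.abs_integral_sub_le hL hf hw hε hg hg1 (by positivity)
    (abs_coagOp_mul_le hL hε hg1) hs ht
  rw [← integral_sub (integrable_bdd_mul' hut hg hg1) (integrable_bdd_mul' hus hg hg1)] at h1
  refine le_trans (le_of_eq ?_) ((le_abs_self _).trans h1)
  congr 1 with x
  simp only [g]
  split_ifs with h
  · rw [abs_of_nonneg (by linarith)]; ring
  · rw [abs_of_nonpos (by linarith)]; ring

theorem zero_ae_eq (hu : IsFlow σ ε L f u) (hσ : 0 ≤ σ) (hf : IsDensity f)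
    (hw : Integrable fun x => weight σ x * f x) : u 0 =ᵐ[volume] f := by
  have hu0 := hu.integrable_density hσ 0
  have hfi := integrable_of_weight_mul hσ hf hw
  refine hu0.ae_eq_of_forall_setIntegral_eq _ _ hfi fun A hA _ => ?_
  have hg : Measurable (A.indicator fun _ : ℝ => (1 : ℝ)) := measurable_const.indicator hA
  have h1 := hu.eqn _ hg ⟨1, fun x => by by_cases hx : x ∈ A <;> simp [hx]⟩ 0 le_rfl
  rw [intervalIntegral.integral_same, sub_eq_zero] at h1
  have heq : ∀ v : ℝ → ℝ, ∫ x, A.indicator (fun _ : ℝ => (1 : ℝ)) x * v x = ∫ x in A, v x := by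
    intro v
    rw [← integral_indicator hA]
    congr 1 with x
    by_cases hx : x ∈ A <;> simp [hx]
  rwa [heq, heq] at h1

/-- Continuity in time in the weighted space, by interpolation between the `L¹` estimate and the
control of the tails. -/
theorem exists_integral_weight_abs_sub_le (hu : IsFlow σ ε L f u) (hL : IsReducedKernel k σ η L)
    (hf : IsDensity f) (hw : Integrable fun x => weight σ x * f x)
    (hε : ε ∈ Ioc (0 : ℝ) 1) {t : ℝ} (ht : 0 ≤ t) {δ : ℝ} (hδ : 0 < δ) :
    ∃ h > 0, ∀ s, 0 ≤ s → |s - t| ≤ h → ∫ x, weight σ x * |u s x - u t x| ≤ δ := by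
  have hk := hL.k_nonneg
  obtain ⟨M, R, r, hM, -, hr, hr0, hr1, hr2, hr3⟩ :=
    exists_weight_split hL.σ_nonneg hf hw k η (t + 1) (δ := δ / 3) (by positivity)
  have hwr : ∀ x, 0 < x → weight σ x ≤ r x + M := fun x hx => by
    rcases lt_or_ge x R with h | h
    · exact hr1 x hx h
    · linarith [hr2 x h]
  have hε0 := hε.1
  set C := (2 / ε + 1) * 1 * (2 * k) * (∫ x, weight σ x * f x) ^ 2
  have hC : 0 ≤ C := by positivity
  refine ⟨min 1 (δ / 3 / (M * C + 1)), by positivity, fun s hs hst => ?_⟩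
  have hst1 : s ≤ t + 1 := by
    have := (le_abs_self _).trans (hst.trans (min_le_left _ _)); linarith
  obtain ⟨i1, j1⟩ := hr3 ε hε L u hL hu t ⟨ht, by linarith⟩
  obtain ⟨i2, j2⟩ := hr3 ε hε L u hL hu s ⟨hs, hst1⟩
  have hus := hu.integrable_density hL.σ_nonneg s
  have hut := hu.integrable_density hL.σ_nonneg t
  have h1 : ∫ x, weight σ x * |u s x - u t x| ≤
      ∫ x, (r x * u s x + r x * u t x + M * |u s x - u t x|) := by
    refine integral_mono_of_nonneg (ae_of_all _ fun x => ?_)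
      ((i2.add i1).add ((hus.sub hut).abs.const_mul M)) (ae_of_all _ fun x => ?_)
    · rcases le_or_gt x 0 with hx | hx
      · simp [(hu.dens s).eq_zero x hx, (hu.dens t).eq_zero x hx]
      · exact mul_nonneg (weight_pos hx).le (abs_nonneg _)
    · rcases le_or_gt x 0 with hx | hx
      · simp [(hu.dens s).eq_zero x hx, (hu.dens t).eq_zero x hx]
      · have h2 : |u s x - u t x| ≤ u s x + u t x := by
          have := abs_sub (u s x) (u t x)
          rwa [abs_of_nonneg ((hu.dens s).nonneg x), abs_of_nonneg ((hu.dens t).nonneg x)] at this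
        have h3 := mul_le_mul_of_nonneg_left h2 (hr0 x hx)
        have h4 := mul_le_mul_of_nonneg_right (hwr x hx) (abs_nonneg (u s x - u t x))
        dsimp only
        linarith
  have h2 := hu.integral_abs_sub_le hL hf hw hε.1 ht hs
  have i12 : Integrable fun x => r x * u s x + r x * u t x := i2.add i1
  have i3 : Integrable fun x => M * |u s x - u t x| := (hus.sub hut).abs.const_mul M
  rw [integral_add i12 i3, integral_add i2 i1,
    integral_const_mul] at h1
  have h3 : M * ∫ x, |u s x - u t x| ≤ δ / 3 := by
    calc M * ∫ x, |u s x - u t x| ≤ M * (C * |s - t|) := by gcongr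
      _ = (M * C) * |s - t| := by ring
      _ ≤ (M * C + 1) * (δ / 3 / (M * C + 1)) := by
        gcongr
        · linarith
        · exact hst.trans (min_le_right _ _)
      _ = δ / 3 := mul_div_cancel₀ _ (by positivity)
  linarith

end IsFlow

/-- Local Lipschitz continuity of the collision integral in the weighted norm. -/
theorem abs_coagRate_sub_le {σ C W : ℝ} {ε : ℝ} {L : ℝ × ℝ → ℝ} {g u v : ℝ → ℝ}
    (hu : IsDensity u) (hv : IsDensity v) (hwu : Integrable fun x => weight σ x * u x)
    (hwv : Integrable fun x => weight σ x * v x) (hL : Measurable L) (hg : Measurable g)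
    (hC0 : 0 ≤ C) (hC : ∀ p : ℝ × ℝ, 0 < p.1 → 0 < p.2 →
      |coagOp ε g p * L p| ≤ C * (weight σ p.1 * weight σ p.2))
    (hWu : ∫ x, weight σ x * u x ≤ W) (hWv : ∫ x, weight σ x * v x ≤ W) :
    |coagRate ε L g u - coagRate ε L g v| ≤
      2 * C * W * ∫ x, weight σ x * |u x - v x| := by
  have hK : Measurable fun p => coagOp ε g p * L p := (measurable_coagOp ε hg).mul hL
  have hwd : Integrable fun x => weight σ x * |u x - v x| := by
    refine (hwu.add hwv).mono' ((measurable_weight σ).mul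
      (hu.measurable.sub hv.measurable).abs).aestronglyMeasurable (ae_of_all _ fun x => ?_)
    rcases le_or_gt x 0 with hx | hx
    · simp [hu.eq_zero x hx, hv.eq_zero x hx]
    · have h2 : |u x - v x| ≤ u x + v x := by
        have := abs_sub (u x) (v x)
        rwa [abs_of_nonneg (hu.nonneg x), abs_of_nonneg (hv.nonneg x)] at this
      rw [Real.norm_eq_abs, abs_mul, abs_abs, abs_of_pos (weight_pos hx)]
      have := mul_le_mul_of_nonneg_left h2 (weight_pos (σ := σ) hx).le
      simp only [Pi.add_apply]
      linarith
  have hd0 : 0 ≤ ∫ x, weight σ x * |u x - v x| := integral_nonneg fun x => by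
    rcases le_or_gt x 0 with hx | hx
    · simp [hu.eq_zero x hx, hv.eq_zero x hx]
    · exact mul_nonneg (weight_pos hx).le (abs_nonneg _)
  unfold coagRate
  rw [← integral_sub (integrable_mul_tensor hu hu hwu hwu hK hC)
    (integrable_mul_tensor hv hv hwv hwv hK hC)]
  have hint : Integrable fun p : ℝ × ℝ =>
      C * ((weight σ p.1 * u p.1) * (weight σ p.2 * |u p.2 - v p.2|) +
        (weight σ p.1 * |u p.1 - v p.1|) * (weight σ p.2 * v p.2)) :=
    ((hwu.mul_prod hwd).add (hwd.mul_prod hwv)).const_mul C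
  have h1 : |∫ p : ℝ × ℝ, (coagOp ε g p * L p * (u p.1 * u p.2) -
      coagOp ε g p * L p * (v p.1 * v p.2))| ≤
      ∫ p : ℝ × ℝ, C * ((weight σ p.1 * u p.1) * (weight σ p.2 * |u p.2 - v p.2|) +
        (weight σ p.1 * |u p.1 - v p.1|) * (weight σ p.2 * v p.2)) := by
    rw [← Real.norm_eq_abs]
    refine norm_integral_le_of_norm_le hint (ae_of_all _ fun p => ?_)
    rcases le_or_gt p.1 0 with h1 | h1
    · simp [hu.eq_zero _ h1, hv.eq_zero _ h1]
    rcases le_or_gt p.2 0 with h2 | h2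
    · simp [hu.eq_zero _ h2, hv.eq_zero _ h2]
    have h3 : |u p.1 * u p.2 - v p.1 * v p.2| ≤
        u p.1 * |u p.2 - v p.2| + |u p.1 - v p.1| * v p.2 := by
      have : u p.1 * u p.2 - v p.1 * v p.2 =
        u p.1 * (u p.2 - v p.2) + (u p.1 - v p.1) * v p.2 := by ring
      rw [this]
      refine (abs_add_le _ _).trans ?_
      rw [abs_mul, abs_mul, abs_of_nonneg (hu.nonneg _), abs_of_nonneg (hv.nonneg _)]
    have hw1 := weight_pos (σ := σ) h1
    have hw2 := weight_pos (σ := σ) h2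
    rw [← mul_sub, Real.norm_eq_abs, abs_mul]
    calc _ ≤ C * (weight σ p.1 * weight σ p.2) *
          (u p.1 * |u p.2 - v p.2| + |u p.1 - v p.1| * v p.2) :=
          mul_le_mul (hC p h1 h2) h3 (abs_nonneg _) (by positivity)
      _ = _ := by ring
  refine h1.trans ?_
  rw [integral_const_mul, Measure.volume_eq_prod,
    integral_add (hwu.mul_prod hwd) (hwd.mul_prod hwv),
    integral_prod_mul (fun x => weight σ x * u x) (fun x => weight σ x * |u x - v x|),
    integral_prod_mul (fun x => weight σ x * |u x - v x|) (fun x => weight σ x * v x)]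
  have h2 := mul_le_mul_of_nonneg_right hWu hd0
  have h3 := mul_le_mul_of_nonneg_left hWv hd0
  calc _ ≤ C * (W * (∫ x, weight σ x * |u x - v x|) +
        (∫ x, weight σ x * |u x - v x|) * W) := by gcongr
    _ = _ := by ring

/-! ### Equi-integrability -/

theorem measurePreserving_shear (c : ℝ) :
    MeasurePreserving (fun p : ℝ × ℝ => (p.1 - c * p.2, p.2)) := by
  have h1 : MeasurePreserving (fun p : ℝ × ℝ => (p.1, p.2 - c * p.1)) :=
    (MeasurePreserving.id (volume : Measure ℝ)).skew_product (g := fun z y => y - c * z)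
      (by fun_prop) (ae_of_all _ fun z => (measurePreserving_sub_right volume (c * z)).map_eq)
  exact (Measure.measurePreserving_swap.comp h1).comp Measure.measurePreserving_swap

theorem measurableEmbedding_shear (c : ℝ) :
    MeasurableEmbedding (fun p : ℝ × ℝ => (p.1 - c * p.2, p.2)) :=
  Measurable.measurableEmbedding (by fun_prop) fun p q h => by
    simp only [Prod.mk.injEq] at h
    ext
    · have := h.1
      rw [h.2] at this
      linarith
    · exact h.2

/-- The key estimate for equi-integrability, applied to a superlevel set `A` of the density. For
`θ = 1_A` one has `(θ (y + ε z) - θ y) v y ≤ ℓ (θ (y + ε z) - θ y)`: the density is replaced by the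
constant `ℓ`, so that the difference quotient can be moved onto the kernel. -/
theorem coagRate_superlevel_le {k σ η ε : ℝ} {L : ℝ × ℝ → ℝ} (hL : IsReducedKernel k σ η L)
    (hε : ε ∈ Ioc (0 : ℝ) 1) {v : ℝ → ℝ} (hv : IsDensity v)
    (hw : Integrable fun x => weight σ x * v x) (hv2 : Integrable fun x => x ^ (-2 * σ) * v x)
    {ℓ R : ℝ} (hℓ : 0 ≤ ℓ) :
    coagRate ε L ({x | ℓ < v x ∧ 0 < x ∧ x < R}.indicator fun _ => 1) v ≤
      η * (∫ x, x ^ (-2 * σ) * v x) * (ℓ * volume.real {x | ℓ < v x ∧ 0 < x ∧ x < R}) := by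
  have hε0 := hε.1
  have hσ := hL.σ_nonneg
  have hk := hL.k_nonneg
  have hvi := integrable_of_weight_mul hσ hv hw
  set A : Set ℝ := {x | ℓ < v x ∧ 0 < x ∧ x < R}
  have hA : MeasurableSet A := (measurableSet_lt measurable_const hv.measurable).inter
    ((measurableSet_lt measurable_const measurable_id).inter
      (measurableSet_lt measurable_id measurable_const))
  have hAR : A ⊆ Ioo 0 R := fun x hx => ⟨hx.2.1, hx.2.2⟩
  have hAv : volume A ≠ ⊤ := ((measure_mono hAR).trans_lt measure_Ioo_lt_top).ne
  set θ : ℝ → ℝ := A.indicator fun _ => 1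
  have hθ : Measurable θ := measurable_const.indicator hA
  have hθ0 : ∀ x, 0 ≤ θ x := fun x => indicator_nonneg (fun _ _ => zero_le_one) x
  have hθ1 : ∀ x, θ x ≤ 1 := fun x => indicator_le' (fun _ _ => le_rfl) (fun _ _ => zero_le_one) x
  have hθa : ∀ x, |θ x| ≤ 1 := fun x => by rw [abs_of_nonneg (hθ0 x)]; exact hθ1 x
  have hθi : Integrable θ := (integrable_indicator_iff hA).2 (integrableOn_const hAv)
  have hθint : ∫ x, θ x = volume.real A := by
    simp only [θ]
    rw [integral_indicator hA]; simp
  -- below the level `R` the kernel is controlled by a function of the second variable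
  have hLle : ∀ p : ℝ × ℝ, p.1 < R → 0 < p.2 → L p ≤
      2 * k * (|R| + 1) * (1 + p.2 ^ (-2 * σ)) := by
    intro p hp hp2
    by_cases h : p.2 < p.1
    swap
    · rw [hL.eq_zero p (by tauto)]
      have := Real.rpow_nonneg hp2.le (-2 * σ)
      positivity
    · have ha : p.2 ^ (-2 * σ) = p.2 ^ (-σ) * p.2 ^ (-σ) := by
        rw [← Real.rpow_add hp2]; ring_nf
      set a := p.2 ^ (-σ)
      have ha0 : 0 ≤ a := Real.rpow_nonneg hp2.le _
      have h1 : max p.1 (p.1 ^ (-σ)) ≤ (|R| + 1) * max 1 a := by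
        have hR := le_abs_self R
        have hR0 := abs_nonneg R
        refine max_le ?_ ?_
        · calc p.1 ≤ (|R| + 1) * 1 := by linarith
            _ ≤ _ := by gcongr; exact le_max_left _ _
        · calc p.1 ^ (-σ) ≤ a := antitoneOn_rpow_neg hσ hp2 (hp2.trans h) h.le
            _ ≤ 1 * max 1 a := by rw [one_mul]; exact le_max_right _ _
            _ ≤ _ := by gcongr; linarith
      have h2 : max 1 a * max 1 a ≤ 1 + a * a := by
        rcases le_total 1 a with h3 | h3
        · rw [max_eq_right h3]; linarith
        · rw [max_eq_left h3]; nlinarith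
      calc L p ≤ 2 * k * (max p.1 (p.1 ^ (-σ)) * max 1 a) := hL.le p hp2 h
        _ ≤ 2 * k * (((|R| + 1) * max 1 a) * max 1 a) := by gcongr
        _ = 2 * k * (|R| + 1) * (max 1 a * max 1 a) := by ring
        _ ≤ _ := by rw [ha]; gcongr
  set ψ : ℝ → ℝ := fun z => v z + z ^ (-2 * σ) * v z
  have hψ : Integrable ψ := hvi.add hv2
  have hdom : Integrable fun p : ℝ × ℝ => 2 * k * (|R| + 1) * (θ p.1 * ψ p.2) :=
    (hθi.mul_prod hψ).const_mul _
  have hbd : ∀ (p : ℝ × ℝ) (y : ℝ), (0 < p.2 → y ≤ p.1) →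
      ‖θ p.1 * L (y, p.2) * v p.2‖ ≤ 2 * k * (|R| + 1) * (θ p.1 * ψ p.2) := by
    intro p y hy
    rcases le_or_gt p.2 0 with h2 | h2
    · simp [ψ, hv.eq_zero _ h2]
    rw [Real.norm_of_nonneg (mul_nonneg (mul_nonneg (hθ0 _) (hL.nonneg _)) (hv.nonneg _))]
    by_cases hp : p.1 ∈ A
    · have h1 : θ p.1 = 1 := indicator_of_mem hp _
      have h3 := hLle (y, p.2) ((hy h2).trans_lt hp.2.2) h2
      rw [h1, one_mul, one_mul]
      calc _ ≤ _ := mul_le_mul_of_nonneg_right h3 (hv.nonneg _)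
        _ = _ := by simp only [ψ]; ring
    · have h1 : θ p.1 = 0 := indicator_of_notMem hp _
      simp [h1]
  set F : ℝ × ℝ → ℝ := fun p => θ p.1 * L p * v p.2
  set G' : ℝ × ℝ → ℝ := fun p => θ p.1 * L (p.1 - ε * p.2, p.2) * v p.2
  set G : ℝ × ℝ → ℝ := fun p => θ (p.1 + ε * p.2) * L p * v p.2
  have hF : Integrable F := hdom.mono'
    (((hθ.comp measurable_fst).mul hL.measurable).mul
      (hv.measurable.comp measurable_snd)).aestronglyMeasurable
    (ae_of_all _ fun p => hbd p p.1 fun _ => le_rfl)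
  have hG' : Integrable G' := hdom.mono'
    (((hθ.comp measurable_fst).mul (hL.measurable.comp (by fun_prop))).mul
      (hv.measurable.comp measurable_snd)).aestronglyMeasurable
    (ae_of_all _ fun p => hbd p _ fun h2 => sub_le_self _ (mul_pos hε0 h2).le)
  have hGG : G = G' ∘ fun p : ℝ × ℝ => (p.1 - (-ε) * p.2, p.2) := by
    ext p
    simp only [G, G', Function.comp]
    ring_nf
  have hG : Integrable G := by
    rw [hGG]
    exact ((measurePreserving_shear (-ε)).integrable_comp_emb
      (measurableEmbedding_shear (-ε))).2 hG'
  have hGint : ∫ p, G p = ∫ p, G' p := by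
    rw [hGG]
    exact (measurePreserving_shear (-ε)).integral_comp (measurableEmbedding_shear (-ε)) G'
  -- replace the density `v y` by the level `ℓ`, and drop the loss term
  have hstep1 : coagRate ε L θ v ≤ ∫ p, ℓ / ε * (G p - F p) := by
    refine integral_mono (integrable_mul_tensor hv hv hw hw
      ((measurable_coagOp ε hθ).mul hL.measurable) (abs_coagOp_mul_le hL hε0 hθa))
      ((hG.sub hF).const_mul _) fun p => ?_
    dsimp only
    by_cases h : 0 < p.2 ∧ p.2 < p.1
    swap
    · simp [G, F, hL.eq_zero p h]
    have h3 : 0 < ε * p.2 := mul_pos hε0 h.1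
    have h4 : (θ (p.1 + ε * p.2) - θ p.1) * v p.1 ≤ ℓ * (θ (p.1 + ε * p.2) - θ p.1) := by
      by_cases h5 : p.1 + ε * p.2 ∈ A
      · have h6 : θ (p.1 + ε * p.2) = 1 := indicator_of_mem h5 _
        by_cases h7 : p.1 ∈ A
        · have h8 : θ p.1 = 1 := indicator_of_mem h7 _
          rw [h6, h8]; simp
        · have h8 : θ p.1 = 0 := indicator_of_notMem h7 _
          have h9 : v p.1 ≤ ℓ := by
            by_contra! h10
            exact h7 ⟨h10, h.1.trans h.2, by linarith [h5.2.2]⟩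
          rw [h6, h8]; linarith
      · have h6 : θ (p.1 + ε * p.2) = 0 := indicator_of_notMem h5 _
        by_cases h7 : p.1 ∈ A
        · have h8 : θ p.1 = 1 := indicator_of_mem h7 _
          have := h7.1
          rw [h6, h8]; linarith
        · have h8 : θ p.1 = 0 := indicator_of_notMem h7 _
          rw [h6, h8]; simp
    have h5 : 0 ≤ L p * v p.2 := mul_nonneg (hL.nonneg p) (hv.nonneg _)
    have h6 : 0 ≤ θ p.2 * (L p * v p.2 * v p.1) :=
      mul_nonneg (hθ0 _) (mul_nonneg h5 (hv.nonneg _))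
    calc coagOp ε θ p * L p * (v p.1 * v p.2)
        = (θ (p.1 + ε * p.2) - θ p.1) * v p.1 * (L p * v p.2 / ε) -
          θ p.2 * (L p * v p.2 * v p.1) := by unfold coagOp; ring
      _ ≤ ℓ * (θ (p.1 + ε * p.2) - θ p.1) * (L p * v p.2 / ε) := by
        have := mul_le_mul_of_nonneg_right h4 (div_nonneg h5 hε0.le)
        linarith
      _ = _ := by simp only [G, F]; ring
  -- after the shear the difference quotient falls on `L`; where `y ≤ (1 + ε) z` its first term is `0`
  have hstep2 : ∫ p, (G' p - F p) ≤ ∫ p : ℝ × ℝ, ε * η * (θ p.1 * (p.2 ^ (-2 * σ) * v p.2)) := by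
    refine integral_mono_ae (hG'.sub hF) ((hθi.mul_prod hv2).const_mul _) ?_
    filter_upwards [hL.incr ε hε] with p hp
    rcases le_or_gt p.2 0 with h2 | h2
    · simp [G', F, hv.eq_zero _ h2]
    have h3 : L (p.1 - ε * p.2, p.2) - L p ≤ ε * η * p.2 ^ (-2 * σ) := by
      rcases lt_or_ge ((1 + ε) * p.2) p.1 with h | h
      · exact hp h2 h
      · rw [hL.eq_zero (p.1 - ε * p.2, p.2) (by simp only; intro h'; linarith [h'.2])]
        have h4 := hL.nonneg p
        have h5 := Real.rpow_nonneg h2.le (-2 * σ)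
        have h6 : 0 ≤ ε * η * p.2 ^ (-2 * σ) := mul_nonneg (mul_nonneg hε0.le hL.η_nonneg) h5
        linarith
    calc G' p - F p = (L (p.1 - ε * p.2, p.2) - L p) * (θ p.1 * v p.2) := by
          simp only [G', F]; ring
      _ ≤ ε * η * p.2 ^ (-2 * σ) * (θ p.1 * v p.2) :=
        mul_le_mul_of_nonneg_right h3 (mul_nonneg (hθ0 _) (hv.nonneg _))
      _ = _ := by ring
  rw [integral_const_mul, integral_sub hG hF, hGint, ← integral_sub hG' hF] at hstep1
  rw [integral_const_mul, Measure.volume_eq_prod,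
    integral_prod_mul θ (fun z => z ^ (-2 * σ) * v z), hθint] at hstep2
  refine hstep1.trans ?_
  calc _ ≤ ℓ / ε * (ε * η * (volume.real A * ∫ z, z ^ (-2 * σ) * v z)) := by
        refine mul_le_mul_of_nonneg_left ?_ (by positivity)
        rwa [← Measure.volume_eq_prod] at hstep2
    _ = _ := by field_simp

/-- The excess `∫_0^R (u(x) - ℓ)₊ dx` of a density above the level `ℓ`. -/
noncomputable def excess (R ℓ : ℝ) (u : ℝ → ℝ) : ℝ := ∫ x in Ioo 0 R, max (u x - ℓ) 0

theorem IsDensity.integrable_excess {u : ℝ → ℝ} (hu : IsDensity u) (hi : Integrable u) {ℓ : ℝ}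
    (hℓ : 0 ≤ ℓ) : Integrable fun x => max (u x - ℓ) 0 := by
  have hm := hu.measurable
  refine hi.mono' (by fun_prop) (ae_of_all _ fun x => ?_)
  rw [Real.norm_of_nonneg (le_max_right _ _)]
  exact max_le (by linarith) (hu.nonneg x)

theorem excess_nonneg (R ℓ : ℝ) (u : ℝ → ℝ) : 0 ≤ excess R ℓ u :=
  integral_nonneg fun _ => le_max_right _ _

theorem excess_le {u : ℝ → ℝ} (hu : IsDensity u) (hi : Integrable u) (R : ℝ) {ℓ : ℝ}
    (hℓ : 0 ≤ ℓ) : excess R ℓ u ≤ ∫ x, u x :=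
  (setIntegral_mono (hu.integrable_excess hi hℓ).integrableOn hi.integrableOn fun x =>
    max_le (by linarith) (hu.nonneg x)).trans
      (setIntegral_le_integral hi (ae_of_all _ hu.nonneg))

theorem excess_anti {u : ℝ → ℝ} (hu : IsDensity u) (hi : Integrable u) (R : ℝ) {ℓ ℓ' : ℝ}
    (hℓ : 0 ≤ ℓ) (h : ℓ ≤ ℓ') : excess R ℓ' u ≤ excess R ℓ u :=
  setIntegral_mono (hu.integrable_excess hi (hℓ.trans h)).integrableOn
    (hu.integrable_excess hi hℓ).integrableOn fun x => max_le_max_right _ (by linarith)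

theorem abs_excess_sub_le {u v : ℝ → ℝ} (hu : IsDensity u) (hi : Integrable u)
    (hv : IsDensity v) (hiv : Integrable v) (R : ℝ) {ℓ : ℝ} (hℓ : 0 ≤ ℓ) :
    |excess R ℓ u - excess R ℓ v| ≤ ∫ x, |u x - v x| := by
  unfold excess
  rw [← integral_sub (hu.integrable_excess hi hℓ).integrableOn
    (hv.integrable_excess hiv hℓ).integrableOn, ← Real.norm_eq_abs]
  refine (norm_integral_le_of_norm_le (hi.sub hiv).abs.integrableOn
    (ae_of_all _ fun x => ?_)).trans (setIntegral_le_integral (hi.sub hiv).abs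
      (ae_of_all _ fun x => abs_nonneg _))
  have := abs_max_sub_max_le_abs (u x - ℓ) (v x - ℓ) 0
  rwa [sub_sub_sub_cancel_right] at this

theorem tendsto_excess {u : ℝ → ℝ} (hu : IsDensity u) (hi : Integrable u) (R : ℝ) :
    Tendsto (fun n : ℕ => excess R n u) atTop (𝓝 0) := by
  have h0 : (0 : ℝ) = ∫ x in Ioo 0 R, (0 : ℝ) := by simp
  rw [h0]
  refine tendsto_integral_of_dominated_convergence _
    (fun n => (hu.integrable_excess hi (Nat.cast_nonneg n)).integrableOn.aestronglyMeasurable)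
    hi.integrableOn
    (fun n => ae_of_all _ fun x => ?_) (ae_of_all _ fun x => ?_)
  · rw [Real.norm_of_nonneg (le_max_right _ _)]
    exact max_le (by linarith [(Nat.cast_nonneg n : (0 : ℝ) ≤ n)]) (hu.nonneg x)
  · refine tendsto_const_nhds.congr' ?_
    filter_upwards [eventually_ge_atTop ⌈u x⌉₊] with n hn
    have := Nat.ceil_le.1 hn
    rw [max_eq_right (by linarith)]

/-- Chebyshev's inequality for the superlevel set, in terms of the excess at half the level. -/
theorem level_mul_measure_le {u : ℝ → ℝ} (hu : IsDensity u) (hi : Integrable u) (R : ℝ) {ℓ : ℝ}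
    (hℓ : 0 ≤ ℓ) :
    ℓ * volume.real {x | ℓ < u x ∧ 0 < x ∧ x < R} ≤ 2 * excess R (ℓ / 2) u := by
  set A : Set ℝ := {x | ℓ < u x ∧ 0 < x ∧ x < R}
  have hA : MeasurableSet A := (measurableSet_lt measurable_const hu.measurable).inter
    ((measurableSet_lt measurable_const measurable_id).inter
      (measurableSet_lt measurable_id measurable_const))
  have hAR : A ⊆ Ioo 0 R := fun x hx => ⟨hx.2.1, hx.2.2⟩
  have hAv : volume A ≠ ⊤ := ((measure_mono hAR).trans_lt measure_Ioo_lt_top).ne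
  have hex := hu.integrable_excess hi (show 0 ≤ ℓ / 2 by positivity)
  have h1 : ∫ _ in A, ℓ / 2 ≤ ∫ x in A, max (u x - ℓ / 2) 0 :=
    setIntegral_mono_on (integrableOn_const hAv) hex.integrableOn hA
      fun x hx => le_max_of_le_left (by linarith [hx.1])
  have h2 : ∫ x in A, max (u x - ℓ / 2) 0 ≤ excess R (ℓ / 2) u :=
    setIntegral_mono_set hex.integrableOn (ae_of_all _ fun x => le_max_right _ _)
      hAR.eventuallyLE
  rw [setIntegral_const, smul_eq_mul] at h1
  linarith

namespace IsFlow

variable {k σ η ε : ℝ} {L : ℝ × ℝ → ℝ} {f : ℝ → ℝ} {u : ℝ → ℝ → ℝ}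

theorem continuous_excess (hu : IsFlow σ ε L f u) (hL : IsReducedKernel k σ η L)
    (hf : IsDensity f) (hw : Integrable fun x => weight σ x * f x) (hε : 0 < ε)
    (R : ℝ) {ℓ : ℝ} (hℓ : 0 ≤ ℓ) : Continuous fun t => excess R ℓ (u (max t 0)) := by
  have hk := hL.k_nonneg
  have hi := hu.integrable_density hL.σ_nonneg
  set C := (2 / ε + 1) * 1 * (2 * k) * (∫ x, weight σ x * f x) ^ 2
  refine (LipschitzWith.of_dist_le_mul (K := C.toNNReal) fun s t => ?_).continuous
  rw [Real.coe_toNNReal C (by positivity), Real.dist_eq, Real.dist_eq]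
  refine (abs_excess_sub_le (hu.dens _) (hi _) (hu.dens _) (hi _) R hℓ).trans ?_
  refine (hu.integral_abs_sub_le hL hf hw hε (le_max_right _ _) (le_max_right _ _)).trans ?_
  have h := abs_max_sub_max_le_abs s t 0
  have hC : 0 ≤ C := by positivity
  exact mul_le_mul_of_nonneg_left h hC

/-- The excess above the level `ℓ` is controlled by the excess above `ℓ / 2`. -/
theorem excess_le_add_integral (hu : IsFlow σ ε L f u) (hL : IsReducedKernel k σ η L)
    (hf : IsDensity f) (hw : Integrable fun x => weight σ x * f x)
    (hf2 : Integrable fun x => x ^ (-2 * σ) * f x) (hε : ε ∈ Ioc (0 : ℝ) 1) (R : ℝ) {ℓ : ℝ}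
    (hℓ : 0 ≤ ℓ) {b : ℝ} (hb : 0 ≤ b) :
    excess R ℓ (u b) ≤ excess R ℓ f + 2 * (η * ∫ x, x ^ (-2 * σ) * f x) *
      ∫ s in (0 : ℝ)..b, excess R (ℓ / 2) (u s) := by
  have hk := hL.k_nonneg
  have hσ := hL.σ_nonneg
  have hi := hu.integrable_density hσ
  set m := ∫ x, x ^ (-2 * σ) * f x
  set c := 2 * (η * m)
  have hcont := hu.continuous_excess hL hf hw hε.1 R hℓ
  have hcont2 := hu.continuous_excess hL hf hw hε.1 R (show 0 ≤ ℓ / 2 by positivity)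
  set H : ℝ → ℝ := fun t => excess R ℓ (u (max t 0))
  set H2 : ℝ → ℝ := fun t => excess R (ℓ / 2) (u (max t 0))
  have hB : ∀ x, HasDerivAt (fun τ => -H b + ∫ s in (0 : ℝ)..τ, c * H2 (b - s)) (c * H2 (b - x)) x :=
    fun x => (Continuous.integral_hasStrictDerivAt (by fun_prop) 0 x).hasDerivAt.const_add _
  -- time is reversed, since the superlevel set has to be taken at the later time
  have key := image_le_of_liminf_slope_right_le_deriv_boundary (f := fun τ => -H (b - τ))
    (a := 0) (b := b) (B := fun τ => -H b + ∫ s in (0 : ℝ)..τ, c * H2 (b - s))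
    (B' := fun τ => c * H2 (b - τ)) (by fun_prop) (by simp)
    (fun x _ => (hB x).continuousAt.continuousWithinAt) (fun x _ => (hB x).hasDerivWithinAt) ?_
    (right_mem_Icc.2 hb)
  · have h1 : ∫ s in (0 : ℝ)..b, c * H2 (b - s) =
        c * ∫ s in (0 : ℝ)..b, excess R (ℓ / 2) (u s) := by
      rw [intervalIntegral.integral_const_mul,
        intervalIntegral.integral_comp_sub_left (fun s => H2 s), sub_self, sub_zero]
      congr 1
      refine intervalIntegral.integral_congr fun s hs => ?_
      rw [uIcc_of_le hb] at hs
      simp only [H2, max_eq_left hs.1]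
    have h2 : H 0 = excess R ℓ f := by
      simp only [H, max_self]
      refine integral_congr_ae (ae_restrict_of_ae ?_)
      filter_upwards [hu.zero_ae_eq hσ hf hw] with x hx
      rw [hx]
    have h3 : H b = excess R ℓ (u b) := by simp only [H, max_eq_left hb]
    simp only [sub_self] at key
    linarith
  · intro τ hτ r hr
    refine Eventually.frequently ?_
    set t := b - τ
    have ht0 : 0 < t := by simp only [t]; linarith [hτ.2]
    set A : Set ℝ := {x | ℓ < u t x ∧ 0 < x ∧ x < R}
    have hA : MeasurableSet A := (measurableSet_lt measurable_const (hu.dens t).measurable).inter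
      ((measurableSet_lt measurable_const measurable_id).inter
        (measurableSet_lt measurable_id measurable_const))
    have hAR : A ⊆ Ioo 0 R := fun x hx => ⟨hx.2.1, hx.2.2⟩
    set θ : ℝ → ℝ := A.indicator fun _ => 1
    have hθ : Measurable θ := measurable_const.indicator hA
    have hθa : ∀ x, |θ x| ≤ 1 := fun x => by
      by_cases hx : x ∈ A <;> simp [θ, hx]
    obtain ⟨hm1, hm2⟩ := hu.integral_antitone_le hL hf hε.1 (g := fun x => x ^ (-2 * σ))
      (by fun_prop) (fun x hx => Real.rpow_nonneg hx.le _)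
      (by simpa [neg_mul] using antitoneOn_rpow_neg (show 0 ≤ 2 * σ by positivity)) hf2 ht0.le
    have hrate : coagRate ε L θ (u t) ≤ c * H2 t := by
      refine (coagRate_superlevel_le hL hε (hu.dens t) (hu.integrable t) hm1 hℓ).trans ?_
      have h1 := level_mul_measure_le (hu.dens t) (hi t) R hℓ
      have h2 : H2 t = excess R (ℓ / 2) (u t) := by simp only [H2, max_eq_left ht0.le]
      rw [h2]
      calc η * (∫ x, x ^ (-2 * σ) * u t x) * (ℓ * volume.real A)
          ≤ η * m * (2 * excess R (ℓ / 2) (u t)) := by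
            have hη := hL.η_nonneg
            have h3 : 0 ≤ ∫ x, x ^ (-2 * σ) * u t x := integral_nonneg fun x => by
              rcases le_or_gt x 0 with hx | hx
              · simp [(hu.dens t).eq_zero x hx]
              · exact mul_nonneg (Real.rpow_nonneg hx.le _) ((hu.dens t).nonneg x)
            have h4 : 0 ≤ ℓ * volume.real A := mul_nonneg hℓ measureReal_nonneg
            have h5 : 0 ≤ η * m := mul_nonneg hη (h3.trans hm2)
            exact mul_le_mul (mul_le_mul_of_nonneg_left hm2 hη) h1 h4 h5
        _ = _ := by ring
    set W := ∫ x, weight σ x * f x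
    have hW : 0 ≤ W := integral_nonneg (hf.weight_mul σ).nonneg
    have hε0 := hε.1
    set C := (2 / ε + 1) * 1 * (2 * k)
    have hC0 : 0 ≤ C := by positivity
    set d := (r - c * H2 t) / 2
    have hd : 0 < d := by simp only [d]; linarith
    obtain ⟨h, hh, hs⟩ := hu.exists_integral_weight_abs_sub_le hL hf hw hε ht0.le
      (δ := d / (2 * C * W + 1)) (by positivity)
    -- the rate for the fixed set `A` is continuous in time
    have hclose : ∀ q, 0 ≤ q → |q - t| ≤ h → coagRate ε L θ (u q) ≤ c * H2 t + d := by
      intro q hq hqt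
      have h1 := abs_coagRate_sub_le (hu.dens q) (hu.dens t) (hu.integrable q) (hu.integrable t)
        hL.measurable hθ hC0 (abs_coagOp_mul_le hL hε.1 hθa)
        (hu.integral_weight_le hL hf hε.1 hw hq) (hu.integral_weight_le hL hf hε.1 hw ht0.le)
      have h2 : 2 * C * W * ∫ x, weight σ x * |u q x - u t x| ≤ d := by
        have h0 : 0 ≤ ∫ x, weight σ x * |u q x - u t x| := integral_nonneg fun x => by
          rcases le_or_gt x 0 with hx | hx
          · simp [(hu.dens q).eq_zero x hx, (hu.dens t).eq_zero x hx]
          · exact mul_nonneg (weight_pos hx).le (abs_nonneg _)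
        calc _ ≤ (2 * C * W + 1) * (d / (2 * C * W + 1)) := by
              apply mul_le_mul (by linarith) (hs q hq hqt) h0 (by positivity)
          _ = d := mul_div_cancel₀ _ (by positivity)
      have h3 := (le_abs_self _).trans (h1.trans h2)
      linarith
    have hev : ∀ᶠ z in 𝓝[>] τ, z < τ + min h t :=
      nhdsWithin_le_nhds (Iio_mem_nhds (by have := lt_min hh ht0; linarith))
    filter_upwards [hev, self_mem_nhdsWithin] with z hz1 hz2
    have hz2' : τ < z := hz2
    set s := b - z
    have hst : s < t := by simp only [s, t]; linarith
    have hs0 : 0 ≤ s := by simp only [s]; linarith [min_le_right h t]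
    have hsh : t - s ≤ h := by simp only [s, t]; linarith [min_le_left h t]
    -- `θ` is a subgradient of the convex function `(· - ℓ)₊` at `u t`
    have h1 : H t - H s ≤ (∫ x, θ x * u t x) - ∫ x, θ x * u s x := by
      simp only [H, max_eq_left ht0.le, max_eq_left hs0]
      unfold excess
      rw [← integral_sub ((hu.dens t).integrable_excess (hi t) hℓ).integrableOn
        ((hu.dens s).integrable_excess (hi s) hℓ).integrableOn,
        ← integral_sub (integrable_bdd_mul' (hi t) hθ hθa) (integrable_bdd_mul' (hi s) hθ hθa),
        ← integral_indicator measurableSet_Ioo]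
      refine integral_mono ((((hu.dens t).integrable_excess (hi t) hℓ).sub
        ((hu.dens s).integrable_excess (hi s) hℓ)).indicator measurableSet_Ioo)
        ((integrable_bdd_mul' (hi t) hθ hθa).sub (integrable_bdd_mul' (hi s) hθ hθa)) fun x => ?_
      by_cases hx : x ∈ Ioo 0 R
      · simp only [indicator_of_mem hx]
        by_cases hxA : x ∈ A
        · have h2 : θ x = 1 := indicator_of_mem hxA _
          rw [h2, max_eq_left (by linarith [hxA.1])]
          linarith [le_max_left (u s x - ℓ) 0]
        · have h2 : θ x = 0 := indicator_of_notMem hxA _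
          have h3 : u t x ≤ ℓ := by
            by_contra! h4
            exact hxA ⟨h4, hx.1, hx.2⟩
          rw [h2, max_eq_right (by linarith)]
          linarith [le_max_right (u s x - ℓ) 0]
      · have h2 : θ x = 0 := indicator_of_notMem (fun h => hx (hAR h)) _
        simp [indicator_of_notMem hx, h2]
    rw [hu.eqn_sub hL hε.1 hθ hθa hs0 ht0.le] at h1
    have h2 : ∫ q in s..t, coagRate ε L θ (u q) ≤ ∫ q in s..t, (c * H2 t + d) :=
      intervalIntegral.integral_mono_on hst.le (hu.intervalIntegrable_coagRate hL hε.1 hθ hθa _ _)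
        intervalIntegrable_const fun q hq => hclose q (hs0.trans hq.1) (by
          rw [abs_of_nonpos (by linarith [hq.2])]; linarith [hq.1])
    rw [intervalIntegral.integral_const, smul_eq_mul] at h2
    have h3 : z - τ = t - s := by simp only [s, t]; ring
    rw [slope_def_field, h3, div_lt_iff₀ (by linarith)]
    have h4 : c * H2 t + d < r := by simp only [d]; linarith
    have h5 := mul_lt_mul_of_pos_left h4 (show 0 < t - s by linarith)
    linarith

end IsFlow

/-- The excesses of all flows with a given initial datum are uniformly small at high levels. -/
theorem exists_excess_le {σ : ℝ} (hσ : 0 ≤ σ) {f : ℝ → ℝ} (hf : IsDensity f)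
    (hw : Integrable fun x => weight σ x * f x)
    (hf2 : Integrable fun x => x ^ (-2 * σ) * f x) (k η b R : ℝ) {δ : ℝ} (hδ : 0 < δ) :
    ∃ ℓ, 0 ≤ ℓ ∧ ∀ ε ∈ Ioc (0 : ℝ) 1, ∀ L u, IsReducedKernel k σ η L → IsFlow σ ε L f u →
      ∀ t ∈ Icc 0 b, excess R ℓ (u t) ≤ δ := by
  rcases lt_or_ge η 0 with hη | hη
  · exact ⟨0, le_rfl, fun ε _ L u hL => absurd hL.η_nonneg (not_le.2 hη)⟩
  have hfi := integrable_of_weight_mul hσ hf hw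
  set W := ∫ x, weight σ x * f x
  have hW : 0 ≤ W := integral_nonneg (hf.weight_mul σ).nonneg
  set c := 2 * (η * ∫ x, x ^ (-2 * σ) * f x)
  have hc : 0 ≤ c := mul_nonneg zero_le_two (mul_nonneg hη (integral_nonneg fun x => by
    rcases le_or_gt x 0 with hx | hx
    · simp [hf.eq_zero x hx]
    · exact mul_nonneg (Real.rpow_nonneg hx.le _) (hf.nonneg x)))
  have hE := Real.exp_pos (c * b)
  obtain ⟨m, hm⟩ : ∃ m : ℕ, excess R m f < δ / 2 / Real.exp (c * b) :=
    ((tendsto_excess hf hfi R).eventually_lt_const (by positivity)).exists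
  obtain ⟨n, hn⟩ : ∃ n : ℕ, W * ((c * b) ^ n / n.factorial) < δ / 2 := by
    have h1 : Tendsto (fun n : ℕ => W * ((c * b) ^ n / n.factorial)) atTop (𝓝 (W * 0)) :=
      (FloorSemiring.tendsto_pow_div_factorial_atTop (c * b)).const_mul W
    rw [mul_zero] at h1
    exact (h1.eventually_lt_const (by positivity)).exists
  have hlev : ∀ i : ℕ, (0 : ℝ) ≤ m * 2 ^ i := fun i => by positivity
  refine ⟨m * 2 ^ n, hlev n, fun ε hε L u hL hu t ht => ?_⟩
  have hi := hu.integrable_density hσ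
  have key := le_exp_add_pow_div_factorial (h := fun i t => excess R (m * 2 ^ i) (u t)) (b := b)
    (M := W) hc
    (fun i t ht => (excess_le (hu.dens t) (hi t) R (hlev i)).trans
      ((integral_mono (hi t) (hu.integrable t) ((hu.dens t).le_weight_mul hσ)).trans
        (hu.integral_weight_le hL hf hε.1 hw ht.1)))
    (excess_nonneg R m f)
    (fun i t ht => by
      refine ((hu.continuous_excess hL hf hw hε.1 R (hlev i)).intervalIntegrable 0 t).congr ?_
      intro s hs
      rw [uIoc_of_le ht.1] at hs
      simp only [max_eq_left hs.1.le])
    (fun i t ht => by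
      have h1 := hu.excess_le_add_integral hL hf hw hf2 hε R (hlev (i + 1)) ht.1
      have h2 : (m * 2 ^ (i + 1) : ℝ) / 2 = m * 2 ^ i := by rw [pow_succ]; ring
      rw [h2] at h1
      have h3 : excess R (m * 2 ^ (i + 1)) f ≤ excess R m f := excess_anti hf hfi R
        (Nat.cast_nonneg m)
        (le_mul_of_one_le_right (Nat.cast_nonneg m) (one_le_pow₀ (by norm_num)))
      linarith) n t ht
  have h1 : excess R m f * Real.exp (c * t) ≤ δ / 2 := by
    calc _ ≤ δ / 2 / Real.exp (c * b) * Real.exp (c * b) := by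
          gcongr
          exact ht.2
      _ = _ := div_mul_cancel₀ _ hE.ne'
  have h2 : W * ((c * t) ^ n / n.factorial) ≤ W * ((c * b) ^ n / n.factorial) := by
    have := ht.1
    gcongr
    exact ht.2
  linarith

/-- The weighted densities of all flows with a given initial datum are equi-integrable, locally
uniformly in time and uniformly in `ε` and in the kernel. -/
theorem exists_equiIntegrable {σ : ℝ} (hσ : 0 ≤ σ) {f : ℝ → ℝ} (hf : IsDensity f)
    (hw : Integrable fun x => weight σ x * f x)
    (hf2 : Integrable fun x => x ^ (-2 * σ) * f x) (k η b : ℝ) {δ : ℝ} (hδ : 0 < δ) :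
    ∃ R κ : ℝ, 0 < κ ∧ ∀ ε ∈ Ioc (0 : ℝ) 1, ∀ L u, IsReducedKernel k σ η L → IsFlow σ ε L f u →
      ∀ t ∈ Icc 0 b, ∀ A, MeasurableSet A → volume (A ∩ Ioo 0 R) ≤ ENNReal.ofReal κ →
        ∫ x in A, weight σ x * u t x ≤ δ := by
  obtain ⟨M, R, r, hM, hR1, hr, hr0, hr1, hr2, hr3⟩ :=
    exists_weight_split hσ hf hw k η b (half_pos hδ)
  obtain ⟨ℓ, hℓ, hex⟩ := exists_excess_le hσ hf hw hf2 k η b R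
    (δ := δ / 4 / (M + 1)) (by positivity)
  refine ⟨R, δ / 4 / ((M + 1) * (ℓ + 1)), by positivity, fun ε hε L u hL hu t ht A hA hAv => ?_⟩
  have hut := hu.dens t
  have hi := hu.integrable_density hσ t
  obtain ⟨i1, j1⟩ := hr3 ε hε L u hL hu t ht
  have hAm : MeasurableSet (A ∩ Ioo 0 R) := hA.inter measurableSet_Ioo
  have hAt : volume (A ∩ Ioo 0 R) ≠ ⊤ := ne_top_of_le_ne_top ENNReal.ofReal_ne_top hAv
  have hr0' : ∀ x, 0 ≤ r x * u t x := fun x => by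
    rcases le_or_gt x 0 with hx | hx
    · simp [hut.eq_zero x hx]
    · exact mul_nonneg (hr0 x hx) (hut.nonneg x)
  have i2 : Integrable fun x => r x * u t x + (A ∩ Ioo 0 R).indicator (fun x => M * u t x) x :=
    i1.add ((hi.const_mul M).indicator hAm)
  have h1 : ∫ x in A, weight σ x * u t x ≤
      ∫ x, (r x * u t x + (A ∩ Ioo 0 R).indicator (fun x => M * u t x) x) := by
    rw [← integral_indicator hA]
    refine integral_mono ((hu.integrable t).indicator hA) i2 fun x => ?_
    have hind0 : 0 ≤ (A ∩ Ioo 0 R).indicator (fun x => M * u t x) x :=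
      indicator_nonneg (fun x _ => mul_nonneg hM (hut.nonneg x)) x
    by_cases hx : x ∈ A
    swap
    · simp only [indicator_of_notMem hx]
      exact add_nonneg (hr0' x) hind0
    simp only [indicator_of_mem hx]
    rcases le_or_gt x 0 with hx0 | hx0
    · rw [hut.eq_zero x hx0, mul_zero]
      have h2 := hr0' x
      rw [hut.eq_zero x hx0] at h2
      linarith
    rcases lt_or_ge x R with hxR | hxR
    · rw [indicator_of_mem (show x ∈ A ∩ Ioo 0 R from ⟨hx, hx0, hxR⟩), ← add_mul]
      exact mul_le_mul_of_nonneg_right (hr1 x hx0 hxR) (hut.nonneg x)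
    · have := mul_le_mul_of_nonneg_right (hr2 x hxR) (hut.nonneg x)
      linarith
  rw [integral_add i1 ((hi.const_mul M).indicator hAm), integral_indicator hAm,
    integral_const_mul] at h1
  have h2 : ∫ x in A ∩ Ioo 0 R, u t x ≤ ∫ x in A ∩ Ioo 0 R, (ℓ + max (u t x - ℓ) 0) :=
    setIntegral_mono hi.integrableOn ((integrableOn_const hAt).add
      (hut.integrable_excess hi hℓ).integrableOn) fun x => by
        linarith [le_max_left (u t x - ℓ) 0]
  have hconst : Integrable (fun _ : ℝ => ℓ) (volume.restrict (A ∩ Ioo 0 R)) :=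
    integrableOn_const hAt
  rw [integral_add hconst (hut.integrable_excess hi hℓ).integrableOn,
    setIntegral_const, smul_eq_mul] at h2
  have h3 : ∫ x in A ∩ Ioo 0 R, max (u t x - ℓ) 0 ≤ excess R ℓ (u t) :=
    setIntegral_mono_set (hut.integrable_excess hi hℓ).integrableOn
      (ae_of_all _ fun x => le_max_right _ _) inter_subset_right.eventuallyLE
  have h4 := hex ε hε L u hL hu t ht
  have h5 : volume.real (A ∩ Ioo 0 R) ≤ δ / 4 / ((M + 1) * (ℓ + 1)) :=
    ENNReal.toReal_le_of_le_ofReal (by positivity) hAv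
  have h6 : volume.real (A ∩ Ioo 0 R) * ℓ ≤ δ / 4 / (M + 1) := by
    calc _ ≤ δ / 4 / ((M + 1) * (ℓ + 1)) * (ℓ + 1) := by
          apply mul_le_mul h5 (by linarith) hℓ (by positivity)
      _ = _ := by field_simp
  have h7 : M * ∫ x in A ∩ Ioo 0 R, u t x ≤ δ / 2 := by
    have h8 : ∫ x in A ∩ Ioo 0 R, u t x ≤ δ / 2 / (M + 1) := by
      have : δ / 4 / (M + 1) + δ / 4 / (M + 1) = δ / 2 / (M + 1) := by ring
      linarith
    calc _ ≤ (M + 1) * (δ / 2 / (M + 1)) := by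
          apply mul_le_mul (by linarith) h8 (integral_nonneg hut.nonneg) (by linarith)
      _ = _ := mul_div_cancel₀ _ (by positivity)
  linarith

/-! ### Compactness -/

/-- A sequence of flows with common initial datum, whose parameters and kernels may vary. -/
structure IsFlowSeq (k σ η : ℝ) (e : ℕ → ℝ) (L : ℕ → ℝ × ℝ → ℝ) (f : ℝ → ℝ)
    (u : ℕ → ℝ → ℝ → ℝ) : Prop where
  dens : IsDensity f
  integrable : Integrable fun x => weight σ x * f x
  integrable_two : Integrable fun x => x ^ (-2 * σ) * f x
  mem : ∀ n, e n ∈ Ioc (0 : ℝ) 1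
  kernel : ∀ n, IsReducedKernel k σ η (L n)
  flow : ∀ n, IsFlow σ (e n) (L n) f (u n)

namespace IsFlowSeq

variable {k σ η : ℝ} {e : ℕ → ℝ} {L : ℕ → ℝ × ℝ → ℝ} {f : ℝ → ℝ} {u : ℕ → ℝ → ℝ → ℝ}

theorem σ_nonneg (h : IsFlowSeq k σ η e L f u) : 0 ≤ σ := (h.kernel 0).σ_nonneg

theorem comp (h : IsFlowSeq k σ η e L f u) (φ : ℕ → ℕ) :
    IsFlowSeq k σ η (fun n => e (φ n)) (fun n => L (φ n)) f (fun n => u (φ n)) :=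
  ⟨h.dens, h.integrable, h.integrable_two, fun _ => h.mem _, fun _ => h.kernel _,
    fun _ => h.flow _⟩

theorem integral_weight_le (h : IsFlowSeq k σ η e L f u) (n : ℕ) {t : ℝ} (ht : 0 ≤ t) :
    ∫ x, weight σ x * u n t x ≤ ∫ x, weight σ x * f x :=
  (h.flow n).integral_weight_le (h.kernel n) h.dens (h.mem n).1 h.integrable ht

theorem integrable_density (h : IsFlowSeq k σ η e L f u) (n : ℕ) (t : ℝ) : Integrable (u n t) :=
  (h.flow n).integrable_density h.σ_nonneg t

theorem integral_density_le (h : IsFlowSeq k σ η e L f u) (n : ℕ) {t : ℝ} (ht : 0 ≤ t) :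
    ∫ x, u n t x ≤ ∫ x, weight σ x * f x :=
  (integral_mono (h.integrable_density n t) ((h.flow n).integrable t)
    (((h.flow n).dens t).le_weight_mul h.σ_nonneg)).trans (h.integral_weight_le n ht)

theorem equiIntegrable (h : IsFlowSeq k σ η e L f u) (b : ℝ) :
    EquiIntegrable fun (i : ℕ × Icc 0 b) x => weight σ x * u i.1 i.2 x := by
  intro δ hδ
  obtain ⟨R, κ, hκ, H⟩ := exists_equiIntegrable h.σ_nonneg h.dens h.integrable h.integrable_two
    k η b hδ
  exact ⟨R, κ, hκ, fun i A hA hAv =>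
    H _ (h.mem i.1) _ _ (h.kernel i.1) (h.flow i.1) i.2 i.2.2 A hA hAv⟩

theorem unifCountablyAdditive_weight (h : IsFlowSeq k σ η e L f u) (b : ℝ) :
    UnifCountablyAdditive volume fun (i : ℕ × Icc 0 b) x => weight σ x * u i.1 i.2 x :=
  (h.equiIntegrable b).unifCountablyAdditive fun i => ((h.flow i.1).dens _).weight_mul σ

theorem unifCountablyAdditive (h : IsFlowSeq k σ η e L f u) (b : ℝ) :
    UnifCountablyAdditive volume fun (i : ℕ × Icc 0 b) x => u i.1 i.2 x := by
  intro B hB hB' h0 δ hδ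
  obtain ⟨N, hN⟩ := h.unifCountablyAdditive_weight b B hB hB' h0 δ hδ
  refine ⟨N, fun i => (setIntegral_mono (h.integrable_density _ _).abs.integrableOn
    ((h.flow i.1).integrable i.2).abs.integrableOn fun x => ?_).trans (hN i)⟩
  have h1 := (h.flow i.1).dens i.2
  dsimp only
  rw [abs_of_nonneg (h1.nonneg x), abs_of_nonneg ((h1.weight_mul σ).nonneg x)]
  exact h1.le_weight_mul h.σ_nonneg x

theorem integral_abs_sub_le (h : IsFlowSeq k σ η e L f u) (n m : ℕ) {t : ℝ} (ht : 0 ≤ t) :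
    ∫ x, |u n t x - u m t x| ≤ 2 * ∫ x, weight σ x * f x := by
  have h1 : ∫ x, |u n t x - u m t x| ≤ ∫ x, (u n t x + u m t x) :=
    integral_mono ((h.integrable_density n t).sub (h.integrable_density m t)).abs
      ((h.integrable_density n t).add (h.integrable_density m t)) fun x => by
        have := abs_sub (u n t x) (u m t x)
        rwa [abs_of_nonneg (((h.flow n).dens t).nonneg x),
          abs_of_nonneg (((h.flow m).dens t).nonneg x)] at this
  rw [integral_add (h.integrable_density n t) (h.integrable_density m t)] at h1
  linarith [h.integral_density_le n ht, h.integral_density_le m ht]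

/-- The mass in a set is equicontinuous in time if the indicator of the set is a bounded pointwise
limit of Lipschitz functions. -/
theorem equicontinuous (h : IsFlowSeq k σ η e L f u) {A : Set ℝ} (hA : MeasurableSet A)
    {χ : ℕ → ℝ → ℝ} (hχ : ∀ j, Measurable (χ j)) (hχ1 : ∀ j x, |χ j x| ≤ 1)
    (hχl : ∀ j x y, |χ j x - χ j y| ≤ j * |x - y|)
    (hlim : ∀ x, Tendsto (fun j => χ j x) atTop (𝓝 (A.indicator (fun _ => 1) x)))
    (b : ℝ) {δ : ℝ} (hδ : 0 < δ) :
    ∃ τ > 0, ∀ n, ∀ s ∈ Icc 0 b, ∀ t ∈ Icc 0 b, |t - s| ≤ τ →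
      |(∫ x in A, u n t x) - ∫ x in A, u n s x| ≤ δ := by
  have hk := (h.kernel 0).k_nonneg
  set W := ∫ x, weight σ x * f x
  have hind : Measurable (A.indicator fun _ : ℝ => (1 : ℝ)) := measurable_const.indicator hA
  have hind1 : ∀ x, |A.indicator (fun _ : ℝ => (1 : ℝ)) x| ≤ 1 := fun x => by
    by_cases hx : x ∈ A <;> simp [hx]
  obtain ⟨J, hJ⟩ := (h.unifCountablyAdditive b).exists_integral_abs_sub_le
    (fun i => h.integrable_density _ _) (W := W) (fun i => by
      simp_rw [abs_of_nonneg (((h.flow i.1).dens i.2).nonneg _)]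
      exact h.integral_density_le i.1 i.2.2.1)
    hχ hind hχ1 hind1 (ae_of_all _ hlim) (show 0 < δ / 3 by positivity)
  have hclose : ∀ n, ∀ t ∈ Icc 0 b,
      |(∫ x, χ J x * u n t x) - ∫ x in A, u n t x| ≤ δ / 3 := by
    intro n t ht
    have h1 := hJ J le_rfl (n, ⟨t, ht⟩)
    have h2 : ∫ x in A, u n t x = ∫ x, A.indicator (fun _ => 1) x * u n t x := by
      rw [← integral_indicator hA]
      congr 1 with x
      by_cases hx : x ∈ A <;> simp [hx]
    have i1 := integrable_bdd_mul' (h.integrable_density n t) (hχ J) (hχ1 J)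
    have i2 := integrable_bdd_mul' (h.integrable_density n t) hind hind1
    rw [h2, ← integral_sub i1 i2, ← Real.norm_eq_abs]
    refine (norm_integral_le_integral_norm _).trans (le_trans (le_of_eq ?_) h1)
    congr 1 with x
    rw [← sub_mul, norm_mul, Real.norm_eq_abs, Real.norm_eq_abs]
  have hJ0 : (0 : ℝ) ≤ J := Nat.cast_nonneg J
  set C := ((J : ℝ) + 1) * (2 * k)
  have hC : 0 ≤ C := by positivity
  refine ⟨δ / 3 / (C * W ^ 2 + 1), by positivity, fun n s hs t ht hst => ?_⟩
  have h1 := (h.flow n).abs_integral_sub_le (h.kernel n) h.dens h.integrable (h.mem n).1 (hχ J)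
    (hχ1 J) hC (abs_coagOp_mul_le_of_lipschitz (h.kernel n) (h.mem n).1 (hχ1 J) hJ0 (hχl J))
    hs.1 ht.1
  have h2 : C * W ^ 2 * |t - s| ≤ δ / 3 := by
    calc _ ≤ (C * W ^ 2 + 1) * (δ / 3 / (C * W ^ 2 + 1)) := by
          apply mul_le_mul (by linarith) hst (abs_nonneg _) (by positivity)
      _ = _ := mul_div_cancel₀ _ (by positivity)
  have h3 := hclose n t ht
  have h4 := hclose n s hs
  rw [abs_le] at h1 h3 h4 ⊢
  constructor <;> linarith

end IsFlowSeq

/-- The rational half-lines, together with the whole line. -/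
def ratIic : Option ℚ → Set ℝ
  | none => univ
  | some r => Iic (r : ℝ)

theorem measurableSet_ratIic (o : Option ℚ) : MeasurableSet (ratIic o) := by
  cases o with
  | none => exact MeasurableSet.univ
  | some r => exact measurableSet_Iic

namespace IsFlowSeq

variable {k σ η : ℝ} {e : ℕ → ℝ} {L : ℕ → ℝ × ℝ → ℝ} {f : ℝ → ℝ} {u : ℕ → ℝ → ℝ → ℝ}

theorem equicontinuous_ratIic (h : IsFlowSeq k σ η e L f u) (o : Option ℚ)
    (b : ℝ) {δ : ℝ} (hδ : 0 < δ) :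
    ∃ τ > 0, ∀ n, ∀ s ∈ Icc 0 b, ∀ t ∈ Icc 0 b, |t - s| ≤ τ →
      |(∫ x in ratIic o, u n t x) - ∫ x in ratIic o, u n s x| ≤ δ := by
  cases o with
  | none =>
    refine h.equicontinuous (measurableSet_ratIic none) (χ := fun _ _ => 1)
      (fun _ => measurable_const) (by simp) (fun j x y => ?_) (fun x => ?_) b hδ
    · simp only [sub_self, abs_zero]; positivity
    · simp [ratIic]
  | some r =>
    refine h.equicontinuous (measurableSet_ratIic (some r))
      (χ := fun j x => max 0 (min 1 (1 - j * (x - r))))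
      (fun _ => by fun_prop) (fun j x => ?_) (fun j x y => ?_) (fun x => ?_) b hδ
    · rw [abs_of_nonneg (le_max_left _ _)]
      exact max_le zero_le_one (min_le_left _ _)
    · have h1 := abs_max_sub_max_le_abs (min 1 (1 - j * (x - r))) (min 1 (1 - j * (y - r))) 0
      have h2 := abs_min_sub_min_le_max 1 (1 - j * (x - r)) 1 (1 - j * (y - r))
      rw [max_comm 0, max_comm 0]
      refine h1.trans (h2.trans ?_)
      rw [sub_self, abs_zero]
      refine max_le (by positivity) (le_of_eq ?_)
      have : 1 - j * (x - r) - (1 - j * (y - r)) = (j : ℝ) * (y - x) := by ring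
      rw [this, abs_mul, Nat.abs_cast, abs_sub_comm]
    · rcases le_or_gt x r with hx | hx
      · rw [indicator_of_mem (show x ∈ ratIic (some r) from hx)]
        refine tendsto_const_nhds.congr fun j => ?_
        have : (j : ℝ) * (x - r) ≤ 0 :=
          mul_nonpos_of_nonneg_of_nonpos (Nat.cast_nonneg j) (by linarith)
        rw [min_eq_left (by linarith), max_eq_right zero_le_one]
      · rw [indicator_of_notMem (show x ∉ ratIic (some r) from not_le.2 hx)]
        refine tendsto_const_nhds.congr' ?_
        filter_upwards [eventually_ge_atTop ⌈1 / (x - r)⌉₊] with j hj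
        have h1 := Nat.ceil_le.1 hj
        rw [div_le_iff₀ (by linarith)] at h1
        rw [min_eq_right (by linarith), max_eq_left (by linarith)]

/-- Diagonal extraction over countably many times and sets. -/
theorem exists_subseq (h : IsFlowSeq k σ η e L f u) :
    ∃ φ : ℕ → ℕ, StrictMono φ ∧ ∀ (j K : ℕ) (o : Option ℚ),
      CauchySeq fun n => ∫ x in ratIic o, u (φ n) (j / (K + 1)) x := by
  set W := ∫ x, weight σ x * f x
  let x : ℕ → (ℕ × ℕ × Option ℚ) → ℝ := fun n q =>
    ∫ x in ratIic q.2.2, u n (q.1 / (q.2.1 + 1)) x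
  have hx : ∀ n, x n ∈ Set.pi univ fun _ : ℕ × ℕ × Option ℚ => Icc (0 : ℝ) W := by
    intro n q _
    have hd := (h.flow n).dens (q.1 / (q.2.1 + 1))
    exact ⟨integral_nonneg hd.nonneg, (setIntegral_le_integral (h.integrable_density n _)
      (ae_of_all _ hd.nonneg)).trans (h.integral_density_le n (by positivity))⟩
  obtain ⟨a, -, φ, hφ, hlim⟩ := (isCompact_univ_pi fun _ => isCompact_Icc).tendsto_subseq hx
  refine ⟨φ, hφ, fun j K o => ?_⟩
  exact ((tendsto_pi_nhds.1 hlim) (j, K, o)).cauchySeq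

theorem tendsto_setIntegral_ratIic (h : IsFlowSeq k σ η e L f u)
    (hc : ∀ (j K : ℕ) (o : Option ℚ), CauchySeq fun n => ∫ x in ratIic o, u n (j / (K + 1)) x)
    (b : ℝ) (o : Option ℚ) :
    Tendsto (fun i : ℕ × ℕ × Icc 0 b =>
      ∫ x in ratIic o, (u i.1 i.2.2 x - u i.2.1 i.2.2 x)) (atTop ×ˢ atTop ×ˢ ⊤) (𝓝 0) := by
  rw [Metric.tendsto_nhds]
  intro δ hδ
  obtain ⟨τ, hτ, heq⟩ := h.equicontinuous_ratIic o b (show 0 < δ / 4 by positivity)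
  obtain ⟨K, hK⟩ := exists_nat_one_div_lt hτ
  have hK0 : (0 : ℝ) < K + 1 := by positivity
  obtain ⟨N, hN⟩ : ∃ N, ∀ j ∈ Finset.range (⌊b * (K + 1)⌋₊ + 1), ∀ n ≥ N, ∀ m ≥ N,
      dist (∫ x in ratIic o, u n (j / (K + 1)) x) (∫ x in ratIic o, u m (j / (K + 1)) x) <
        δ / 4 := by
    have h1 : ∀ j : ℕ, ∃ N, ∀ n ≥ N, ∀ m ≥ N, dist (∫ x in ratIic o, u n (j / (K + 1)) x)
        (∫ x in ratIic o, u m (j / (K + 1)) x) < δ / 4 := fun j =>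
      Metric.cauchySeq_iff.1 (hc j K o) (δ / 4) (by positivity)
    choose N hN using h1
    exact ⟨(Finset.range (⌊b * (K + 1)⌋₊ + 1)).sup N, fun j hj n hn m hm =>
      hN j n ((Finset.le_sup hj).trans hn) m ((Finset.le_sup hj).trans hm)⟩
  have hev : ∀ᶠ i : ℕ × ℕ × Icc 0 b in atTop ×ˢ atTop ×ˢ ⊤, N ≤ i.1 ∧ N ≤ i.2.1 ∧ True :=
    by
    have hT : ∀ᶠ _ in (⊤ : Filter (Icc 0 b)), True := Eventually.of_forall fun _ => trivial
    exact (eventually_ge_atTop N).prod_mk ((eventually_ge_atTop N).prod_mk hT)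
  filter_upwards [hev] with i hi
  obtain ⟨n, m, t, ht⟩ := i
  obtain ⟨hn, hm, -⟩ := hi
  dsimp only at hn hm ⊢
  set j := ⌊t * (K + 1)⌋₊
  have hjt : (j : ℝ) ≤ t * (K + 1) := Nat.floor_le (mul_nonneg ht.1 hK0.le)
  have hjt' : t * (K + 1) < j + 1 := Nat.lt_floor_add_one _
  have hs1 : (j : ℝ) / (K + 1) ≤ t := by rwa [div_le_iff₀ hK0]
  have hs2 : |t - j / (K + 1)| ≤ τ := by
    rw [abs_of_nonneg (by linarith)]
    refine le_trans ?_ hK.le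
    rw [le_div_iff₀ hK0, sub_mul, div_mul_cancel₀ _ hK0.ne']
    linarith
  have hj : j ∈ Finset.range (⌊b * (K + 1)⌋₊ + 1) := by
    rw [Finset.mem_range, Nat.lt_add_one_iff]
    exact Nat.floor_mono (mul_le_mul_of_nonneg_right ht.2 hK0.le)
  have hsm : (j : ℝ) / (K + 1) ∈ Icc 0 b := ⟨by positivity, hs1.trans ht.2⟩
  have h1 := heq n _ hsm t ht hs2
  have h2 := heq m _ hsm t ht hs2
  have h3 := hN j hj n hn m hm
  rw [integral_sub (h.integrable_density n t).integrableOn (h.integrable_density m t).integrableOn,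
    dist_zero_right, Real.norm_eq_abs]
  rw [Real.dist_eq] at h3
  rw [abs_lt] at h3 ⊢
  rw [abs_le] at h1 h2
  constructor <;> linarith

/-- Along the extracted subsequence all bounded measurable functions may be integrated. -/
theorem tendsto_integral_weight_sub (h : IsFlowSeq k σ η e L f u)
    (hc : ∀ (j K : ℕ) (o : Option ℚ), CauchySeq fun n => ∫ x in ratIic o, u n (j / (K + 1)) x)
    (b : ℝ) {ψ : ℝ → ℝ} (hψ : Measurable ψ) {M : ℝ} (hM : ∀ x, |ψ x| ≤ M) :
    Tendsto (fun i : ℕ × ℕ × Icc 0 b =>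
      ∫ x, ψ x * (weight σ x * u i.1 i.2.2 x - weight σ x * u i.2.1 i.2.2 x))
      (atTop ×ˢ atTop ×ˢ ⊤) (𝓝 0) := by
  set W := ∫ x, weight σ x * f x
  have hM0 : 0 ≤ M := (abs_nonneg _).trans (hM 0)
  have hi : ∀ i : ℕ × ℕ × Icc 0 b, Integrable fun x => u i.1 i.2.2 x - u i.2.1 i.2.2 x :=
    fun i => (h.integrable_density _ _).sub (h.integrable_density _ _)
  have hu : UnifCountablyAdditive volume
      fun (i : ℕ × ℕ × Icc 0 b) x => u i.1 i.2.2 x - u i.2.1 i.2.2 x :=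
    ((h.unifCountablyAdditive b).comp fun i : ℕ × ℕ × Icc 0 b => (i.1, i.2.2)).sub
      ((h.unifCountablyAdditive b).comp fun i : ℕ × ℕ × Icc 0 b => (i.2.1, i.2.2))
      (fun i => h.integrable_density _ _) (fun i => h.integrable_density _ _)
  have huW : ∀ i : ℕ × ℕ × Icc 0 b, ∫ x, |u i.1 i.2.2 x - u i.2.1 i.2.2 x| ≤ 2 * W :=
    fun i => h.integral_abs_sub_le _ _ i.2.2.2.1
  -- convergence of the unweighted masses of all measurable sets
  have hset := tendsto_setIntegral_zero (d := fun (i : ℕ × ℕ × Icc 0 b) x =>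
    u i.1 i.2.2 x - u i.2.1 i.2.2 x) (l := atTop ×ˢ atTop ×ˢ ⊤)
    (BorelSpace.measurable_eq.trans Real.borel_eq_generateFrom_Iic_rat) Real.isPiSystem_Iic_rat
    hi hu (by simpa [ratIic] using h.tendsto_setIntegral_ratIic hc b none) (fun A hA => by
      simp only [mem_iUnion, mem_singleton_iff] at hA
      obtain ⟨r, rfl⟩ := hA
      exact h.tendsto_setIntegral_ratIic hc b (some r))
  have hbdd : ∀ {φ : ℝ → ℝ}, Measurable φ → (∃ M, ∀ x, |φ x| ≤ M) → Tendsto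
      (fun i : ℕ × ℕ × Icc 0 b => ∫ x, φ x * (u i.1 i.2.2 x - u i.2.1 i.2.2 x))
      (atTop ×ˢ atTop ×ˢ ⊤) (𝓝 0) := fun hφ ⟨M, hφM⟩ =>
    tendsto_integral_mul_zero hi hu huW hset hφ hφM
  -- the weight is bounded on the complement of `B N`
  let B : ℕ → Set ℝ := fun N => {x | 0 < x ∧ (x < 1 / (N + 1) ∨ N + 1 < x)}
  have hB : ∀ N, MeasurableSet (B N) := fun N =>
    measurableSet_Ioi.inter (measurableSet_Iio.union measurableSet_Ioi)
  have hBa : Antitone B := by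
    intro N N' hN x hx
    have hN' : (N : ℝ) ≤ N' := by exact_mod_cast hN
    have h1 : 1 / ((N' : ℝ) + 1) ≤ 1 / (N + 1) :=
      one_div_le_one_div_of_le (by positivity) (by linarith)
    exact ⟨hx.1, hx.2.imp (fun h' => h'.trans_le h1) (fun h' => by linarith)⟩
  have hB0 : ⋂ N, B N = ∅ := by
    ext x
    simp only [mem_iInter, mem_empty_iff_false, iff_false, not_forall]
    by_contra! hx
    have hx0 : 0 < x := (hx 0).1
    obtain ⟨n, hn⟩ := exists_nat_gt (max x (1 / x))
    have h1 := (hx n).2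
    have h2 : x < n := (le_max_left _ _).trans_lt hn
    have h3 : 1 / x < n := (le_max_right _ _).trans_lt hn
    rcases h1 with h1 | h1
    · rw [lt_div_iff₀ (by positivity)] at h1
      rw [div_lt_iff₀ hx0] at h3
      nlinarith
    · linarith
  rw [Metric.tendsto_nhds]
  intro δ hδ
  obtain ⟨N, hN⟩ := h.unifCountablyAdditive_weight b B hB hBa (by rw [hB0, measure_empty])
    (δ / 4 / (M + 1)) (by positivity)
  let φ : ℝ → ℝ := fun x => if x ∈ Ioi 0 \ B N then ψ x * weight σ x else 0
  have hφm : Measurable φ := Measurable.ite (measurableSet_Ioi.diff (hB N))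
    (hψ.mul (measurable_weight σ)) measurable_const
  have hφb : ∃ M', ∀ x, |φ x| ≤ M' := by
    refine ⟨M * ((1 / (N + 1 : ℝ)) ^ (-σ) + (N + 1)), fun x => ?_⟩
    have hN0 : (0 : ℝ) < 1 / (N + 1) := by positivity
    have h0 := Real.rpow_nonneg hN0.le (-σ)
    simp only [φ]
    split_ifs with hx
    · have hx0 : 0 < x := hx.1
      have hx2 : ¬ (x < 1 / (N + 1) ∨ N + 1 < x) := fun h' => hx.2 ⟨hx0, h'⟩
      push Not at hx2
      rw [abs_mul, abs_of_pos (weight_pos hx0)]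
      have h1 := antitoneOn_rpow_neg h.σ_nonneg (show (1 / (N + 1) : ℝ) ∈ Ioi 0 from hN0)
        (show x ∈ Ioi 0 from hx0) hx2.1
      exact mul_le_mul (hM x) (add_le_add h1 hx2.2) (weight_pos hx0).le hM0
    · rw [abs_zero]; positivity
  filter_upwards [(Metric.tendsto_nhds.1 (hbdd hφm hφb)) (δ / 2) (half_pos hδ)] with i h1
  rw [dist_zero_right] at h1 ⊢
  have hd1 := (h.flow i.1).dens i.2.2
  have hd2 := (h.flow i.2.1).dens i.2.2
  have hw1 := (h.flow i.1).integrable i.2.2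
  have hw2 := (h.flow i.2.1).integrable i.2.2
  have i1 : Integrable fun x => ψ x *
      (weight σ x * u i.1 i.2.2 x - weight σ x * u i.2.1 i.2.2 x) :=
    integrable_bdd_mul' (hw1.sub hw2) hψ hM
  obtain ⟨M', hM'⟩ := hφb
  have i2 : Integrable fun x => φ x * (u i.1 i.2.2 x - u i.2.1 i.2.2 x) :=
    integrable_bdd_mul' (hi i) hφm hM'
  have h2 : ‖(∫ x, ψ x * (weight σ x * u i.1 i.2.2 x - weight σ x * u i.2.1 i.2.2 x)) -
      ∫ x, φ x * (u i.1 i.2.2 x - u i.2.1 i.2.2 x)‖ ≤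
      ∫ x, (B N).indicator (fun x => M * (|weight σ x * u i.1 i.2.2 x| +
        |weight σ x * u i.2.1 i.2.2 x|)) x := by
    rw [← integral_sub i1 i2]
    refine norm_integral_le_of_norm_le (((hw1.abs.add hw2.abs).const_mul M).indicator (hB N))
      (ae_of_all _ fun x => ?_)
    rcases le_or_gt x 0 with hx | hx
    · simp only [hd1.eq_zero x hx, hd2.eq_zero x hx, mul_zero, sub_self, norm_zero]
      refine indicator_nonneg (fun x _ => ?_) x
      positivity
    by_cases hxB : x ∈ B N
    · have h3 : φ x = 0 := if_neg fun h' => h'.2 hxB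
      rw [indicator_of_mem hxB, h3, zero_mul, sub_zero, norm_mul]
      exact mul_le_mul (hM x) (abs_sub _ _) (abs_nonneg _) hM0
    · have h3 : φ x = ψ x * weight σ x := if_pos ⟨hx, hxB⟩
      rw [indicator_of_notMem hxB, h3]
      simp only [Real.norm_eq_abs, abs_nonpos_iff]
      ring
  rw [integral_indicator (hB N), integral_const_mul,
    integral_add hw1.abs.integrableOn hw2.abs.integrableOn] at h2
  have h3 := hN (i.1, i.2.2)
  have h4 := hN (i.2.1, i.2.2)
  dsimp only at h3 h4
  have h5 : M * ((∫ x in B N, |weight σ x * u i.1 i.2.2 x|) +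
      ∫ x in B N, |weight σ x * u i.2.1 i.2.2 x|) ≤ δ / 2 := by
    have h6 : 0 ≤ (∫ x in B N, |weight σ x * u i.1 i.2.2 x|) +
      ∫ x in B N, |weight σ x * u i.2.1 i.2.2 x| :=
      add_nonneg (integral_nonneg fun x => abs_nonneg _) (integral_nonneg fun x => abs_nonneg _)
    calc _ ≤ (M + 1) * (δ / 4 / (M + 1) + δ / 4 / (M + 1)) := by
          apply mul_le_mul (by linarith) (add_le_add h3 h4) h6 (by linarith)
      _ = _ := by field_simp; ring
  have h6 := norm_sub_norm_le (∫ x, ψ x * (weight σ x * u i.1 i.2.2 x -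
    weight σ x * u i.2.1 i.2.2 x)) (∫ x, φ x * (u i.1 i.2.2 x - u i.2.1 i.2.2 x))
  linarith

end IsFlowSeq

/-- Convergence of the collision integrals when both the kernels and the densities converge. -/
theorem tendsto_integral_mul_tensor {σ W C : ℝ} {v : ℕ → ℝ → ℝ} {u : ℝ → ℝ}
    (hv : ∀ n, IsDensity (v n)) (hu : IsDensity u)
    (hvi : ∀ n, Integrable fun x => weight σ x * v n x)
    (hui : Integrable fun x => weight σ x * u x)
    (hW : ∀ n, ∫ x, weight σ x * v n x ≤ W)
    (heq : EquiIntegrable fun n x => weight σ x * v n x)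
    (hlim : ∀ A, MeasurableSet A → Tendsto (fun n => ∫ x in A, weight σ x * v n x) atTop
      (𝓝 (∫ x in A, weight σ x * u x)))
    {κ : ℕ → ℝ × ℝ → ℝ} {K : ℝ × ℝ → ℝ} (hκ : ∀ n, Measurable (κ n)) (hK : Measurable K)
    (hκC : ∀ n p, 0 < p.1 → 0 < p.2 → |κ n p| ≤ C * (weight σ p.1 * weight σ p.2))
    (hKC : ∀ p : ℝ × ℝ, 0 < p.1 → 0 < p.2 → |K p| ≤ C * (weight σ p.1 * weight σ p.2))
    (hκK : ∀ᵐ p, Tendsto (fun n => κ n p) atTop (𝓝 (K p))) :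
    Tendsto (fun n => ∫ p : ℝ × ℝ, κ n p * (v n p.1 * v n p.2)) atTop
      (𝓝 (∫ p : ℝ × ℝ, K p * (u p.1 * u p.2))) := by
  have hW0 : 0 ≤ W := (integral_nonneg ((hv 0).weight_mul σ).nonneg).trans (hW 0)
  have hC : 0 ≤ C := by
    have h1 := hKC (1, 1) one_pos one_pos
    have h2 : 0 < weight σ 1 * weight σ 1 := mul_pos (weight_pos one_pos) (weight_pos one_pos)
    exact nonneg_of_mul_nonneg_left ((abs_nonneg _).trans h1) h2
  let q : Set (ℝ × ℝ) := {p | 0 < p.1 ∧ 0 < p.2}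
  have hq : MeasurableSet q := (measurableSet_lt measurable_const measurable_fst).inter
    (measurableSet_lt measurable_const measurable_snd)
  let V : ℕ → ℝ × ℝ → ℝ := fun n p => (weight σ p.1 * v n p.1) * (weight σ p.2 * v n p.2)
  let U : ℝ × ℝ → ℝ := fun p => (weight σ p.1 * u p.1) * (weight σ p.2 * u p.2)
  let den : (ℝ × ℝ → ℝ) → ℝ × ℝ → ℝ := fun κ p =>
    if p ∈ q then κ p / (weight σ p.1 * weight σ p.2) else 0
  have hwm : Measurable fun p : ℝ × ℝ => weight σ p.1 * weight σ p.2 :=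
    ((measurable_weight σ).comp measurable_fst).mul ((measurable_weight σ).comp measurable_snd)
  have hdm : ∀ {κ : ℝ × ℝ → ℝ}, Measurable κ → Measurable (den κ) := fun h =>
    Measurable.ite hq (h.div hwm) measurable_const
  have hdC : ∀ {κ : ℝ × ℝ → ℝ}, (∀ p : ℝ × ℝ, 0 < p.1 → 0 < p.2 →
      |κ p| ≤ C * (weight σ p.1 * weight σ p.2)) → ∀ p, |den κ p| ≤ C := by
    intro κ h p
    by_cases hp : p ∈ q
    · have h1 : 0 < weight σ p.1 * weight σ p.2 := mul_pos (weight_pos hp.1) (weight_pos hp.2)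
      simp only [den, if_pos hp, abs_div, abs_of_pos h1]
      exact (div_le_iff₀ h1).2 (h p hp.1 hp.2)
    · simp only [den, if_neg hp, abs_zero, hC]
  have hdmul : ∀ (κ : ℝ × ℝ → ℝ) {a : ℝ → ℝ}, IsDensity a → ∀ p : ℝ × ℝ,
      κ p * (a p.1 * a p.2) = den κ p * ((weight σ p.1 * a p.1) * (weight σ p.2 * a p.2)) := by
    intro κ a ha p
    by_cases hp : p ∈ q
    · have h1 : weight σ p.1 ≠ 0 := (weight_pos hp.1).ne'
      have h2 : weight σ p.2 ≠ 0 := (weight_pos hp.2).ne'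
      simp only [den, if_pos hp]
      field_simp
    · have h1 : a p.1 * a p.2 = 0 := by
        rcases not_and_or.1 hp with h | h
        · rw [ha.eq_zero _ (not_lt.1 h), zero_mul]
        · rw [ha.eq_zero _ (not_lt.1 h), mul_zero]
      simp only [den, if_neg hp, h1, mul_zero, zero_mul]
  have hVi : ∀ n, Integrable (V n) := fun n => (hvi n).mul_prod (hvi n)
  have hUi : Integrable U := hui.mul_prod hui
  have hV0 : ∀ n p, 0 ≤ V n p := fun n p =>
    mul_nonneg (((hv n).weight_mul σ).nonneg _) (((hv n).weight_mul σ).nonneg _)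
  have hU0 : ∀ p, 0 ≤ U p := fun p =>
    mul_nonneg ((hu.weight_mul σ).nonneg _) ((hu.weight_mul σ).nonneg _)
  have hVint : ∀ n, ∫ p, V n p ≤ W ^ 2 := by
    intro n
    have h1 : ∫ p, V n p = (∫ x, weight σ x * v n x) * ∫ x, weight σ x * v n x := by
      rw [Measure.volume_eq_prod]
      exact integral_prod_mul (fun x => weight σ x * v n x) fun x => weight σ x * v n x
    rw [h1, sq]
    exact mul_le_mul (hW n) (hW n) (integral_nonneg ((hv n).weight_mul σ).nonneg) hW0
  have hVu : UnifCountablyAdditive volume V :=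
    heq.tensor (fun n => (hv n).weight_mul σ) hvi hW
  -- the tensor products converge on all measurable sets
  have hset := tendsto_setIntegral_zero (d := fun n p => V n p - U p) (l := atTop)
    (generateFrom_prod (α := ℝ) (β := ℝ)).symm isPiSystem_prod (fun n => (hVi n).sub hUi)
    (hVu.sub (unifCountablyAdditive_const hUi) hVi fun _ => hUi) ?_ ?_
  rotate_left
  · have h1 := ((hlim univ MeasurableSet.univ).mul (hlim univ MeasurableSet.univ)).sub_const
      ((∫ x in univ, weight σ x * u x) * ∫ x in univ, weight σ x * u x)
    rw [sub_self] at h1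
    refine h1.congr fun n => ?_
    simp only [Measure.restrict_univ]
    rw [integral_sub (hVi n) hUi, Measure.volume_eq_prod]
    rw [← integral_prod_mul (μ := (volume : Measure ℝ)) (ν := (volume : Measure ℝ)),
      ← integral_prod_mul (μ := (volume : Measure ℝ)) (ν := (volume : Measure ℝ))]
  · rintro _ ⟨A, hA, B, hB, rfl⟩
    have h1 := ((hlim A hA).mul (hlim B hB)).sub_const
      ((∫ x in A, weight σ x * u x) * ∫ x in B, weight σ x * u x)
    rw [sub_self] at h1
    refine h1.congr fun n => ?_
    rw [integral_sub (hVi n).integrableOn hUi.integrableOn, Measure.volume_eq_prod]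
    rw [← setIntegral_prod_mul, ← setIntegral_prod_mul]
  have hUW : ∀ n, ∫ p, |V n p - U p| ≤ W ^ 2 + ∫ p, U p := by
    intro n
    have h1 : ∫ p, |V n p - U p| ≤ ∫ p, (V n p + U p) :=
      integral_mono ((hVi n).sub hUi).abs ((hVi n).add hUi) fun p => by
        have := abs_sub (V n p) (U p)
        rwa [abs_of_nonneg (hV0 n p), abs_of_nonneg (hU0 p)] at this
    rw [integral_add (hVi n) hUi] at h1
    linarith [hVint n]
  have hlim1 := tendsto_integral_mul_zero (d := fun n p => V n p - U p) (l := atTop)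
    (fun n => (hVi n).sub hUi) (hVu.sub (unifCountablyAdditive_const hUi) hVi fun _ => hUi)
    hUW hset (hdm hK) (hdC hKC)
  simp_rw [fun n p => hdmul (κ n) (hv n) p, fun p => hdmul K hu p]
  rw [Metric.tendsto_atTop] at hlim1 ⊢
  intro δ hδ
  obtain ⟨N1, hN1⟩ := hlim1 (δ / 2) (half_pos hδ)
  obtain ⟨N2, hN2⟩ := hVu.exists_integral_abs_sub_le hVi (W := W ^ 2) (fun n => by
      simp_rw [abs_of_nonneg (hV0 n _)]; exact hVint n)
    (fun n => hdm (hκ n)) (hdm hK) (fun n => hdC (hκC n)) (hdC hKC) (by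
      filter_upwards [hκK] with p hp
      by_cases hpq : p ∈ q
      · simp only [den, if_pos hpq]
        exact hp.div_const _
      · simp only [den, if_neg hpq, tendsto_const_nhds]) (show 0 < δ / 4 by positivity)
  refine ⟨max N1 N2, fun n hn => ?_⟩
  have h1 := hN1 n ((le_max_left _ _).trans hn)
  have h2 := hN2 n ((le_max_right _ _).trans hn) n
  rw [dist_zero_right] at h1
  have i1 : Integrable fun p => den (κ n) p * V n p :=
    integrable_bdd_mul' (hVi n) (hdm (hκ n)) (hdC (hκC n))
  have i2 : Integrable fun p => den K p * V n p := integrable_bdd_mul' (hVi n) (hdm hK) (hdC hKC)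
  have i3 : Integrable fun p => den K p * U p := integrable_bdd_mul' hUi (hdm hK) (hdC hKC)
  have h3 : ‖(∫ p, den (κ n) p * V n p) - ∫ p, den K p * V n p‖ ≤ δ / 4 := by
    rw [← integral_sub i1 i2]
    refine (norm_integral_le_integral_norm _).trans (le_trans (le_of_eq ?_) h2)
    congr 1 with p
    rw [← sub_mul, norm_mul, Real.norm_eq_abs, Real.norm_eq_abs]
  have h4 : ∫ p, den K p * (V n p - U p) =
      (∫ p, den K p * V n p) - ∫ p, den K p * U p := by
    rw [← integral_sub i2 i3]
    simp_rw [mul_sub]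
  rw [h4] at h1
  rw [dist_eq_norm]
  calc _ = ‖((∫ p, den (κ n) p * V n p) - ∫ p, den K p * V n p) +
        ((∫ p, den K p * V n p) - ∫ p, den K p * U p)‖ := by
        congr 1; simp only [V, U]; ring
    _ ≤ _ := norm_add_le _ _
    _ < δ := by linarith

namespace IsFlowSeq

variable {k σ η : ℝ} {e : ℕ → ℝ} {L : ℕ → ℝ × ℝ → ℝ} {f : ℝ → ℝ} {u : ℕ → ℝ → ℝ → ℝ}

/-- The limits of the weighted densities at fixed times are again weighted densities, and the weak
convergence is locally uniform in time. -/
theorem exists_limit_density (h : IsFlowSeq k σ η e L f u)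
    (hc : ∀ (j K : ℕ) (o : Option ℚ), CauchySeq fun n => ∫ x in ratIic o, u n (j / (K + 1)) x) :
    ∃ v : ℝ → ℝ → ℝ, (∀ t, IsDensity (v t)) ∧ (∀ t, Integrable fun x => weight σ x * v t x) ∧
      ∀ ψ : ℝ → ℝ, Measurable ψ → (∃ M, ∀ x, |ψ x| ≤ M) → ∀ b : ℝ,
        TendstoUniformlyOn (fun n t => ∫ x, ψ x * (weight σ x * u n t x))
          (fun t => ∫ x, ψ x * (weight σ x * v t x)) atTop (Icc 0 b) := by
  have hcauchy : ∀ ψ : ℝ → ℝ, Measurable ψ → (∃ M, ∀ x, |ψ x| ≤ M) → ∀ (b δ : ℝ), 0 < δ →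
      ∃ N, ∀ n ≥ N, ∀ m ≥ N, ∀ t ∈ Icc 0 b,
        dist (∫ x, ψ x * (weight σ x * u n t x)) (∫ x, ψ x * (weight σ x * u m t x)) < δ := by
    rintro ψ hψ ⟨M, hM⟩ b δ hδ
    have h1 := (Metric.tendsto_nhds.1 (h.tendsto_integral_weight_sub hc b hψ hM)) δ hδ
    obtain ⟨pa, hpa, pb, hpb, h2⟩ := eventually_prod_iff.1 h1
    obtain ⟨pc, hpc, pd, hpd, h3⟩ := eventually_prod_iff.1 hpb
    obtain ⟨N, hN⟩ := (hpa.and hpc).exists_forall_of_atTop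
    refine ⟨N, fun n hn m hm t ht => ?_⟩
    have h4 := h2 (hN n hn).1 (h3 (hN m hm).2 ((eventually_top.1 hpd) ⟨t, ht⟩))
    dsimp only at h4
    simp_rw [mul_sub] at h4
    rw [integral_sub (integrable_bdd_mul' ((h.flow n).integrable t) hψ hM)
      (integrable_bdd_mul' ((h.flow m).integrable t) hψ hM)] at h4
    rwa [dist_zero_right, ← dist_eq_norm] at h4
  have hdens : ∀ t, ∃ v : ℝ → ℝ, IsDensity v ∧ (Integrable fun x => weight σ x * v x) ∧
      (0 ≤ t → ∀ A, MeasurableSet A → Tendsto (fun n => ∫ x in A, weight σ x * u n t x) atTop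
        (𝓝 (∫ x in A, weight σ x * v x))) := by
    intro t
    rcases lt_or_ge t 0 with ht | ht
    · exact ⟨fun _ => 0, ⟨measurable_const, fun _ => le_rfl, fun _ _ => rfl⟩, by simp,
        fun h' => absurd ht h'.not_gt⟩
    have hind : ∀ (n : ℕ) {A : Set ℝ}, MeasurableSet A → ∫ x in A, weight σ x * u n t x =
        ∫ x, A.indicator (fun _ => 1) x * (weight σ x * u n t x) := by
      intro n A hA
      rw [← integral_indicator hA]
      congr 1 with x
      by_cases hx : x ∈ A <;> simp [hx]
    obtain ⟨v, hvm, hv0, hvi, hvl⟩ := exists_density_tendsto_setIntegral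
      (fun n => (h.flow n).integrable t)
      (fun n x => (((h.flow n).dens t).weight_mul σ).nonneg x)
      ((h.unifCountablyAdditive_weight t).comp fun n : ℕ => (n, (⟨t, ht, le_rfl⟩ : Icc 0 t)))
      (fun A hA => by
        simp_rw [hind _ hA]
        rw [Metric.cauchySeq_iff]
        intro δ hδ
        obtain ⟨N, hN⟩ := hcauchy (A.indicator fun _ => 1) (measurable_const.indicator hA)
          ⟨1, fun x => by by_cases hx : x ∈ A <;> simp [hx]⟩ t δ hδ
        exact ⟨N, fun n hn m hm => hN n hn m hm t ⟨ht, le_rfl⟩⟩)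
    let v' : ℝ → ℝ := fun x => if x ∈ Ioi 0 then v x / weight σ x else 0
    have hv' : ∀ x, weight σ x * v' x = (Ioi 0).indicator v x := by
      intro x
      by_cases hx : x ∈ Ioi 0
      · have := (weight_pos (σ := σ) hx).ne'
        simp only [v', if_pos hx, indicator_of_mem hx]
        field_simp
      · simp only [v', if_neg hx, indicator_of_notMem hx, mul_zero]
    refine ⟨v', ⟨Measurable.ite measurableSet_Ioi (hvm.div (measurable_weight σ))
      measurable_const, fun x => ?_, fun x hx => if_neg (not_lt.2 hx)⟩, ?_, fun _ A hA => ?_⟩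
    · by_cases hx : x ∈ Ioi 0
      · simp only [v', if_pos hx]
        exact div_nonneg (hv0 x) (weight_pos hx).le
      · simp only [v', if_neg hx, le_refl]
    · simp_rw [hv']
      exact hvi.indicator measurableSet_Ioi
    · simp_rw [hv']
      have h1 := hvl (A ∩ Ioi 0) (hA.inter measurableSet_Ioi)
      rw [setIntegral_indicator measurableSet_Ioi]
      refine h1.congr fun n => ?_
      rw [← setIntegral_indicator measurableSet_Ioi]
      refine setIntegral_congr_fun hA fun x _ => ?_
      by_cases hx : x ∈ Ioi 0
      · simp only [indicator_of_mem hx]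
      · simp only [indicator_of_notMem hx, ((h.flow n).dens t).eq_zero x (not_lt.1 hx), mul_zero]
  choose v hv hvi hvl using hdens
  refine ⟨v, hv, hvi, fun ψ hψ hM b => ?_⟩
  obtain ⟨M, hM'⟩ := id hM
  set W := ∫ x, weight σ x * f x
  have hpt : ∀ t, 0 ≤ t → Tendsto (fun n => ∫ x, ψ x * (weight σ x * u n t x)) atTop
      (𝓝 (∫ x, ψ x * (weight σ x * v t x))) := by
    intro t ht
    have hid : ∀ n, Integrable fun x => weight σ x * u n t x - weight σ x * v t x :=
      fun n => ((h.flow n).integrable t).sub (hvi t)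
    have hud : UnifCountablyAdditive volume
        fun n x => weight σ x * u n t x - weight σ x * v t x :=
      ((h.unifCountablyAdditive_weight t).comp
        fun n : ℕ => (n, (⟨t, ht, le_rfl⟩ : Icc 0 t))).sub
        (unifCountablyAdditive_const (hvi t)) (fun n => (h.flow n).integrable t) fun _ => hvi t
    have h1 := tendsto_integral_mul_zero (l := atTop) hid hud
      (W := W + ∫ x, weight σ x * v t x) (fun n => by
        have i1 := (h.flow n).integrable t
        have h1 : ∫ x, |weight σ x * u n t x - weight σ x * v t x| ≤
            ∫ x, (weight σ x * u n t x + weight σ x * v t x) :=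
          integral_mono (hid n).abs (i1.add (hvi t)) fun x => by
            have := abs_sub (weight σ x * u n t x) (weight σ x * v t x)
            rwa [abs_of_nonneg ((((h.flow n).dens t).weight_mul σ).nonneg x),
              abs_of_nonneg (((hv t).weight_mul σ).nonneg x)] at this
        rw [integral_add i1 (hvi t)] at h1
        linarith [h.integral_weight_le n ht]) (fun A hA => by
        have h2 := (hvl t ht A hA).sub_const (∫ x in A, weight σ x * v t x)
        rw [sub_self] at h2
        refine h2.congr fun n => ?_
        rw [integral_sub ((h.flow n).integrable t).integrableOn (hvi t).integrableOn]) hψ hM'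
    have h2 := h1.add_const (∫ x, ψ x * (weight σ x * v t x))
    rw [zero_add] at h2
    refine h2.congr fun n => ?_
    simp_rw [mul_sub]
    rw [integral_sub (integrable_bdd_mul' ((h.flow n).integrable t) hψ hM')
      (integrable_bdd_mul' (hvi t) hψ hM')]
    ring
  rw [Metric.tendstoUniformlyOn_iff]
  intro δ hδ
  obtain ⟨N, hN⟩ := hcauchy ψ hψ hM b (δ / 2) (half_pos hδ)
  filter_upwards [eventually_ge_atTop N] with n hn t ht
  refine lt_of_le_of_lt (le_of_tendsto ((hpt t ht.1).dist tendsto_const_nhds) ?_)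
    (half_lt_self hδ)
  filter_upwards [eventually_ge_atTop N] with m hm
  exact (hN m hm n hn t ht).le

/-- Compactness of sequences of flows with a common initial datum, and the equation satisfied by
the limits. -/
theorem exists_limit (h : IsFlowSeq k σ η e L f u) :
    ∃ φ : ℕ → ℕ, StrictMono φ ∧ ∃ v : ℝ → ℝ → ℝ, (∀ t, IsDensity (v t)) ∧
      (∀ t, Integrable fun x => weight σ x * v t x) ∧
      (∀ t, 0 ≤ t → ∫ x, weight σ x * v t x ≤ ∫ x, weight σ x * f x) ∧
      (∀ ψ : ℝ → ℝ, Measurable ψ → (∃ M, ∀ x, |ψ x| ≤ M) → ∀ b : ℝ,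
        TendstoUniformlyOn (fun n t => ∫ x, ψ x * (weight σ x * u (φ n) t x))
          (fun t => ∫ x, ψ x * (weight σ x * v t x)) atTop (Icc 0 b)) ∧
      ∀ (G : ℝ → ℝ) (K : ℝ × ℝ → ℝ) (C : ℝ), Measurable G → (∃ M, ∀ x, |G x| ≤ M) →
        Measurable K →
        (∀ n p, 0 < p.1 → 0 < p.2 →
          |coagOp (e n) G p * L n p| ≤ C * (weight σ p.1 * weight σ p.2)) →
        (∀ p : ℝ × ℝ, 0 < p.1 → 0 < p.2 → |K p| ≤ C * (weight σ p.1 * weight σ p.2)) →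
        (∀ᵐ p, Tendsto (fun n => coagOp (e n) G p * L n p) atTop (𝓝 (K p))) →
        ∀ t, 0 ≤ t → (∫ x, G x * v t x) - ∫ x, G x * f x =
          ∫ s in (0 : ℝ)..t, ∫ p : ℝ × ℝ, K p * (v s p.1 * v s p.2) := by
  obtain ⟨φ, hφ, hc⟩ := h.exists_subseq
  have h' := h.comp φ
  obtain ⟨v, hv, hvi, hvl⟩ := h'.exists_limit_density hc
  set W := ∫ x, weight σ x * f x with hWdef
  have hpt : ∀ ψ : ℝ → ℝ, Measurable ψ → (∃ M, ∀ x, |ψ x| ≤ M) → ∀ t, 0 ≤ t →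
      Tendsto (fun n => ∫ x, ψ x * (weight σ x * u (φ n) t x)) atTop
        (𝓝 (∫ x, ψ x * (weight σ x * v t x))) := fun ψ hψ hM t ht =>
    (hvl ψ hψ hM t).tendsto_at ⟨ht, le_rfl⟩
  refine ⟨φ, hφ, v, hv, hvi, fun t ht => ?_, hvl, ?_⟩
  · have h1 := hpt (fun _ => 1) measurable_const ⟨1, by simp⟩ t ht
    simp only [one_mul] at h1
    exact le_of_tendsto' h1 fun n => h'.integral_weight_le n ht
  intro G K C hG ⟨M, hM⟩ hK hLC hKC hlim t ht
  -- the weight is at least `1`, so that `G / weight` is a bounded test function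
  have hL1 : Tendsto (fun n => ∫ x, G x * u (φ n) t x) atTop (𝓝 (∫ x, G x * v t x)) := by
    let ψ : ℝ → ℝ := fun x => if x ∈ Ioi 0 then G x / weight σ x else 0
    have hψ : Measurable ψ :=
      Measurable.ite measurableSet_Ioi (hG.div (measurable_weight σ)) measurable_const
    have hM0 : 0 ≤ M := (abs_nonneg _).trans (hM 0)
    have hψM : ∀ x, |ψ x| ≤ M := by
      intro x
      by_cases hx : x ∈ Ioi 0
      · simp only [ψ, if_pos hx, abs_div, abs_of_pos (weight_pos (σ := σ) hx)]
        exact (div_le_self (abs_nonneg _) (one_le_weight h.σ_nonneg hx)).trans (hM x)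
      · simp only [ψ, if_neg hx, abs_zero, hM0]
    have hψG : ∀ {a : ℝ → ℝ}, IsDensity a → ∀ x, ψ x * (weight σ x * a x) = G x * a x := by
      intro a ha x
      by_cases hx : x ∈ Ioi 0
      · have := (weight_pos (σ := σ) hx).ne'
        simp only [ψ, if_pos hx]
        field_simp
      · rw [ha.eq_zero x (not_lt.1 hx)]; simp
    have h1 := hpt ψ hψ ⟨M, hψM⟩ t ht
    simp_rw [hψG (hv t), fun n => hψG ((h'.flow n).dens t)] at h1
    exact h1
  have hR : Tendsto (fun n => ∫ s in (0 : ℝ)..t, coagRate (e (φ n)) (L (φ n)) G (u (φ n) s)) atTop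
      (𝓝 (∫ s in (0 : ℝ)..t, ∫ p : ℝ × ℝ, K p * (v s p.1 * v s p.2))) := by
    refine intervalIntegral.tendsto_integral_filter_of_dominated_convergence
      (fun _ => C * (W * W)) (Eventually.of_forall fun n => ?_)
      (Eventually.of_forall fun n => ae_of_all _ fun s hs => ?_) intervalIntegrable_const
      (ae_of_all _ fun s hs => ?_)
    · exact ((h'.flow n).measurable_integral_tensor h.σ_nonneg
        ((measurable_coagOp _ hG).mul (h'.kernel n).measurable)).aestronglyMeasurable
    · rw [uIoc_of_le ht] at hs
      have h1 := abs_integral_mul_tensor_le ((h'.flow n).dens s) ((h'.flow n).dens s)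
        ((h'.flow n).integrable s) ((h'.flow n).integrable s) (hLC (φ n))
      have h2 := h'.integral_weight_le n hs.1.le
      have hC : 0 ≤ C := by
        have h1 := hKC (1, 1) one_pos one_pos
        have h2 : 0 < weight σ 1 * weight σ 1 := mul_pos (weight_pos one_pos) (weight_pos one_pos)
        exact nonneg_of_mul_nonneg_left ((abs_nonneg _).trans h1) h2
      have h3 : 0 ≤ ∫ x, weight σ x * u (φ n) s x :=
        integral_nonneg (((h'.flow n).dens s).weight_mul σ).nonneg
      exact h1.trans (mul_le_mul_of_nonneg_left (mul_le_mul h2 h2 h3 (h3.trans h2)) hC)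
    · rw [uIoc_of_le ht] at hs
      refine tendsto_integral_mul_tensor (fun n => (h'.flow n).dens s) (hv s)
        (fun n => (h'.flow n).integrable s) (hvi s) (fun n => h'.integral_weight_le n hs.1.le) ?_ ?_
        (fun n => (measurable_coagOp _ hG).mul (h'.kernel n).measurable) hK
        (fun n => hLC (φ n)) hKC (hlim.mono fun p hp => hp.comp hφ.tendsto_atTop)
      · intro δ hδ
        obtain ⟨R, κ, hκ, H⟩ := h'.equiIntegrable s δ hδ
        exact ⟨R, κ, hκ, fun n => H (n, ⟨s, hs.1.le, le_rfl⟩)⟩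
      · intro A hA
        have h1 := hpt (A.indicator fun _ => 1) (measurable_const.indicator hA)
          ⟨1, fun x => by by_cases hx : x ∈ A <;> simp [hx]⟩ s hs.1.le
        have h2 : ∀ a : ℝ → ℝ, ∫ x, A.indicator (fun _ => (1 : ℝ)) x * a x = ∫ x in A, a x := by
          intro a
          rw [← integral_indicator hA]
          congr 1 with x
          by_cases hx : x ∈ A <;> simp [hx]
        simp_rw [h2] at h1
        exact h1
  refine tendsto_nhds_unique (hL1.sub_const _) (hR.congr fun n => ?_)
  exact ((h'.flow n).eqn G hG ⟨M, hM⟩ t ht).symm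

end IsFlowSeq

/-! ### Increments of the kernel -/

/-- A locally integrable function is nonnegative if its integrals against nonnegative smooth
functions are. -/
theorem ae_nonneg_of_forall_contDiff {E : Type*} [NormedAddCommGroup E] [NormedSpace ℝ E]
    [FiniteDimensional ℝ E] [MeasureSpace E] [BorelSpace E]
    [(volume : Measure E).IsAddHaarMeasure] {V : Set E} (hV : IsOpen V) {f : E → ℝ}
    (hf : ∀ K, IsCompact K → K ⊆ V → IntegrableOn f K)
    (h : ∀ Φ : E → ℝ, ContDiff ℝ ((⊤ : ℕ∞) : WithTop ℕ∞) Φ → HasCompactSupport Φ →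
      tsupport Φ ⊆ V → (∀ x, 0 ≤ Φ x) → 0 ≤ ∫ x, f x * Φ x) :
    ∀ᵐ x, x ∈ V → 0 ≤ f x := by
  have : ProperSpace E := FiniteDimensional.proper_real E
  rw [ae_iff]
  refine measure_null_of_locally_null _ fun x₀ hx₀ => ?_
  have hx₀V : x₀ ∈ V := by
    by_contra h'
    exact hx₀ fun h'' => absurd h'' h'
  obtain ⟨r, hr, hrV⟩ := Metric.nhds_basis_closedBall.mem_iff.1 (hV.mem_nhds hx₀V)
  refine ⟨_, inter_mem_nhdsWithin _ (Metric.ball_mem_nhds x₀ hr), ?_⟩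
  set B := Metric.closedBall x₀ r
  have hB : IsCompact B := isCompact_closedBall x₀ r
  have hg : Integrable (B.indicator f) :=
    (hf B hB hrV).integrable_indicator hB.measurableSet
  let φ : ℕ → ContDiffBump (0 : E) := fun n =>
    ⟨1 / (n + 1), 2 / (n + 1), by positivity, by gcongr; norm_num⟩
  have hφ : Tendsto (fun n => (φ n).rOut) atTop (𝓝 0) := by
    have := (tendsto_one_div_add_atTop_nhds_zero_nat (𝕜 := ℝ)).const_mul 2
    rw [mul_zero] at this
    exact this.congr fun n => by simp only [φ]; ring
  have key := ContDiffBump.ae_convolution_tendsto_right_of_locallyIntegrable (K := 2) hφ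
    (Eventually.of_forall fun n => le_of_eq (by simp only [φ]; ring)) hg.locallyIntegrable
    (μ := volume)
  refine measure_mono_null (fun x hx => ?_) (ae_iff.1 key)
  intro hlim
  refine hx.1 fun hxV => ?_
  have hxB : x ∈ Metric.ball x₀ r := hx.2
  rw [← indicator_of_mem (Metric.ball_subset_closedBall hxB) f]
  refine ge_of_tendsto hlim ?_
  have hd : 0 < r - dist x x₀ := sub_pos.2 hxB
  filter_upwards [(tendsto_order.1 hφ).2 _ hd] with n hn
  rw [convolution_eq_swap]
  have hsub : tsupport (fun t => (φ n).normed volume (x - t)) ⊆ Metric.closedBall x (φ n).rOut := by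
    refine closure_minimal (fun t ht => ?_) Metric.isClosed_closedBall
    have h1 : x - t ∈ Function.support ((φ n).normed volume) := ht
    rw [ContDiffBump.support_normed_eq, mem_ball_zero_iff] at h1
    rw [Metric.mem_closedBall, dist_comm, dist_eq_norm]
    exact h1.le
  have hsubB : Metric.closedBall x (φ n).rOut ⊆ B := Metric.closedBall_subset_closedBall' (by linarith)
  refine le_of_le_of_eq (h (fun t => (φ n).normed volume (x - t)) ?_ ?_
    ((hsub.trans hsubB).trans hrV) fun t => ContDiffBump.nonneg_normed _ _) ?_
  · exact (ContDiffBump.contDiff_normed _).comp (contDiff_const.sub contDiff_id)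
  · exact HasCompactSupport.of_support_subset_isCompact (isCompact_closedBall x (φ n).rOut)
      ((subset_tsupport _).trans hsub)
  · refine integral_congr_ae (ae_of_all _ fun t => ?_)
    simp only [ContinuousLinearMap.lsmul_apply, smul_eq_mul]
    by_cases ht : t ∈ B
    · rw [indicator_of_mem ht, mul_comm]
    · have : (φ n).normed volume (x - t) = 0 := by
        by_contra h'
        exact ht (hsubB (hsub (subset_tsupport _ h')))
      rw [this, mul_zero, zero_mul]

/-- Integration of a one-sided bound on a weak derivative along horizontal segments of length
proportional to the second variable. -/
theorem increment_le_of_hasWeakDirDeriv {σ η ε : ℝ} (hσ : 0 ≤ σ) (hη : 0 ≤ η) (hε : 0 < ε)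
    {F G : ℝ × ℝ → ℝ} (hF : ∀ K, IsCompact K → K ⊆ quadrant → IntegrableOn F K)
    (hG : ∀ K, IsCompact K → K ⊆ quadrant → IntegrableOn G K)
    (hw : HasWeakDirDeriv quadrant ((1 : ℝ), (0 : ℝ)) F G)
    (hb : ∀ᵐ p ∂(volume.restrict quadrant), -η * p.1 ^ (-σ - 1) * p.2 ^ (-σ) ≤ G p) :
    ∀ᵐ p : ℝ × ℝ, 0 < p.2 → (1 + ε) * p.2 < p.1 →
      F (p.1 - ε * p.2, p.2) - F p ≤ ε * η * p.2 ^ (-2 * σ) := by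
  let V : Set (ℝ × ℝ) := {p | 0 < p.2 ∧ (1 + ε) * p.2 < p.1}
  have hV : IsOpen V := (isOpen_lt continuous_const continuous_snd).inter
    (isOpen_lt (by fun_prop) continuous_fst)
  have hqm : MeasurableSet quadrant := measurableSet_Ioi.prod measurableSet_Ioi
  -- the shear `T c (y, z) = (y - c z, z)`
  let T : ℝ → ℝ × ℝ → ℝ × ℝ := fun c p => (p.1 - c * p.2, p.2)
  have hTc : ∀ c, Continuous (T c) := fun c => by fun_prop
  have hTT : ∀ c p, T c (T (-c) p) = p := fun c p => by ext <;> simp [T]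
  have hTT' : ∀ c p, T (-c) (T c p) = p := fun c p => by ext <;> simp [T]
  have hVq : V ⊆ quadrant := fun p hp =>
    ⟨(mul_pos (by linarith) hp.1).trans hp.2, hp.1⟩
  have hTVq : ∀ p ∈ V, ∀ c ∈ Icc 0 ε, 0 < (T c p).2 ∧ (T c p).2 < (T c p).1 := by
    rintro p ⟨hp1, hp2⟩ c ⟨hc0, hc⟩
    refine ⟨hp1, ?_⟩
    have := mul_le_mul_of_nonneg_right hc hp1.le
    simp only [T]
    linarith
  have hmain := ae_nonneg_of_forall_contDiff hV
    (f := fun p => ε * η * p.2 ^ (-2 * σ) - (F (T ε p) - F p)) ?_ ?_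
  · filter_upwards [hmain] with p hp h1 h2
    have := hp ⟨h1, h2⟩
    simp only [T] at this
    linarith
  · intro K hK hKV
    refine Integrable.sub ?_ (Integrable.sub ?_ (hF K hK (hKV.trans hVq)))
    · refine ContinuousOn.integrableOn_compact hK (continuousOn_const.mul ?_)
      exact continuousOn_snd.rpow_const fun p hp => Or.inl (hKV hp).1.ne'
    · have h1 : IntegrableOn F (T ε '' K) := hF _ (hK.image (hTc ε)) (by
        rintro _ ⟨p, hp, rfl⟩
        have := hTVq p (hKV hp) ε ⟨hε.le, le_rfl⟩
        exact ⟨this.1.trans this.2, this.1⟩)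
      have h2 := ((measurePreserving_shear ε).integrableOn_comp_preimage
        (measurableEmbedding_shear ε)).2 h1
      exact h2.mono_set (subset_preimage_image _ _)
  · intro Φ hΦ hΦc hΦV hΦ0
    have hΦd : Differentiable ℝ Φ := hΦ.differentiable (by simp)
    let D : ℝ × ℝ → ℝ := fun q => q.2 * fderiv ℝ Φ q (1, 0)
    have hDc : Continuous D :=
      continuous_snd.mul ((hΦ.continuous_fderiv (by simp)).clm_apply continuous_const)
    have hDs : HasCompactSupport D := (hΦc.fderiv_apply ℝ (1, 0)).mul_left
    obtain ⟨M₀, hM₀⟩ := hΦc.exists_bound_of_continuous hΦ.continuous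
    obtain ⟨M₁, hM₁⟩ := hDs.exists_bound_of_continuous hDc
    let K : Set (ℝ × ℝ) := (fun q : (ℝ × ℝ) × ℝ => T q.2 q.1) '' (tsupport Φ ×ˢ Icc 0 ε)
    have hKc : IsCompact K := (hΦc.isCompact.prod isCompact_Icc).image (by fun_prop)
    have hK : ∀ p ∈ K, 0 < p.2 ∧ p.2 < p.1 := by
      rintro _ ⟨⟨p, c⟩, ⟨hp, hc⟩, rfl⟩
      exact hTVq p (hΦV hp) c hc
    have hKq : K ⊆ quadrant := fun p hp => ⟨(hK p hp).1.trans (hK p hp).2, (hK p hp).1⟩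
    have hmem : ∀ c ∈ Icc 0 ε, ∀ p, T (-c) p ∈ tsupport Φ → p ∈ K := fun c hc p hp =>
      ⟨(T (-c) p, c), ⟨hp, hc⟩, hTT c p⟩
    have hzero : ∀ c ∈ Icc 0 ε, ∀ p ∉ K, Φ (T (-c) p) = 0 := fun c hc p hp =>
      image_eq_zero_of_notMem_tsupport fun h' => hp (hmem c hc p h')
    have hDzero : ∀ c ∈ Icc 0 ε, ∀ p ∉ K, D (T (-c) p) = 0 := by
      intro c hc p hp
      have h1 : T (-c) p ∉ tsupport (fderiv ℝ Φ) := fun h' =>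
        hp (hmem c hc p (tsupport_fderiv_subset ℝ (f := Φ) h'))
      simp only [D, image_eq_zero_of_notMem_tsupport h1]
      simp
    set FK := K.indicator F with hFKdef
    have hFK : Integrable FK (volume.restrict quadrant) :=
      (IntegrableOn.integrable_indicator (hF K hKc hKq) hKc.measurableSet).integrableOn
    have hGK : Integrable (K.indicator G) (volume.restrict quadrant) :=
      (IntegrableOn.integrable_indicator (hG K hKc hKq) hKc.measurableSet).integrableOn
    have hFKmul : ∀ {a : ℝ × ℝ → ℝ} (F : ℝ × ℝ → ℝ), (∀ p ∉ K, a p = 0) →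
        ∀ p, K.indicator F p * a p = F p * a p := by
      intro a F ha p
      by_cases hp : p ∈ K
      · rw [indicator_of_mem hp]
      · rw [ha p hp, mul_zero, mul_zero]
    -- `I τ` interpolates between the two terms of the increment
    set I : ℝ → ℝ := fun τ => ∫ p in quadrant, FK p * Φ (T (-τ) p) with hI
    set J := ∫ p : ℝ × ℝ, p.2 ^ (-2 * σ) * Φ p with hJ
    have hderiv : ∀ τ, HasDerivAt I (∫ p in quadrant, FK p * D (T (-τ) p)) τ := by
      intro τ
      refine (hasDerivAt_integral_of_dominated_loc_of_deriv_le (𝕜 := ℝ)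
        (F := fun τ p => FK p * Φ (T (-τ) p)) (F' := fun τ p => FK p * D (T (-τ) p)) (s := univ)
        (bound := fun p => |FK p| * M₁) univ_mem
        (Eventually.of_forall fun c => ?_) ?_ ?_ (ae_of_all _ fun p c _ => ?_)
        (hFK.abs.mul_const _) (ae_of_all _ fun p c _ => ?_)).2
      · exact hFK.1.mul (hΦ.continuous.comp (hTc _)).aestronglyMeasurable
      · exact hFK.mul_bdd (hΦ.continuous.comp (hTc _)).aestronglyMeasurable
          (ae_of_all _ fun p => hM₀ _)
      · exact hFK.1.mul (hDc.comp (hTc _)).aestronglyMeasurable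
      · rw [norm_mul, Real.norm_eq_abs]
        exact mul_le_mul_of_nonneg_left (hM₁ _) (abs_nonneg _)
      · refine HasDerivAt.const_mul _ ?_
        have h1 : HasDerivAt (fun c : ℝ => T (-c) p) (p.2 • ((1 : ℝ), (0 : ℝ))) c := by
          have h2 : HasDerivAt (fun c : ℝ => p.1 - -c * p.2) p.2 c := by
            have := ((hasDerivAt_id c).neg.mul_const p.2).const_sub p.1
            simpa using this
          have := h2.prodMk (hasDerivAt_const c p.2)
          simpa [T] using this
        have h2 := (hΦd (T (-c) p)).hasFDerivAt.comp_hasDerivAt c h1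
        rw [map_smul, smul_eq_mul] at h2
        exact h2
    have hζ : Integrable fun p : ℝ × ℝ => p.2 ^ (-2 * σ) * Φ p := by
      have h2 : IntegrableOn (fun p : ℝ × ℝ => p.2 ^ (-2 * σ) * Φ p) (tsupport Φ) :=
        ContinuousOn.integrableOn_compact hΦc.isCompact
          ((continuousOn_snd.rpow_const fun p hp => Or.inl (hΦV hp).1.ne').mul
            hΦ.continuous.continuousOn)
      refine (integrableOn_iff_integrable_of_support_subset fun p hp => ?_).1 h2
      exact subset_tsupport _ (right_ne_zero_of_mul hp)
    -- the derivative of `I` is a weak derivative, tested with `z Φ (y + τ z, z)`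
    have hle : ∀ τ ∈ Icc 0 ε, ∫ p in quadrant, FK p * D (T (-τ) p) ≤ η * J := by
      intro τ hτ
      let S : ℝ × ℝ →L[ℝ] ℝ × ℝ :=
        (ContinuousLinearMap.fst ℝ ℝ ℝ + τ • ContinuousLinearMap.snd ℝ ℝ ℝ).prod
          (ContinuousLinearMap.snd ℝ ℝ ℝ)
      have hS : ∀ p, S p = T (-τ) p := fun p => by simp [S, T]
      let ψ : ℝ × ℝ → ℝ := fun p => p.2 * Φ (T (-τ) p)
      have hψeq : ψ = fun p => p.2 * Φ (S p) := by ext p; simp only [ψ, hS]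
      have hψK : ∀ p ∉ K, ψ p = 0 := fun p hp => by simp only [ψ, hzero τ hτ p hp, mul_zero]
      have hψs : tsupport ψ ⊆ K := closure_minimal (fun p hp => by
        by_contra h'
        exact hp (hψK p h')) hKc.isClosed
      have hψd : ContDiff ℝ ((⊤ : ℕ∞) : WithTop ℕ∞) ψ := by
        rw [hψeq]
        exact contDiff_snd.mul (hΦ.comp S.contDiff)
      have hψ' : ∀ p, fderiv ℝ ψ p (1, 0) = D (T (-τ) p) := by
        intro p
        have h1 : HasFDerivAt (fun p => Φ (S p)) ((fderiv ℝ Φ (S p)).comp S) p :=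
          (hΦd (S p)).hasFDerivAt.comp p S.hasFDerivAt
        have h2 : HasFDerivAt (fun p : ℝ × ℝ => p.2 * Φ (S p)) _ p :=
          (hasFDerivAt_snd (𝕜 := ℝ) (p := p)).mul h1
        rw [hψeq, h2.fderiv]
        have h3 : S (1, 0) = (1, 0) := by simp [S]
        simp [D, h3, hS, T]
      have h1 : ∫ p in quadrant, FK p * D (T (-τ) p) = -∫ p in quadrant, G p * ψ p := by
        rw [← hw ψ hψd (hKc.of_isClosed_subset (isClosed_tsupport _) hψs) (hψs.trans hKq)]
        refine integral_congr_ae (ae_of_all _ fun p => ?_)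
        simp only [hψ', hFKdef]
        exact hFKmul (a := fun p => D (T (-τ) p)) F (hDzero τ hτ) p
      have hζT : Integrable fun p : ℝ × ℝ => p.2 ^ (-2 * σ) * Φ (T (-τ) p) :=
        ((measurePreserving_shear (-τ)).integrable_comp_emb (measurableEmbedding_shear (-τ))).2 hζ
      have hψM : ∃ C, ∀ p, ‖ψ p‖ ≤ C :=
        HasCompactSupport.exists_bound_of_continuous
          (hKc.of_isClosed_subset (isClosed_tsupport _) hψs) hψd.continuous
      obtain ⟨C, hC⟩ := hψM
      have hGψ : Integrable (fun p => G p * ψ p) (volume.restrict quadrant) := by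
        have := hGK.mul_bdd hψd.continuous.aestronglyMeasurable (ae_of_all _ hC)
        exact this.congr (ae_of_all _ fun p => hFKmul G hψK p)
      rw [h1, ← integral_neg]
      have h4 : ∫ p in quadrant, -(G p * ψ p) ≤
          ∫ p in quadrant, η * (p.2 ^ (-2 * σ) * Φ (T (-τ) p)) := by
        refine integral_mono_ae hGψ.neg (hζT.integrableOn.const_mul η) ?_
        filter_upwards [hb, ae_restrict_mem hqm] with p hp hpq
        by_cases hpK : p ∈ K
        · have hp2 : 0 < p.2 := hpq.2
          have h5 : p.1 ^ (-σ - 1) ≤ p.2 ^ (-σ - 1) :=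
            Real.rpow_le_rpow_of_nonpos hp2 (hK p hpK).2.le (by linarith)
          have h6 : -G p ≤ η * (p.2 ^ (-σ - 1) * p.2 ^ (-σ)) := by
            have h7 := mul_le_mul_of_nonneg_right h5 (Real.rpow_nonneg hp2.le (-σ))
            have h8 := mul_le_mul_of_nonneg_left h7 hη
            linarith
          have h7 : p.2 ^ (-σ - 1) * p.2 ^ (-σ) * p.2 = p.2 ^ (-2 * σ) := by
            rw [← Real.rpow_add hp2]
            nth_rewrite 2 [← Real.rpow_one p.2]
            rw [← Real.rpow_add hp2]
            congr 1; ring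
          calc -(G p * ψ p) = -G p * (p.2 * Φ (T (-τ) p)) := by simp only [ψ]; ring
            _ ≤ η * (p.2 ^ (-σ - 1) * p.2 ^ (-σ)) * (p.2 * Φ (T (-τ) p)) :=
              mul_le_mul_of_nonneg_right h6 (mul_nonneg hp2.le (hΦ0 _))
            _ = η * ((p.2 ^ (-σ - 1) * p.2 ^ (-σ) * p.2) * Φ (T (-τ) p)) := by ring
            _ = _ := by rw [h7]
        · simp only [hψK p hpK, hzero τ hτ p hpK]
          simp
      refine h4.trans (le_of_eq ?_)
      rw [integral_const_mul, hJ]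
      congr 1
      rw [setIntegral_eq_integral_of_forall_compl_eq_zero fun p hp => by
        rw [hzero τ hτ p fun h' => hp (hKq h'), mul_zero]]
      exact (measurePreserving_shear (-τ)).integral_comp (measurableEmbedding_shear (-τ))
        fun p : ℝ × ℝ => p.2 ^ (-2 * σ) * Φ p
    have hmv := (convex_Icc (0 : ℝ) ε).image_sub_le_mul_sub_of_deriv_le
      (fun τ _ => (hderiv τ).continuousAt.continuousWithinAt)
      (fun τ _ => (hderiv τ).differentiableAt.differentiableWithinAt)
      (fun τ hτ => by
        rw [(hderiv τ).deriv]
        exact hle τ (interior_subset hτ)) 0 ⟨le_rfl, hε.le⟩ ε ⟨hε.le, le_rfl⟩ hε.le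
    have hI' : ∀ τ ∈ Icc 0 ε, I τ = ∫ p, F (T τ p) * Φ p := by
      intro τ hτ
      have h1 : I τ = ∫ p, F p * Φ (T (-τ) p) := by
        rw [← setIntegral_eq_integral_of_forall_compl_eq_zero (s := quadrant) fun p hp => by
          rw [hzero τ hτ p fun h' => hp (hKq h'), mul_zero]]
        refine integral_congr_ae (ae_of_all _ fun p => ?_)
        exact hFKmul (a := fun p => Φ (T (-τ) p)) F (hzero τ hτ) p
      rw [h1, ← (measurePreserving_shear τ).integral_comp (measurableEmbedding_shear τ)]
      refine integral_congr_ae (ae_of_all _ fun p => ?_)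
      change F (T τ p) * Φ (T (-τ) (T τ p)) = _
      rw [hTT']
    have hint : ∀ τ ∈ Icc 0 ε, Integrable fun p => F (T τ p) * Φ p := by
      intro τ hτ
      have h1 : Integrable fun p => F p * Φ (T (-τ) p) := by
        have h2 := (IntegrableOn.integrable_indicator (hF K hKc hKq) hKc.measurableSet).mul_bdd
          (hΦ.continuous.comp (hTc (-τ))).aestronglyMeasurable (ae_of_all _ fun p => hM₀ _)
        exact h2.congr (ae_of_all _ fun p =>
          hFKmul (a := fun p => Φ (T (-τ) p)) F (hzero τ hτ) p)
      refine (((measurePreserving_shear τ).integrable_comp_emb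
        (measurableEmbedding_shear τ)).2 h1).congr (ae_of_all _ fun p => ?_)
      change F (T τ p) * Φ (T (-τ) (T τ p)) = _
      rw [hTT']
    have h0 : (0 : ℝ) ∈ Icc 0 ε := ⟨le_rfl, hε.le⟩
    have h1 : ε ∈ Icc 0 ε := ⟨hε.le, le_rfl⟩
    rw [hI' ε h1, hI' 0 h0, sub_zero] at hmv
    have hT0 : ∀ p, T 0 p = p := fun p => by simp [T]
    have i0 := hint 0 h0
    simp only [hT0] at hmv i0
    have h2 : ∫ p, (ε * η * p.2 ^ (-2 * σ) - (F (T ε p) - F p)) * Φ p =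
        ε * η * J - ((∫ p, F (T ε p) * Φ p) - ∫ p, F p * Φ p) := by
      have i1 : Integrable fun p : ℝ × ℝ => F (T ε p) * Φ p - F p * Φ p := (hint ε h1).sub i0
      rw [← integral_sub (hint ε h1) i0, hJ, ← integral_const_mul,
        ← integral_sub (hζ.const_mul _) i1]
      congr 1 with p
      ring
    rw [h2]
    linarith

theorem MemLinftyLoc.integrableOn {E : Type*} [TopologicalSpace E] [MeasureSpace E]
    [IsFiniteMeasureOnCompacts (volume : Measure E)] {U : Set E} {f : E → ℝ}
    (hf : MemLinftyLoc U f) {K : Set E} (hK : IsCompact K) (hKU : K ⊆ U) : IntegrableOn f K := by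
  have : IsFiniteMeasure (volume.restrict K) := ⟨by simpa using hK.measure_lt_top⟩
  exact (hf K hK hKU).integrable le_top

theorem IsAdmissibleKernel.le {k σ η : ℝ} {Λ : ℝ → ℝ → ℝ} (hΛ : IsAdmissibleKernel k σ η Λ)
    {y z : ℝ} (hz : 0 < z) (hzy : z < y) :
    Λ y z ≤ 2 * k * (max y (y ^ (-σ)) * max 1 (z ^ (-σ))) := by
  have hk := hΛ.k_nonneg
  have hy : 0 < y := hz.trans hzy
  have h0 : 0 ≤ k * (max y (y ^ (-σ)) * max 1 (z ^ (-σ))) := by positivity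
  have h2 : ∀ {a b : ℝ}, 0 ≤ a → 0 ≤ b → a ≤ max y (y ^ (-σ)) → b ≤ max 1 (z ^ (-σ)) →
      a * b ≤ max y (y ^ (-σ)) * max 1 (z ^ (-σ)) := fun ha hb h h' =>
    mul_le_mul h h' hb (ha.trans h)
  rcases lt_or_ge y 1 with h1 | h1
  · have h3 := hΛ.bound_small y z hy h1 hz (hzy.trans h1)
    rw [Real.mul_rpow hy.le hz.le] at h3
    have h4 := mul_le_mul_of_nonneg_left (h2 (Real.rpow_nonneg hy.le _) (Real.rpow_nonneg hz.le _)
      (le_max_right _ _) (le_max_right _ _)) hk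
    linarith
  · rcases lt_or_ge z 1 with hz1 | hz1
    · have h3 := hΛ.bound_mixed y z h1 hz hz1
      have h4 := mul_le_mul_of_nonneg_left (h2 hy.le (Real.rpow_nonneg hz.le _)
        (le_max_left _ _) (le_max_right _ _)) hk
      linarith
    · have h3 := hΛ.bound_large y z h1 hz1
      have h4 := mul_le_mul_of_nonneg_left (h2 hy.le zero_le_one
        (le_max_left _ _) (le_max_left _ _)) hk
      have h5 := mul_le_mul_of_nonneg_left hzy.le hk
      linarith

/-- An admissible kernel agrees almost everywhere in `0 < z < y` with a reduced kernel. -/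
theorem IsAdmissibleKernel.exists_isReducedKernel {k σ η : ℝ} {Λ : ℝ → ℝ → ℝ}
    (hΛ : IsAdmissibleKernel k σ η Λ) :
    ∃ L, IsReducedKernel k σ η L ∧
      ∀ᵐ p : ℝ × ℝ, 0 < p.2 → p.2 < p.1 → Λ p.1 p.2 = L p := by
  have hk := hΛ.k_nonneg
  let V : Set (ℝ × ℝ) := {p | 0 < p.2 ∧ p.2 < p.1}
  have hV : MeasurableSet V := (measurableSet_lt measurable_const measurable_snd).inter
    (measurableSet_lt measurable_snd measurable_fst)
  have hqm : MeasurableSet quadrant := measurableSet_Ioi.prod measurableSet_Ioi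
  let m : ℝ × ℝ → ℝ := hΛ.measurable.mk _
  let bd : ℝ × ℝ → ℝ := fun p => 2 * k * (max p.1 (p.1 ^ (-σ)) * max 1 (p.2 ^ (-σ)))
  have hbd : Measurable bd := by fun_prop
  let L : ℝ × ℝ → ℝ := fun p => if p ∈ V then min (max 0 (m p)) (bd p) else 0
  have hLV : ∀ p ∈ V, L p = min (max 0 (m p)) (bd p) := fun p hp => if_pos hp
  have hLV' : ∀ p ∉ V, L p = 0 := fun p hp => if_neg hp
  have hbd0 : ∀ p ∈ V, 0 ≤ bd p := fun p hp => by
    have : 0 < p.1 := hp.1.trans hp.2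
    simp only [bd]
    positivity
  have heq : ∀ᵐ p : ℝ × ℝ, 0 < p.2 → p.2 < p.1 → Λ p.1 p.2 = L p := by
    have h1 := hΛ.measurable.ae_eq_mk
    rw [EventuallyEq, ae_restrict_iff' hqm] at h1
    filter_upwards [h1] with p hp h2 h3
    have h4 : Λ p.1 p.2 = m p := hp ⟨h2.trans h3, h2⟩
    rw [hLV p ⟨h2, h3⟩, ← h4, max_eq_right (hΛ.nonneg _ _ (h2.trans h3) h2),
      min_eq_left (hΛ.le h2 h3)]
  refine ⟨L, ⟨hk, hΛ.σ_nonneg, hΛ.η_nonneg, ?_, fun p => ?_, hLV', fun p h1 h2 => ?_, ?_⟩, heq⟩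
  · exact Measurable.ite hV ((measurable_const.max hΛ.measurable.measurable_mk).min hbd)
      measurable_const
  · by_cases hp : p ∈ V
    · rw [hLV p hp]
      exact le_min (le_max_left _ _) (hbd0 p hp)
    · rw [hLV' p hp]
  · rw [hLV p ⟨h1, h2⟩]
    exact min_le_right _ _
  · intro ε hε
    obtain ⟨Λ₁, Λ₂, hreg, hlow⟩ := hΛ.regular
    have h1 := increment_le_of_hasWeakDirDeriv hΛ.σ_nonneg hΛ.η_nonneg hε.1
      (fun K hK hKq => hreg.mem.integrableOn hK hKq)
      (fun K hK hKq => hreg.mem_fst.integrableOn hK hKq) hreg.weak_fst hlow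
    have h2 := (measurePreserving_shear ε).quasiMeasurePreserving.ae heq
    filter_upwards [h1, heq, h2] with p h1 h2 h3 h4 h5
    have h6 : p.2 < p.1 - ε * p.2 := by linarith
    have h7 : p.2 < p.1 := by linarith [mul_pos hε.1 h4]
    rw [← h2 h4 h7, ← h3 h4 h6]
    exact h1 h4 h5

/-! ### Test functions -/

/-- Lipschitz functions have weak derivatives, given by the pointwise derivative. -/
theorem hasWeakDirDeriv_of_lipschitz {G d : ℝ → ℝ} {C : NNReal} (hG : LipschitzWith C G)
    (hd : ∀ᵐ x, 0 < x → HasDerivAt G (d x) x) : HasWeakDirDeriv (Ioi (0 : ℝ)) (1 : ℝ) G d := by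
  intro φ hφ hφc hφs
  have hφ1 : ContDiff ℝ 1 φ := hφ.of_le (by exact_mod_cast le_top)
  obtain ⟨C', hC'⟩ := hφ1.lipschitzWith_of_hasCompactSupport hφc (by simp)
  have h1 := LipschitzWith.integral_lineDeriv_mul_eq (μ := volume) hG hC' hφc 1
  rw [setIntegral_eq_integral_of_forall_compl_eq_zero, setIntegral_eq_integral_of_forall_compl_eq_zero]
  · have h2 : ∫ x, d x * φ x = ∫ x, lineDeriv ℝ G x 1 * φ x := by
      refine integral_congr_ae ?_
      filter_upwards [hd] with x hx
      by_cases hx0 : 0 < x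
      · rw [(hx hx0).hasFDerivAt.hasLineDerivAt 1 |>.lineDeriv]
        simp
      · rw [image_eq_zero_of_notMem_tsupport fun h' => hx0 (hφs h'), mul_zero, mul_zero]
    rw [h2, h1, ← integral_neg]
    refine integral_congr_ae (ae_of_all _ fun x => ?_)
    have h3 : lineDeriv ℝ φ x (-1) = fderiv ℝ φ x (-1) :=
      ((hφ1.differentiable (by simp)) x).lineDeriv_eq_fderiv
    simp only [h3, map_neg]
    ring
  · intro x hx
    rw [image_eq_zero_of_notMem_tsupport fun h' => hx (hφs h'), mul_zero]
  · intro x hx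
    rw [image_eq_zero_of_notMem_tsupport (f := fderiv ℝ φ)
      fun h' => hx (hφs (tsupport_fderiv_subset ℝ h'))]
    simp

theorem isTestFunction_of_lipschitz {G : ℝ → ℝ} {C : NNReal} (hG : LipschitzWith C G) {M R c : ℝ}
    (hM : ∀ x, |G x| ≤ M) (hR : ∀ x, R < x → G x = c) : IsTestFunction G (deriv G) where
  mem := memLp_top_of_bound hG.continuous.aestronglyMeasurable M (ae_of_all _ hM)
  mem_deriv := memLp_top_of_bound (measurable_deriv G).aestronglyMeasurable C
    (ae_of_all _ fun _ => norm_deriv_le_of_lipschitz hG)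
  weak_deriv := hasWeakDirDeriv_of_lipschitz hG (hG.ae_differentiableAt.mono fun x hx _ =>
    hx.hasDerivAt)
  support := ⟨R, ae_of_all _ fun x hx => by
    have : G =ᶠ[𝓝 x] fun _ => c := (eventually_gt_nhds hx).mono hR
    rw [this.deriv_eq, deriv_const]⟩

/-- The du Bois-Reymond lemma on the half-line. -/
theorem exists_ae_eq_const_of_hasWeakDirDeriv_zero {h : ℝ → ℝ}
    (hi : ∀ K, IsCompact K → K ⊆ Ioi 0 → IntegrableOn h K)
    (hw : HasWeakDirDeriv (Ioi (0 : ℝ)) (1 : ℝ) h fun _ => 0) :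
    ∃ c, ∀ᵐ x, x ∈ Ioi 0 → h x - c = 0 := by
  let φ₀ : ContDiffBump (2 : ℝ) := ⟨1 / 2, 1, by norm_num, by norm_num⟩
  let χ : ℝ → ℝ := φ₀.normed volume
  have hχd : ContDiff ℝ ((⊤ : ℕ∞) : WithTop ℕ∞) χ := φ₀.contDiff_normed
  have hχc : HasCompactSupport χ := φ₀.hasCompactSupport_normed
  have hχs : tsupport χ ⊆ Ioi 0 := by
    rw [φ₀.tsupport_normed_eq, Real.closedBall_eq_Icc]
    intro x hx
    simp only [φ₀] at hx
    exact lt_of_lt_of_le (by norm_num) hx.1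
  have hχ1 : ∫ x, χ x = 1 := φ₀.integral_normed
  have hint : ∀ {ψ : ℝ → ℝ}, Continuous ψ → HasCompactSupport ψ → tsupport ψ ⊆ Ioi 0 →
      Integrable fun x => h x * ψ x := by
    intro ψ hψ hψc hψs
    have h1 : IntegrableOn (fun x => h x * ψ x) (tsupport ψ) := by
      obtain ⟨C, hC⟩ := hψc.exists_bound_of_continuous hψ
      exact (hi _ hψc.isCompact hψs).mul_bdd hψ.aestronglyMeasurable (ae_of_all _ hC)
    refine (integrableOn_iff_integrable_of_support_subset fun x hx => ?_).1 h1
    exact subset_tsupport _ (right_ne_zero_of_mul hx)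
  refine ⟨∫ x, h x * χ x, ?_⟩
  refine isOpen_Ioi.ae_eq_zero_of_integral_contDiff_smul_eq_zero ?_ fun ψ hψ hψc hψs => ?_
  · rw [locallyIntegrableOn_iff isOpen_Ioi.isLocallyClosed]
    intro K hK hKc
    exact (hi K hKc hK).sub (integrableOn_const hKc.measure_lt_top.ne)
  set m := ∫ x, ψ x
  let θ : ℝ → ℝ := fun x => ψ x - m * χ x
  have hθd : ContDiff ℝ ((⊤ : ℕ∞) : WithTop ℕ∞) θ := hψ.sub (contDiff_const.mul hχd)
  have hiψ : Integrable ψ := hψ.continuous.integrable_of_hasCompactSupport hψc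
  have hiχ : Integrable χ := hχd.continuous.integrable_of_hasCompactSupport hχc
  have hiθ : Integrable θ := hiψ.sub (hiχ.const_mul m)
  have hθ0 : ∫ x, θ x = 0 := by
    rw [integral_sub hiψ (hiχ.const_mul m), integral_const_mul, hχ1, mul_one, sub_self]
  -- the primitive of `θ` is an admissible test function
  let φ : ℝ → ℝ := fun x => ∫ t in (0 : ℝ)..x, θ t
  have hφ' : ∀ x, HasDerivAt φ (θ x) x := fun x =>
    intervalIntegral.integral_hasDerivAt_right hiθ.intervalIntegrable
      hθd.continuous.stronglyMeasurable.stronglyMeasurableAtFilter hθd.continuous.continuousAt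
  have hφd : ContDiff ℝ ((⊤ : ℕ∞) : WithTop ℕ∞) φ := by
    rw [contDiff_infty_iff_deriv]
    refine ⟨fun x => (hφ' x).differentiableAt, ?_⟩
    rwa [show deriv φ = θ from funext fun x => (hφ' x).deriv]
  obtain ⟨a, b, ha, hab⟩ : ∃ a b : ℝ, 0 < a ∧ ∀ x, x ∉ Icc a b → θ x = 0 := by
    have hK : IsCompact (tsupport ψ ∪ tsupport χ) := hψc.isCompact.union hχc.isCompact
    have hne : (tsupport ψ ∪ tsupport χ).Nonempty := by
      refine Nonempty.inr ?_
      rw [φ₀.tsupport_normed_eq]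
      exact ⟨2, Metric.mem_closedBall_self φ₀.rOut_pos.le⟩
    obtain ⟨a, haK, ha⟩ := hK.exists_isLeast hne
    obtain ⟨b, hbK, hb⟩ := hK.exists_isGreatest hne
    refine ⟨a, b, (union_subset hψs hχs) haK, fun x hx => ?_⟩
    have hx1 : x ∉ tsupport ψ ∪ tsupport χ := fun h' => hx ⟨ha h', hb h'⟩
    simp only [θ, image_eq_zero_of_notMem_tsupport fun h' => hx1 (Or.inl h'),
      image_eq_zero_of_notMem_tsupport fun h' => hx1 (Or.inr h'), mul_zero, sub_zero]
  have hφ0 : ∀ x, x ∉ Icc a b → φ x = 0 := by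
    intro x hx
    rcases lt_or_ge x a with h1 | h1
    · refine intervalIntegral.integral_zero_ae (ae_of_all _ fun t ht => hab t fun h' => ?_)
      have := (mem_uIoc.1 ht)
      rcases this with h2 | h2 <;> linarith [h'.1]
    · have h2 : b < x := not_le.1 fun h' => hx ⟨h1, h'⟩
      have hx0 : 0 ≤ x := by linarith
      rw [← hθ0]
      simp only [φ]
      rw [intervalIntegral.integral_of_le hx0]
      refine setIntegral_eq_integral_of_forall_compl_eq_zero fun t ht => hab t fun h' => ht ?_
      exact ⟨by linarith [h'.1], by linarith [h'.2]⟩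
  have hφs : tsupport φ ⊆ Icc a b := closure_minimal (fun x hx => by
    by_contra h'
    exact hx (hφ0 x h')) isClosed_Icc
  have h1 := hw φ hφd (isCompact_Icc.of_isClosed_subset (isClosed_tsupport _) hφs)
    (hφs.trans fun x hx => lt_of_lt_of_le ha hx.1)
  have h2 : ∀ x, fderiv ℝ φ x 1 = θ x := fun x => (hφ' x).deriv
  simp only [h2, zero_mul, integral_zero, neg_zero] at h1
  rw [setIntegral_eq_integral_of_forall_compl_eq_zero fun x hx => by
    rw [hab x fun h' => hx (lt_of_lt_of_le ha h'.1), mul_zero]] at h1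
  have i1 := hint hψ.continuous hψc hψs
  have i2 := hint hχd.continuous hχc hχs
  have h3 : ∫ x, h x * θ x = (∫ x, h x * ψ x) - m * ∫ x, h x * χ x := by
    rw [← integral_const_mul, ← integral_sub i1 (i2.const_mul m)]
    congr 1 with x
    simp only [θ]
    ring
  have h4 : ∫ x, ψ x • (h x - ∫ x, h x * χ x) = (∫ x, h x * ψ x) - m * ∫ x, h x * χ x := by
    rw [← integral_mul_const, ← integral_sub i1 (hiψ.mul_const _)]
    congr 1 with x
    simp only [smul_eq_mul]
    ring
  rw [h4, ← h3, h1]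

theorem exists_measurable_bounded_of_memLp_top {ψ : ℝ → ℝ}
    (h : MemLp ψ ⊤ (volume.restrict (Ioi (0 : ℝ)))) :
    ∃ (φ : ℝ → ℝ) (M : ℝ), Measurable φ ∧ (∀ x, |φ x| ≤ M) ∧ ∀ᵐ x, 0 < x → ψ x = φ x := by
  let M : ℝ := (eLpNormEssSup ψ (volume.restrict (Ioi 0))).toReal
  have hM : ∀ᵐ x, 0 < x → |ψ x| ≤ M := by
    have h1 := h.2
    rw [eLpNorm_exponent_top] at h1
    have h2 := ae_le_eLpNormEssSup (f := ψ) (μ := volume.restrict (Ioi 0))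
    rw [ae_restrict_iff' measurableSet_Ioi] at h2
    filter_upwards [h2] with x hx h0
    have h3 := (ENNReal.toReal_le_toReal (by simp) h1.ne).2 (hx h0)
    simpa using h3
  have hM0 : 0 ≤ M := ENNReal.toReal_nonneg
  let m : ℝ → ℝ := h.1.mk ψ
  refine ⟨fun x => max (-M) (min M (m x)), M, ?_, fun x => ?_, ?_⟩
  · exact measurable_const.max (measurable_const.min h.1.stronglyMeasurable_mk.measurable)
  · exact abs_le.2 ⟨le_max_left _ _, max_le (by linarith) (min_le_left _ _)⟩
  · have h1 := h.1.ae_eq_mk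
    rw [EventuallyEq, ae_restrict_iff' measurableSet_Ioi] at h1
    filter_upwards [h1, hM] with x h2 h3 h0
    have h4 : ψ x = m x := h2 h0
    have h5 := abs_le.1 (h3 h0)
    rw [← h4, min_eq_right h5.2, max_eq_right h5.1]

/-- Test functions have Lipschitz representatives. -/
theorem IsTestFunction.exists_lipschitz {g g' : ℝ → ℝ} (h : IsTestFunction g g') :
    ∃ (G : ℝ → ℝ) (M : ℝ) (C : NNReal), LipschitzWith C G ∧ (∀ x, |G x| ≤ M) ∧
      (∀ᵐ x, 0 < x → g x = G x) ∧ ∀ᵐ x, 0 < x → HasDerivAt G (g' x) x := by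
  obtain ⟨R, hR⟩ := h.support
  rw [ae_restrict_iff' measurableSet_Ioi] at hR
  obtain ⟨d₀, ℓ, hd₀m, hd₀, hd₀eq⟩ := exists_measurable_bounded_of_memLp_top h.mem_deriv
  have hℓ0 : 0 ≤ ℓ := (abs_nonneg _).trans (hd₀ 0)
  let d : ℝ → ℝ := (Ioc 0 R).indicator d₀
  have hdm : Measurable d := hd₀m.indicator measurableSet_Ioc
  have hdℓ : ∀ x, |d x| ≤ ℓ := fun x => by
    by_cases hx : x ∈ Ioc 0 R
    · simp only [d, indicator_of_mem hx, hd₀ x]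
    · simp only [d, indicator_of_notMem hx, abs_zero, hℓ0]
  have hd : ∀ᵐ x, 0 < x → g' x = d x := by
    filter_upwards [hR, hd₀eq] with x h1 h2 h0
    by_cases hx : x ≤ R
    · rw [h2 h0]
      exact (indicator_of_mem (show x ∈ Ioc 0 R from ⟨h0, hx⟩) d₀).symm
    · rw [h1 h0 (not_le.1 hx)]
      exact (indicator_of_notMem (fun h' : x ∈ Ioc 0 R => hx h'.2) d₀).symm
  have hdi : Integrable d := by
    rw [integrable_indicator_iff measurableSet_Ioc]
    exact Measure.integrableOn_of_bounded (M := ℓ) measure_Ioc_lt_top.ne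
      hd₀m.aestronglyMeasurable (ae_of_all _ hd₀)
  -- the primitive of the derivative differs from `g` by a constant, by the du Bois-Reymond lemma
  let P : ℝ → ℝ := fun x => ∫ t in (0 : ℝ)..x, d t
  have hPl : LipschitzWith ⟨ℓ, hℓ0⟩ P := by
    refine LipschitzWith.of_dist_le_mul fun x y => ?_
    rw [Real.dist_eq, Real.dist_eq]
    simp only [P]
    rw [intervalIntegral.integral_interval_sub_left hdi.intervalIntegrable hdi.intervalIntegrable]
    exact intervalIntegral.norm_integral_le_of_norm_le_const (f := d) (C := ℓ) fun t _ => hdℓ t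
  have hPb : ∀ x, |P x| ≤ ∫ t, |d t| := fun x =>
    (intervalIntegral.norm_integral_le_integral_norm_uIoc).trans
      (setIntegral_le_integral hdi.norm (ae_of_all _ fun _ => norm_nonneg _))
  have hPd : ∀ᵐ x, 0 < x → HasDerivAt P (g' x) x := by
    filter_upwards [LocallyIntegrable.ae_hasDerivAt_integral hdi.locallyIntegrable, hd] with x h1 h2 h0
    rw [h2 h0]
    exact h1 0
  have hgi : ∀ K, IsCompact K → K ⊆ Ioi 0 → IntegrableOn g K := fun K hK hKs => by
    have : IsFiniteMeasure (volume.restrict K) := ⟨by simpa using hK.measure_lt_top⟩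
    have h1 := (h.mem.mono_measure (Measure.restrict_mono hKs le_rfl)).integrable le_top
    exact h1
  have hPi : ∀ K, IsCompact K → IntegrableOn P K := fun K hK =>
    hPl.continuous.continuousOn.integrableOn_compact hK
  have hgP : HasWeakDirDeriv (Ioi (0 : ℝ)) (1 : ℝ) (fun x => g x - P x) fun _ => 0 := by
    intro φ hφ hφc hφs
    have h1 := h.weak_deriv φ hφ hφc hφs
    have h2 := hasWeakDirDeriv_of_lipschitz hPl hPd φ hφ hφc hφs
    have hint : ∀ {a : ℝ → ℝ}, IntegrableOn a (tsupport φ) →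
        IntegrableOn (fun x => a x * fderiv ℝ φ x 1) (Ioi 0) := by
      intro a ha
      have hc : Continuous fun x => fderiv ℝ φ x 1 :=
        (hφ.continuous_fderiv (by simp)).clm_apply continuous_const
      have hcs : HasCompactSupport fun x => fderiv ℝ φ x 1 := hφc.fderiv_apply ℝ 1
      obtain ⟨C, hC⟩ := hcs.exists_bound_of_continuous hc
      have h3 : IntegrableOn (fun x => a x * fderiv ℝ φ x 1) (tsupport φ) :=
        ha.mul_bdd hc.aestronglyMeasurable (ae_of_all _ hC)
      refine ((integrableOn_iff_integrable_of_support_subset fun x hx => ?_).1 h3).integrableOn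
      by_contra h'
      refine right_ne_zero_of_mul hx ?_
      rw [image_eq_zero_of_notMem_tsupport (f := fderiv ℝ φ)
        fun h'' => h' (tsupport_fderiv_subset ℝ h'')]
      simp
    simp_rw [sub_mul]
    rw [integral_sub (hint (hgi _ hφc.isCompact hφs)) (hint (hPi _ hφc.isCompact)), h1, h2]
    simp
  obtain ⟨c, hc⟩ := exists_ae_eq_const_of_hasWeakDirDeriv_zero
    (fun K hK hKs => (hgi K hK hKs).sub (hPi K hK)) hgP
  refine ⟨fun x => P x + c, (∫ t, |d t|) + |c|, ⟨ℓ, hℓ0⟩, ?_, fun x => ?_, ?_, ?_⟩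
  · exact LipschitzWith.of_dist_le_mul fun x y => by
      rw [dist_add_right]
      exact hPl.dist_le_mul x y
  · exact (abs_add_le _ _).trans (add_le_add (hPb x) le_rfl)
  · filter_upwards [hc] with x hx h0
    have h1 : g x - P x - c = 0 := hx h0
    linarith
  · filter_upwards [hPd] with x hx h0
    exact (hx h0).add_const c

/-! ### From the weak formulation to flows -/

theorem integral_Ioi_eq {a b : ℝ → ℝ} (hab : ∀ᵐ x, 0 < x → a x = b x) (hb : ∀ x, x ≤ 0 → b x = 0) :
    ∫ x in Ioi (0 : ℝ), a x = ∫ x, b x := by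
  rw [← setIntegral_eq_integral_of_forall_compl_eq_zero fun x hx => hb x (not_lt.1 hx)]
  exact setIntegral_congr_ae measurableSet_Ioi hab

theorem integrableOn_Ioi_iff {a b : ℝ → ℝ} (hab : ∀ᵐ x, 0 < x → a x = b x)
    (hb : ∀ x, x ≤ 0 → b x = 0) : IntegrableOn a (Ioi 0) ↔ Integrable b := by
  rw [← integrableOn_iff_integrable_of_support_subset (s := Ioi 0) fun x hx =>
    not_le.1 fun h' => hx (hb x h')]
  exact integrableOn_congr_fun_ae ((ae_restrict_iff' measurableSet_Ioi).2 hab)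

theorem exists_isDensity {h : ℝ → ℝ} (hm : AEMeasurable h (volume.restrict (Ioi (0 : ℝ))))
    (h0 : ∀ᵐ x ∂(volume.restrict (Ioi (0 : ℝ))), 0 ≤ h x) :
    ∃ h', IsDensity h' ∧ ∀ᵐ x, 0 < x → h x = h' x := by
  refine ⟨fun x => if x ∈ Ioi 0 then max 0 (hm.mk h x) else 0, ⟨?_, fun x => ?_, fun x hx => ?_⟩, ?_⟩
  · exact Measurable.ite measurableSet_Ioi (measurable_const.max hm.measurable_mk) measurable_const
  · split_ifs
    · exact le_max_left _ _
    · exact le_rfl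
  · exact if_neg (not_lt.2 hx)
  · have h1 := hm.ae_eq_mk
    rw [EventuallyEq, ae_restrict_iff' measurableSet_Ioi] at h1
    rw [ae_restrict_iff' measurableSet_Ioi] at h0
    filter_upwards [h0, h1] with x h2 h3 hx
    rw [if_pos (show x ∈ Ioi 0 from hx), ← h3 hx, max_eq_right (h2 hx)]

theorem IsAdmissibleDatum.exists_isDensity {σ : ℝ} (hσ : 0 ≤ σ) {f : ℝ → ℝ}
    (hf : IsAdmissibleDatum σ f) :
    ∃ f', IsDensity f' ∧ (∀ᵐ x, 0 < x → f x = f' x) ∧ (Integrable fun x => weight σ x * f' x) ∧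
      Integrable fun x => x ^ (-2 * σ) * f' x := by
  have hpos : ∀ x : ℝ, 0 < x → 0 < x + x ^ (-2 * σ) := fun x hx =>
    add_pos hx (Real.rpow_pos_of_pos hx _)
  have hm : AEMeasurable f (volume.restrict (Ioi (0 : ℝ))) := by
    have h1 : AEMeasurable (fun x => (x + x ^ (-2 * σ))⁻¹ * ((x + x ^ (-2 * σ)) * f x))
        (volume.restrict (Ioi (0 : ℝ))) :=
      (Measurable.aemeasurable (by fun_prop)).mul hf.2.1.aemeasurable
    refine h1.congr ((ae_restrict_iff' measurableSet_Ioi).2 (ae_of_all _ fun x hx => ?_))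
    exact inv_mul_cancel_left₀ (hpos x hx).ne' _
  obtain ⟨f', hf', heq⟩ := OHS.exists_isDensity hm hf.1
  have hi : Integrable fun x => (x + x ^ (-2 * σ)) * f' x := by
    refine (integrableOn_Ioi_iff ?_ fun x hx => ?_).1 hf.2
    · filter_upwards [heq] with x hx h0
      rw [hx h0]
    · rw [hf'.eq_zero x hx, mul_zero]
  have hdom : ∀ {φ : ℝ → ℝ} {c : ℝ}, Measurable φ →
      (∀ x, 0 < x → |φ x| ≤ c * (x + x ^ (-2 * σ))) → Integrable fun x => φ x * f' x := by
    intro φ c hφ h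
    refine (hi.const_mul c).mono' (hφ.mul hf'.measurable).aestronglyMeasurable
      (ae_of_all _ fun x => ?_)
    rcases le_or_gt x 0 with hx | hx
    · simp [hf'.eq_zero x hx]
    · rw [norm_mul, Real.norm_eq_abs, Real.norm_of_nonneg (hf'.nonneg x), ← mul_assoc]
      exact mul_le_mul_of_nonneg_right (h x hx) (hf'.nonneg x)
  refine ⟨f', hf', heq, hdom (c := 2) (measurable_weight σ) fun x hx => ?_,
    hdom (c := 1) (by fun_prop) fun x hx => ?_⟩
  · rw [abs_of_pos (weight_pos hx), weight]
    have h2 := Real.rpow_nonneg hx.le (-2 * σ)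
    rcases le_total x 1 with h | h
    · have := Real.rpow_le_rpow_of_exponent_ge hx h (show -2 * σ ≤ -σ by linarith)
      linarith
    · have := Real.rpow_le_one_of_one_le_of_nonpos h (neg_nonpos.2 hσ)
      linarith
  · rw [abs_of_nonneg (Real.rpow_nonneg hx.le _)]
    linarith

theorem integral_collision_eq {Φ : ℝ → ℝ → ℝ} {Ψ : ℝ × ℝ → ℝ} (hΨ : Integrable Ψ)
    (h0 : ∀ p : ℝ × ℝ, ¬ (0 < p.2 ∧ p.2 < p.1) → Ψ p = 0)
    (h : ∀ᵐ p : ℝ × ℝ, 0 < p.2 → p.2 < p.1 → Φ p.1 p.2 = Ψ p) :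
    ∫ y in Ioi (0 : ℝ), ∫ z in Ioo (0 : ℝ) y, Φ y z = ∫ p, Ψ p := by
  rw [Measure.volume_eq_prod] at hΨ ⊢
  rw [integral_prod _ hΨ]
  refine integral_Ioi_eq ?_ fun y hy => integral_eq_zero_of_ae (ae_of_all _ fun z => h0 _ ?_)
  · rw [Measure.volume_eq_prod] at h
    filter_upwards [Measure.ae_ae_of_ae_prod h] with y hy _
    rw [← setIntegral_eq_integral_of_forall_compl_eq_zero (s := Ioo 0 y) fun z hz =>
      h0 (y, z) hz]
    refine setIntegral_congr_ae measurableSet_Ioo ?_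
    filter_upwards [hy] with z hz hzy
    exact hz hzy.1 hzy.2
  · rintro ⟨h1, h2⟩
    simp only at h1 h2
    linarith

theorem mem_timeInterval_top {t : ℝ} : t ∈ timeInterval ⊤ ↔ 0 ≤ t :=
  ⟨fun h => h.1, fun h => ⟨h, EReal.coe_lt_top t⟩⟩

theorem measurableSet_timeInterval (T : EReal) : MeasurableSet (timeInterval T) := by
  have : (timeInterval T).OrdConnected := ⟨fun a ha b hb x hx =>
    ⟨ha.1.trans hx.1, lt_of_le_of_lt (by exact_mod_cast hx.2) hb.2⟩⟩
  exact this.measurableSet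

theorem IsSolutionClass.ae_tendsto {T : EReal} {P : ℝ → Prop}
    (hP : ∀ᵐ t ∂(volume.restrict (timeInterval T)), P t) {t : ℝ} (ht : t ∈ timeInterval T) :
    ∃ s : ℕ → ℝ, (∀ n, s n ∈ timeInterval T ∧ P (s n)) ∧
      Tendsto s atTop (𝓝[timeInterval T] t) := by
  obtain ⟨b, htb, hb⟩ : ∃ b, t < b ∧ Ioo t b ⊆ timeInterval T := by
    obtain ⟨q, hq1, hq2⟩ := EReal.lt_iff_exists_real_btwn.1 ht.2
    refine ⟨q, by exact_mod_cast hq1, fun x hx => ⟨ht.1.trans hx.1.le, ?_⟩⟩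
    exact lt_trans (by exact_mod_cast hx.2) hq2
  have hex : ∀ n : ℕ, ∃ s ∈ Ioo t (min b (t + 1 / (n + 1))), P s := by
    intro n
    by_contra! hcon
    have hlt : t < min b (t + 1 / (n + 1)) :=
      lt_min htb (lt_add_of_pos_right _ (by positivity))
    have h1 : volume.restrict (timeInterval T) (Ioo t (min b (t + 1 / (n + 1)))) = 0 :=
      measure_mono_null (fun s hs => hcon s hs) (ae_iff.1 hP)
    rw [Measure.restrict_apply measurableSet_Ioo, inter_eq_left.2 fun s hs =>
      hb ⟨hs.1, hs.2.trans_le (min_le_left _ _)⟩, Real.volume_Ioo, ENNReal.ofReal_eq_zero] at h1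
    linarith
  choose s hs hPs using hex
  have hmem : ∀ n, s n ∈ timeInterval T := fun n =>
    hb ⟨(hs n).1, (hs n).2.trans_le (min_le_left _ _)⟩
  refine ⟨s, fun n => ⟨hmem n, hPs n⟩, tendsto_nhdsWithin_iff.2
    ⟨?_, Eventually.of_forall hmem⟩⟩
  have h1 : Tendsto (fun n : ℕ => t + 1 / ((n : ℝ) + 1)) atTop (𝓝 t) := by
    have := (tendsto_one_div_add_atTop_nhds_zero_nat (𝕜 := ℝ)).const_add t
    rwa [add_zero] at this
  exact tendsto_of_tendsto_of_tendsto_of_le_of_le tendsto_const_nhds h1 (fun n => (hs n).1.le)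
    fun n => ((hs n).2.trans_le (min_le_right _ _)).le

/-- The bound on the weighted norm holds at all times, by weak continuity and Fatou's lemma, and
the solution has representatives which are densities. -/
theorem IsSolutionClass.exists_density {σ : ℝ} {T : EReal} {u : ℝ → ℝ → ℝ}
    (h : IsSolutionClass σ T u) :
    ∃ v : ℝ → ℝ → ℝ, (∀ t, IsDensity (v t)) ∧
      (∀ t ∈ timeInterval T, ∀ᵐ x, 0 < x → u t x = v t x) ∧ (∀ t, Integrable (v t)) ∧
      (∀ A, MeasurableSet A → Measurable fun t => ∫ x in A, v t x) ∧
      (∀ t, Integrable fun x => weight σ x * v t x) ∧ ∃ C, ∀ t, ∫ x, weight σ x * v t x ≤ C := by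
  have h1 : ∀ t, ∃ v, IsDensity v ∧ (t ∈ timeInterval T → ∀ᵐ x, 0 < x → u t x = v x) ∧
      (t ∉ timeInterval T → v = fun _ => 0) := by
    intro t
    by_cases ht : t ∈ timeInterval T
    · have hi := h.mem_Cw.integrable t ht
      simp only [one_mul] at hi
      obtain ⟨v, hv, hv'⟩ := OHS.exists_isDensity hi.1.aemeasurable (h.nonneg t ht)
      exact ⟨v, hv, fun _ => hv', fun h' => absurd ht h'⟩
    · exact ⟨fun _ => 0, ⟨measurable_const, fun _ => le_rfl, fun _ _ => rfl⟩,
        fun h' => absurd h' ht, fun _ => rfl⟩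
  choose v hv huv hv0 using h1
  have hi : ∀ t, Integrable (v t) := by
    intro t
    by_cases ht : t ∈ timeInterval T
    · have h2 := h.mem_Cw.integrable t ht
      simp only [one_mul] at h2
      exact (integrableOn_Ioi_iff (huv t ht) (hv t).eq_zero).1 h2
    · rw [hv0 t ht]
      exact integrable_zero _ _ _
  have hcont : ∀ ψ : ℝ → ℝ, Measurable ψ → (∃ M, ∀ x, |ψ x| ≤ M) →
      ContinuousOn (fun t => ∫ x, ψ x * v t x) (timeInterval T) := by
    rintro ψ hψ ⟨M, hM⟩
    refine (h.mem_Cw.weak_continuous ψ (memLp_top_of_bound hψ.aestronglyMeasurable M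
      (ae_of_all _ hM))).congr fun t ht => ?_
    refine (integral_Ioi_eq ?_ fun x hx => ?_).symm
    · filter_upwards [huv t ht] with x hx h0
      rw [hx h0, one_mul]
    · rw [(hv t).eq_zero x hx, mul_zero]
  have hmeas : ∀ A, MeasurableSet A → Measurable fun t => ∫ x in A, v t x := by
    intro A hA
    classical
    have h2 := hcont (A.indicator fun _ => 1) (measurable_const.indicator hA)
      ⟨1, fun x => by by_cases hx : x ∈ A <;> simp [hx]⟩
    have h3 := h2.measurable_piecewise (g := fun _ => (0 : ℝ)) continuousOn_const
      (measurableSet_timeInterval T)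
    convert h3 using 1
    ext t
    by_cases ht : t ∈ timeInterval T
    · rw [piecewise_eq_of_mem _ _ _ ht, ← integral_indicator hA]
      congr 1 with x
      by_cases hx : x ∈ A <;> simp [hx]
    · rw [piecewise_eq_of_notMem _ _ _ ht, hv0 t ht]
      simp
  obtain ⟨C, hC⟩ := h.bounded
  have hb : ∀ t, (Integrable fun x => weight σ x * v t x) ∧
      ∫ x, weight σ x * v t x ≤ max C 0 := by
    intro t
    by_cases ht : t ∈ timeInterval T
    · obtain ⟨s, hs, hst⟩ := IsSolutionClass.ae_tendsto hC ht
      have hws : ∀ n, (Integrable fun x => weight σ x * v (s n) x) ∧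
          ∫ x, weight σ x * v (s n) x ≤ C := by
        intro n
        have h2 : ∀ᵐ x, 0 < x → weight σ x * u (s n) x = weight σ x * v (s n) x := by
          filter_upwards [huv _ (hs n).1] with x hx h0
          rw [hx h0]
        have h3 := ((hv (s n)).weight_mul σ).eq_zero
        exact ⟨(integrableOn_Ioi_iff h2 h3).1 (hs n).2.1,
          (integral_Ioi_eq h2 h3).symm.trans_le (hs n).2.2⟩
      let wm : ℕ → ℝ → ℝ := fun m x => max 0 (min (weight σ x) m)
      have hwm : ∀ m, Measurable (wm m) := fun m =>
        measurable_const.max ((measurable_weight σ).min measurable_const)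
      have hwm0 : ∀ m x, 0 ≤ wm m x := fun m x => le_max_left _ _
      have hwmm : ∀ m x, |wm m x| ≤ m := fun m x => by
        rw [abs_of_nonneg (hwm0 m x)]
        exact max_le (Nat.cast_nonneg m) (min_le_right _ _)
      have hle : ∀ m, ∫ x, wm m x * v t x ≤ C := by
        intro m
        refine le_of_tendsto' (((hcont _ (hwm m) ⟨m, hwmm m⟩) t ht).tendsto.comp hst) fun n => ?_
        refine le_trans (integral_mono ?_ (hws n).1 fun x => ?_) (hws n).2
        · exact integrable_bdd_mul' (hi _) (hwm m) (hwmm m)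
        · rcases le_or_gt x 0 with hx | hx
          · simp only [(hv (s n)).eq_zero x hx, mul_zero, le_refl]
          · exact mul_le_mul_of_nonneg_right (max_le (weight_pos hx).le (min_le_left _ _))
              ((hv (s n)).nonneg x)
      have hF := integrable_of_tendsto_of_integral_le (F := fun m x => wm m x * v t x)
        (G := fun x => weight σ x * v t x) (C := C)
        (fun m => integrable_bdd_mul' (hi _) (hwm m) (hwmm m))
        (fun m x => mul_nonneg (hwm0 m x) ((hv t).nonneg x))
        ((hv t).weight_mul σ).measurable.aestronglyMeasurable (fun x => ?_) hle
      · exact ⟨hF.1, hF.2.trans (le_max_left _ _)⟩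
      · rcases le_or_gt x 0 with hx | hx
        · simp only [(hv t).eq_zero x hx, mul_zero, tendsto_const_nhds]
        · refine Tendsto.mul_const _ (tendsto_const_nhds.congr' ?_)
          filter_upwards [eventually_ge_atTop ⌈weight σ x⌉₊] with m hm
          simp only [wm]
          rw [min_eq_left (Nat.ceil_le.1 hm), max_eq_right (weight_pos hx).le]
    · rw [hv0 t ht]
      simp
  exact ⟨v, hv, huv, hi, hmeas, fun t => (hb t).1, max C 0, fun t => (hb t).2⟩

/-- The weak formulation for Lipschitz test functions implies that for all bounded measurable test
functions, by a monotone class argument. -/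
theorem isFlow_of_lipschitz {k σ η ε : ℝ} {L : ℝ × ℝ → ℝ} (hL : IsReducedKernel k σ η L)
    (hε : 0 < ε) {f : ℝ → ℝ} {v : ℝ → ℝ → ℝ} (hfi : Integrable f)
    (hv : ∀ t, IsDensity (v t)) (hm : ∀ A, MeasurableSet A → Measurable fun t => ∫ x in A, v t x)
    (hi : ∀ t, Integrable fun x => weight σ x * v t x)
    (hb : ∃ C, ∀ t, ∫ x, weight σ x * v t x ≤ C)
    (heq : ∀ (G : ℝ → ℝ) (C : NNReal) (M R c : ℝ), LipschitzWith C G → (∀ x, |G x| ≤ M) →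
      (∀ x, R < x → G x = c) → ∀ t, 0 ≤ t →
      (∫ x, G x * v t x) - ∫ x, G x * f x = ∫ s in (0 : ℝ)..t, coagRate ε L G (v s)) :
    IsFlow σ ε L f v := by
  have hσ := hL.σ_nonneg
  have hvi : ∀ t, Integrable (v t) := fun t => integrable_of_weight_mul hσ (hv t) (hi t)
  obtain ⟨W, hW⟩ := id hb
  have hW0 : 0 ≤ W := (integral_nonneg ((hv 0).weight_mul σ).nonneg).trans (hW 0)
  have hWv : ∀ t, ∫ x, v t x ≤ W := fun t =>
    (integral_mono (hvi t) (hi t) ((hv t).le_weight_mul hσ)).trans (hW t)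
  have hK : ∀ {G : ℝ → ℝ} {M : ℝ}, (∀ x, |G x| ≤ M) → ∀ p : ℝ × ℝ, 0 < p.1 → 0 < p.2 →
      |coagOp ε G p * L p| ≤ (2 / ε + 1) * M * (2 * k) * (weight σ p.1 * weight σ p.2) :=
    fun hM => abs_coagOp_mul_le hL hε hM
  have hKm : ∀ {G : ℝ → ℝ}, Measurable G → Measurable fun p => coagOp ε G p * L p := fun hG =>
    (measurable_coagOp ε hG).mul hL.measurable
  have hKi : ∀ {G : ℝ → ℝ} {M : ℝ}, Measurable G → (∀ x, |G x| ≤ M) → ∀ t,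
      Integrable fun p : ℝ × ℝ => coagOp ε G p * L p * (v t p.1 * v t p.2) := fun hG hM t =>
    integrable_mul_tensor (hv t) (hv t) (hi t) (hi t) (hKm hG) (hK hM)
  have hrm : ∀ {G : ℝ → ℝ}, Measurable G → Measurable fun t => coagRate ε L G (v t) := fun hG =>
    measurable_integral_mul_tensor hv hvi hWv hm (hKm hG)
  have hk := hL.k_nonneg
  have hrb : ∀ {G : ℝ → ℝ} {M : ℝ}, (∀ x, |G x| ≤ M) → ∀ t,
      |coagRate ε L G (v t)| ≤ (2 / ε + 1) * M * (2 * k) * (W * W) := by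
    intro G M hM t
    have hM0 : 0 ≤ M := (abs_nonneg _).trans (hM 0)
    have h2 : 0 ≤ ∫ x, weight σ x * v t x := integral_nonneg ((hv t).weight_mul σ).nonneg
    refine (abs_integral_mul_tensor_le (hv t) (hv t) (hi t) (hi t) (hK hM)).trans ?_
    exact mul_le_mul_of_nonneg_left (mul_le_mul (hW t) (hW t) h2 hW0) (by positivity)
  have hri : ∀ {G : ℝ → ℝ} {M : ℝ}, Measurable G → (∀ x, |G x| ≤ M) → ∀ a b,
      IntervalIntegrable (fun t => coagRate ε L G (v t)) volume a b := fun hG hM a b =>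
    (intervalIntegrable_const (c := (2 / ε + 1) * _ * (2 * k) * (W * W))).mono_fun
      (hrm hG).aestronglyMeasurable (ae_of_all _ fun t => (hrb hM t).trans (le_abs_self _))
  -- the test functions satisfying the equation form a vector space closed under bounded pointwise
  -- limits
  let E : (ℝ → ℝ) → Prop := fun G => Measurable G ∧ (∃ M, ∀ x, |G x| ≤ M) ∧ ∀ t, 0 ≤ t →
    (∫ x, G x * v t x) - ∫ x, G x * f x = ∫ s in (0 : ℝ)..t, coagRate ε L G (v s)
  have hlin : ∀ {G H : ℝ → ℝ} (c : ℝ), E G → E H → E fun x => G x + c * H x := by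
    rintro G H c ⟨hG, ⟨M, hM⟩, hGe⟩ ⟨hH, ⟨N, hN⟩, hHe⟩
    refine ⟨hG.add (hH.const_mul c), ⟨M + |c| * N, fun x => ?_⟩, fun t ht => ?_⟩
    · refine (abs_add_le _ _).trans (add_le_add (hM x) ?_)
      rw [abs_mul]
      exact mul_le_mul_of_nonneg_left (hN x) (abs_nonneg c)
    · have h1 : ∀ {a : ℝ → ℝ}, Integrable a → ∫ x, (G x + c * H x) * a x =
          (∫ x, G x * a x) + c * ∫ x, H x * a x := by
        intro a ha
        rw [← integral_const_mul, ← integral_add (integrable_bdd_mul' ha hG hM)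
          ((integrable_bdd_mul' ha hH hN).const_mul c)]
        congr 1 with x
        ring
      have h2 : ∀ s, coagRate ε L (fun x => G x + c * H x) (v s) =
          coagRate ε L G (v s) + c * coagRate ε L H (v s) := by
        intro s
        unfold coagRate
        rw [← integral_const_mul, ← integral_add (hKi hG hM s) ((hKi hH hN s).const_mul c)]
        congr 1 with p
        simp only [coagOp]
        ring
      simp_rw [h2]
      rw [h1 (hvi t), h1 hfi, intervalIntegral.integral_add (hri hG hM 0 t)
        ((hri hH hN 0 t).const_mul c), intervalIntegral.integral_const_mul, ← hGe t ht,
        ← hHe t ht]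
      ring
  have hlim : ∀ {G : ℕ → ℝ → ℝ} {H : ℝ → ℝ} {M : ℝ}, (∀ n, E (G n)) → (∀ n x, |G n x| ≤ M) →
      (∀ x, Tendsto (fun n => G n x) atTop (𝓝 (H x))) → E H := by
    intro G H M hG hM hGH
    have hHm : Measurable H := measurable_of_tendsto_metrizable (fun n => (hG n).1)
      (tendsto_pi_nhds.2 hGH)
    have hHM : ∀ x, |H x| ≤ M := fun x => le_of_tendsto' (hGH x).abs fun n => hM n x
    refine ⟨hHm, ⟨M, hHM⟩, fun t ht => ?_⟩
    have h1 : ∀ {a : ℝ → ℝ}, Integrable a → Tendsto (fun n => ∫ x, G n x * a x) atTop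
        (𝓝 (∫ x, H x * a x)) := fun {a} ha =>
      tendsto_integral_of_dominated_convergence (fun x => M * |a x|)
        (fun n => (hG n).1.aestronglyMeasurable.mul ha.1) (ha.abs.const_mul M)
        (fun n => ae_of_all _ fun x => by
          rw [norm_mul]
          exact mul_le_mul_of_nonneg_right (hM n x) (abs_nonneg _))
        (ae_of_all _ fun x => (hGH x).mul_const _)
    have h2 : ∀ s, Tendsto (fun n => coagRate ε L (G n) (v s)) atTop
        (𝓝 (coagRate ε L H (v s))) := by
      intro s
      refine tendsto_integral_of_dominated_convergence
        (fun p : ℝ × ℝ => (2 / ε + 1) * M * (2 * k) *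
          ((weight σ p.1 * v s p.1) * (weight σ p.2 * v s p.2)))
        (fun n => (hKi (hG n).1 (hM n) s).1) (((hi s).mul_prod (hi s)).const_mul _)
        (fun n => ae_of_all _ fun p => by
          rw [Real.norm_eq_abs]
          exact abs_mul_tensor_le (K := fun p => coagOp ε (G n) p * L p) (hv s) (hv s) (hK (hM n) p))
        (ae_of_all _ fun p => ?_)
      refine Tendsto.mul_const _ (Tendsto.mul_const _ ?_)
      exact (((hGH _).sub (hGH _)).div_const ε).sub (hGH _)
    have h3 : Tendsto (fun n => ∫ s in (0 : ℝ)..t, coagRate ε L (G n) (v s)) atTop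
        (𝓝 (∫ s in (0 : ℝ)..t, coagRate ε L H (v s))) :=
      intervalIntegral.tendsto_integral_filter_of_dominated_convergence
        (fun _ => (2 / ε + 1) * M * (2 * k) * (W * W))
        (Eventually.of_forall fun n => (hrm (hG n).1).aestronglyMeasurable)
        (Eventually.of_forall fun n => ae_of_all _ fun s _ => hrb (hM n) s)
        intervalIntegrable_const (ae_of_all _ fun s _ => h2 s)
    exact tendsto_nhds_unique ((h1 (hvi t)).sub (h1 hfi))
      (h3.congr fun n => ((hG n).2.2 t ht).symm)
  have hconst : ∀ c : ℝ, E fun _ => c := fun c =>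
    ⟨measurable_const, ⟨|c|, fun _ => le_rfl⟩,
      heq (fun _ => c) 0 |c| 0 c (LipschitzWith.const' c) (fun _ => le_rfl) fun _ _ => rfl⟩
  have hind : ∀ A, MeasurableSet A → E (A.indicator fun _ => 1) := by
    intro A hA
    induction A, hA using MeasurableSpace.induction_on_inter
      (BorelSpace.measurable_eq.trans (borel_eq_generateFrom_Iic ℝ)) isPiSystem_Iic with
    | empty => simpa using hconst 0
    | basic A hA =>
      obtain ⟨r, rfl⟩ := hA
      -- half-lines are limits of piecewise linear functions
      let χ : ℕ → ℝ → ℝ := fun j x => max 0 (min 1 (1 - j * (x - r)))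
      have hχ1 : ∀ j x, |χ j x| ≤ 1 := fun j x => by
        rw [abs_of_nonneg (le_max_left _ _)]
        exact max_le zero_le_one (min_le_left _ _)
      refine hlim (G := χ) (M := 1) (fun j => ⟨by fun_prop, ⟨1, hχ1 j⟩, ?_⟩) hχ1 fun x => ?_
      · refine heq (χ j) j 1 (r + 1 / j) (if j = 0 then 1 else 0) ?_ (hχ1 j) fun x hx => ?_
        · have h1 : LipschitzWith j fun x : ℝ => 1 - j * (x - r) :=
            LipschitzWith.of_dist_le_mul fun x y => by
              rw [Real.dist_eq, Real.dist_eq]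
              have : 1 - j * (x - r) - (1 - j * (y - r)) = (j : ℝ) * (y - x) := by ring
              rw [this, abs_mul, Nat.abs_cast, abs_sub_comm]
              simp
          exact (h1.const_min 1).const_max 0
        · split_ifs with hj
          · simp [χ, hj]
          · have hj0 : (0 : ℝ) < j := by exact_mod_cast Nat.pos_of_ne_zero hj
            have h1 : 1 / (j : ℝ) < x - r := by linarith
            rw [div_lt_iff₀ hj0] at h1
            simp only [χ]
            rw [min_eq_right (by nlinarith), max_eq_left (by nlinarith)]
      · rcases le_or_gt x r with hx | hx
        · rw [indicator_of_mem (show x ∈ Iic r from hx)]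
          refine tendsto_const_nhds.congr fun j => ?_
          have : (j : ℝ) * (x - r) ≤ 0 :=
            mul_nonpos_of_nonneg_of_nonpos (Nat.cast_nonneg j) (by linarith)
          simp only [χ]
          rw [min_eq_left (by linarith), max_eq_right zero_le_one]
        · rw [indicator_of_notMem (show x ∉ Iic r from not_le.2 hx)]
          refine tendsto_const_nhds.congr' ?_
          filter_upwards [eventually_ge_atTop ⌈1 / (x - r)⌉₊] with j hj
          have h1 := Nat.ceil_le.1 hj
          rw [div_le_iff₀ (by linarith)] at h1
          simp only [χ]
          rw [min_eq_right (by linarith), max_eq_left (by linarith)]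
    | compl A hA ih =>
      have h1 := hlin (-1) (hconst 1) ih
      convert h1 using 1
      ext x
      by_cases hx : x ∈ A <;> simp [hx]
    | iUnion A hAd hA ih =>
      have hs : ∀ n : ℕ, E fun x => ∑ i ∈ Finset.range n, (A i).indicator (fun _ => 1) x := by
        intro n
        induction n with
        | zero => simpa using hconst 0
        | succ n ihn =>
          have h1 := hlin 1 ihn (ih n)
          simpa only [Finset.sum_range_succ, one_mul] using h1
      have hsum : ∀ n x, ∑ i ∈ Finset.range n, (A i).indicator (fun _ => (1 : ℝ)) x =
          (⋃ i ∈ Finset.range n, A i).indicator (fun _ => 1) x := by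
        intro n x
        rw [Finset.indicator_biUnion_apply]
        exact fun i _ j _ hij => hAd hij
      refine hlim (M := 1) hs (fun n x => ?_) fun x => ?_
      · rw [hsum]
        by_cases hx : x ∈ ⋃ i ∈ Finset.range n, A i
        · rw [indicator_of_mem hx, abs_one]
        · rw [indicator_of_notMem hx, abs_zero]
          exact zero_le_one
      · simp_rw [hsum]
        by_cases hx : x ∈ ⋃ i, A i
        · obtain ⟨i, hi⟩ := mem_iUnion.1 hx
          rw [indicator_of_mem hx]
          refine tendsto_const_nhds.congr' ?_
          filter_upwards [eventually_gt_atTop i] with n hn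
          rw [indicator_of_mem (mem_iUnion₂.2 ⟨i, Finset.mem_range.2 hn, hi⟩)]
        · rw [indicator_of_notMem hx]
          refine tendsto_const_nhds.congr fun n => ?_
          rw [indicator_of_notMem fun h' => hx ?_]
          obtain ⟨i, -, hi⟩ := mem_iUnion₂.1 h'
          exact mem_iUnion.2 ⟨i, hi⟩
  have hsimple : ∀ F : SimpleFunc ℝ ℝ, E F := by
    intro F
    induction F using SimpleFunc.induction with
    | const c hs =>
      have h1 := hlin c (hconst 0) (hind _ hs)
      convert h1 using 1
      ext x
      rw [SimpleFunc.coe_piecewise]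
      rename_i s
      by_cases hx : x ∈ s <;> simp [hx]
    | add _ hf hg =>
      have h1 := hlin 1 hf hg
      simp only [one_mul] at h1
      exact h1
  refine ⟨hv, hm, hi, hb, fun g hg ⟨M, hM⟩ => ?_⟩
  have hM0 : 0 ≤ M := (abs_nonneg _).trans (hM 0)
  refine (hlim (G := fun n => hg.stronglyMeasurable.approxBounded M n) (M := M)
    (fun n => hsimple _) (fun n x => ?_) fun x => ?_).2.2
  · exact hg.stronglyMeasurable.norm_approxBounded_le hM0 n x
  · exact hg.stronglyMeasurable.tendsto_approxBounded_of_norm_le (hM x)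

theorem integral_Ioi_mul_sub_eq {u v f f' : ℝ → ℝ} (hv : IsDensity v) (hf' : IsDensity f')
    (huv : ∀ᵐ x, 0 < x → u x = v x) (hff' : ∀ᵐ x, 0 < x → f x = f' x) (hvi : Integrable v)
    (hfi : Integrable f') {G : ℝ → ℝ} (hG : Measurable G) {M : ℝ} (hM : ∀ x, |G x| ≤ M) :
    ∫ x in Ioi (0 : ℝ), G x * (u x - f x) = (∫ x, G x * v x) - ∫ x, G x * f' x := by
  have h2 : ∫ x in Ioi (0 : ℝ), G x * (u x - f x) = ∫ x, G x * (v x - f' x) := by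
    refine integral_Ioi_eq ?_ fun x hx => by simp [hv.eq_zero x hx, hf'.eq_zero x hx]
    filter_upwards [huv, hff'] with x h3 h4 hx
    rw [h3 hx, h4 hx]
  rw [h2]
  simp_rw [mul_sub]
  exact integral_sub (integrable_bdd_mul' hvi hG hM) (integrable_bdd_mul' hfi hG hM)

/-- Weak solutions of the generalized equation are flows, up to the choice of representatives. -/
theorem IsWeakSolutionGen.exists_isFlow {k σ η ε : ℝ} {Λ : ℝ → ℝ → ℝ} {L : ℝ × ℝ → ℝ}
    (hL : IsReducedKernel k σ η L) (hΛL : ∀ᵐ p : ℝ × ℝ, 0 < p.2 → p.2 < p.1 → Λ p.1 p.2 = L p)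
    (hε : 0 < ε) {f f' : ℝ → ℝ} (hf' : IsDensity f') (hff' : ∀ᵐ x, 0 < x → f x = f' x)
    (hfi : Integrable f') {u : ℝ → ℝ → ℝ} (hu : IsWeakSolutionGen σ Λ f ε ⊤ u) :
    ∃ v, IsFlow σ ε L f' v ∧ ∀ t, 0 ≤ t → ∀ᵐ x, 0 < x → u t x = v t x := by
  obtain ⟨v, hv, huv, hvi, hm, hi, C, hC⟩ := hu.mem.exists_density
  have huv' : ∀ t, 0 ≤ t → ∀ᵐ x, 0 < x → u t x = v t x := fun t ht =>
    huv t (mem_timeInterval_top.2 ht)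
  refine ⟨v, isFlow_of_lipschitz hL hε hfi hv hm hi ⟨C, hC⟩ ?_, huv'⟩
  intro G C M R c hG hM hR t ht
  have h1 := hu.eqn G (deriv G) (isTestFunction_of_lipschitz hG hM hR) t
    (mem_timeInterval_top.2 ht)
  rw [← integral_Ioi_mul_sub_eq (hv t) hf' (huv' t ht) hff' (hvi t) hfi hG.continuous.measurable hM,
    h1]
  refine intervalIntegral.integral_congr fun s hs => ?_
  rw [uIcc_of_le ht] at hs
  have h4 := huv' s hs.1
  refine integral_collision_eq (Ψ := fun p => coagOp ε G p * L p * (v s p.1 * v s p.2))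
    (integrable_mul_tensor (hv s) (hv s) (hi s) (hi s)
      ((measurable_coagOp ε hG.continuous.measurable).mul hL.measurable)
      (abs_coagOp_mul_le hL hε hM)) (fun p hp => by simp [hL.eq_zero p hp]) ?_
  have h5 : ∀ᵐ p : ℝ × ℝ, 0 < p.1 → u s p.1 = v s p.1 :=
    Measure.quasiMeasurePreserving_fst.ae h4
  have h6 : ∀ᵐ p : ℝ × ℝ, 0 < p.2 → u s p.2 = v s p.2 :=
    Measure.quasiMeasurePreserving_snd.ae h4
  filter_upwards [hΛL, h5, h6] with p h7 h8 h9 h10 h11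
  rw [h7 h10 h11, h8 (h10.trans h11), h9 h10]
  simp only [coagOp]
  ring

/-! ### Conservation of mass -/

theorem tendsto_integral_min_mul {σ : ℝ} {v : ℝ → ℝ} (hv : IsDensity v)
    (hi : Integrable fun x => weight σ x * v x) :
    Tendsto (fun n : ℕ => ∫ x : ℝ, max 0 (min x n) * v x) atTop (𝓝 (∫ x, x * v x)) := by
  refine tendsto_integral_of_dominated_convergence (fun x => weight σ x * v x)
    (fun n => ?_) hi (fun n => ae_of_all _ fun x => ?_) (ae_of_all _ fun x => ?_)
  · exact (Measurable.mul (by fun_prop) hv.measurable).aestronglyMeasurable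
  · rcases le_or_gt x 0 with hx | hx
    · simp [hv.eq_zero x hx]
    · rw [norm_mul, Real.norm_of_nonneg (le_max_left _ _), Real.norm_of_nonneg (hv.nonneg x)]
      refine mul_le_mul_of_nonneg_right ?_ (hv.nonneg x)
      exact max_le (weight_pos hx).le ((min_le_left _ _).trans (le_weight hx))
  · rcases le_or_gt x 0 with hx | hx
    · simp [hv.eq_zero x hx]
    · refine Tendsto.mul_const _ (tendsto_const_nhds.congr' ?_)
      filter_upwards [eventually_ge_atTop ⌈x⌉₊] with n hn
      rw [min_eq_left (Nat.ceil_le.1 hn), max_eq_right hx.le]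

/-- For the test function `min x n` the integrand of the collision term is carried by `y ≥ n`, so
that the term vanishes in the limit. -/
theorem IsWeakSolutionOHS.sameMass {k σ η : ℝ} {Λ : ℝ → ℝ → ℝ} {L : ℝ × ℝ → ℝ}
    (hL : IsReducedKernel k σ η L) (hΛL : ∀ᵐ p : ℝ × ℝ, 0 < p.2 → p.2 < p.1 → Λ p.1 p.2 = L p)
    {f f' : ℝ → ℝ} (hf' : IsDensity f') (hff' : ∀ᵐ x, 0 < x → f x = f' x)
    (hfi : Integrable fun x => weight σ x * f' x) {T : EReal} {u : ℝ → ℝ → ℝ}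
    (hu : IsWeakSolutionOHS σ Λ f T u) {t : ℝ} (ht : t ∈ timeInterval T) :
    SameMass (u t) f := by
  obtain ⟨v, hv, huv, hvi, hm, hi, C, hC⟩ := hu.mem.exists_density
  have hσ := hL.σ_nonneg
  have hk := hL.k_nonneg
  have hC0 : 0 ≤ C := (integral_nonneg ((hv 0).weight_mul σ).nonneg).trans (hC 0)
  have hvC : ∀ t, ∫ x, v t x ≤ C := fun t =>
    (integral_mono (hvi t) (hi t) ((hv t).le_weight_mul hσ)).trans (hC t)
  -- the cut-off at `0` only serves to have a bounded function on the whole line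
  let G : ℕ → ℝ → ℝ := fun n x => max 0 (min x n)
  have hGm : ∀ n, Measurable (G n) := fun n => by fun_prop
  have hG0 : ∀ n x, 0 ≤ G n x := fun n x => le_max_left _ _
  have hGn : ∀ n x, |G n x| ≤ n := fun n x => by
    rw [abs_of_nonneg (hG0 n x)]
    exact max_le (Nat.cast_nonneg n) (min_le_right _ _)
  have hGl : ∀ n, LipschitzWith 1 (G n) := fun n =>
    (LipschitzWith.id.min_const (n : ℝ)).const_max 0
  have hGd : ∀ (n : ℕ) (x : ℝ), 0 < x → x < n → deriv (G n) x = 1 := by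
    intro n x h0 hx
    have h1 : G n =ᶠ[𝓝 x] id := by
      filter_upwards [eventually_gt_nhds h0, eventually_lt_nhds hx] with y h2 h3
      simp only [G, id]
      rw [min_eq_left h3.le, max_eq_right h2.le]
    rw [h1.deriv_eq, deriv_id]
  have hGd' : ∀ (n : ℕ) (x : ℝ), n < x → deriv (G n) x = 0 := by
    intro n x hx
    have h1 : G n =ᶠ[𝓝 x] fun _ => n := by
      filter_upwards [eventually_gt_nhds hx] with y h2
      simp only [G]
      rw [min_eq_right h2.le, max_eq_right (Nat.cast_nonneg n)]
    rw [h1.deriv_eq, deriv_const]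
  let d : ℕ → ℝ → ℝ := fun n => (Iio (n : ℝ)).indicator fun _ => 1
  let K : ℕ → ℝ × ℝ → ℝ := fun n p => (p.2 * d n p.1 - G n p.2) * L p
  have hKm : ∀ n, Measurable (K n) := fun n =>
    ((measurable_snd.mul ((measurable_const.indicator measurableSet_Iio).comp measurable_fst)).sub
      ((hGm n).comp measurable_snd)).mul hL.measurable
  -- for `z < y < n` the two terms `z G' y` and `G z` cancel
  have hKsmall : ∀ (n : ℕ) (p : ℝ × ℝ), p.1 < n → K n p = 0 := by
    intro n p hp
    by_cases h : 0 < p.2 ∧ p.2 < p.1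
    · have h1 : G n p.2 = p.2 := by
        simp only [G]
        rw [min_eq_left (h.2.trans hp).le, max_eq_right h.1.le]
      simp only [K, d, h1, indicator_of_mem (show p.1 ∈ Iio (n : ℝ) from hp), mul_one, sub_self,
        zero_mul]
    · simp only [K, hL.eq_zero p h, mul_zero]
  have hKw : ∀ (n : ℕ) (p : ℝ × ℝ), 0 < p.1 → 0 < p.2 → |K n p| ≤ 2 * k * (weight σ p.1 * weight σ p.2) := by
    intro n p h1 h2
    rcases lt_or_ge p.1 n with h | h
    · rw [hKsmall n p h, abs_zero]
      have := weight_pos (σ := σ) h1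
      have := weight_pos (σ := σ) h2
      positivity
    · have h3 : |p.2 * d n p.1 - G n p.2| ≤ p.2 := by
        simp only [d, indicator_of_notMem (show p.1 ∉ Iio (n : ℝ) from not_lt.2 h), mul_zero,
          zero_sub, abs_neg, abs_of_nonneg (hG0 n p.2)]
        exact max_le h2.le (min_le_left _ _)
      refine le_trans ?_ (hL.mul_le_weight_mul h1 h2)
      rw [abs_mul, abs_of_nonneg (hL.nonneg p)]
      exact mul_le_mul_of_nonneg_right h3 (hL.nonneg p)
  have hKi : ∀ n s, Integrable fun p : ℝ × ℝ => K n p * (v s p.1 * v s p.2) := fun n s =>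
    integrable_mul_tensor (hv s) (hv s) (hi s) (hi s) (hKm n) (hKw n)
  have heq : ∀ n : ℕ, (∫ x, G n x * v t x) - ∫ x, G n x * f' x =
      ∫ s in (0 : ℝ)..t, ∫ p : ℝ × ℝ, K n p * (v s p.1 * v s p.2) := by
    intro n
    have h1 := hu.eqn (G n) (deriv (G n)) (isTestFunction_of_lipschitz (R := n) (c := n) (hGl n)
      (hGn n) fun x hx => by
        simp only [G]
        rw [min_eq_right hx.le, max_eq_right (Nat.cast_nonneg n)]) t ht
    rw [← integral_Ioi_mul_sub_eq (hv t) hf' (huv t ht) hff' (hvi t)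
      (integrable_of_weight_mul hσ hf' hfi) (hGm n) (hGn n), h1]
    refine intervalIntegral.integral_congr fun s hs => ?_
    rw [uIcc_of_le ht.1] at hs
    have hsT : s ∈ timeInterval T :=
      ⟨hs.1, lt_of_le_of_lt (by exact_mod_cast hs.2) ht.2⟩
    have h4 := huv s hsT
    refine integral_collision_eq (Ψ := fun p => K n p * (v s p.1 * v s p.2)) (hKi n s)
      (fun p hp => by simp [K, hL.eq_zero p hp]) ?_
    have h5 : ∀ᵐ p : ℝ × ℝ, 0 < p.1 → u s p.1 = v s p.1 :=
      Measure.quasiMeasurePreserving_fst.ae h4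
    have h6 : ∀ᵐ p : ℝ × ℝ, 0 < p.2 → u s p.2 = v s p.2 :=
      Measure.quasiMeasurePreserving_snd.ae h4
    -- `G n` has a kink at `n`
    have h7 : ∀ᵐ x : ℝ, x ≠ n := by simp [ae_iff]
    have h8 : ∀ᵐ p : ℝ × ℝ, p.1 ≠ n := Measure.quasiMeasurePreserving_fst.ae h7
    filter_upwards [hΛL, h5, h6, h8] with p h7 h8 h9 h12 h10 h11
    have h13 : deriv (G n) p.1 = d n p.1 := by
      rcases lt_or_gt_of_ne h12 with h | h
      · rw [hGd n p.1 (h10.trans h11) h]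
        exact (indicator_of_mem (show p.1 ∈ Iio (n : ℝ) from h) fun _ => (1 : ℝ)).symm
      · rw [hGd' n p.1 h]
        exact (indicator_of_notMem (show p.1 ∉ Iio (n : ℝ) from not_lt.2 (le_of_lt h))
          fun _ => (1 : ℝ)).symm
    rw [h7 h10 h11, h8 (h10.trans h11), h9 h10, h13]
    simp only [K]
    ring
  have hR : Tendsto (fun n => ∫ s in (0 : ℝ)..t, ∫ p : ℝ × ℝ, K n p * (v s p.1 * v s p.2)) atTop
      (𝓝 (∫ _ in (0 : ℝ)..t, (0 : ℝ))) := by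
    refine intervalIntegral.tendsto_integral_filter_of_dominated_convergence
      (fun _ => 2 * k * (C * C)) (Eventually.of_forall fun n => ?_)
      (Eventually.of_forall fun n => ae_of_all _ fun s _ => ?_) intervalIntegrable_const
      (ae_of_all _ fun s _ => ?_)
    · exact (measurable_integral_mul_tensor hv hvi hvC hm (hKm n)).aestronglyMeasurable
    · have h2 : 0 ≤ ∫ x, weight σ x * v s x := integral_nonneg ((hv s).weight_mul σ).nonneg
      exact (abs_integral_mul_tensor_le (hv s) (hv s) (hi s) (hi s) (hKw n)).trans
        (mul_le_mul_of_nonneg_left (mul_le_mul (hC s) (hC s) h2 hC0) (by positivity))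
    · rw [← integral_zero (ℝ × ℝ) ℝ]
      refine tendsto_integral_of_dominated_convergence
        (fun p : ℝ × ℝ => 2 * k * ((weight σ p.1 * v s p.1) * (weight σ p.2 * v s p.2)))
        (fun n => (hKi n s).1) (((hi s).mul_prod (hi s)).const_mul _)
        (fun n => ae_of_all _ fun p => ?_) (ae_of_all _ fun p => ?_)
      · rw [Real.norm_eq_abs]
        exact abs_mul_tensor_le (K := K n) (hv s) (hv s) (hKw n p)
      · refine tendsto_const_nhds.congr' ?_
        filter_upwards [eventually_gt_atTop ⌈p.1⌉₊] with n hn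
        rw [hKsmall n p (Nat.lt_of_ceil_lt hn), zero_mul]
  have hmass : (∫ x, x * v t x) - ∫ x, x * f' x = 0 := by
    have h1 := tendsto_nhds_unique ((tendsto_integral_min_mul (hv t) (hi t)).sub
      (tendsto_integral_min_mul hf' hfi)) (hR.congr fun n => (heq n).symm)
    simpa using h1
  have h1 : ∀ᵐ x, 0 < x → x * u t x = x * v t x := by
    filter_upwards [huv t ht] with x hx h0
    rw [hx h0]
  have h2 : ∀ᵐ x, 0 < x → x * f x = x * f' x := by
    filter_upwards [hff'] with x hx h0
    rw [hx h0]
  have h3 : ∀ x : ℝ, x ≤ 0 → x * v t x = 0 := fun x hx => by rw [(hv t).eq_zero x hx, mul_zero]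
  refine ⟨(integrableOn_Ioi_iff h1 h3).2 ((hv t).integrable_id_mul (hi t)), ?_⟩
  rw [integral_Ioi_eq h1 h3, integral_Ioi_eq h2 fun x hx => by rw [hf'.eq_zero x hx, mul_zero]]
  linarith

/-! ### From limits of flows to weak solutions -/

section WeakContinuity

variable {σ : ℝ} {v : ℝ → ℝ → ℝ}

theorem integral_Ioi_mul_weight_eq {u v ψ φ : ℝ → ℝ} (hv : IsDensity v)
    (huv : ∀ᵐ x, 0 < x → u x = v x) (hψ : ∀ᵐ x, 0 < x → ψ x = φ x) :
    ∫ x in Ioi (0 : ℝ), ψ x * (weight σ x * u x) = ∫ x, φ x * (weight σ x * v x) := by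
  refine integral_Ioi_eq ?_ fun x hx => by rw [hv.eq_zero x hx, mul_zero, mul_zero]
  filter_upwards [huv, hψ] with x h1 h2 hx
  rw [h1 hx, h2 hx]

theorem memCw_weight (hv : ∀ t, IsDensity (v t)) (hi : ∀ t, Integrable fun x => weight σ x * v t x)
    (hc : ∀ ψ : ℝ → ℝ, Measurable ψ → (∃ M, ∀ x, |ψ x| ≤ M) →
      ContinuousOn (fun t => ∫ x, ψ x * (weight σ x * v t x)) (Ici 0))
    {u : ℝ → ℝ → ℝ} (huv : ∀ t, 0 ≤ t → ∀ᵐ x, 0 < x → u t x = v t x) (T : EReal) :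
    MemCw (weight σ) T u where
  integrable t ht := by
    refine (integrableOn_Ioi_iff ?_ ((hv t).weight_mul σ).eq_zero).2 (hi t)
    filter_upwards [huv t ht.1] with x hx h0
    rw [hx h0]
  weak_continuous ψ hψ := by
    obtain ⟨φ, M, hφ, hM, hψφ⟩ := exists_measurable_bounded_of_memLp_top hψ
    refine ((hc φ hφ ⟨M, hM⟩).mono fun t ht => ht.1).congr fun t ht => ?_
    exact integral_Ioi_mul_weight_eq (hv t) (huv t ht.1) hψφ

theorem isSolutionClass_of_continuous (hσ : 0 ≤ σ) (hv : ∀ t, IsDensity (v t))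
    (hi : ∀ t, Integrable fun x => weight σ x * v t x) {W : ℝ}
    (hW : ∀ t, 0 ≤ t → ∫ x, weight σ x * v t x ≤ W)
    (hc : ∀ ψ : ℝ → ℝ, Measurable ψ → (∃ M, ∀ x, |ψ x| ≤ M) →
      ContinuousOn (fun t => ∫ x, ψ x * (weight σ x * v t x)) (Ici 0)) (T : EReal) :
    IsSolutionClass σ T v where
  nonneg t _ := ae_of_all _ (hv t).nonneg
  mem_Cw := by
    have hvi : ∀ t, Integrable (v t) := fun t => integrable_of_weight_mul hσ (hv t) (hi t)
    refine ⟨fun t _ => by simpa using (hvi t).integrableOn, fun ψ hψ => ?_⟩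
    obtain ⟨φ, M, hφ, hM, hψφ⟩ := exists_measurable_bounded_of_memLp_top hψ
    have hM0 : 0 ≤ M := (abs_nonneg _).trans (hM 0)
    let χ : ℝ → ℝ := fun x => if x ∈ Ioi 0 then φ x / weight σ x else 0
    have hχ : Measurable χ :=
      Measurable.ite measurableSet_Ioi (hφ.div (measurable_weight σ)) measurable_const
    have hχM : ∀ x, |χ x| ≤ M := by
      intro x
      by_cases hx : x ∈ Ioi 0
      · simp only [χ, if_pos hx, abs_div, abs_of_pos (weight_pos (σ := σ) hx)]
        exact (div_le_self (abs_nonneg _) (one_le_weight hσ hx)).trans (hM x)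
      · simp only [χ, if_neg hx, abs_zero, hM0]
    refine ((hc χ hχ ⟨M, hχM⟩).mono fun t ht => ht.1).congr fun t ht => ?_
    refine integral_Ioi_eq ?_ fun x hx => by rw [(hv t).eq_zero x hx, mul_zero, mul_zero]
    filter_upwards [hψφ] with x h1 hx
    have h2 := (weight_pos (σ := σ) hx).ne'
    simp only [χ, if_pos (show x ∈ Ioi 0 from hx), h1 hx]
    field_simp
  bounded := ⟨W, (ae_restrict_iff' (measurableSet_timeInterval T)).2 (ae_of_all _ fun t ht =>
    ⟨(hi t).integrableOn, (integral_Ioi_eq (ae_of_all _ fun _ _ => rfl)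
      ((hv t).weight_mul σ).eq_zero).trans_le (hW t ht.1)⟩)⟩

/-- Flows are weakly continuous in time. -/
theorem IsFlow.continuousOn {k η ε : ℝ} {L : ℝ × ℝ → ℝ} {f : ℝ → ℝ} (hu : IsFlow σ ε L f v)
    (hL : IsReducedKernel k σ η L) (hf : IsDensity f) (hε : ε ∈ Ioc (0 : ℝ) 1)
    (hw : Integrable fun x => weight σ x * f x) {ψ : ℝ → ℝ} (hψ : Measurable ψ)
    (hM : ∃ M, ∀ x, |ψ x| ≤ M) :
    ContinuousOn (fun t => ∫ x, ψ x * (weight σ x * v t x)) (Ici 0) := by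
  obtain ⟨M, hM⟩ := hM
  have hM0 : 0 ≤ M := (abs_nonneg _).trans (hM 0)
  rw [Metric.continuousOn_iff]
  intro t ht δ hδ
  obtain ⟨τ, hτ, H⟩ := hu.exists_integral_weight_abs_sub_le hL hf hw hε ht
    (show 0 < δ / (2 * (M + 1)) by positivity)
  refine ⟨τ, hτ, fun s hs hst => ?_⟩
  have h1 := H s hs (by rw [Real.dist_eq] at hst; exact hst.le)
  have hdi : Integrable fun x => weight σ x * |v s x - v t x| := by
    refine ((hu.integrable s).sub (hu.integrable t)).abs.congr (ae_of_all _ fun x => ?_)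
    simp only [Pi.sub_apply]
    rcases le_or_gt x 0 with hx | hx
    · simp [(hu.dens s).eq_zero x hx, (hu.dens t).eq_zero x hx]
    · rw [← mul_sub, abs_mul, abs_of_pos (weight_pos hx)]
  rw [dist_eq_norm, ← integral_sub (integrable_bdd_mul' (hu.integrable s) hψ hM)
    (integrable_bdd_mul' (hu.integrable t) hψ hM)]
  have h2 : ‖∫ x, (ψ x * (weight σ x * v s x) - ψ x * (weight σ x * v t x))‖ ≤
      ∫ x, M * (weight σ x * |v s x - v t x|) := by
    refine norm_integral_le_of_norm_le (hdi.const_mul M) (ae_of_all _ fun x => ?_)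
    rcases le_or_gt x 0 with hx | hx
    · simp [(hu.dens s).eq_zero x hx, (hu.dens t).eq_zero x hx]
    · rw [← mul_sub, ← mul_sub, norm_mul, norm_mul, Real.norm_of_nonneg (weight_pos hx).le]
      exact mul_le_mul_of_nonneg_right (hM x)
        (mul_nonneg (weight_pos hx).le (abs_nonneg _))
  rw [integral_const_mul] at h2
  refine h2.trans_lt ?_
  calc M * ∫ x, weight σ x * |v s x - v t x| ≤ (M + 1) * (δ / (2 * (M + 1))) := by
        refine mul_le_mul (by linarith) h1 (integral_nonneg fun x => ?_) (by linarith)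
        rcases le_or_gt x 0 with hx | hx
        · simp [(hu.dens s).eq_zero x hx, (hu.dens t).eq_zero x hx]
        · exact mul_nonneg (weight_pos hx).le (abs_nonneg _)
    _ = δ / 2 := by field_simp
    _ < δ := half_lt_self hδ

theorem continuousOn_Ici_of_tendstoUniformlyOn {F : ℕ → ℝ → ℝ} {G : ℝ → ℝ}
    (hF : ∀ n, ContinuousOn (F n) (Ici 0))
    (h : ∀ b, TendstoUniformlyOn F G atTop (Icc 0 b)) : ContinuousOn G (Ici 0) := by
  intro t ht
  have h1 : ContinuousOn G (Icc 0 (t + 1)) := (h (t + 1)).continuousOn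
    (Frequently.of_forall fun n => (hF n).mono Icc_subset_Ici_self)
  refine (h1 t ⟨ht, by linarith⟩).mono_of_mem_nhdsWithin ?_
  rw [← Ici_inter_Iic]
  exact inter_mem self_mem_nhdsWithin (mem_nhdsWithin_of_mem_nhds (Iic_mem_nhds (by linarith)))

end WeakContinuity

theorem tendsto_coagOp {G : ℝ → ℝ} {e : ℕ → ℝ} (he : ∀ n, 0 < e n) (he0 : Tendsto e atTop (𝓝 0))
    {p : ℝ × ℝ} (hp : DifferentiableAt ℝ G p.1) :
    Tendsto (fun n => coagOp (e n) G p) atTop (𝓝 (p.2 * deriv G p.1 - G p.2)) := by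
  have h1 : HasDerivAt (fun ε : ℝ => G (p.1 + ε * p.2)) (p.2 * deriv G p.1) 0 := by
    have h2 : HasDerivAt (fun ε : ℝ => p.1 + ε * p.2) p.2 0 := by
      simpa using ((hasDerivAt_id (0 : ℝ)).mul_const p.2).const_add p.1
    have h3 : HasDerivAt G (deriv G p.1) (p.1 + 0 * p.2) := by
      rw [zero_mul, add_zero]
      exact hp.hasDerivAt
    have h4 := h3.comp (0 : ℝ) h2
    rwa [mul_comm] at h4
  rw [hasDerivAt_iff_tendsto_slope] at h1
  have h2 : Tendsto e atTop (𝓝[≠] 0) :=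
    tendsto_nhdsWithin_iff.2 ⟨he0, Eventually.of_forall fun n => (he n).ne'⟩
  refine ((h1.comp h2).sub_const (G p.2)).congr fun n => ?_
  simp only [Function.comp_apply, slope_def_field, coagOp, zero_mul, add_zero, sub_zero]

/-- The limit `ε → 0` of flows. -/
theorem exists_tendsto_isWeakSolutionOHS {k σ η : ℝ} {Λ : ℝ → ℝ → ℝ} {L : ℝ × ℝ → ℝ}
    (hL : IsReducedKernel k σ η L) (hΛL : ∀ᵐ p : ℝ × ℝ, 0 < p.2 → p.2 < p.1 → Λ p.1 p.2 = L p)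
    {f f' : ℝ → ℝ} (hff' : ∀ᵐ x, 0 < x → f x = f' x) {e : ℕ → ℝ} {u : ℕ → ℝ → ℝ → ℝ}
    (h : IsFlowSeq k σ η e (fun _ => L) f' u) (he0 : Tendsto e atTop (𝓝 0))
    {Z : ℕ → ℝ → ℝ → ℝ} (hZ : ∀ n t, 0 ≤ t → ∀ᵐ x, 0 < x → Z n t x = u n t x) :
    ∃ φ : ℕ → ℕ, StrictMono φ ∧ ∃ v : ℝ → ℝ → ℝ, IsWeakSolutionOHS σ Λ f ⊤ v ∧
      ∀ T : EReal, TendstoCw (weight σ) T (fun n => Z (φ n)) v := by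
  obtain ⟨φ, hφ, v, hv, hi, hW, hlim, heqn⟩ := h.exists_limit
  have hσ := hL.σ_nonneg
  have hk := hL.k_nonneg
  have hcn : ∀ n, ∀ ψ : ℝ → ℝ, Measurable ψ → (∃ M, ∀ x, |ψ x| ≤ M) →
      ContinuousOn (fun t => ∫ x, ψ x * (weight σ x * u n t x)) (Ici 0) := fun n ψ hψ hM =>
    (h.flow n).continuousOn hL h.dens (h.mem n) h.integrable hψ hM
  have hc : ∀ ψ : ℝ → ℝ, Measurable ψ → (∃ M, ∀ x, |ψ x| ≤ M) →
      ContinuousOn (fun t => ∫ x, ψ x * (weight σ x * v t x)) (Ici 0) := fun ψ hψ hM =>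
    continuousOn_Ici_of_tendstoUniformlyOn (fun n => hcn (φ n) ψ hψ hM) (hlim ψ hψ hM)
  refine ⟨φ, hφ, v, ⟨isSolutionClass_of_continuous hσ hv hi hW hc ⊤, ?_⟩, fun T => ⟨fun n => ?_, ?_, ?_⟩⟩
  · intro g g' hg t ht
    obtain ⟨G, M, C, hG, hM, hgG, hG'⟩ := hg.exists_lipschitz
    have hGm := hG.continuous.measurable
    have hM0 : 0 ≤ M := (abs_nonneg _).trans (hM 0)
    have hvi : ∀ t, Integrable (v t) := fun t => integrable_of_weight_mul hσ (hv t) (hi t)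
    let K : ℝ × ℝ → ℝ := fun p => (p.2 * deriv G p.1 - G p.2) * L p
    have hKm : Measurable K :=
      ((measurable_snd.mul ((measurable_deriv G).comp measurable_fst)).sub
        (hGm.comp measurable_snd)).mul hL.measurable
    have hK : ∀ p : ℝ × ℝ, 0 < p.1 → 0 < p.2 →
        |K p| ≤ (C + M) * (2 * k) * (weight σ p.1 * weight σ p.2) := by
      intro p h1 h2
      have h3 : |p.2 * deriv G p.1 - G p.2| ≤ C * p.2 + M := by
        refine (abs_sub _ _).trans (add_le_add ?_ (hM _))
        rw [abs_mul, abs_of_pos h2, mul_comm]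
        exact mul_le_mul_of_nonneg_right (norm_deriv_le_of_lipschitz hG) h2.le
      rw [abs_mul, abs_of_nonneg (hL.nonneg p)]
      calc _ ≤ (C * p.2 + M) * L p := mul_le_mul_of_nonneg_right h3 (hL.nonneg p)
        _ = C * (p.2 * L p) + M * L p := by ring
        _ ≤ C * (2 * k * (weight σ p.1 * weight σ p.2)) +
            M * (2 * k * (weight σ p.1 * weight σ p.2)) :=
          add_le_add (mul_le_mul_of_nonneg_left (hL.mul_le_weight_mul h1 h2) C.2)
            (mul_le_mul_of_nonneg_left (hL.le_weight_mul h1 h2) hM0)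
        _ = _ := by ring
    have h1 := heqn G K _ hGm ⟨M, hM⟩ hKm (fun n => abs_coagOp_mul_le_of_lipschitz (h.kernel n)
        (h.mem n).1 hM C.2 fun x y => by simpa [Real.dist_eq] using hG.dist_le_mul x y) hK (by
      have h2 : ∀ᵐ p : ℝ × ℝ, DifferentiableAt ℝ G p.1 :=
        Measure.quasiMeasurePreserving_fst.ae hG.ae_differentiableAt
      filter_upwards [h2] with p hp
      exact (tendsto_coagOp (fun n => (h.mem n).1) he0 hp).mul_const _) t ht.1
    have h2 : ∫ x in Ioi (0 : ℝ), g x * (v t x - f x) = ∫ x in Ioi (0 : ℝ), G x * (v t x - f x) := by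
      refine setIntegral_congr_ae measurableSet_Ioi ?_
      filter_upwards [hgG] with x hx h0
      rw [hx h0]
    rw [h2, integral_Ioi_mul_sub_eq (hv t) h.dens (ae_of_all _ fun _ _ => rfl) hff' (hvi t)
      (integrable_of_weight_mul hσ h.dens h.integrable) hGm hM, h1]
    refine intervalIntegral.integral_congr fun s _ => ?_
    refine (integral_collision_eq (Ψ := fun p => K p * (v s p.1 * v s p.2))
      (integrable_mul_tensor (hv s) (hv s) (hi s) (hi s) hKm hK)
      (fun p hp => by simp [K, hL.eq_zero p hp]) ?_).symm
    have h5 : ∀ᵐ p : ℝ × ℝ, 0 < p.1 → HasDerivAt G (g' p.1) p.1 :=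
      Measure.quasiMeasurePreserving_fst.ae hG'
    have h6 : ∀ᵐ p : ℝ × ℝ, 0 < p.2 → g p.2 = G p.2 := Measure.quasiMeasurePreserving_snd.ae hgG
    filter_upwards [hΛL, h5, h6] with p h7 h8 h9 h10 h11
    rw [h7 h10 h11, h9 h10, ← (h8 (h10.trans h11)).deriv]
    simp only [K]
    ring
  · exact memCw_weight (fun t => (h.flow _).dens t) (h.flow _).integrable (hcn (φ n)) (hZ _) T
  · exact memCw_weight hv hi hc (fun t _ => ae_of_all _ fun _ _ => rfl) T
  · intro ψ hψ b hb
    obtain ⟨χ, M, hχ, hM, hψχ⟩ := exists_measurable_bounded_of_memLp_top hψ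
    refine ((hlim χ hχ ⟨M, hM⟩ b).congr (Eventually.of_forall fun n t ht => ?_)).congr_right
      fun t ht => ?_
    · exact (integral_Ioi_mul_weight_eq ((h.flow _).dens t) (hZ _ t ht.1) hψχ).symm
    · exact (integral_Ioi_mul_weight_eq (hv t) (ae_of_all _ fun _ _ => rfl) hψχ).symm

/-- Solutions for truncated kernels converge to solutions for the original kernel. -/
theorem exists_isWeakSolutionGen {k σ η ε : ℝ} {Λ : ℝ → ℝ → ℝ} {L : ℝ × ℝ → ℝ}
    (hL : IsReducedKernel k σ η L) (hΛL : ∀ᵐ p : ℝ × ℝ, 0 < p.2 → p.2 < p.1 → Λ p.1 p.2 = L p)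
    {f f' : ℝ → ℝ} (hff' : ∀ᵐ x, 0 < x → f x = f' x) {u : ℕ → ℝ → ℝ → ℝ}
    (h : IsFlowSeq k σ η (fun _ => ε) (fun n p => min (L p) n) f' u) :
    ∃ v, IsWeakSolutionGen σ Λ f ε ⊤ v := by
  obtain ⟨φ, hφ, v, hv, hi, hW, hlim, heqn⟩ := h.exists_limit
  have hσ := hL.σ_nonneg
  have hε : 0 < ε := (h.mem 0).1
  have hc : ∀ ψ : ℝ → ℝ, Measurable ψ → (∃ M, ∀ x, |ψ x| ≤ M) →
      ContinuousOn (fun t => ∫ x, ψ x * (weight σ x * v t x)) (Ici 0) := fun ψ hψ hM =>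
    continuousOn_Ici_of_tendstoUniformlyOn (fun n => (h.flow (φ n)).continuousOn (h.kernel _)
      h.dens (h.mem 0) h.integrable hψ hM) (hlim ψ hψ hM)
  refine ⟨v, ⟨isSolutionClass_of_continuous hσ hv hi hW hc ⊤, ?_⟩⟩
  intro g g' hg t ht
  obtain ⟨G, M, C, hG, hM, hgG, -⟩ := hg.exists_lipschitz
  have hGm := hG.continuous.measurable
  have hvi : ∀ t, Integrable (v t) := fun t => integrable_of_weight_mul hσ (hv t) (hi t)
  have h1 := heqn G (fun p => coagOp ε G p * L p) _ hGm ⟨M, hM⟩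
    ((measurable_coagOp ε hGm).mul hL.measurable)
    (fun n => abs_coagOp_mul_le (h.kernel n) hε hM) (abs_coagOp_mul_le hL hε hM)
    (ae_of_all _ fun p => by
      refine tendsto_const_nhds.congr' ?_
      filter_upwards [eventually_ge_atTop ⌈L p⌉₊] with n hn
      rw [min_eq_left (Nat.ceil_le.1 hn)]) t ht.1
  have h2 : ∫ x in Ioi (0 : ℝ), g x * (v t x - f x) = ∫ x in Ioi (0 : ℝ), G x * (v t x - f x) := by
    refine setIntegral_congr_ae measurableSet_Ioi ?_
    filter_upwards [hgG] with x hx h0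
    rw [hx h0]
  rw [h2, integral_Ioi_mul_sub_eq (hv t) h.dens (ae_of_all _ fun _ _ => rfl) hff' (hvi t)
    (integrable_of_weight_mul hσ h.dens h.integrable) hGm hM, h1]
  refine intervalIntegral.integral_congr fun s _ => ?_
  refine (integral_collision_eq (Ψ := fun p => coagOp ε G p * L p * (v s p.1 * v s p.2))
    (integrable_mul_tensor (hv s) (hv s) (hi s) (hi s)
      ((measurable_coagOp ε hGm).mul hL.measurable) (abs_coagOp_mul_le hL hε hM))
    (fun p hp => by simp [hL.eq_zero p hp]) ?_).symm
  have h5 : ∀ᵐ p : ℝ × ℝ, 0 < p.1 → g p.1 = G p.1 := Measure.quasiMeasurePreserving_fst.ae hgG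
  have h6 : ∀ᵐ p : ℝ × ℝ, 0 < p.2 → g p.2 = G p.2 := Measure.quasiMeasurePreserving_snd.ae hgG
  have h7 := (measurePreserving_shear (-ε)).quasiMeasurePreserving.ae h5
  filter_upwards [hΛL, h5, h6, h7] with p h8 h9 h10 h11 h12 h13
  have h14 : 0 < p.1 - -ε * p.2 := by
    have := mul_pos hε h12
    linarith [h12.trans h13]
  have h15 : p.1 + ε * p.2 = p.1 - -ε * p.2 := by ring
  have h16 : g (p.1 - -ε * p.2) = G (p.1 - -ε * p.2) := h11 h14
  rw [h8 h12 h13, h9 (h12.trans h13), h10 h12, h15, h16]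
  simp only [coagOp, h15]
  ring

/-! ### The collision operator on `L¹` for a bounded kernel -/

theorem norm_eq_integral_abs {α : Type*} [MeasurableSpace α] {μ : Measure α} (w : Lp ℝ 1 μ) :
    ‖w‖ = ∫ x, |w x| ∂μ := L1.norm_eq_integral_norm w

theorem integrable_marginal (w : Lp ℝ 1 (volume : Measure (ℝ × ℝ))) :
    Integrable fun x : ℝ => ∫ z : ℝ, w (x, z) :=
  Integrable.integral_prod_left (f := fun p : ℝ × ℝ => w p) (L1.integrable_coeFn w)

/-- Integration over the second variable, as an operator from `L¹` of the plane to `L¹` of the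
line. -/
noncomputable def marginal :
    Lp ℝ 1 (volume : Measure (ℝ × ℝ)) →L[ℝ] Lp ℝ 1 (volume : Measure ℝ) :=
  LinearMap.mkContinuous
    { toFun := fun w => (integrable_marginal w).toL1 _
      map_add' := fun w w' => by
        rw [← Integrable.toL1_add, Integrable.toL1_eq_toL1_iff]
        have h1 : ∀ᵐ p ∂(volume : Measure ℝ).prod (volume : Measure ℝ),
          (w + w') p = w p + w' p := Lp.coeFn_add w w'
        have i1 : Integrable (fun p => w p) ((volume : Measure ℝ).prod (volume : Measure ℝ)) :=
          L1.integrable_coeFn w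
        have i2 : Integrable (fun p => w' p) ((volume : Measure ℝ).prod (volume : Measure ℝ)) :=
          L1.integrable_coeFn w'
        filter_upwards [Measure.ae_ae_of_ae_prod h1, i1.prod_right_ae, i2.prod_right_ae]
          with x h2 h3 h4
        rw [Pi.add_apply, ← integral_add h3 h4]
        exact integral_congr_ae h2
      map_smul' := fun c w => by
        rw [RingHom.id_apply, ← Integrable.toL1_smul, Integrable.toL1_eq_toL1_iff]
        have h1 : ∀ᵐ p ∂(volume : Measure ℝ).prod (volume : Measure ℝ),
          (c • w) p = c * w p := Lp.coeFn_smul c w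
        filter_upwards [Measure.ae_ae_of_ae_prod h1] with x h2
        rw [smul_eq_mul, ← integral_const_mul]
        exact integral_congr_ae h2 }
    1 fun w => by
      have i1 : Integrable (fun p => |w p|) ((volume : Measure ℝ).prod (volume : Measure ℝ)) :=
        (L1.integrable_coeFn w).abs
      have h : ‖w‖ = ∫ x : ℝ, ∫ z : ℝ, |w (x, z)| := by
        rw [norm_eq_integral_abs]
        exact integral_prod _ i1
      rw [one_mul, h, LinearMap.coe_mk, AddHom.coe_mk, L1.norm_of_fun_eq_integral_norm]
      refine integral_mono (integrable_marginal w).norm i1.integral_prod_left fun x => ?_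
      exact norm_integral_le_integral_norm _

theorem integral_mul_marginal (w : Lp ℝ 1 (volume : Measure (ℝ × ℝ))) {g : ℝ → ℝ}
    (hg : Measurable g) {M : ℝ} (hM : ∀ x, |g x| ≤ M) :
    ∫ x, g x * marginal w x = ∫ p : ℝ × ℝ, g p.1 * w p := by
  have i1 : Integrable (fun p : ℝ × ℝ => g p.1 * w p)
      ((volume : Measure ℝ).prod (volume : Measure ℝ)) :=
    (L1.integrable_coeFn w).bdd_mul (hg.comp measurable_fst).aestronglyMeasurable
      (ae_of_all _ fun p => hM p.1)
  refine Eq.trans ?_ (integral_prod _ i1).symm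
  refine integral_congr_ae ?_
  filter_upwards [Integrable.coeFn_toL1 (integrable_marginal w)] with x hx
  rw [integral_const_mul]
  congr 1

theorem integrable_kernel_tensor {L : ℝ × ℝ → ℝ} {B : ℝ} (hL : Measurable L)
    (hB : ∀ p, |L p| ≤ B) (u v : Lp ℝ 1 (volume : Measure ℝ)) :
    Integrable fun p : ℝ × ℝ => L p * (u p.1 * v p.2) :=
  ((L1.integrable_coeFn u).mul_prod (L1.integrable_coeFn v)).bdd_mul
    hL.aestronglyMeasurable (ae_of_all _ hB)

/-- The bilinear map `(u, v) ↦ L(y, z) u(y) v(z)` on `L¹`, for a bounded kernel `L`. -/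
noncomputable def kernelTensor {L : ℝ × ℝ → ℝ} {B : ℝ} (hL : Measurable L)
    (hB : ∀ p, |L p| ≤ B) :
    Lp ℝ 1 (volume : Measure ℝ) →L[ℝ] Lp ℝ 1 (volume : Measure ℝ) →L[ℝ]
      Lp ℝ 1 (volume : Measure (ℝ × ℝ)) :=
  LinearMap.mkContinuous₂
    (LinearMap.mk₂ ℝ (fun u v => (integrable_kernel_tensor hL hB u v).toL1 _)
      (fun u u' v => by
        rw [← Integrable.toL1_add, Integrable.toL1_eq_toL1_iff]
        filter_upwards [Measure.quasiMeasurePreserving_fst.ae (Lp.coeFn_add u u')] with p hp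
        simp only [Pi.add_apply] at hp ⊢
        rw [hp]; ring)
      (fun c u v => by
        rw [← Integrable.toL1_smul, Integrable.toL1_eq_toL1_iff]
        filter_upwards [Measure.quasiMeasurePreserving_fst.ae (Lp.coeFn_smul c u)] with p hp
        simp only [Pi.smul_apply, smul_eq_mul] at hp ⊢
        rw [hp]; ring)
      (fun u v v' => by
        rw [← Integrable.toL1_add, Integrable.toL1_eq_toL1_iff]
        filter_upwards [Measure.quasiMeasurePreserving_snd.ae (Lp.coeFn_add v v')] with p hp
        simp only [Pi.add_apply] at hp ⊢
        rw [hp]; ring)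
      (fun c u v => by
        rw [← Integrable.toL1_smul, Integrable.toL1_eq_toL1_iff]
        filter_upwards [Measure.quasiMeasurePreserving_snd.ae (Lp.coeFn_smul c v)] with p hp
        simp only [Pi.smul_apply, smul_eq_mul] at hp ⊢
        rw [hp]; ring))
    B fun u v => by
      rw [LinearMap.mk₂_apply, L1.norm_of_fun_eq_integral_norm, norm_eq_integral_abs,
        norm_eq_integral_abs, mul_assoc, ← integral_prod_mul, ← integral_const_mul]
      refine integral_mono (integrable_kernel_tensor hL hB u v).norm
        (((L1.integrable_coeFn u).abs.mul_prod (L1.integrable_coeFn v).abs).const_mul B)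
        fun p => ?_
      simp only [norm_mul, Real.norm_eq_abs]
      exact mul_le_mul_of_nonneg_right (hB p) (by positivity)

theorem coeFn_kernelTensor {L : ℝ × ℝ → ℝ} {B : ℝ} (hL : Measurable L)
    (hB : ∀ p, |L p| ≤ B) (u v : Lp ℝ 1 (volume : Measure ℝ)) :
    kernelTensor hL hB u v =ᵐ[volume] fun p => L p * (u p.1 * v p.2) :=
  Integrable.coeFn_toL1 (integrable_kernel_tensor hL hB u v)

theorem mul_sub_sub_integral {α : Type*} [MeasurableSpace α] {μ : Measure α} {f g h : α → ℝ}
    (hf : Integrable f μ) (hg : Integrable g μ) (hh : Integrable h μ) (c : ℝ) :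
    c * ((∫ x, f x ∂μ) - ∫ x, g x ∂μ) - ∫ x, h x ∂μ = ∫ x, (c * (f x - g x) - h x) ∂μ := by
  rw [← integral_sub hf hg, ← integral_const_mul]
  exact (integral_sub ((hf.sub hg).const_mul c) hh).symm

/-- The adjoint of `g ↦ coagOp ε g`, from `L¹` of the plane to `L¹` of the line. -/
noncomputable def coagAdjoint (ε : ℝ) :
    Lp ℝ 1 (volume : Measure (ℝ × ℝ)) →L[ℝ] Lp ℝ 1 (volume : Measure ℝ) :=
  ε⁻¹ • (marginal.comp (Lp.compMeasurePreservingₗᵢ ℝ (fun p : ℝ × ℝ => (p.1 - ε * p.2, p.2))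
      (measurePreserving_shear ε)).toContinuousLinearMap - marginal) -
    marginal.comp (Lp.compMeasurePreservingₗᵢ ℝ (Prod.swap : ℝ × ℝ → ℝ × ℝ)
      (Measure.measurePreserving_swap (μ := (volume : Measure ℝ))
        (ν := (volume : Measure ℝ)))).toContinuousLinearMap

theorem integral_mul_coagAdjoint (ε : ℝ) (w : Lp ℝ 1 (volume : Measure (ℝ × ℝ))) {g : ℝ → ℝ}
    (hg : Measurable g) {M : ℝ} (hM : ∀ x, |g x| ≤ M) :
    ∫ x, g x * coagAdjoint ε w x = ∫ p : ℝ × ℝ, coagOp ε g p * w p := by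
  set w₁ := Lp.compMeasurePreserving (fun p : ℝ × ℝ => (p.1 - ε * p.2, p.2))
      (measurePreserving_shear ε) w with hw₁
  set w₂ := Lp.compMeasurePreserving (Prod.swap : ℝ × ℝ → ℝ × ℝ)
      (Measure.measurePreserving_swap (μ := (volume : Measure ℝ))
        (ν := (volume : Measure ℝ))) w with hw₂
  have e1 : coagAdjoint ε w = ε⁻¹ • (marginal w₁ - marginal w) - marginal w₂ := rfl
  have i : ∀ (v : Lp ℝ 1 (volume : Measure ℝ)), Integrable fun x => g x * v x := fun v =>
    (L1.integrable_coeFn v).bdd_mul hg.aestronglyMeasurable (ae_of_all _ hM)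
  have e2 : ∫ x, g x * coagAdjoint ε w x = ε⁻¹ * ((∫ x, g x * marginal w₁ x) -
      ∫ x, g x * marginal w x) - ∫ x, g x * marginal w₂ x := by
    rw [mul_sub_sub_integral (i _) (i _) (i _), e1]
    refine integral_congr_ae ?_
    filter_upwards [Lp.coeFn_sub (ε⁻¹ • (marginal w₁ - marginal w)) (marginal w₂),
      Lp.coeFn_smul ε⁻¹ (marginal w₁ - marginal w), Lp.coeFn_sub (marginal w₁) (marginal w)]
      with x h1 h2 h3
    rw [h1, Pi.sub_apply, h2, Pi.smul_apply, h3, Pi.sub_apply, smul_eq_mul]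
    ring
  have j : ∀ h : ℝ × ℝ → ℝ, Measurable h → Integrable fun p => g (h p) * w p := fun h hh =>
    (L1.integrable_coeFn w).bdd_mul (hg.comp hh).aestronglyMeasurable
      (ae_of_all _ fun p => hM (h p))
  have f1 : ∫ p : ℝ × ℝ, g p.1 * w₁ p = ∫ p : ℝ × ℝ, g (p.1 + ε * p.2) * w p := by
    refine Eq.trans ?_ ((measurePreserving_shear ε).integral_comp (measurableEmbedding_shear ε)
      (fun p : ℝ × ℝ => g (p.1 + ε * p.2) * w p))
    refine integral_congr_ae ?_
    filter_upwards [Lp.coeFn_compMeasurePreserving w (measurePreserving_shear ε)] with p hp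
    rw [hw₁, hp]
    simp
  have f2 : ∫ p : ℝ × ℝ, g p.1 * w₂ p = ∫ p : ℝ × ℝ, g p.2 * w p := by
    have hs := Measure.measurePreserving_swap (μ := (volume : Measure ℝ))
        (ν := (volume : Measure ℝ))
    refine Eq.trans ?_ (hs.integral_comp MeasurableEquiv.prodComm.measurableEmbedding
      (fun p : ℝ × ℝ => g p.2 * w p))
    refine integral_congr_ae ?_
    filter_upwards [Lp.coeFn_compMeasurePreserving w hs] with p hp
    rw [hw₂, hp]
    rfl
  rw [e2, integral_mul_marginal _ hg hM, integral_mul_marginal _ hg hM,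
    integral_mul_marginal _ hg hM, f1, f2,
    mul_sub_sub_integral (j (fun p => p.1 + ε * p.2) (by fun_prop)) (j (fun p => p.1) (by fun_prop))
      (j (fun p => p.2) (by fun_prop))]
  refine integral_congr_ae (ae_of_all _ fun p => ?_)
  simp only [coagOp]
  ring

/-- The weak form of the collision operator `coagAdjoint ε (kernelTensor u u)`. -/
theorem integral_mul_coagAdjoint_kernelTensor {L : ℝ × ℝ → ℝ} {B : ℝ} (hL : Measurable L)
    (hB : ∀ p, |L p| ≤ B) (ε : ℝ) (u : Lp ℝ 1 (volume : Measure ℝ)) {g : ℝ → ℝ}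
    (hg : Measurable g) {M : ℝ} (hM : ∀ x, |g x| ≤ M) :
    ∫ x, g x * coagAdjoint ε (kernelTensor hL hB u u) x = coagRate ε L g u := by
  rw [integral_mul_coagAdjoint ε _ hg hM]
  refine integral_congr_ae ?_
  filter_upwards [coeFn_kernelTensor hL hB u u] with p hp
  rw [hp]; ring

/-! ### Global solutions of ordinary differential equations in Banach spaces -/

/-- Radial projection onto a ball is Lipschitz. -/
theorem norm_radial_sub_radial_le {E : Type*} [NormedAddCommGroup E] [NormedSpace ℝ E] {ρ : ℝ}
    (hρ : 0 < ρ) (u v : E) :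
    ‖(ρ / max ρ ‖u‖) • u - (ρ / max ρ ‖v‖) • v‖ ≤ 2 * ‖u - v‖ := by
  have hu : 0 < max ρ ‖u‖ := lt_max_of_lt_left hρ
  have hv : 0 < max ρ ‖v‖ := lt_max_of_lt_left hρ
  have e : (ρ / max ρ ‖u‖) • u - (ρ / max ρ ‖v‖) • v =
      (ρ / max ρ ‖u‖) • (u - v) + (ρ / max ρ ‖u‖ - ρ / max ρ ‖v‖) • v := by
    rw [smul_sub, sub_smul]; abel
  have h1 : ‖(ρ / max ρ ‖u‖) • (u - v)‖ ≤ ‖u - v‖ := by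
    rw [norm_smul, Real.norm_of_nonneg (by positivity)]
    exact mul_le_of_le_one_left (norm_nonneg _) ((div_le_one hu).2 (le_max_left _ _))
  have h2 : ‖(ρ / max ρ ‖u‖ - ρ / max ρ ‖v‖) • v‖ ≤ ‖u - v‖ := by
    have h3 : ρ / max ρ ‖u‖ - ρ / max ρ ‖v‖ =
        ρ / max ρ ‖u‖ * ((max ρ ‖v‖ - max ρ ‖u‖) / max ρ ‖v‖) := by
      field_simp
    have h4 : |max ρ ‖v‖ - max ρ ‖u‖| ≤ ‖u - v‖ := by
      rw [abs_sub_comm, max_comm ρ, max_comm ρ]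
      exact (abs_max_sub_max_le_abs _ _ _).trans (abs_norm_sub_norm_le u v)
    rw [norm_smul, h3, Real.norm_eq_abs, abs_mul,
      abs_of_nonneg (show 0 ≤ ρ / max ρ ‖u‖ by positivity), abs_div, abs_of_pos hv, mul_assoc]
    refine (mul_le_of_le_one_left (by positivity) ((div_le_one hu).2 (le_max_left _ _))).trans ?_
    rw [div_mul_eq_mul_div, div_le_iff₀ hv]
    exact mul_le_mul h4 (le_max_right _ _) (norm_nonneg _) (norm_nonneg _)
  rw [e]
  linarith [norm_add_le ((ρ / max ρ ‖u‖) • (u - v)) ((ρ / max ρ ‖u‖ - ρ / max ρ ‖v‖) • v)]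

/-- Global solvability of `u' + a u = P u` for a bounded and Lipschitz map `P`, written for
`v t = exp (a t) • u t`. -/
theorem exists_forall_hasDerivWithinAt_exp_smul {E : Type*} [NormedAddCommGroup E]
    [NormedSpace ℝ E] [CompleteSpace E] {P : E → E} {K : NNReal} (hP : LipschitzWith K P)
    {M : NNReal} (hM : ∀ x, ‖P x‖ ≤ M) {a : ℝ} (ha : 0 ≤ a) (x₀ : E) :
    ∃ v : ℝ → E, v 0 = x₀ ∧ ∀ t, 0 ≤ t →
      HasDerivWithinAt v (Real.exp (a * t) • P (Real.exp (-(a * t)) • v t)) (Ici 0) t := by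
  set F : ℝ → E → E := fun t x => Real.exp (a * t) • P (Real.exp (-(a * t)) • x) with hF
  have hlip : ∀ t, LipschitzWith K (F t) := fun t => by
    refine LipschitzWith.of_dist_le_mul fun x y => ?_
    have h1 := hP.dist_le_mul (Real.exp (-(a * t)) • x) (Real.exp (-(a * t)) • y)
    rw [dist_smul₀, Real.norm_of_nonneg (Real.exp_pos _).le] at h1
    simp only [hF]
    rw [dist_smul₀, Real.norm_of_nonneg (Real.exp_pos _).le]
    calc _ ≤ Real.exp (a * t) * (K * (Real.exp (-(a * t)) * dist x y)) := by gcongr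
      _ = (Real.exp (a * t) * Real.exp (-(a * t))) * (K * dist x y) := by ring
      _ = _ := by rw [← Real.exp_add, add_neg_cancel, Real.exp_zero, one_mul]
  have hcont : ∀ x, Continuous fun t => F t x := fun x => by
    have := hP.continuous
    simp only [hF]
    fun_prop
  have hex : ∀ n : ℕ, ∃ w : ℝ → E, w 0 = x₀ ∧
      ∀ t ∈ Icc (0 : ℝ) n, HasDerivWithinAt w (F t (w t)) (Icc 0 n) t := fun n => by
    let c : NNReal := ⟨Real.exp (a * n), (Real.exp_pos _).le⟩
    have hPL : IsPicardLindelof F (tmin := 0) (tmax := n)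
        ⟨0, left_mem_Icc.2 (Nat.cast_nonneg n)⟩ x₀ (c * M * n) 0 (c * M) K :=
      { lipschitzOnWith := fun t _ => (hlip t).lipschitzOnWith
        continuousOn := fun x _ => (hcont x).continuousOn
        norm_le := fun t ht x _ => by
          simp only [hF]
          rw [norm_smul, Real.norm_of_nonneg (Real.exp_pos _).le, NNReal.coe_mul]
          refine mul_le_mul ?_ (hM _) (norm_nonneg _) c.2
          exact Real.exp_le_exp.2 (mul_le_mul_of_nonneg_left ht.2 ha)
        mul_max_le := by simp }
    exact hPL.exists_eq_forall_mem_Icc_hasDerivWithinAt₀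
  choose w hw0 hw using hex
  -- solutions on different intervals agree on the smaller one
  have huniq : ∀ m n : ℕ, m ≤ n → EqOn (w m) (w n) (Icc 0 m) := fun m n hmn => by
    have hmn' : (m : ℝ) ≤ n := by exact_mod_cast hmn
    have hn : ∀ t ∈ Icc (0 : ℝ) m, HasDerivWithinAt (w n) (F t (w n t)) (Icc 0 m) t :=
      fun t ht => (hw n t ⟨ht.1, ht.2.trans hmn'⟩).mono (Icc_subset_Icc_right hmn')
    refine ODE_solution_unique_of_mem_Icc_right (v := F) (s := fun _ => univ) (K := K)
      (fun t _ => (hlip t).lipschitzOnWith)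
      (fun t ht => (hw m t ht).continuousWithinAt) (fun t ht => ?_) (fun _ _ => mem_univ _)
      (fun t ht => (hn t ht).continuousWithinAt) (fun t ht => ?_) (fun _ _ => mem_univ _)
      ((hw0 m).trans (hw0 n).symm)
    · exact (hw m t ⟨ht.1, ht.2.le⟩).mono_of_mem_nhdsWithin
        (mem_of_superset (Icc_mem_nhdsGE_of_mem ⟨le_rfl, ht.2⟩) (Icc_subset_Icc_left ht.1))
    · exact (hn t ⟨ht.1, ht.2.le⟩).mono_of_mem_nhdsWithin
        (mem_of_superset (Icc_mem_nhdsGE_of_mem ⟨le_rfl, ht.2⟩) (Icc_subset_Icc_left ht.1))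
  refine ⟨fun t => w ⌈t⌉₊ t, hw0 _, fun t ht => ?_⟩
  obtain ⟨n, hn⟩ := exists_nat_gt t
  have heq : ∀ s ∈ Icc (0 : ℝ) n, w ⌈s⌉₊ s = w n s := fun s hs =>
    huniq _ _ (Nat.ceil_le.2 hs.2) ⟨hs.1, Nat.le_ceil s⟩
  have h1 : HasDerivWithinAt (fun s => w ⌈s⌉₊ s) (F t (w n t)) (Icc 0 n) t :=
    (hw n t ⟨ht, hn.le⟩).congr heq (heq t ⟨ht, hn.le⟩)
  rw [← heq t ⟨ht, hn.le⟩] at h1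
  refine h1.mono_of_mem_nhdsWithin ?_
  rw [← Ici_inter_Iic]
  exact inter_mem self_mem_nhdsWithin (mem_nhdsWithin_of_mem_nhds (Iic_mem_nhds hn))

/-! ### Flows in `L¹` for a bounded kernel -/

theorem integrable_mul_coeFn {g : ℝ → ℝ} (hg : Measurable g) {M : ℝ} (hM : ∀ x, |g x| ≤ M)
    (u : Lp ℝ 1 (volume : Measure ℝ)) : Integrable fun x => g x * u x :=
  integrable_bdd_mul' (L1.integrable_coeFn u) hg hM

/-- The continuous linear functional on `L¹` given by a bounded measurable function. -/
noncomputable def integralMul {g : ℝ → ℝ} (hg : Measurable g) {M : ℝ} (hM : ∀ x, |g x| ≤ M) :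
    Lp ℝ 1 (volume : Measure ℝ) →L[ℝ] ℝ :=
  LinearMap.mkContinuous
    { toFun := fun u => ∫ x, g x * u x
      map_add' := fun u v => by
        rw [← integral_add (integrable_mul_coeFn hg hM u) (integrable_mul_coeFn hg hM v)]
        refine integral_congr_ae ?_
        filter_upwards [Lp.coeFn_add u v] with x hx
        rw [hx, Pi.add_apply, mul_add]
      map_smul' := fun c u => by
        rw [RingHom.id_apply, smul_eq_mul, ← integral_const_mul]
        refine integral_congr_ae ?_
        filter_upwards [Lp.coeFn_smul c u] with x hx
        rw [hx, Pi.smul_apply, smul_eq_mul]; ring }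
    M fun u => by
      rw [norm_eq_integral_abs, ← integral_const_mul]
      refine norm_integral_le_of_norm_le ((L1.integrable_coeFn u).abs.const_mul M)
        (ae_of_all _ fun x => ?_)
      rw [norm_mul]
      exact mul_le_mul_of_nonneg_right (hM x) (abs_nonneg _)

theorem integralMul_apply {g : ℝ → ℝ} (hg : Measurable g) {M : ℝ} (hM : ∀ x, |g x| ≤ M)
    (u : Lp ℝ 1 (volume : Measure ℝ)) : integralMul hg hM u = ∫ x, g x * u x := rfl

theorem abs_indicator_one_le (A : Set ℝ) (x : ℝ) : |A.indicator (fun _ => (1 : ℝ)) x| ≤ 1 := by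
  by_cases h : x ∈ A <;> simp [h]

theorem integral_indicator_one_mul {A : Set ℝ} (hA : MeasurableSet A) (u : ℝ → ℝ) :
    ∫ x, A.indicator (fun _ => (1 : ℝ)) x * u x = ∫ x in A, u x := by
  rw [← integral_indicator hA]
  refine integral_congr_ae (ae_of_all _ fun x => ?_)
  by_cases h : x ∈ A <;> simp [h]

theorem ae_nonneg_mul_tensor {r : ℝ → ℝ} (h0 : 0 ≤ᵐ[volume] r) :
    ∀ᵐ p : ℝ × ℝ, 0 ≤ r p.1 ∧ 0 ≤ r p.2 := by
  filter_upwards [Measure.quasiMeasurePreserving_fst.ae h0,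
    Measure.quasiMeasurePreserving_snd.ae h0] with p h1 h2
  exact ⟨h1, h2⟩

theorem integrable_coagRate_integrand {L : ℝ × ℝ → ℝ} {B : ℝ} (hL : Measurable L)
    (hB : ∀ p, |L p| ≤ B) {ε : ℝ} (hε : 0 < ε) {g : ℝ → ℝ} (hg : Measurable g) {M : ℝ}
    (hM : ∀ x, |g x| ≤ M) {r : ℝ → ℝ} (hr : Integrable r) :
    Integrable fun p : ℝ × ℝ => coagOp ε g p * L p * (r p.1 * r p.2) := by
  refine (hr.mul_prod hr).bdd_mul (c := (2 / ε + 1) * M * B)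
    ((measurable_coagOp ε hg).mul hL).aestronglyMeasurable (ae_of_all _ fun p => ?_)
  rw [norm_mul]
  exact mul_le_mul (abs_coagOp_le hε hM p) (hB p) (abs_nonneg _)
    ((abs_nonneg _).trans (abs_coagOp_le hε hM p))

theorem coagRate_nonpos {k σ η ε : ℝ} {L : ℝ × ℝ → ℝ} (hL : IsReducedKernel k σ η L)
    {g r : ℝ → ℝ} (h0 : 0 ≤ᵐ[volume] r)
    (hg : ∀ p : ℝ × ℝ, 0 < p.2 → p.2 < p.1 → coagOp ε g p ≤ 0) : coagRate ε L g r ≤ 0 := by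
  refine integral_nonpos_of_ae ?_
  filter_upwards [ae_nonneg_mul_tensor h0] with p hp
  refine mul_nonpos_of_nonpos_of_nonneg ?_ (mul_nonneg hp.1 hp.2)
  by_cases h : 0 < p.2 ∧ p.2 < p.1
  · exact mul_nonpos_of_nonpos_of_nonneg (hg p h.1 h.2) (hL.nonneg p)
  · rw [hL.eq_zero p h, mul_zero]

theorem coagRate_congr {ε : ℝ} {L : ℝ × ℝ → ℝ} {g u v : ℝ → ℝ} (h : u =ᵐ[volume] v) :
    coagRate ε L g u = coagRate ε L g v := by
  refine integral_congr_ae ?_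
  filter_upwards [Measure.quasiMeasurePreserving_fst.ae h,
    Measure.quasiMeasurePreserving_snd.ae h] with p h1 h2
  rw [h1, h2]

/-- The loss term of the collision operator is at most a multiple of the density. -/
theorem neg_le_coagRate_indicator {L : ℝ × ℝ → ℝ} {B : ℝ} (hL : Measurable L)
    (hL0 : ∀ p, 0 ≤ L p) (hB : ∀ p, L p ≤ B) {ε : ℝ} (hε : 0 < ε) {r : ℝ → ℝ}
    (hr : Integrable r) (h0 : 0 ≤ᵐ[volume] r) {A : Set ℝ} (hA : MeasurableSet A) :
    -((1 / ε + 1) * B * (∫ x, r x) * ∫ x in A, r x) ≤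
      coagRate ε L (A.indicator fun _ => 1) r := by
  have hm : Measurable (A.indicator fun _ : ℝ => (1 : ℝ)) := measurable_const.indicator hA
  have hB' : ∀ p, |L p| ≤ B := fun p => by rw [abs_of_nonneg (hL0 p)]; exact hB p
  have hAr := integrable_bdd_mul' hr hm (abs_indicator_one_le A)
  have h1 : -((1 / ε + 1) * B * (∫ x, r x) * ∫ x in A, r x) =
      ∫ p : ℝ × ℝ, (-(B / ε) * ((A.indicator (fun _ => (1 : ℝ)) p.1 * r p.1) * r p.2) +
        -B * (r p.1 * (A.indicator (fun _ => (1 : ℝ)) p.2 * r p.2))) := by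
    have e1 := integral_prod_mul (μ := (volume : Measure ℝ)) (ν := (volume : Measure ℝ))
      (fun x => A.indicator (fun _ => (1 : ℝ)) x * r x) r
    have e2 := integral_prod_mul (μ := (volume : Measure ℝ)) (ν := (volume : Measure ℝ))
      r (fun x => A.indicator (fun _ => (1 : ℝ)) x * r x)
    rw [Measure.volume_eq_prod, integral_add ((hAr.mul_prod hr).const_mul _)
      ((hr.mul_prod hAr).const_mul _), integral_const_mul, integral_const_mul, e1, e2,
      integral_indicator_one_mul hA]
    ring
  rw [h1]
  refine integral_mono_ae (((hAr.mul_prod hr).const_mul _).add ((hr.mul_prod hAr).const_mul _))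
    (integrable_coagRate_integrand hL hB' hε hm (abs_indicator_one_le A) hr) ?_
  filter_upwards [ae_nonneg_mul_tensor h0] with p hp
  have hi : ∀ x, 0 ≤ A.indicator (fun _ => (1 : ℝ)) x := fun x =>
    indicator_nonneg (fun _ _ => zero_le_one) x
  have h2 : -(A.indicator (fun _ => (1 : ℝ)) p.1 / ε + A.indicator (fun _ => (1 : ℝ)) p.2) ≤
      coagOp ε (A.indicator fun _ => 1) p := by
    unfold coagOp
    have : 0 ≤ A.indicator (fun _ => (1 : ℝ)) (p.1 + ε * p.2) / ε := div_nonneg (hi _) hε.le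
    rw [sub_div]; linarith
  have h3 : -(A.indicator (fun _ => (1 : ℝ)) p.1 / ε + A.indicator (fun _ => (1 : ℝ)) p.2) * B ≤
      coagOp ε (A.indicator fun _ => 1) p * L p := by
    have h4 : 0 ≤ A.indicator (fun _ => (1 : ℝ)) p.1 / ε + A.indicator (fun _ => (1 : ℝ)) p.2 :=
      add_nonneg (div_nonneg (hi _) hε.le) (hi _)
    have h5 := mul_le_mul_of_nonneg_right h2 (hL0 p)
    have h6 := mul_le_mul_of_nonneg_left (hB p) h4
    linarith
  have h7 := mul_le_mul_of_nonneg_right h3 (mul_nonneg hp.1 hp.2)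
  refine le_trans (le_of_eq ?_) h7
  ring

/-- The absolute value of a function in `L¹`, projected radially onto the ball of radius `ρ`. -/
noncomputable def capAbs (ρ : ℝ) (u : Lp ℝ 1 (volume : Measure ℝ)) :
    Lp ℝ 1 (volume : Measure ℝ) := (ρ / max ρ ‖|u|‖) • |u|

theorem norm_capAbs_le {ρ : ℝ} (hρ : 0 < ρ) (u : Lp ℝ 1 (volume : Measure ℝ)) :
    ‖capAbs ρ u‖ ≤ ρ := by
  have h : 0 < max ρ ‖|u|‖ := lt_max_of_lt_left hρ
  rw [capAbs, norm_smul, Real.norm_of_nonneg (by positivity), div_mul_eq_mul_div, div_le_iff₀ h]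
  exact mul_le_mul_of_nonneg_left (le_max_right _ _) hρ.le

theorem norm_capAbs_sub_le {ρ : ℝ} (hρ : 0 < ρ) (u v : Lp ℝ 1 (volume : Measure ℝ)) :
    ‖capAbs ρ u - capAbs ρ v‖ ≤ 2 * ‖u - v‖ :=
  (norm_radial_sub_radial_le hρ _ _).trans
    (mul_le_mul_of_nonneg_left (norm_abs_sub_abs u v) zero_le_two)

theorem coeFn_capAbs (ρ : ℝ) (u : Lp ℝ 1 (volume : Measure ℝ)) :
    capAbs ρ u =ᵐ[volume] fun x => ρ / max ρ ‖|u|‖ * |u x| := by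
  filter_upwards [Lp.coeFn_smul (ρ / max ρ ‖|u|‖) |u|, Lp.coeFn_abs u] with x h1 h2
  rw [capAbs, h1, Pi.smul_apply, h2, smul_eq_mul]

theorem capAbs_nonneg {ρ : ℝ} (hρ : 0 < ρ) (u : Lp ℝ 1 (volume : Measure ℝ)) :
    0 ≤ᵐ[volume] capAbs ρ u := by
  filter_upwards [coeFn_capAbs ρ u] with x hx
  rw [hx]
  have h : 0 < max ρ ‖|u|‖ := lt_max_of_lt_left hρ
  show (0 : ℝ) ≤ _
  positivity

theorem capAbs_le {ρ : ℝ} (hρ : 0 < ρ) {u : Lp ℝ 1 (volume : Measure ℝ)} (h0 : 0 ≤ᵐ[volume] u) :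
    capAbs ρ u ≤ᵐ[volume] u := by
  filter_upwards [coeFn_capAbs ρ u, h0] with x hx h0
  have h : 0 < max ρ ‖|u|‖ := lt_max_of_lt_left hρ
  rw [hx, abs_of_nonneg h0]
  exact mul_le_of_le_one_left h0 ((div_le_one h).2 (le_max_left _ _))

theorem capAbs_eq_self {ρ : ℝ} (hρ : 0 < ρ) {u : Lp ℝ 1 (volume : Measure ℝ)}
    (h0 : 0 ≤ᵐ[volume] u) (hu : ‖u‖ ≤ ρ) : capAbs ρ u = u := by
  have h1 : |u| = u := abs_of_nonneg ((Lp.coeFn_nonneg u).1 h0)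
  rw [capAbs, h1, max_eq_left hu, div_self hρ.ne', one_smul]

theorem norm_eq_integral_of_nonneg {u : Lp ℝ 1 (volume : Measure ℝ)} (h0 : 0 ≤ᵐ[volume] u) :
    ‖u‖ = ∫ x, u x := by
  rw [norm_eq_integral_abs]
  refine integral_congr_ae ?_
  filter_upwards [h0] with x hx
  exact abs_of_nonneg hx

theorem norm_bilinear_self_sub_le {E F : Type*} [NormedAddCommGroup E] [NormedSpace ℝ E]
    [NormedAddCommGroup F] [NormedSpace ℝ F] (b : E →L[ℝ] E →L[ℝ] F) {ρ : ℝ} {x y : E}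
    (hx : ‖x‖ ≤ ρ) (hy : ‖y‖ ≤ ρ) : ‖b x x - b y y‖ ≤ 2 * ‖b‖ * ρ * ‖x - y‖ := by
  have e : b x x - b y y = b x (x - y) + b (x - y) y := by
    rw [map_sub, map_sub, sub_apply]; abel
  have h1 := b.le_opNorm₂ x (x - y)
  have h2 := b.le_opNorm₂ (x - y) y
  have h3 : ‖b‖ * ‖x‖ * ‖x - y‖ ≤ ‖b‖ * ρ * ‖x - y‖ := by gcongr
  have h4 : ‖b‖ * ‖x - y‖ * ‖y‖ ≤ ‖b‖ * ‖x - y‖ * ρ := by gcongr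
  rw [e]
  linarith [norm_add_le (b x (x - y)) (b (x - y) y)]

/-- The collision operator `u ↦ coagAdjoint ε (L u ⊗ u)` on `L¹`, for a bounded kernel `L`. -/
noncomputable def collision {L : ℝ × ℝ → ℝ} {B : ℝ} (hL : Measurable L) (hB : ∀ p, |L p| ≤ B)
    (ε : ℝ) (u : Lp ℝ 1 (volume : Measure ℝ)) : Lp ℝ 1 (volume : Measure ℝ) :=
  (ContinuousLinearMap.compL ℝ _ _ _ (coagAdjoint ε)).comp (kernelTensor hL hB) u u

theorem integralMul_collision {L : ℝ × ℝ → ℝ} {B : ℝ} (hL : Measurable L) (hB : ∀ p, |L p| ≤ B)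
    (ε : ℝ) (u : Lp ℝ 1 (volume : Measure ℝ)) {g : ℝ → ℝ} (hg : Measurable g) {M : ℝ}
    (hM : ∀ x, |g x| ≤ M) : integralMul hg hM (collision hL hB ε u) = coagRate ε L g u :=
  integral_mul_coagAdjoint_kernelTensor hL hB ε u hg hM

theorem continuous_collision {L : ℝ × ℝ → ℝ} {B : ℝ} (hL : Measurable L) (hB : ∀ p, |L p| ≤ B)
    (ε : ℝ) : Continuous (collision hL hB ε) := by
  unfold collision
  fun_prop

/-- A decomposition `collision u = P u - a u` on the nonnegative functions in a ball, where `P` is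
nonnegative, bounded and Lipschitz. -/
theorem exists_collision_decomposition {k σ η ε B ρ : ℝ} {L : ℝ × ℝ → ℝ}
    (hL : IsReducedKernel k σ η L) (hB : ∀ p, L p ≤ B) (hB' : ∀ p, |L p| ≤ B) (hε : 0 < ε)
    (hρ : 0 < ρ) :
    ∃ (a : ℝ) (P : Lp ℝ 1 (volume : Measure ℝ) → Lp ℝ 1 (volume : Measure ℝ)) (K M : NNReal),
      0 ≤ a ∧ LipschitzWith K P ∧ (∀ u, ‖P u‖ ≤ M) ∧ (∀ u, 0 ≤ᵐ[volume] P u) ∧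
      (∀ u : Lp ℝ 1 (volume : Measure ℝ), 0 ≤ᵐ[volume] u → ∫ x, P u x ≤ a * ∫ x, u x) ∧
      ∀ u : Lp ℝ 1 (volume : Measure ℝ), 0 ≤ᵐ[volume] u → ‖u‖ ≤ ρ →
        P u - a • u = collision hL.measurable hB' ε u := by
  have hB0 : 0 ≤ B := (hL.nonneg 0).trans (hB 0)
  set a : ℝ := (1 / ε + 1) * B * ρ with ha
  have ha0 : 0 ≤ a := by positivity
  set b := (ContinuousLinearMap.compL ℝ (Lp ℝ 1 (volume : Measure ℝ)) _ _
    (coagAdjoint ε)).comp (kernelTensor hL.measurable hB') with hb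
  set P : Lp ℝ 1 (volume : Measure ℝ) → Lp ℝ 1 (volume : Measure ℝ) := fun u =>
    a • capAbs ρ u + collision hL.measurable hB' ε (capAbs ρ u) with hP
  have hpair : ∀ (u : Lp ℝ 1 (volume : Measure ℝ)) {g : ℝ → ℝ} (hg : Measurable g)
      (hM : ∀ x, |g x| ≤ 1), ∫ x, g x * P u x =
        a * (∫ x, g x * capAbs ρ u x) + coagRate ε L g (capAbs ρ u) := fun u g hg hM => by
    rw [← integralMul_apply hg hM, ← integralMul_apply hg hM,
      ← integralMul_collision hL.measurable hB' ε _ hg hM, hP, map_add, map_smul, smul_eq_mul]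
  refine ⟨a, P, ⟨2 * a + 4 * ‖b‖ * ρ, by positivity⟩, ⟨a * ρ + ‖b‖ * ρ * ρ, by positivity⟩, ha0,
    LipschitzWith.of_dist_le_mul fun u v => ?_, fun u => ?_, fun u => ?_, fun u hu => ?_,
    fun u hu hn => ?_⟩
  · rw [dist_eq_norm, dist_eq_norm]
    have e : P u - P v = a • (capAbs ρ u - capAbs ρ v) +
        (b (capAbs ρ u) (capAbs ρ u) - b (capAbs ρ v) (capAbs ρ v)) := by
      simp only [hP, hb, collision, smul_sub]; abel
    have h1 := norm_capAbs_sub_le hρ u v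
    have h2 := norm_bilinear_self_sub_le b (norm_capAbs_le hρ u) (norm_capAbs_le hρ v)
    have h3 : ‖a • (capAbs ρ u - capAbs ρ v)‖ ≤ a * (2 * ‖u - v‖) := by
      rw [norm_smul, Real.norm_of_nonneg ha0]
      gcongr
    have h4 : 2 * ‖b‖ * ρ * ‖capAbs ρ u - capAbs ρ v‖ ≤ 2 * ‖b‖ * ρ * (2 * ‖u - v‖) := by
      gcongr
    rw [e]
    refine (norm_add_le _ _).trans ((add_le_add h3 (h2.trans h4)).trans (le_of_eq ?_))
    change _ = (2 * a + 4 * ‖b‖ * ρ) * ‖u - v‖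
    ring
  · have h1 := norm_capAbs_le hρ u
    have h2 : ‖a • capAbs ρ u‖ ≤ a * ρ := by
      rw [norm_smul, Real.norm_of_nonneg ha0]
      gcongr
    have h3 : ‖collision hL.measurable hB' ε (capAbs ρ u)‖ ≤ ‖b‖ * ρ * ρ :=
      (b.le_opNorm₂ _ _).trans (by gcongr)
    exact (norm_add_le _ _).trans (add_le_add h2 h3)
  · refine ae_nonneg_of_forall_setIntegral_nonneg (L1.integrable_coeFn _) fun A hA _ => ?_
    have h0 := capAbs_nonneg hρ u
    have h1 : ∫ x, capAbs ρ u x ≤ ρ := by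
      rw [← norm_eq_integral_of_nonneg h0]
      exact norm_capAbs_le hρ u
    have h2 : 0 ≤ ∫ x in A, capAbs ρ u x :=
      integral_nonneg_of_ae (ae_restrict_of_ae h0)
    have h3 := neg_le_coagRate_indicator hL.measurable hL.nonneg hB hε
      (L1.integrable_coeFn (capAbs ρ u)) h0 hA
    have h4 : (1 / ε + 1) * B * (∫ x, capAbs ρ u x) * (∫ x in A, capAbs ρ u x) ≤
        a * ∫ x in A, capAbs ρ u x := by
      rw [ha]; gcongr
    rw [← integral_indicator_one_mul hA,
      hpair u (measurable_const.indicator hA) (abs_indicator_one_le A),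
      integral_indicator_one_mul hA]
    linarith
  · have h1 := hpair u (g := fun _ => 1) measurable_const (fun _ => by simp)
    simp only [one_mul] at h1
    have h2 : coagRate ε L (fun _ => 1) (capAbs ρ u) ≤ 0 :=
      coagRate_nonpos hL (capAbs_nonneg hρ u) fun p _ _ => by simp [coagOp]
    have h3 : ∫ x, capAbs ρ u x ≤ ∫ x, u x :=
      integral_mono_ae (L1.integrable_coeFn _) (L1.integrable_coeFn _) (capAbs_le hρ hu)
    have h4 := mul_le_mul_of_nonneg_left h3 ha0
    linarith
  · simp only [hP]
    rw [capAbs_eq_self hρ hu hn, add_sub_cancel_left]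

/-- Global existence in `L¹` for a bounded kernel. -/
theorem exists_hasDerivWithinAt_collision {k σ η ε B : ℝ} {L : ℝ × ℝ → ℝ}
    (hL : IsReducedKernel k σ η L) (hB : ∀ p, L p ≤ B) (hB' : ∀ p, |L p| ≤ B) (hε : 0 < ε)
    {u₀ : Lp ℝ 1 (volume : Measure ℝ)} (h0 : 0 ≤ᵐ[volume] u₀) :
    ∃ u : ℝ → Lp ℝ 1 (volume : Measure ℝ), u 0 = u₀ ∧ (∀ t, 0 ≤ t → 0 ≤ᵐ[volume] u t) ∧
      ∀ t, 0 ≤ t → HasDerivWithinAt u (collision hL.measurable hB' ε (u t)) (Ici 0) t := by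
  have hρ : 0 < ‖u₀‖ + 1 := by positivity
  obtain ⟨a, P, K, M, ha, hPK, hPM, hP0, hPint, hPeq⟩ :=
    exists_collision_decomposition hL hB hB' hε hρ
  obtain ⟨v, hv0, hv⟩ := exists_forall_hasDerivWithinAt_exp_smul hPK hPM ha u₀
  have hvc : ContinuousOn v (Ici 0) := fun t ht => (hv t ht).continuousWithinAt
  set u : ℝ → Lp ℝ 1 (volume : Measure ℝ) := fun t => Real.exp (-(a * t)) • v t with hu
  have hu0 : u 0 = u₀ := by simp [hu, hv0]
  have hud : ∀ t, 0 ≤ t → HasDerivWithinAt u (P (u t) - a • u t) (Ici 0) t := fun t ht => by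
    have h1 : HasDerivAt (fun t : ℝ => Real.exp (-(a * t))) (Real.exp (-(a * t)) * -(a * 1)) t :=
      (((hasDerivAt_id t).const_mul a).neg).exp
    have h2 := h1.hasDerivWithinAt (s := Ici 0) |>.smul (hv t ht)
    have h3 : Real.exp (-(a * t)) • Real.exp (a * t) • P (Real.exp (-(a * t)) • v t) +
        (Real.exp (-(a * t)) * -(a * 1)) • v t = P (u t) - a • u t := by
      rw [smul_smul, ← Real.exp_add, neg_add_cancel, Real.exp_zero, one_smul, mul_one, mul_neg,
        neg_smul, mul_comm (Real.exp _) a, mul_smul, sub_eq_add_neg]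
    rw [h3] at h2
    exact h2
  have hderiv : ∀ {w w' : ℝ → Lp ℝ 1 (volume : Measure ℝ)},
      (∀ t, 0 ≤ t → HasDerivWithinAt w (w' t) (Ici 0) t) → ∀ {g : ℝ → ℝ} (hg : Measurable g)
      (hM : ∀ x, |g x| ≤ 1), ContinuousOn (fun t => ∫ x, g x * w t x) (Ici 0) ∧
        ∀ t ∈ interior (Ici (0 : ℝ)), HasDerivWithinAt (fun t => ∫ x, g x * w t x)
          (∫ x, g x * w' t x) (interior (Ici 0)) t := fun {w w'} hw g hg hM => by
    have h1 : ∀ t, 0 ≤ t → HasDerivWithinAt (fun t => ∫ x, g x * w t x)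
        (∫ x, g x * w' t x) (Ici 0) t := fun t ht =>
      (integralMul hg hM).hasFDerivAt.comp_hasDerivWithinAt t (hw t ht)
    exact ⟨fun t ht => (h1 t ht).continuousWithinAt, fun t ht =>
      (h1 t (interior_subset ht)).mono interior_subset⟩
  -- `v` increases, hence stays nonnegative
  have hvn : ∀ t, 0 ≤ t → 0 ≤ᵐ[volume] v t := fun t ht => by
    refine ae_nonneg_of_forall_setIntegral_nonneg (L1.integrable_coeFn _) fun A hA _ => ?_
    obtain ⟨h1, h2⟩ := hderiv hv (g := A.indicator fun _ => 1) (measurable_const.indicator hA)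
      (abs_indicator_one_le A)
    have h3 := monotoneOn_of_hasDerivWithinAt_nonneg (convex_Ici 0) h1 h2 fun s _ => by
      rw [integral_indicator_one_mul hA]
      refine integral_nonneg_of_ae (ae_restrict_of_ae ?_)
      filter_upwards [hP0 (Real.exp (-(a * s)) • v s), Lp.coeFn_smul (Real.exp (a * s))
        (P (Real.exp (-(a * s)) • v s))] with x h4 h5
      rw [h5]
      exact mul_nonneg (Real.exp_pos _).le h4
    have h4 := h3 self_mem_Ici ht ht
    simp only [integral_indicator_one_mul hA, hv0] at h4
    exact (integral_nonneg_of_ae (ae_restrict_of_ae h0)).trans h4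
  have hun : ∀ t, 0 ≤ t → 0 ≤ᵐ[volume] u t := fun t ht => by
    filter_upwards [hvn t ht, Lp.coeFn_smul (Real.exp (-(a * t))) (v t)] with x h1 h2
    rw [hu, h2]
    exact mul_nonneg (Real.exp_pos _).le h1
  -- the total number of particles decreases, so that the cut-offs in `P` are inactive
  have hle : ∀ t, 0 ≤ t → ‖u t‖ ≤ ‖u₀‖ + 1 := fun t ht => by
    obtain ⟨h1, h2⟩ := hderiv hud (g := fun _ => 1) measurable_const (fun _ => by simp)
    have h3 := antitoneOn_of_hasDerivWithinAt_nonpos (convex_Ici 0) h1 h2 fun s hs => by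
      have h4 := hPint (u s) (hun s (interior_subset hs))
      have h5 : ∫ x, (1 : ℝ) * (P (u s) - a • u s) x = (∫ x, P (u s) x) - a * ∫ x, u s x := by
        have h6 := (integralMul (g := fun _ => 1) measurable_const (M := 1) (by simp)).map_sub
          (P (u s)) (a • u s)
        rw [map_smul] at h6
        simpa [integralMul_apply] using h6
      rw [h5]; linarith
    have h4 := h3 self_mem_Ici ht ht
    simp only [one_mul] at h4
    rw [norm_eq_integral_of_nonneg (hun t ht)]
    rw [hu0, ← norm_eq_integral_of_nonneg h0] at h4
    linarith
  refine ⟨u, hu0, hun, fun t ht => ?_⟩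
  rw [← hPeq (u t) (hun t ht) (hle t ht)]
  exact hud t ht

/-- The truncation at height `m` of the weight `x ^ (-σ) + x`, extended by zero. -/
noncomputable def truncWeight (σ m x : ℝ) : ℝ := if 0 < x then min (x ^ (-σ)) m + min x m else 0

theorem measurable_truncWeight (σ m : ℝ) : Measurable (truncWeight σ m) := by
  unfold truncWeight
  exact Measurable.ite measurableSet_Ioi (by fun_prop) measurable_const

theorem truncWeight_nonneg (σ : ℝ) {m : ℝ} (hm : 0 ≤ m) (x : ℝ) : 0 ≤ truncWeight σ m x := by
  unfold truncWeight
  split_ifs with h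
  · exact add_nonneg (le_min (Real.rpow_nonneg h.le _) hm) (le_min h.le hm)
  · exact le_rfl

theorem abs_truncWeight_le (σ : ℝ) {m : ℝ} (hm : 0 ≤ m) (x : ℝ) :
    |truncWeight σ m x| ≤ 2 * m := by
  rw [abs_of_nonneg (truncWeight_nonneg σ hm x)]
  unfold truncWeight
  split_ifs with h
  · linarith [min_le_right (x ^ (-σ)) m, min_le_right x m]
  · linarith

/-- The truncated weights are subsolutions of the dual equation. -/
theorem coagOp_truncWeight_nonpos {σ m ε : ℝ} (hσ : 0 ≤ σ) (hm : 0 ≤ m) (hε : 0 < ε) {p : ℝ × ℝ}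
    (h2 : 0 < p.2) (h1 : p.2 < p.1) : coagOp ε (truncWeight σ m) p ≤ 0 := by
  obtain ⟨y, z⟩ := p
  simp only at h1 h2
  have hy : 0 < y := h2.trans h1
  have hyz : y ≤ y + ε * z := le_add_of_nonneg_right (mul_pos hε h2).le
  have h3 : (y + ε * z) ^ (-σ) ≤ y ^ (-σ) :=
    antitoneOn_rpow_neg hσ hy (hy.trans_le hyz) hyz
  have h4 : min ((y + ε * z) ^ (-σ)) m ≤ min (y ^ (-σ)) m := min_le_min_right m h3
  have h5 : min (y + ε * z) m ≤ min y m + ε * min z m := by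
    rcases le_total m y with h | h
    · rw [min_eq_right h]
      have : 0 ≤ ε * min z m := mul_nonneg hε.le (le_min h2.le hm)
      linarith [min_le_right (y + ε * z) m]
    · rw [min_eq_left h, min_eq_left (h1.le.trans h)]
      exact min_le_left _ _
  have h6 : 0 ≤ min (z ^ (-σ)) m := le_min (Real.rpow_nonneg h2.le _) hm
  simp only [coagOp, truncWeight, if_pos hy, if_pos h2, if_pos (hy.trans_le hyz)]
  have h7 : (min ((y + ε * z) ^ (-σ)) m + min (y + ε * z) m - (min (y ^ (-σ)) m + min y m)) / ε ≤
      min z m := by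
    rw [div_le_iff₀ hε]
    linarith
  linarith

/-- The `L¹` solution for a bounded kernel, represented by densities, is a flow: it charges only
`(0,∞)` and keeps its weighted moment. -/
theorem exists_isFlow_of_bounded {k σ η ε B : ℝ} {L : ℝ × ℝ → ℝ} {f : ℝ → ℝ}
    (hL : IsReducedKernel k σ η L) (hB : ∀ p, L p ≤ B) (hε : 0 < ε) (hf : IsDensity f)
    (hw : Integrable fun x => weight σ x * f x) : ∃ u, IsFlow σ ε L f u := by
  have hB' : ∀ p, |L p| ≤ B := fun p => by rw [abs_of_nonneg (hL.nonneg p)]; exact hB p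
  have hfi := integrable_of_weight_mul hL.σ_nonneg hf hw
  have hf1 : hfi.toL1 f =ᵐ[volume] f := Integrable.coeFn_toL1 hfi
  obtain ⟨w, hw0, hwn, hwd⟩ := exists_hasDerivWithinAt_collision hL hB hB' hε
    (u₀ := hfi.toL1 f) (by filter_upwards [hf1] with x hx; rw [hx]; exact hf.nonneg x)
  have hwc : ContinuousOn w (Ici 0) := fun t ht => (hwd t ht).continuousWithinAt
  have hderiv : ∀ {g : ℝ → ℝ} (_ : Measurable g) {M : ℝ} (_ : ∀ x, |g x| ≤ M) (t : ℝ),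
      0 ≤ t → HasDerivWithinAt (fun t => ∫ x, g x * w t x) (coagRate ε L g (w t)) (Ici 0) t :=
    fun {g} hg {M} hM t ht => by
      rw [← integralMul_collision hL.measurable hB' ε _ hg hM]
      exact (integralMul hg hM).hasFDerivAt.comp_hasDerivWithinAt t (hwd t ht)
  have hw0' : ∀ g : ℝ → ℝ, ∫ x, g x * w 0 x = ∫ x, g x * f x := fun g => by
    rw [hw0]
    refine integral_congr_ae ?_
    filter_upwards [hf1] with x hx
    rw [hx]
  have hanti : ∀ {g : ℝ → ℝ} (_ : Measurable g) {M : ℝ} (_ : ∀ x, |g x| ≤ M),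
      (∀ p : ℝ × ℝ, 0 < p.2 → p.2 < p.1 → coagOp ε g p ≤ 0) → ∀ t, 0 ≤ t →
      ∫ x, g x * w t x ≤ ∫ x, g x * f x := fun {g} hg {M} hM hop t ht => by
    have h1 := hderiv hg hM
    have h2 := antitoneOn_of_hasDerivWithinAt_nonpos (convex_Ici 0)
      (fun s hs => (h1 s hs).continuousWithinAt)
      (fun s hs => (h1 s (interior_subset hs)).mono interior_subset)
      (fun s hs => coagRate_nonpos hL (hwn s (interior_subset hs)) hop)
    rw [← hw0']
    exact h2 self_mem_Ici ht ht
  -- no mass appears on the negative half-line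
  have hneg : ∀ t, 0 ≤ t → ∀ᵐ x, x ≤ 0 → w t x = 0 := fun t ht => by
    have hm : Measurable ((Iic (0 : ℝ)).indicator fun _ : ℝ => (1 : ℝ)) :=
      measurable_const.indicator measurableSet_Iic
    have h1 := hanti hm (abs_indicator_one_le _) (fun p hp1 hp2 => by
      have h3 : 0 < p.1 + ε * p.2 := by have := mul_pos hε hp1; linarith
      simp [coagOp, hp1, hp1.trans hp2, h3]) t ht
    have h2 : ∫ x in Iic (0 : ℝ), f x = 0 :=
      setIntegral_eq_zero_of_forall_eq_zero fun x hx => hf.eq_zero x hx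
    rw [integral_indicator_one_mul measurableSet_Iic, integral_indicator_one_mul measurableSet_Iic,
      h2] at h1
    have h3 := ae_restrict_of_ae (s := Iic (0 : ℝ)) (hwn t ht)
    have h4 := (setIntegral_eq_zero_iff_of_nonneg_ae h3
      (L1.integrable_coeFn (w t)).integrableOn).1 (le_antisymm h1 (integral_nonneg_of_ae h3))
    exact (ae_restrict_iff' measurableSet_Iic).1 h4
  have hrep : ∀ t, ∃ v, IsDensity v ∧ v =ᵐ[volume] w (max t 0) := fun t => by
    have ht : 0 ≤ max t 0 := le_max_right _ _
    obtain ⟨v, hv, hvw⟩ := exists_isDensity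
      (L1.integrable_coeFn (w (max t 0))).aestronglyMeasurable.aemeasurable.restrict
      (ae_restrict_of_ae (hwn _ ht))
    refine ⟨v, hv, ?_⟩
    filter_upwards [hvw, hneg _ ht] with x h1 h2
    rcases le_or_gt x 0 with hx | hx
    · rw [h2 hx, hv.eq_zero x hx]
    · exact (h1 hx).symm
  choose v hvd hvw using hrep
  have hvi : ∀ t, Integrable (v t) := fun t =>
    (L1.integrable_coeFn (w (max t 0))).congr (hvw t).symm
  have hpair : ∀ (g : ℝ → ℝ) t, ∫ x, g x * v t x = ∫ x, g x * w (max t 0) x := fun g t => by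
    refine integral_congr_ae ?_
    filter_upwards [hvw t] with x hx
    rw [hx]
  have hmom : ∀ t, Integrable (fun x => weight σ x * v t x) ∧
      ∫ x, weight σ x * v t x ≤ ∫ x, weight σ x * f x := fun t => by
    refine integrable_of_tendsto_of_integral_le (F := fun n : ℕ => fun x => truncWeight σ n x * v t x)
      (fun n => integrable_bdd_mul' (hvi t) (measurable_truncWeight σ n)
        (abs_truncWeight_le σ (Nat.cast_nonneg n)))
      (fun n x => mul_nonneg (truncWeight_nonneg σ (Nat.cast_nonneg n) x) ((hvd t).nonneg x))
      ((hvd t).weight_mul σ).measurable.aestronglyMeasurable (fun x => ?_) (fun n => ?_)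
    · rcases le_or_gt x 0 with hx | hx
      · simp [(hvd t).eq_zero x hx]
      · refine Tendsto.mul_const _ (tendsto_const_nhds.congr' ?_)
        filter_upwards [eventually_ge_atTop ⌈max (x ^ (-σ)) x⌉₊] with n hn
        have h1 : max (x ^ (-σ)) x ≤ n := Nat.ceil_le.1 hn
        rw [truncWeight, if_pos hx, min_eq_left ((le_max_left _ _).trans h1),
          min_eq_left ((le_max_right _ _).trans h1), weight]
    · rw [hpair]
      refine (hanti (measurable_truncWeight σ n) (abs_truncWeight_le σ (Nat.cast_nonneg n))
        (fun p => coagOp_truncWeight_nonpos hL.σ_nonneg (Nat.cast_nonneg n) hε) _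
        (le_max_right _ _)).trans ?_
      refine integral_mono (integrable_bdd_mul' hfi (measurable_truncWeight σ n)
        (abs_truncWeight_le σ (Nat.cast_nonneg n))) hw fun x => ?_
      rcases le_or_gt x 0 with hx | hx
      · simp [hf.eq_zero x hx]
      · refine mul_le_mul_of_nonneg_right ?_ (hf.nonneg x)
        rw [truncWeight, if_pos hx, weight]
        exact add_le_add (min_le_left _ _) (min_le_left _ _)
  refine ⟨v, hvd, fun A hA => ?_, fun t => (hmom t).1, ⟨_, fun t => (hmom t).2⟩,
    fun g hg ⟨M, hM⟩ t ht => ?_⟩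
  · have h1 : Continuous fun t : ℝ => w (max t 0) :=
      hwc.comp_continuous (by fun_prop) fun t => mem_Ici.2 (le_max_right _ _)
    have h2 : (fun t => ∫ x in A, v t x) = fun t =>
        integralMul (measurable_const.indicator hA) (abs_indicator_one_le A) (w (max t 0)) := by
      ext t
      rw [integralMul_apply, ← hpair, integral_indicator_one_mul hA]
    rw [h2]
    exact ((integralMul _ _).continuous.comp h1).measurable
  · have h1 := hderiv hg hM
    have h2 : ContinuousOn (fun s => coagRate ε L g (w s)) (Icc 0 t) := by
      have h3 : ContinuousOn (fun s => integralMul hg hM (collision hL.measurable hB' ε (w s)))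
          (Icc 0 t) := (integralMul hg hM).continuous.comp_continuousOn
        ((continuous_collision hL.measurable hB' ε).comp_continuousOn
          (hwc.mono Icc_subset_Ici_self))
      simpa only [integralMul_collision] using h3
    have h3 := intervalIntegral.integral_eq_sub_of_hasDeriv_right_of_le ht
      (fun s hs => (h1 s hs.1).continuousWithinAt.mono Icc_subset_Ici_self)
      (fun s hs => (h1 s hs.1.le).mono (Ioi_subset_Ici hs.1.le))
      (h2.intervalIntegrable_of_Icc ht)
    rw [hw0'] at h3
    rw [hpair, max_eq_left ht, ← h3]
    refine intervalIntegral.integral_congr fun s hs => ?_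
    rw [uIcc_of_le ht] at hs
    have h4 := coagRate_congr (ε := ε) (L := L) (g := g) (hvw s)
    rw [max_eq_left hs.1] at h4
    exact h4.symm

end OHS

theorem theorem1 (k σ η : ℝ) (Λ : ℝ → ℝ → ℝ) (hΛ : OHS.IsAdmissibleKernel k σ η Λ)
    (f : ℝ → ℝ) (hf : OHS.IsAdmissibleDatum σ f) :
    -- the generalized equations have global weak solutions
    (∃ Z : ℝ → ℝ → ℝ → ℝ, ∀ ε ∈ Set.Ioc (0 : ℝ) 1, OHS.IsWeakSolutionGen σ Λ f ε ⊤ (Z ε)) ∧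
    -- any family of these converges, along a subsequence, to a mass-conserving weak solution
    (∀ Z : ℝ → ℝ → ℝ → ℝ, (∀ ε ∈ Set.Ioc (0 : ℝ) 1, OHS.IsWeakSolutionGen σ Λ f ε ⊤ (Z ε)) →
      ∀ e : ℕ → ℝ, (∀ n, e n ∈ Set.Ioc (0 : ℝ) 1) → Filter.Tendsto e Filter.atTop (nhds 0) →
        ∃ φ : ℕ → ℕ, StrictMono φ ∧ ∃ u : ℝ → ℝ → ℝ,
          OHS.IsWeakSolutionOHS σ Λ f ⊤ u ∧
          (∀ T : EReal, 0 < T →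
            OHS.TendstoCw (OHS.weight σ) T (fun n => Z (e (φ n))) u) ∧
          ∀ t : ℝ, 0 ≤ t → OHS.SameMass (u t) f) ∧
    -- every weak solution conserves mass
    (∀ T : EReal, 0 < T → ∀ u : ℝ → ℝ → ℝ, OHS.IsWeakSolutionOHS σ Λ f T u →
      ∀ t ∈ OHS.timeInterval T, OHS.SameMass (u t) f) := by
  obtain ⟨L, hL, hΛL⟩ := hΛ.exists_isReducedKernel
  obtain ⟨f', hf', hff', hw, hw2⟩ := hf.exists_isDensity hΛ.σ_nonneg
  refine ⟨?_, fun Z hZ e he he0 => ?_, fun T _ u hu t ht =>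
    hu.sameMass hL hΛL hf' hff' hw ht⟩
  · have hex : ∀ ε : ℝ, ∃ v, ε ∈ Set.Ioc (0 : ℝ) 1 → OHS.IsWeakSolutionGen σ Λ f ε ⊤ v :=
      fun ε => by
        by_cases hε : ε ∈ Set.Ioc (0 : ℝ) 1
        · have hLn : ∀ n : ℕ, OHS.IsReducedKernel k σ η (fun p => min (L p) n) :=
            fun n => hL.truncate (Nat.cast_nonneg n)
          choose u hu using fun n : ℕ => OHS.exists_isFlow_of_bounded (hLn n)
            (fun p => min_le_right (L p) n) hε.1 hf' hw
          obtain ⟨v, hv⟩ := OHS.exists_isWeakSolutionGen hL hΛL hff'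
            ⟨hf', hw, hw2, fun _ => hε, hLn, hu⟩
          exact ⟨v, fun _ => hv⟩
        · exact ⟨fun _ _ => 0, fun h => absurd h hε⟩
    choose Z hZ using hex
    exact ⟨Z, hZ⟩
  · choose u hu huZ using fun n => (hZ (e n) (he n)).exists_isFlow hL hΛL (he n).1 hf' hff'
      (OHS.integrable_of_weight_mul hL.σ_nonneg hf' hw)
    obtain ⟨φ, hφ, v, hv, hlim⟩ := OHS.exists_tendsto_isWeakSolutionOHS hL hΛL hff'
      ⟨hf', hw, hw2, he, fun _ => hL, hu⟩ he0 (Z := fun n => Z (e n)) huZ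
    exact ⟨φ, hφ, v, hv, fun T _ => hlim T, fun t ht =>
      hv.sameMass hL hΛL hf' hff' hw (OHS.mem_timeInterval_top.2 ht)⟩
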